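/- **Model (static, No Sensing).** There are $K$ arms and $M$ players, $1\le M\le K$, and a horizon $T\ge 2$. Arm $k$ has a law $\nu_k$ on $[0,1]$ with mean $\mu_k$; the variables $X_k(t)\sim\nu_k$ ($t=1,\dots,T$, $1\le k\le K$) are independent, and $\mu_{(1)}\ge\dots\ge\mu_{(K)}$ are the ordered means. In each round $t$ every player $j$ pulls an arm $\pi^j(t)$ and receives (and observes nothing but) $r^j(t)=X_{\pi^j(t)}(t)$ if no other player pulls the same arm, and $r^j(t)=0$ otherwise. The players know $K$, $T$ and a number $\mu_{\min}$ with $0<\mu_{\min}\le\min_k\mu_k$, but not $M$; they use independent private randomness, do not communicate otherwise, and all run the algorithm below from round $1$ to round $T$. The regret is $$R_T=T\sum_{k=1}^{M}\mu_{(k)}-\mathbb E\Big[\sum_{t=1}^{T}\sum_{j=1}^{M}r^j(t)\Big].$$ **Algorithm (run by each player; stop after round $T$).** Put $T_c=\lceil \log T/\mu_{\min}\rceil$, $T_0=\lceil 2400\log T/\mu_{\min}\rceil$, $B_s=\sqrt{2\log T/s}$. For a set $A$ of arms, "hopping on $A$" means replacing the current arm $\pi$, after each step, by the next arm of $A$ in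 cyclic order. *Musical Chairs on $A$ for $n$ steps*: pull a uniformly random arm of $A$ at each step until a positive reward is received, then pull the arm that gave it for the remaining steps and return this arm (if there was no positive reward, return an arbitrary arm of $A$). *Initialization.* Let $\pi=k$ be the result of Musical Chairs on $\{1,\dots,K\}$ for $KT_c$ steps. To estimate the number of players, set $M_p=1$ and, for $n=1,\dots,2K$: if $n\ge 2k$, move to the next arm modulo $K$; pull the current arm $T_c$ times; if all these rewards are $0$, increase $M_p$ by $1$. Afterwards $\pi=k$ again. Let $A=\{1,\dots,K\}$ (active arms), $T_d=0$, $D=\emptyset$, $S=N=s=n=0$ (vectors indexed by the arms). For $p=1,2,\dots$ do the following. *Exploration phase.* Let $L=|A|2^pT_0$. If $D\ne\emptyset$, let $\pi$ be the result of Musical Chairs on $A$ for $|A|T_c$ steps; otherwise replace $S,N,L$ by $S+s,\ N+n,\ L-T_d$. Then pull $\pi$ and hop on $A$ for $L$ steps, adding the rewards to $S[\cdot]$ and the numbers of pulls to $N[\cdot]$. *Communication phase.* Let $T_d=|A|T_0$, $D=\emptyset$, $\hat\mu_i=S[i]/N[i]$, and let $\mathrm{Rej}$ be the set of $k\in A$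 with $\#\{i\in A:\hat\mu_i-B_{N[i]}\ge\hat\mu_k+B_{N[k]}\}\ge M_p$, and $\mathrm{Acc}$ the set of $k\in A$ with $\#\{i\in A:\hat\mu_k-B_{N[k]}\ge\hat\mu_i+B_{N[i]}\}\ge|A|-M_p$. Then execute blocks of $T_d$ steps. In each block new block statistics $s,n$ (sums of rewards and numbers of pulls of each arm) are started from $0$, and at its end an arm $i\in A$ is *signaled* if $|\hat\mu_i-s[i]/n[i]|\ge\hat\mu_i/4$. 1. While $\mathrm{Rej}\setminus D\ne\emptyset$: *declaration block* for some $k\in\mathrm{Rej}\setminus D$. At each step pull $k$ with probability $1/2$ and $\pi$ with probability $1/2$, and in both cases hop $\pi$ on $A$. Add $k$ and the signaled arms to $D$. 2. If $\mathrm{Acc}\setminus D\neq\emptyset$: *fixation block*. Pull $\pi$ and hop on $A$ until an arm of $\mathrm{Acc}\setminus D$ gives a positive reward; from then on pull this arm until round $T$. If this does not happen within the block, add the signaled arms to $D$. 3. Repeat *reception blocks*, in which the player pulls $\pi$ and hops on $A$, adding the signaled arms to $D$ after each block, until a reception block signals no arm outside $D$. Finally, with $s$ from this last reception block, replace $M_p$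 by $M_p-\#\{i\in D:s[i]=0\}$ and $A$ by $A\setminus D$, and go on with the next $p$ (if $A$ has become empty, pull some fixed arm until round $T$). **Theorem.** There is a universal constant $C>0$ such that for all $1\le M\le K$, $T\ge2$, all laws $\nu_1,\dots,\nu_K$ on $[0,1]$ and all $\mu_{\min}$ with $0<\mu_{\min}\le\min_k\mu_k$, whatever deterministic rule is used (by all players) for the arbitrary choices in the algorithm, its regret satisfies $$R_T\le C\left(\sum_{k=M+1}^{K}\min\left\{\frac{M\log T}{\mu_{(M)}-\mu_{(k)}},\sqrt{MT\log T}\right\}+\frac{MK^2\log T}{\mu_{\min}}\right),$$ where $M\log T/0=\infty$. -/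

import Mathlib

open MeasureTheory

namespace NoSensing

/-! ## Model -/

/-- `orderStat v n` is the `n`-th largest value `v_(n)` of `v` (`1 ≤ n ≤ K`):
`v_(1) ≥ v_(2) ≥ … ≥ v_(K)`. -/
noncomputable def orderStat {K : ℕ} (v : Fin K → ℝ) (n : ℕ) : ℝ :=
  if h : n - 1 < K then v (Tuple.sort (fun k => -v k) ⟨n - 1, h⟩) else 0

/-- The mean of each arm. -/
noncomputable def mean {K : ℕ} (ν : Fin K → Measure ℝ) (k : Fin K) : ℝ := ∫ x, x ∂(ν k)

/-- Reward of player `j` when the players pull the arms `a` and the arm variables are `x`: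
it is `x (a j)`, and `0` if another player pulls the same arm. -/
noncomputable def playerReward {K M : ℕ} (x : Fin K → ℝ) (a : Fin M → Fin K) (j : Fin M) : ℝ :=
  x (a j) * (1 - if 1 < (Finset.univ.filter fun i => a i = a j).card then 1 else 0)

/-- A sample point: for each round, the values of the arms and one private random seed
in `[0,1]` for each player. -/
abbrev Sample (K M : ℕ) : Type := ℕ → (Fin K → ℝ) × (Fin M → unitInterval)

/-- All arm variables and all seeds are independent; `X_k(t)` has law `ν k`, and the seeds are
uniform on `[0,1]`. -/
noncomputable def sampleMeasure {K : ℕ} (M : ℕ) (ν : Fin K → Measure ℝ)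
    [∀ k, IsProbabilityMeasure (ν k)] : Measure (Sample K M) :=
  Measure.infinitePi fun _ : ℕ =>
    (Measure.pi ν).prod (Measure.pi fun _ : Fin M => (volume : Measure unitInterval))

/-! ## The algorithm, from the point of view of one player -/

/-- What is common knowledge to the players: the horizon, the lower bound of the means, and a rule
that picks an element of a set of arms, used wherever the algorithm says "let `k` be in this set".
-/
structure Params (K : ℕ) where
  T : ℕ
  muMin : ℝ
  pick : Finset (Fin K) → Fin K

/-- `T_c = ⌈log T / μ_min⌉`. -/
noncomputable def Params.Tc {K : ℕ} (P : Params K) : ℕ := ⌈Real.log P.T / P.muMin⌉₊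

/-- `T_0 = ⌈2400 log T / μ_min⌉`. -/
noncomputable def Params.T0 {K : ℕ} (P : Params K) : ℕ := ⌈2400 * Real.log P.T / P.muMin⌉₊

/-- The loop that a player is currently executing.

* `chairs initial fixed`: Musical Chairs on the active arms (`initial`: is it the one of the
  initialization?), with the arm `fixed` on which the player is seated, if any;
* `estimate k n m`: block `n` of the estimation of the number of players, with external rank `k`
  and current estimate `m`;
* `explore`: the sequential hopping of an exploration phase;
* `declare k`, `occupy A fixed`, `receive`: declaration block for the arm `k`, fixation block for
  the set of arms `A`, reception block;
* `exploit k`: pull `k` until the end. -/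
inductive Mode (K : ℕ)
  | chairs (initial : Bool) (fixed : Option (Fin K))
  | estimate (k : Fin K) (n m : ℕ)
  | explore
  | declare (k : Fin K)
  | occupy (A : Finset (Fin K)) (fixed : Option (Fin K))
  | receive
  | exploit (k : Fin K)

/-- The memory of a player. -/
structure State (K : ℕ) where
  /-- current loop -/
  mode : Mode K
  /-- number of time steps left in the current loop -/
  left : ℕ
  /-- number of the exploration phase -/
  p : ℕ
  /-- set `[K_p]` of active arms -/
  act : Finset (Fin K)
  /-- number `M_p` of active players -/
  Mp : ℤ
  /-- the arm `π` of the sequential hopping -/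
  pos : Fin K
  /-- exploration statistics: sums of rewards -/
  S : Fin K → ℝ
  /-- exploration statistics: numbers of pulls -/
  N : Fin K → ℕ
  /-- statistics of the current communication block: sums of rewards -/
  s : Fin K → ℝ
  /-- statistics of the current communication block: numbers of pulls -/
  n : Fin K → ℕ
  /-- total reward in the current block of the estimation of the number of players -/
  r : ℝ
  /-- length of a communication block -/
  Td : ℕ
  /-- arms signaled in the current communication phase -/
  decl : Finset (Fin K)
  /-- arms detected as sub-optimal in the last exploration phase -/
  rej : Finset (Fin K)
  /-- arms detected as optimal in the last exploration phase -/
  acc : Finset (Fin K)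

/-- `k + 1 (mod A)`: the successor of `k` in the cyclic order of the set of arms `A`. -/
def succArm {K : ℕ} (A : Finset (Fin K)) (k : Fin K) : Fin K :=
  if h : (A.filter fun i => k < i).Nonempty then (A.filter fun i => k < i).min' h
  else if h : A.Nonempty then A.min' h else k

/-- A uniform element of `A`, sampled by means of a uniform seed `u`. -/
noncomputable def uniformArm {K : ℕ} (P : Params K) (A : Finset (Fin K)) (u : unitInterval) :
    Fin K :=
  (A.sort (· ≤ ·)).getD ⌊(u : ℝ) * A.card⌋₊ (P.pick A)

namespace State

variable {K : ℕ}

/-- Arm pulled by a player, given her memory and her seed of the round. -/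
noncomputable def arm (P : Params K) (σ : State K) (u : unitInterval) : Fin K :=
  match σ.mode with
  | .chairs _ none => uniformArm P σ.act u
  | .chairs _ (some k) => k
  | .estimate _ _ _ => σ.pos
  | .explore => σ.pos
  | .declare k => if (u : ℝ) < 1 / 2 then k else σ.pos
  | .occupy _ none => σ.pos
  | .occupy _ (some k) => k
  | .receive => σ.pos
  | .exploit k => k

/-- Count the reward `r` of arm `i` in the statistics of the block, and hop. -/
noncomputable def countBlock (σ : State K) (i : Fin K) (r : ℝ) : State K :=
  { σ with
    s := Function.update σ.s i (σ.s i + r)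
    n := Function.update σ.n i (σ.n i + 1)
    pos := succArm σ.act σ.pos }

/-- Update of the memory inside a loop, after arm `i` was pulled and reward `r` was received. -/
noncomputable def observe (σ : State K) (i : Fin K) (r : ℝ) : State K :=
  match σ.mode with
  | .chairs b none => { σ with mode := .chairs b (if 0 < r then some i else none) }
  | .chairs _ (some _) => σ
  | .estimate _ _ _ => { σ with r := σ.r + r }
  | .explore =>
      { σ with
        S := Function.update σ.S i (σ.S i + r)
        N := Function.update σ.N i (σ.N i + 1)
        pos := succArm σ.act σ.pos }
  | .declare _ => σ.countBlock i r
  | .occupy A none =>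
      { σ.countBlock i r with mode := .occupy A (if i ∈ A ∧ 0 < r then some i else none) }
  | .occupy _ (some _) => σ
  | .receive => σ.countBlock i r
  | .exploit _ => σ

/-- Empirical mean of arm `i` in the exploration phases. -/
noncomputable def avg (σ : State K) (i : Fin K) : ℝ := σ.S i / σ.N i

/-- Confidence radius `B_{T[i]} = √(2 log T / T[i])` of arm `i`. -/
noncomputable def radius (P : Params K) (σ : State K) (i : Fin K) : ℝ :=
  √(2 * Real.log P.T / σ.N i)

/-- Active arms that are worse than at least `M_p` active arms. -/
noncomputable def rejected (P : Params K) (σ : State K) : Finset (Fin K) :=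
  σ.act.filter fun k =>
    σ.Mp ≤ ((σ.act.filter fun i =>
      σ.avg k + σ.radius P k ≤ σ.avg i - σ.radius P i).card : ℤ)

/-- Active arms that are better than at least `K_p - M_p` active arms. -/
noncomputable def accepted (P : Params K) (σ : State K) : Finset (Fin K) :=
  σ.act.filter fun k =>
    (σ.act.card : ℤ) - σ.Mp ≤ ((σ.act.filter fun i =>
      σ.avg i + σ.radius P i ≤ σ.avg k - σ.radius P k).card : ℤ)

/-- Active arms detected as signaled in the block that just ended. -/
noncomputable def signaled (σ : State K) : Finset (Fin K) :=
  σ.act.filter fun k =>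
    σ.S k / (4 * σ.N k) ≤ |σ.S k / σ.N k - σ.s k / σ.n k|

/-- Start a communication block of a given type. -/
def startBlock (σ : State K) (m : Mode K) : State K :=
  { σ with mode := m, left := σ.Td, s := fun _ => 0, n := fun _ => 0 }

/-- Start the next block of a communication phase in which only declaration blocks have been
executed so far. -/
def nextBlock (P : Params K) (σ : State K) : State K :=
  if (σ.rej \ σ.decl).Nonempty then σ.startBlock (.declare (P.pick (σ.rej \ σ.decl)))
  else if (σ.acc \ σ.decl).Nonempty then σ.startBlock (.occupy (σ.acc \ σ.decl) none)
  else σ.startBlock .receive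

/-- Start the communication phase. -/
noncomputable def startComm (P : Params K) (σ : State K) : State K :=
  nextBlock P
    { σ with
      Td := σ.act.card * P.T0
      decl := ∅
      rej := σ.rejected P
      acc := σ.accepted P }

/-- Start exploration phase `p`: with Musical Chairs if there was a signal in the last
communication phase; otherwise the statistics of the last reception block are used and
its length is deducted. -/
noncomputable def startPhase (P : Params K) (σ : State K) (p : ℕ) : State K :=
  if 0 < σ.decl.card then
    { σ with p := p, mode := .chairs false none, left := σ.act.card * P.Tc }
  else
    { σ with
      p := p
      S := fun i => σ.S i + σ.s i
      N := fun i => σ.N i + σ.n i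
      mode := .explore
      left := σ.act.card * 2 ^ p * P.T0 - σ.Td }

/-- Start block `n` of the estimation of the number of players, with external rank `k`
(which is numbered `k + 1` when the arms are numbered from `1`). -/
noncomputable def startEstimate (P : Params K) (σ : State K) (k : Fin K) (n m : ℕ) (pos : Fin K) :
    State K :=
  { σ with
    mode := .estimate k n m
    left := P.Tc
    r := 0
    pos := if 2 * ((k : ℕ) + 1) ≤ n then succArm Finset.univ pos else pos }

/-- Update of the active sets at the end of a communication phase. -/
noncomputable def updateActive (σ : State K) : State K :=
  { σ with
    act := σ.act \ σ.decl
    Mp := σ.Mp - ((σ.decl.filter fun i => σ.s i = 0).card : ℤ) }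

/-- What a player does when the current loop is over. -/
noncomputable def finish (P : Params K) (σ : State K) : State K :=
  match σ.mode with
  | .chairs true f =>
      σ.startEstimate P (f.getD (P.pick σ.act)) 1 1 (f.getD (P.pick σ.act))
  | .estimate k n m =>
      if n < 2 * K then σ.startEstimate P k (n + 1) (if σ.r = 0 then m + 1 else m) σ.pos
      else startPhase P { σ with Mp := if σ.r = 0 then m + 1 else m, pos := k } 1
  | .chairs false f =>
      { σ with
        mode := .explore
        pos := f.getD (P.pick σ.act)
        left := σ.act.card * 2 ^ σ.p * P.T0 }
  | .explore => σ.startComm P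
  | .declare k => nextBlock P { σ with decl := σ.decl ∪ (σ.signaled ∪ {k}) }
  | .occupy _ none => startBlock { σ with decl := σ.decl ∪ σ.signaled } .receive
  | .occupy _ (some k) => { σ with mode := .exploit k }
  | .receive =>
      if (σ.signaled \ σ.decl).Nonempty then
        startBlock { σ with decl := σ.decl ∪ σ.signaled } .receive
      else startPhase P σ.updateActive (σ.p + 1)
  | .exploit _ => σ

/-- One time step of a player, who pulled arm `i` and received `r`. -/
noncomputable def step (P : Params K) (σ : State K) (i : Fin K) (r : ℝ) : State K :=
  if σ.left ≤ 1 then (σ.observe i r).finish P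
  else { σ.observe i r with left := σ.left - 1 }

/-- Initial memory: Musical Chairs on all arms for `K T_c` steps. -/
noncomputable def init (P : Params K) : State K where
  mode := .chairs true none
  left := K * P.Tc
  p := 0
  act := Finset.univ
  Mp := 0
  pos := P.pick Finset.univ
  S := fun _ => 0
  N := fun _ => 0
  s := fun _ => 0
  n := fun _ => 0
  r := 0
  Td := 0
  decl := ∅
  rej := ∅
  acc := ∅

end State

/-! ## Regret -/

/-- Arms pulled in a round, given the memories of the players and their seeds. -/
noncomputable def arms {K M : ℕ} (P : Params K) (σ : Fin M → State K) (u : Fin M → unitInterval) :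
    Fin M → Fin K :=
  fun j => (σ j).arm P (u j)

/-- Memories of the `M` players after `t` rounds; a player observes nothing but her own reward. -/
noncomputable def run {K M : ℕ} (P : Params K) (ω : Sample K M) : ℕ → Fin M → State K
  | 0 => fun _ => State.init P
  | t + 1 => fun j =>
      (run P ω t j).step P (arms P (run P ω t) (ω t).2 j)
        (playerReward (ω t).1 (arms P (run P ω t) (ω t).2) j)

/-- Reward of player `j` in round `t` (rounds are numbered from `0`). -/
noncomputable def reward {K M : ℕ} (P : Params K) (ω : Sample K M) (t : ℕ) (j : Fin M) : ℝ :=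
  playerReward (ω t).1 (arms P (run P ω t) (ω t).2) j

/-- Regret of `M` players up to the horizon `T`. -/
noncomputable def regret {K : ℕ} (M : ℕ) (P : Params K) (ν : Fin K → Measure ℝ)
    [∀ k, IsProbabilityMeasure (ν k)] : ℝ :=
  ∑ _t ∈ Finset.range P.T, ∑ k ∈ Finset.Icc 1 M, orderStat (mean ν) k
    - ∫ ω, ∑ t ∈ Finset.range P.T, ∑ j : Fin M, reward P ω t j ∂(sampleMeasure M ν)

/-- `min {M log T / Δ, √(M T log T)}`, where `M log T / 0 = ∞`. -/
noncomputable def explorationCost (M T : ℕ) (Δ : ℝ) : ℝ :=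
  if Δ = 0 then √(M * T * Real.log T) else min (M * Real.log T / Δ) (√(M * T * Real.log T))

end NoSensing

/-! The regret is the expectation of the summed `loss`, a quantity that depends only on the pulled
arms (`regret_eq`). It is bounded path by path on an event `Good`; outside that event every round
costs at most `M`, and the event fails so rarely that this contributes only O(M K² log T)
(`measure_not_good`, `cost_not_good`). If T < K² T_0, the trivial bound M T is already small enough.

Probability. All deviation bounds come from one product supermartingale (`Tests.prod_le`) and a
maximal inequality. Rounds are selected adaptively, but the selection in a round never looks at the
arm values (or the coin) being tested in that round. The maximal inequality covers all end times at
once, so only starting rounds and sample sizes need a union bound.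

Behaviour on `Good`. Musical Chairs seats the players on distinct arms, because an unseated player
is alone on an arm with probability at least 1/|A| (`chairs_success`). In the estimation, the
players of ranks k and k' meet in exactly one block (`meet_iff`), so each of them counts M. Hopping
from distinct positions never collides, hence the exploration statistics are honest samples and one
cycle of hopping costs `gap`. All active arms share the confidence radius `width`: only bad arms are
rejected, only top arms are accepted, and every arm whose mean is at least four widths from μ_(M) is
detected (`informed_of_close`). In a communication block an arm that is occupied or declared by
somebody else yields at most 0.7 of its mean, whereas an undisturbed arm yields nearly all of it;
thus after each block all unsettled players hold the same set of signaled arms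
(`BlockStart.signaled_iff`). In the last block the signaled arms without reward are exactly the
occupied ones, so `Mp` stays correct (`BlockStart.lastBlock`).

Cost. Every block before the last one signals a new arm, so communication and reseating cost O(M K
T_0) per removed arm, O(M K² T_0) in total (`ExploreStart.next`). In phase q ≥ 2 all remaining arms
are within four widths of μ_(M); a bad arm costs at most 8 width · min(M 2^q T_0, 2T) (`phaseCost`),
and nothing once its gap exceeds four widths. Since width is of order √(log T / (2^q T_0)), the sums
over q are geometric: the cutoff by the gap gives M log T / Δ, the balance at 2^q T_0 = T/M gives
√(M T log T) (`sum_phaseCost_le`). -/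

namespace NoSensing

open scoped ENNReal

/-! ### Exponential deviation inequalities for adaptively selected observations. -/

section Probability

variable {E : Type*} [MeasurableSpace E] {ρ : Measure E} [IsProbabilityMeasure ρ]

/-- Resampling one coordinate of an i.i.d. sequence does not change its law. -/
theorem measurePreserving_update (ρ : Measure E) [IsProbabilityMeasure ρ] (t : ℕ) :
    MeasurePreserving (fun z : (ℕ → E) × E => Function.update z.1 t z.2)
      ((Measure.infinitePi fun _ : ℕ => ρ).prod ρ) (Measure.infinitePi fun _ : ℕ => ρ) := by
  have hmeas : Measurable (fun z : (ℕ → E) × E => Function.update z.1 t z.2) := by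
    refine measurable_pi_lambda _ fun i => ?_
    by_cases h : i = t
    · subst h; simpa using measurable_snd
    · simp only [Function.update_of_ne h]; fun_prop
  refine ⟨hmeas, Measure.eq_infinitePi _ ?_⟩
  intro s B hB
  have hset : (fun z : (ℕ → E) × E => Function.update z.1 t z.2) ⁻¹' (Set.pi (s : Set ℕ) B)
      = (Set.pi ((s.erase t : Finset ℕ) : Set ℕ) B) ×ˢ (if t ∈ s then B t else Set.univ) := by
    ext ⟨ω, x⟩
    simp only [Set.mem_preimage, Set.mem_pi, Set.mem_prod, Finset.coe_erase, Finset.mem_coe]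
    constructor
    · intro h
      refine ⟨fun i hi => ?_, ?_⟩
      · have := h i hi.1
        rwa [Function.update_of_ne (by simpa using hi.2)] at this
      · split_ifs with hts
        · simpa using h t hts
        · trivial
    · rintro ⟨h1, h2⟩ i hi
      by_cases hit : i = t
      · subst hit; simpa [hi] using h2
      · rw [Function.update_of_ne hit]; exact h1 i ⟨hi, by simpa using hit⟩
  rw [Measure.map_apply hmeas (MeasurableSet.pi s.countable_toSet fun i _ => hB i), hset,
    Measure.prod_prod, Measure.infinitePi_pi _ (fun i _ => hB i)]
  by_cases hts : t ∈ s
  · rw [if_pos hts, mul_comm, Finset.mul_prod_erase s (fun i => ρ (B i)) hts]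
  · simp [hts]

/-- The inner integral over a fresh copy of coordinate `t` plays the role of the conditional
expectation given the other coordinates; this replaces filtrations throughout. -/
theorem lintegral_update (t : ℕ) {f : (ℕ → E) → ℝ≥0∞} (hf : Measurable f) :
    ∫⁻ ω, f ω ∂(Measure.infinitePi fun _ : ℕ => ρ)
      = ∫⁻ ω, ∫⁻ x, f (Function.update ω t x) ∂ρ ∂(Measure.infinitePi fun _ : ℕ => ρ) := by
  have h := measurePreserving_update ρ t
  rw [← h.lintegral_comp hf]
  exact lintegral_prod _ (hf.comp h.measurable).aemeasurable

theorem integral_update (t : ℕ) {f : (ℕ → E) → ℝ}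
    (hf : Integrable f (Measure.infinitePi fun _ : ℕ => ρ)) :
    ∫ ω, f ω ∂(Measure.infinitePi fun _ : ℕ => ρ)
      = ∫ ω, ∫ x, f (Function.update ω t x) ∂ρ ∂(Measure.infinitePi fun _ : ℕ => ρ) := by
  have h := measurePreserving_update ρ t
  have h2 : Integrable (fun z : (ℕ → E) × E => f (Function.update z.1 t z.2))
      ((Measure.infinitePi fun _ : ℕ => ρ).prod ρ) := h.integrable_comp_of_integrable hf
  rw [← integral_prod _ h2]
  conv_lhs => rw [← h.map_eq]
  rw [integral_map h.measurable.aemeasurable]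
  rw [h.map_eq]; exact hf.aestronglyMeasurable

/-- Maximal inequality for a nonnegative supermartingale on a space of i.i.d. sequences. -/
theorem maximal_inequality (W : ℕ → (ℕ → E) → ℝ≥0∞) (hm : ∀ t, Measurable (W t))
    (hdep : ∀ t ω s x, t ≤ s → W t (Function.update ω s x) = W t ω) (hW0 : ∀ ω, W 0 ω ≤ 1)
    (hstep : ∀ t ω, ∫⁻ x, W (t + 1) (Function.update ω t x) ∂ρ ≤ W t ω) (n : ℕ) (c : ℝ≥0∞)
    (hc0 : c ≠ 0) (hc : c ≠ ⊤) :
    (Measure.infinitePi fun _ : ℕ => ρ) {ω | ∃ t ≤ n, c ≤ W t ω} ≤ 1 / c := by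
  classical
  -- `Z` is `W` stopped when it first reaches `c`. Its mean never increases, and it keeps a value of
  -- at least `c` once the level is crossed, so Markov's inequality at the single time `n` suffices.
  let Z : ℕ → (ℕ → E) → ℝ≥0∞ := fun t => Nat.rec (W 0)
    (fun t Zt ω => if ∃ s ≤ t, c ≤ W s ω then Zt ω else W (t + 1) ω) t
  have hZs : ∀ t ω, Z (t + 1) ω = if ∃ s ≤ t, c ≤ W s ω then Z t ω else W (t + 1) ω :=
    fun _ _ => rfl
  have hset : ∀ t, MeasurableSet {ω | ∃ s ≤ t, c ≤ W s ω} := by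
    intro t
    have : {ω | ∃ s ≤ t, c ≤ W s ω} = ⋃ s ∈ Finset.range (t + 1), {ω | c ≤ W s ω} := by
      ext ω; simp
    rw [this]
    exact Finset.measurableSet_biUnion _ fun s _ => measurableSet_le measurable_const (hm s)
  have hZm : ∀ t, Measurable (Z t) := by
    intro t
    induction t with
    | zero => exact hm 0
    | succ t ih => exact Measurable.ite (hset t) ih (hm (t + 1))
  have hZdep : ∀ t ω s x, t ≤ s → Z t (Function.update ω s x) = Z t ω := by
    intro t
    induction t with
    | zero => exact fun ω s x h => hdep 0 ω s x h
    | succ t ih =>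
      intro ω s x h
      have : (∃ r ≤ t, c ≤ W r (Function.update ω s x)) ↔ ∃ r ≤ t, c ≤ W r ω :=
        exists_congr fun r => and_congr_right fun hr => by rw [hdep r ω s x (by omega)]
      rw [hZs, hZs, ih ω s x (by omega), hdep (t + 1) ω s x h]
      simp only [this]
  have hZW : ∀ t ω, (¬ ∃ s < t, c ≤ W s ω) → Z t ω = W t ω := by
    intro t ω h
    cases t with
    | zero => rfl
    | succ t => rw [hZs, if_neg]; rintro ⟨s, hs, h'⟩; exact h ⟨s, by omega, h'⟩
  have hint : ∀ t, ∫⁻ ω, Z t ω ∂(Measure.infinitePi fun _ : ℕ => ρ) ≤ 1 := by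
    intro t
    induction t with
    | zero => exact (lintegral_mono hW0).trans (by simp)
    | succ t ih =>
      refine le_trans ?_ ih
      rw [lintegral_update t (hZm (t + 1))]
      refine lintegral_mono fun ω => ?_
      have hcond : ∀ x, (∃ r ≤ t, c ≤ W r (Function.update ω t x)) ↔ ∃ r ≤ t, c ≤ W r ω :=
        fun x => exists_congr fun r => and_congr_right fun hr => by rw [hdep r ω t x hr]
      simp only [hZs, hcond, hZdep t ω t _ le_rfl]
      split_ifs with h
      · simp
      · rw [hZW t ω (fun ⟨s, hs, h'⟩ => h ⟨s, hs.le, h'⟩)]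
        exact hstep t ω
  have hstay : ∀ t ω, (∃ s ≤ t, c ≤ W s ω) → c ≤ Z t ω := by
    intro t ω
    induction t with
    | zero => rintro ⟨s, hs, h⟩; obtain rfl : s = 0 := by omega
              exact h
    | succ t ih =>
      intro h
      rw [hZs]
      split_ifs with h'
      · exact ih h'
      · obtain ⟨s, hs, h⟩ := h
        obtain rfl : s = t + 1 := by
          by_contra hne
          exact h' ⟨s, by omega, h⟩
        exact h
  calc _ ≤ (Measure.infinitePi fun _ : ℕ => ρ) {ω | c ≤ Z n ω} := measure_mono fun ω h => hstay n ω h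
    _ ≤ (∫⁻ ω, Z n ω ∂(Measure.infinitePi fun _ : ℕ => ρ)) / c :=
        meas_ge_le_lintegral_div (hZm n).aemeasurable hc0 hc
    _ ≤ 1 / c := by gcongr; exact hint n

/-- A sequence of tests: in round `t` the test is performed if `a t = 1`, and its outcome is
`y t ∈ [0,1]`; both are determined by the first `t + 1` coordinates. -/
structure Tests (E : Type*) [MeasurableSpace E] where
  a : ℕ → (ℕ → E) → ℝ
  y : ℕ → (ℕ → E) → ℝ
  measurable_a : ∀ t, Measurable (a t)
  measurable_y : ∀ t, Measurable (y t)
  a_eq : ∀ t ω, a t ω = 0 ∨ a t ω = 1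
  y_nonneg : ∀ t ω, 0 ≤ y t ω
  y_le : ∀ t ω, y t ω ≤ 1
  dep_a : ∀ t ω s x, t < s → a t (Function.update ω s x) = a t ω
  dep_y : ∀ t ω s x, t < s → y t (Function.update ω s x) = y t ω

namespace Tests

variable (X : Tests E)

theorem a_nonneg (t : ℕ) (ω : ℕ → E) : 0 ≤ X.a t ω := by
  rcases X.a_eq t ω with h | h <;> simp [h]

theorem a_le (t : ℕ) (ω : ℕ → E) : X.a t ω ≤ 1 := by
  rcases X.a_eq t ω with h | h <;> simp [h]

theorem measurable_update_right (ω : ℕ → E) (t : ℕ) :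
    Measurable (fun x : E => Function.update ω t x) := measurable_update ω

/-- A performed test multiplies the product by κ(1 - θ y), whose conditional mean is at most 1 by
`hκq` and `hq`, so the product is a nonnegative supermartingale. The hypothesis `hq` carries the
factor θ on both sides because θ may have either sign. With θ = 1 - e^l and κ = e^(-c) it yields
exponential tail bounds; with θ = 1 and κ = e^q it yields the waiting time for a success. -/
theorem prod_le (ρ : Measure E) [IsProbabilityMeasure ρ] (θ q κ : ℝ) (hθ : θ ≤ 1) (hκ : 0 ≤ κ)
    (hκq : κ * (1 - θ * q) ≤ 1)
    (hq : ∀ t ω, θ * (q * ∫ x, X.a t (Function.update ω t x) ∂ρ)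
      ≤ θ * ∫ x, X.a t (Function.update ω t x) * X.y t (Function.update ω t x) ∂ρ)
    (n : ℕ) (L : ℝ) :
    (Measure.infinitePi fun _ : ℕ => ρ) {ω | ∃ t ≤ n, Real.exp L ≤
      ∏ s ∈ Finset.range t, (1 - X.a s ω + X.a s ω * (κ * (1 - θ * X.y s ω)))}
      ≤ ENNReal.ofReal (Real.exp (-L)) := by
  let g : ℕ → (ℕ → E) → ℝ := fun s ω => 1 - X.a s ω + X.a s ω * (κ * (1 - θ * X.y s ω))
  have hθy : ∀ s ω, 0 ≤ 1 - θ * X.y s ω := by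
    intro s ω
    nlinarith [X.y_nonneg s ω, X.y_le s ω, mul_nonneg (sub_nonneg.2 hθ) (X.y_nonneg s ω)]
  have hg : ∀ s ω, 0 ≤ g s ω := fun s ω => add_nonneg (sub_nonneg.2 (X.a_le s ω))
    (mul_nonneg (X.a_nonneg s ω) (mul_nonneg hκ (hθy s ω)))
  have hgm : ∀ s, Measurable (g s) := by
    intro s
    have h1 := X.measurable_a s
    have h2 := X.measurable_y s
    fun_prop
  let W : ℕ → (ℕ → E) → ℝ≥0∞ := fun t ω => ∏ s ∈ Finset.range t, ENNReal.ofReal (g s ω)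
  have hWeq : ∀ t ω, W t ω = ENNReal.ofReal (∏ s ∈ Finset.range t, g s ω) := fun t ω =>
    (ENNReal.ofReal_prod_of_nonneg fun s _ => hg s ω).symm
  have hgdep : ∀ t ω s x, t < s → g t (Function.update ω s x) = g t ω := by
    intro t ω s x h
    simp only [g, X.dep_a t ω s x h, X.dep_y t ω s x h]
  have hWdep : ∀ t ω s x, t ≤ s → W t (Function.update ω s x) = W t ω := by
    intro t ω s x h
    refine Finset.prod_congr rfl fun r hr => ?_
    rw [hgdep r ω s x (by have := Finset.mem_range.1 hr; omega)]
  have key := maximal_inequality (ρ := ρ) W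
    (fun t => Finset.measurable_fun_prod _ fun s _ => (hgm s).ennreal_ofReal)
    hWdep (fun ω => by simp [W]) ?_ n (ENNReal.ofReal (Real.exp L))
    (by simp [Real.exp_pos]) ENNReal.ofReal_ne_top
  · refine (measure_mono ?_).trans (key.trans (le_of_eq ?_))
    · rintro ω ⟨t, ht, h⟩
      exact ⟨t, ht, by rw [hWeq]; exact ENNReal.ofReal_le_ofReal h⟩
    · rw [Real.exp_neg, ENNReal.ofReal_inv_of_pos (Real.exp_pos L), one_div]
  · intro t ω
    have hu := measurable_update_right ω t
    have hW1 : ∀ x, W (t + 1) (Function.update ω t x)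
        = W t ω * ENNReal.ofReal (g t (Function.update ω t x)) := by
      intro x
      have : W (t + 1) (Function.update ω t x)
        = W t (Function.update ω t x) * ENNReal.ofReal (g t (Function.update ω t x)) :=
        Finset.prod_range_succ _ _
      rw [this, hWdep t ω t x le_rfl]
    simp only [hW1]
    rw [lintegral_const_mul (W t ω)
      (f := fun x => ENNReal.ofReal (g t (Function.update ω t x)))
      ((hgm t).comp hu).ennreal_ofReal]
    refine mul_le_of_le_one_right bot_le ?_
    have ha : Integrable (fun x => X.a t (Function.update ω t x)) ρ :=
      Integrable.of_bound (C := 1) ((X.measurable_a t).comp hu).aestronglyMeasurable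
        (Filter.Eventually.of_forall fun x => by
          rw [Real.norm_eq_abs, abs_of_nonneg (X.a_nonneg _ _)]; exact X.a_le _ _)
    have hay : Integrable
        (fun x => X.a t (Function.update ω t x) * X.y t (Function.update ω t x)) ρ :=
      Integrable.of_bound (C := 1)
        (((X.measurable_a t).comp hu).mul ((X.measurable_y t).comp hu)).aestronglyMeasurable
        (Filter.Eventually.of_forall fun x => by
          rw [Real.norm_eq_abs, abs_of_nonneg (mul_nonneg (X.a_nonneg _ _) (X.y_nonneg _ _))]
          exact mul_le_one₀ (X.a_le _ _) (X.y_nonneg _ _) (X.y_le _ _))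
    have hgeq : (fun x => g t (Function.update ω t x)) = fun x =>
        1 + (κ - 1) * X.a t (Function.update ω t x)
          - κ * θ * (X.a t (Function.update ω t x) * X.y t (Function.update ω t x)) := by
      funext x; simp only [g]; ring
    have h1a : Integrable (fun x => 1 + (κ - 1) * X.a t (Function.update ω t x)) ρ :=
      (integrable_const _).add (ha.const_mul _)
    have hgi : Integrable (fun x => g t (Function.update ω t x)) ρ := by
      rw [hgeq]; exact h1a.sub (hay.const_mul _)
    rw [← ofReal_integral_eq_lintegral_ofReal hgi
      (Filter.Eventually.of_forall fun x => hg t _)]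
    rw [← ENNReal.ofReal_one]
    refine ENNReal.ofReal_le_ofReal ?_
    rw [hgeq, integral_sub h1a (hay.const_mul _),
      integral_add (integrable_const _) (ha.const_mul _), integral_const_mul, integral_const_mul]
    simp only [integral_const, probReal_univ, smul_eq_mul, mul_one]
    have h0 : 0 ≤ ∫ x, X.a t (Function.update ω t x) ∂ρ := integral_nonneg fun x => X.a_nonneg _ _
    have := mul_le_mul_of_nonneg_left (hq t ω) hκ
    nlinarith [mul_le_mul_of_nonneg_right hκq h0]

/-- Exponential deviation inequality for sums of outcomes. -/
theorem exp_deviation (ρ : Measure E) [IsProbabilityMeasure ρ] (l q c : ℝ)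
    (hc : 1 + (Real.exp l - 1) * q ≤ Real.exp c)
    (hq : ∀ t ω, (Real.exp l - 1) *
        ∫ x, X.a t (Function.update ω t x) * X.y t (Function.update ω t x) ∂ρ
      ≤ (Real.exp l - 1) * (q * ∫ x, X.a t (Function.update ω t x) ∂ρ))
    (n : ℕ) (L : ℝ) :
    (Measure.infinitePi fun _ : ℕ => ρ) {ω | ∃ t ≤ n,
      L ≤ l * ∑ s ∈ Finset.range t, X.a s ω * X.y s ω - c * ∑ s ∈ Finset.range t, X.a s ω}
      ≤ ENNReal.ofReal (Real.exp (-L)) := by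
  refine (measure_mono ?_).trans (X.prod_le ρ (1 - Real.exp l) q (Real.exp (-c))
    (by linarith [Real.exp_pos l]) (Real.exp_pos _).le ?_ ?_ n L)
  · rintro ω ⟨t, ht, h⟩
    refine ⟨t, ht, (Real.exp_le_exp.2 h).trans ?_⟩
    rw [Finset.mul_sum, Finset.mul_sum, ← Finset.sum_sub_distrib, Real.exp_sum]
    refine Finset.prod_le_prod (fun _ _ => (Real.exp_pos _).le) fun s _ => ?_
    rcases X.a_eq s ω with h | h
    · simp [h]
    · rw [h]
      -- On [0,1] the convex function exp(l y) lies below its chord.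
      have hconv : Real.exp (l * X.y s ω) ≤ 1 - (1 - Real.exp l) * X.y s ω := by
        have := convexOn_exp.2 (Set.mem_univ (0 : ℝ)) (Set.mem_univ l)
          (sub_nonneg.2 (X.y_le s ω)) (X.y_nonneg s ω) (by ring)
        simp only [smul_eq_mul, mul_zero, zero_add, Real.exp_zero, mul_one] at this
        rw [mul_comm l]; linarith
      rw [show l * (1 * X.y s ω) - c * 1 = -c + l * X.y s ω by ring, Real.exp_add]
      have := mul_le_mul_of_nonneg_left hconv (Real.exp_pos (-c)).le
      linarith
  · rw [Real.exp_neg, inv_mul_le_one₀ (Real.exp_pos c)]; linarith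
  · intro t ω; have := hq t ω; linarith

/-- A long sequence of tests has a positive outcome with high probability. -/
theorem exists_success (ρ : Measure E) [IsProbabilityMeasure ρ] (q : ℝ)
    (hq : ∀ t ω, q * ∫ x, X.a t (Function.update ω t x) ∂ρ
      ≤ ∫ x, X.a t (Function.update ω t x) * X.y t (Function.update ω t x) ∂ρ)
    (n : ℕ) (L : ℝ) :
    (Measure.infinitePi fun _ : ℕ => ρ) {ω | ∃ t ≤ n,
      (∀ s < t, X.a s ω * X.y s ω = 0) ∧ L ≤ q * ∑ s ∈ Finset.range t, X.a s ω}
      ≤ ENNReal.ofReal (Real.exp (-L)) := by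
  -- As long as every outcome is 0, each performed test contributes the full factor e^q.
  refine (measure_mono ?_).trans (X.prod_le ρ 1 q (Real.exp q) le_rfl (Real.exp_pos _).le ?_ ?_ n L)
  · rintro ω ⟨t, ht, h0, h⟩
    refine ⟨t, ht, (Real.exp_le_exp.2 h).trans ?_⟩
    rw [Finset.mul_sum, Real.exp_sum]
    refine Finset.prod_le_prod (fun _ _ => (Real.exp_pos _).le) fun s hs => ?_
    have h0s := h0 s (Finset.mem_range.1 hs)
    rcases X.a_eq s ω with h | h
    · simp [h]
    · rw [h, one_mul] at h0s
      simp [h, h0s]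
  · have h := Real.add_one_le_exp (-q)
    have h2 : Real.exp q * Real.exp (-q) = 1 := by rw [← Real.exp_add]; simp
    nlinarith [Real.exp_pos q]
  · intro t ω; simpa using hq t ω

end Tests

/-- Hoeffding's lemma for a Bernoulli variable. -/
theorem one_add_exp_le (l q : ℝ) (h0 : 0 ≤ q) (h1 : q ≤ 1) :
    1 + (Real.exp l - 1) * q ≤ Real.exp (l * q + l ^ 2 / 8) := by
  -- The Bernoulli law with parameter `q` is bounded, hence sub-Gaussian; its centred moment
  -- generating function gives the claim after multiplication by e^(lq).
  let μ : Measure ℝ := ENNReal.ofReal q • Measure.dirac 1 + ENNReal.ofReal (1 - q) • Measure.dirac 0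
  have hμ : IsProbabilityMeasure μ := ⟨by
    simp only [μ, Measure.coe_add, Measure.coe_smul, Pi.add_apply, Pi.smul_apply, measure_univ,
      smul_eq_mul, mul_one]
    rw [← ENNReal.ofReal_add h0 (by linarith)]; simp⟩
  have hi : ∀ f : ℝ → ℝ, ∫ x, f x ∂μ = q * f 1 + (1 - q) * f 0 := by
    intro f
    simp only [μ]
    rw [integral_add_measure, integral_smul_measure, integral_smul_measure, integral_dirac,
      integral_dirac, ENNReal.toReal_ofReal h0, ENNReal.toReal_ofReal (by linarith)]
    · simp
    · exact (integrable_dirac (by simp)).smul_measure ENNReal.ofReal_ne_top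
    · exact (integrable_dirac (by simp)).smul_measure ENNReal.ofReal_ne_top
  have hae : ∀ᵐ x ∂μ, (id x : ℝ) ∈ Set.Icc (0 : ℝ) 1 := by
    simp only [μ, ae_add_measure_iff]
    constructor
    · exact Measure.ae_smul_measure (by simp [ae_dirac_eq]) _
    · exact Measure.ae_smul_measure (by simp [ae_dirac_eq]) _
  have h := (ProbabilityTheory.hasSubgaussianMGF_of_mem_Icc (μ := μ) measurable_id.aemeasurable
    hae).mgf_le l
  rw [ProbabilityTheory.mgf, hi, hi] at h
  simp only [id] at h
  have h3 : Real.exp (l * q + l ^ 2 / 8) = Real.exp (l * q) * Real.exp (l ^ 2 / 8) := Real.exp_add _ _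
  have h4 : q * Real.exp (l * (1 - (q * 1 + (1 - q) * 0))) +
      (1 - q) * Real.exp (l * (0 - (q * 1 + (1 - q) * 0)))
      = Real.exp (-(l * q)) * (1 + (Real.exp l - 1) * q) := by
    rw [show l * (1 - (q * 1 + (1 - q) * 0)) = -(l * q) + l by ring,
      show l * (0 - (q * 1 + (1 - q) * 0)) = -(l * q) by ring, Real.exp_add]; ring
  rw [h4] at h
  rw [h3]
  have h5 := mul_le_mul_of_nonneg_left h (Real.exp_pos (l * q)).le
  rw [← mul_assoc, ← Real.exp_add] at h5
  simp only [add_neg_cancel, Real.exp_zero, one_mul] at h5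
  refine h5.trans (le_of_eq ?_)
  congr 2
  simp
  ring

end Probability


/-! ### Measurability of the algorithm and its adaptedness. -/

section Measurability

variable {K M : ℕ} {Z : Type*} [MeasurableSpace Z]

instance : MeasurableSpace (Mode K) := ⊤

instance : DiscreteMeasurableSpace (Mode K) := ⟨fun _ => trivial⟩

instance : Countable (Mode K) := by
  let f : Mode K → ℕ × Bool × Option (Fin K) × Option (Fin K) × ℕ × ℕ × Finset (Fin K) := fun m =>
    match m with
    | .chairs b o => (0, b, o, none, 0, 0, ∅)
    | .estimate k n m => (1, true, none, some k, n, m, ∅)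
    | .explore => (2, true, none, none, 0, 0, ∅)
    | .declare k => (3, true, none, some k, 0, 0, ∅)
    | .occupy A o => (4, true, o, none, 0, 0, A)
    | .receive => (5, true, none, none, 0, 0, ∅)
    | .exploit k => (6, true, none, some k, 0, 0, ∅)
  refine Function.Injective.countable (f := f) ?_
  intro a b h
  cases a <;> cases b <;> simp_all [f]

/-- The fields of a memory, as a tuple. -/
def State.toTuple (σ : State K) :=
  (σ.mode, σ.left, σ.p, σ.act, σ.Mp, σ.pos, σ.S, σ.N, σ.s, σ.n, σ.r, σ.Td, σ.decl, σ.rej, σ.acc)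

/-- This σ-algebra makes all projections, and through `measurable_mk` the constructor, measurable;
every update of a memory is then handled field by field. -/
instance : MeasurableSpace (State K) := MeasurableSpace.comap State.toTuple inferInstance

theorem State.measurable_toTuple : Measurable (State.toTuple : State K → _) :=
  comap_measurable _

@[fun_prop] theorem measurable_mode : Measurable (State.mode : State K → _) :=
  measurable_fst.comp State.measurable_toTuple
@[fun_prop] theorem measurable_left : Measurable (State.left : State K → _) :=
  (by fun_prop : Measurable fun x : _ × _ × _ => x.2.1).comp State.measurable_toTuple
@[fun_prop] theorem measurable_p : Measurable (State.p : State K → _) :=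
  (by fun_prop : Measurable fun x : _ × _ × _ × _ => x.2.2.1).comp State.measurable_toTuple
@[fun_prop] theorem measurable_act : Measurable (State.act : State K → _) :=
  (by fun_prop : Measurable fun x : _ × _ × _ × _ × _ => x.2.2.2.1).comp State.measurable_toTuple
@[fun_prop] theorem measurable_Mp : Measurable (State.Mp : State K → _) :=
  (by fun_prop : Measurable fun x : _ × _ × _ × _ × _ × _ => x.2.2.2.2.1).comp
    State.measurable_toTuple
@[fun_prop] theorem measurable_pos : Measurable (State.pos : State K → _) :=
  (by fun_prop : Measurable fun x : _ × _ × _ × _ × _ × _ × _ => x.2.2.2.2.2.1).comp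
    State.measurable_toTuple
@[fun_prop] theorem measurable_S : Measurable (State.S : State K → _) :=
  (by fun_prop : Measurable fun x : _ × _ × _ × _ × _ × _ × _ × _ => x.2.2.2.2.2.2.1).comp
    State.measurable_toTuple
@[fun_prop] theorem measurable_N : Measurable (State.N : State K → _) :=
  (by fun_prop : Measurable fun x : _ × _ × _ × _ × _ × _ × _ × _ × _ => x.2.2.2.2.2.2.2.1).comp
    State.measurable_toTuple
@[fun_prop] theorem measurable_s : Measurable (State.s : State K → _) :=
  (by fun_prop : Measurable fun x : _ × _ × _ × _ × _ × _ × _ × _ × _ × _ =>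
    x.2.2.2.2.2.2.2.2.1).comp State.measurable_toTuple
@[fun_prop] theorem measurable_n : Measurable (State.n : State K → _) :=
  (by fun_prop : Measurable fun x : _ × _ × _ × _ × _ × _ × _ × _ × _ × _ × _ =>
    x.2.2.2.2.2.2.2.2.2.1).comp State.measurable_toTuple
@[fun_prop] theorem measurable_r : Measurable (State.r : State K → _) :=
  (by fun_prop : Measurable fun x : _ × _ × _ × _ × _ × _ × _ × _ × _ × _ × _ × _ =>
    x.2.2.2.2.2.2.2.2.2.2.1).comp State.measurable_toTuple
@[fun_prop] theorem measurable_Td : Measurable (State.Td : State K → _) :=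
  (by fun_prop : Measurable fun x : _ × _ × _ × _ × _ × _ × _ × _ × _ × _ × _ × _ × _ =>
    x.2.2.2.2.2.2.2.2.2.2.2.1).comp State.measurable_toTuple
@[fun_prop] theorem measurable_decl : Measurable (State.decl : State K → _) :=
  (by fun_prop : Measurable fun x : _ × _ × _ × _ × _ × _ × _ × _ × _ × _ × _ × _ × _ × _ =>
    x.2.2.2.2.2.2.2.2.2.2.2.2.1).comp State.measurable_toTuple
@[fun_prop] theorem measurable_rej : Measurable (State.rej : State K → _) :=
  (by fun_prop : Measurable fun x : _ × _ × _ × _ × _ × _ × _ × _ × _ × _ × _ × _ × _ × _ × _ =>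
    x.2.2.2.2.2.2.2.2.2.2.2.2.2.1).comp State.measurable_toTuple
@[fun_prop] theorem measurable_acc : Measurable (State.acc : State K → _) :=
  (by fun_prop : Measurable fun x : _ × _ × _ × _ × _ × _ × _ × _ × _ × _ × _ × _ × _ × _ × _ =>
    x.2.2.2.2.2.2.2.2.2.2.2.2.2.2).comp State.measurable_toTuple

@[fun_prop] theorem measurable_mk {mode : Z → Mode K} {left p : Z → ℕ} {act : Z → Finset (Fin K)}
    {Mp : Z → ℤ} {pos : Z → Fin K} {S : Z → Fin K → ℝ} {N : Z → Fin K → ℕ} {s : Z → Fin K → ℝ}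
    {n : Z → Fin K → ℕ} {r : Z → ℝ} {Td : Z → ℕ} {decl rej acc : Z → Finset (Fin K)}
    (h1 : Measurable mode) (h2 : Measurable left) (h3 : Measurable p) (h4 : Measurable act)
    (h5 : Measurable Mp) (h6 : Measurable pos) (h7 : Measurable S) (h8 : Measurable N)
    (h9 : Measurable s) (h10 : Measurable n) (h11 : Measurable r) (h12 : Measurable Td)
    (h13 : Measurable decl) (h14 : Measurable rej) (h15 : Measurable acc) :
    Measurable fun z => State.mk (mode z) (left z) (p z) (act z) (Mp z) (pos z) (S z) (N z) (s z)
      (n z) (r z) (Td z) (decl z) (rej z) (acc z) := by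
  rw [measurable_comap_iff]
  change Measurable fun z => (mode z, left z, p z, act z, Mp z, pos z, S z, N z, s z, n z, r z,
    Td z, decl z, rej z, acc z)
  fun_prop

/-- A countable-valued quantity may be frozen when measurability is checked. It is applied to the
mode, the pulled arm and the active set, which turns every `match` of the algorithm into finitely
many fixed branches. -/
theorem measurable_fiber {D Y : Type*} [Countable D] [MeasurableSpace D]
    [MeasurableSingletonClass D] [MeasurableSpace Y] {d : Z → D} (hd : Measurable d)
    {G : D → Z → Y} (hG : ∀ a, Measurable (G a)) : Measurable fun z => G (d z) z :=
  (measurable_from_prod_countable_right (f := fun x : D × Z => G x.1 x.2) hG).comp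
    (hd.prodMk measurable_id)

theorem measurable_discrete {A C : Type*} [MeasurableSpace A] [DiscreteMeasurableSpace A]
    [MeasurableSpace C] (g : A → C) {f : Z → A} (hf : Measurable f) :
    Measurable fun z => g (f z) := (Measurable.of_discrete (f := g)).comp hf

theorem measurable_discrete₂ {A B C : Type*} [MeasurableSpace A] [Countable A]
    [DiscreteMeasurableSpace A] [MeasurableSpace B] [Countable B] [DiscreteMeasurableSpace B]
    [MeasurableSpace C] (g : A → B → C) {f : Z → A} {f' : Z → B} (hf : Measurable f)
    (hf' : Measurable f') : Measurable fun z => g (f z) (f' z) :=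
  measurable_discrete (fun x : A × B => g x.1 x.2) (hf.prodMk hf')

@[fun_prop] theorem measurable_funUpdate {f : Z → Fin K → ℝ} {i : Z → Fin K} {x : Z → ℝ}
    (hf : Measurable f) (hi : Measurable i) (hx : Measurable x) :
    Measurable fun z => Function.update (f z) (i z) (x z) := by
  refine measurable_fiber (G := fun i z => Function.update (f z) i (x z)) hi fun i => ?_
  refine measurable_pi_lambda _ fun k => ?_
  by_cases h : k = i
  · subst h; simpa using hx
  · simp only [Function.update_of_ne h]; fun_prop

theorem measurable_coord {f : Z → Fin K → ℝ} {i : Z → Fin K}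
    (hf : Measurable f) (hi : Measurable i) : Measurable fun z => f z (i z) :=
  measurable_fiber (G := fun i z => f z i) hi fun i => by fun_prop

@[fun_prop] theorem measurable_S_apply {σ : Z → State K} {i : Z → Fin K}
    (hσ : Measurable σ) (hi : Measurable i) : Measurable fun z => (σ z).S (i z) :=
  measurable_coord (by fun_prop) hi

@[fun_prop] theorem measurable_s_apply {σ : Z → State K} {i : Z → Fin K}
    (hσ : Measurable σ) (hi : Measurable i) : Measurable fun z => (σ z).s (i z) :=
  measurable_coord (by fun_prop) hi

@[fun_prop] theorem measurable_countUpdate {f : Z → Fin K → ℕ} {i : Z → Fin K}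
    (hf : Measurable f) (hi : Measurable i) :
    Measurable fun z => Function.update (f z) (i z) (f z (i z) + 1) :=
  measurable_discrete₂ (fun (f : Fin K → ℕ) i => Function.update f i (f i + 1)) hf hi

@[fun_prop] theorem measurable_succArm {A : Z → Finset (Fin K)} {k : Z → Fin K}
    (hA : Measurable A) (hk : Measurable k) : Measurable fun z => succArm (A z) (k z) :=
  measurable_discrete₂ succArm hA hk

@[fun_prop] theorem measurable_finset_union {A B : Z → Finset (Fin K)}
    (hA : Measurable A) (hB : Measurable B) : Measurable fun z => A z ∪ B z :=
  measurable_discrete₂ (fun A B => A ∪ B) hA hB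

@[fun_prop] theorem measurable_finset_sdiff {A B : Z → Finset (Fin K)}
    (hA : Measurable A) (hB : Measurable B) : Measurable fun z => A z \ B z :=
  measurable_discrete₂ (fun A B => A \ B) hA hB

@[fun_prop] theorem measurable_finset_card {A : Z → Finset (Fin K)}
    (hA : Measurable A) : Measurable fun z => (A z).card :=
  measurable_discrete Finset.card hA

theorem measurable_finset_filter {A : Z → Finset (Fin K)} {q : Fin K → Z → Prop}
    [∀ z, DecidablePred fun k => q k z]
    (hA : Measurable A) (hq : ∀ k, MeasurableSet {z | q k z}) :
    Measurable fun z => (A z).filter fun k => q k z := by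
  rw [measurable_finset_iff]
  intro k
  simp only [Finset.mem_filter]
  exact ((measurable_finset_mem k).comp hA).and (measurableSet_setOfPred.1 (hq k))

namespace State

variable {σ : Z → State K} {i : Z → Fin K} {r : Z → ℝ}

theorem measurable_countBlock (hσ : Measurable σ) (hi : Measurable i) (hr : Measurable r) :
    Measurable fun z => (σ z).countBlock (i z) (r z) := by
  unfold countBlock; fun_prop

theorem measurable_setMode (hσ : Measurable σ) {m : Z → Mode K} (hm : Measurable m) :
    Measurable fun z => { σ z with mode := m z } := by
  fun_prop

theorem measurable_observe (hσ : Measurable σ) (hi : Measurable i) (hr : Measurable r) :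
    Measurable fun z => (σ z).observe (i z) (r z) := by
  have hpos : MeasurableSet {z | 0 < r z} := measurableSet_lt measurable_const hr
  refine measurable_fiber (d := fun z => (σ z).mode)
    (G := fun m z => ({ σ z with mode := m } : State K).observe (i z) (r z)) (by fun_prop) ?_
  intro m
  have hcb := measurable_countBlock hσ hi hr
  unfold countBlock at hcb
  rcases m with ⟨b, _ | k⟩ | ⟨k, n, m⟩ | _ | k | ⟨A, _ | k⟩ | _ | k <;> simp only [observe]
  · refine measurable_setMode hσ ?_
    simp only [apply_ite (Mode.chairs b)]
    exact Measurable.ite hpos (measurable_discrete (fun i => Mode.chairs b (some i)) hi)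
      measurable_const
  · fun_prop
  · fun_prop
  · fun_prop
  · unfold countBlock; fun_prop
  · have hset : MeasurableSet {z | i z ∈ A ∧ 0 < r z} :=
      (measurableSet_preimage hi (MeasurableSet.of_discrete (s := {k | k ∈ A}))).inter hpos
    unfold countBlock
    refine measurable_setMode (σ := fun z => { (σ z) with
      s := Function.update (σ z).s (i z) ((σ z).s (i z) + r z)
      n := Function.update (σ z).n (i z) ((σ z).n (i z) + 1)
      pos := succArm (σ z).act (σ z).pos }) hcb ?_
    simp only [apply_ite (Mode.occupy A)]
    exact Measurable.ite hset (measurable_discrete (fun i => Mode.occupy A (some i)) hi)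
      measurable_const
  · fun_prop
  · unfold countBlock; fun_prop
  · fun_prop

theorem measurable_count (hσ : Measurable σ) (k : Fin K) :
    Measurable fun z => ((σ z).N k : ℝ) :=
  measurable_discrete (fun f : Fin K → ℕ => (f k : ℝ)) (by fun_prop)

theorem measurable_blockCount (hσ : Measurable σ) (k : Fin K) :
    Measurable fun z => ((σ z).n k : ℝ) :=
  measurable_discrete (fun f : Fin K → ℕ => (f k : ℝ)) (by fun_prop)

theorem measurable_avg (hσ : Measurable σ) (k : Fin K) : Measurable fun z => (σ z).avg k := by
  have := measurable_count hσ k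
  unfold avg; fun_prop

theorem measurable_radius (P : Params K) (hσ : Measurable σ) (k : Fin K) :
    Measurable fun z => (σ z).radius P k := by
  have := measurable_count hσ k
  unfold radius; fun_prop

theorem measurable_rejected (P : Params K) (hσ : Measurable σ) :
    Measurable fun z => (σ z).rejected P := by
  unfold rejected
  refine measurable_finset_filter (by fun_prop) fun k => ?_
  refine measurableSet_le (by fun_prop) ?_
  refine measurable_discrete (fun A : Finset (Fin K) => (A.card : ℤ)) ?_
  refine measurable_finset_filter (by fun_prop) fun i => ?_
  exact measurableSet_le ((measurable_avg hσ k).add (measurable_radius P hσ k))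
    ((measurable_avg hσ i).sub (measurable_radius P hσ i))

theorem measurable_accepted (P : Params K) (hσ : Measurable σ) :
    Measurable fun z => (σ z).accepted P := by
  unfold accepted
  refine measurable_finset_filter (by fun_prop) fun k => ?_
  refine measurableSet_le (measurable_discrete₂ (fun (A : Finset (Fin K)) (m : ℤ) => (A.card : ℤ) - m)
    (by fun_prop) (by fun_prop)) ?_
  refine measurable_discrete (fun A : Finset (Fin K) => (A.card : ℤ)) ?_
  refine measurable_finset_filter (by fun_prop) fun i => ?_
  exact measurableSet_le ((measurable_avg hσ i).add (measurable_radius P hσ i))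
    ((measurable_avg hσ k).sub (measurable_radius P hσ k))

theorem measurable_signaled (hσ : Measurable σ) : Measurable fun z => (σ z).signaled := by
  unfold signaled
  refine measurable_finset_filter (by fun_prop) fun k => ?_
  have h1 := measurable_count hσ k
  have h2 := measurable_blockCount hσ k
  exact measurableSet_le (by fun_prop) (by fun_prop)

theorem measurable_startBlock (hσ : Measurable σ) {m : Z → Mode K} (hm : Measurable m) :
    Measurable fun z => (σ z).startBlock (m z) := by
  unfold startBlock; fun_prop

theorem measurableSet_nonempty {A : Z → Finset (Fin K)} (hA : Measurable A) :
    MeasurableSet {z | (A z).Nonempty} :=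
  hA (MeasurableSet.of_discrete (s := {A : Finset (Fin K) | A.Nonempty}))

theorem measurable_nextBlock (P : Params K) (hσ : Measurable σ) :
    Measurable fun z => nextBlock P (σ z) := by
  unfold nextBlock
  refine Measurable.ite (measurableSet_nonempty (by fun_prop)) ?_
    (Measurable.ite (measurableSet_nonempty (by fun_prop)) ?_ ?_)
  · exact measurable_startBlock hσ (measurable_discrete (fun A => Mode.declare (P.pick A))
      (by fun_prop : Measurable fun z => (σ z).rej \ (σ z).decl))
  · exact measurable_startBlock hσ (measurable_discrete (fun A => Mode.occupy A none)
      (by fun_prop : Measurable fun z => (σ z).acc \ (σ z).decl))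
  · exact measurable_startBlock hσ measurable_const

theorem measurable_startComm (P : Params K) (hσ : Measurable σ) :
    Measurable fun z => startComm P (σ z) := by
  unfold startComm
  have h1 := measurable_rejected P hσ
  have h2 := measurable_accepted P hσ
  exact measurable_nextBlock P (by fun_prop)

theorem measurable_startPhase (P : Params K) (hσ : Measurable σ) {p : Z → ℕ} (hp : Measurable p) :
    Measurable fun z => startPhase P (σ z) (p z) := by
  unfold startPhase
  refine Measurable.ite (measurableSet_lt (by fun_prop) (by fun_prop)) ?_ ?_
  · fun_prop
  · have h1 : Measurable fun z => fun i => (σ z).S i + (σ z).s i :=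
      measurable_pi_lambda _ fun i => by fun_prop
    have h2 : Measurable fun z => fun i => (σ z).N i + (σ z).n i :=
      measurable_pi_lambda _ fun i => by fun_prop
    have h3 : Measurable fun z => 2 ^ p z := measurable_discrete (fun p : ℕ => 2 ^ p) hp
    fun_prop

theorem measurable_startEstimate (P : Params K) (hσ : Measurable σ) (n : ℕ) {k pos : Z → Fin K}
    {m : Z → ℕ} (hk : Measurable k) (hm : Measurable m) (hpos : Measurable pos) :
    Measurable fun z => (σ z).startEstimate P (k z) n (m z) (pos z) := by
  unfold startEstimate
  have h1 : Measurable fun z => Mode.estimate (k z) n (m z) :=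
    measurable_discrete₂ (fun k m => Mode.estimate k n m) hk hm
  have h2 : Measurable fun z => if 2 * ((k z : ℕ) + 1) ≤ n then succArm Finset.univ (pos z)
      else pos z :=
    measurable_discrete₂ (fun (k pos : Fin K) => if 2 * ((k : ℕ) + 1) ≤ n
      then succArm Finset.univ pos else pos) hk hpos
  fun_prop

theorem measurable_updateActive (hσ : Measurable σ) : Measurable fun z => (σ z).updateActive := by
  unfold updateActive
  have h1 : Measurable fun z => (((σ z).decl.filter fun i => (σ z).s i = 0).card : ℤ) := by
    refine measurable_discrete (fun A : Finset (Fin K) => (A.card : ℤ)) ?_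
    refine measurable_finset_filter (by fun_prop) fun i => ?_
    exact measurableSet_eq_fun (by fun_prop) measurable_const
  fun_prop

theorem measurable_finish (P : Params K) (hσ : Measurable σ) :
    Measurable fun z => (σ z).finish P := by
  refine measurable_fiber (d := fun z => (σ z).mode)
    (G := fun m z => ({ σ z with mode := m } : State K).finish P) (by fun_prop) ?_
  intro m
  have hmode : Measurable fun z => ({ σ z with mode := m } : State K) := by fun_prop
  have hsig := measurable_signaled hmode
  rcases m with ⟨_ | _, f⟩ | ⟨k, n, m⟩ | _ | k | ⟨A, _ | k⟩ | _ | k <;> simp only [finish]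
  · have h3 : Measurable fun z => 2 ^ (σ z).p :=
      measurable_discrete (fun p : ℕ => 2 ^ p) (by fun_prop)
    have h4 : Measurable fun z => f.getD (P.pick (σ z).act) :=
      measurable_discrete (fun A => f.getD (P.pick A)) (by fun_prop)
    fun_prop
  · have h4 : Measurable fun z => f.getD (P.pick (σ z).act) :=
      measurable_discrete (fun A => f.getD (P.pick A)) (by fun_prop)
    exact measurable_startEstimate P hmode 1 h4 measurable_const h4
  · have h1 : MeasurableSet {z | (σ z).r = 0} :=
      measurableSet_eq_fun (by fun_prop) measurable_const
    have h2 : Measurable fun z => if (σ z).r = 0 then m + 1 else m :=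
      Measurable.ite h1 measurable_const measurable_const
    have h3 : Measurable fun z => ((if (σ z).r = 0 then m + 1 else m : ℕ) : ℤ) :=
      measurable_discrete (fun m : ℕ => (m : ℤ)) h2
    split_ifs
    · exact measurable_startEstimate P hmode (n + 1) measurable_const h2 (by fun_prop)
    · have h3' : Measurable fun z => (if (σ z).r = 0 then (m : ℤ) + 1 else m) :=
        Measurable.ite h1 measurable_const measurable_const
      exact measurable_startPhase P (by fun_prop) measurable_const
  · exact measurable_startComm P hmode
  · exact measurable_nextBlock P (by fun_prop)
  · exact measurable_startBlock (by fun_prop) measurable_const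
  · fun_prop
  · refine Measurable.ite (measurableSet_nonempty (by fun_prop)) ?_ ?_
    · exact measurable_startBlock (by fun_prop) measurable_const
    · exact measurable_startPhase P (measurable_updateActive hmode) (by fun_prop)
  · exact hmode

theorem measurable_step (P : Params K) (hσ : Measurable σ) (hi : Measurable i)
    (hr : Measurable r) : Measurable fun z => (σ z).step P (i z) (r z) := by
  unfold step
  have h := measurable_observe hσ hi hr
  exact Measurable.ite (measurableSet_le (by fun_prop) measurable_const)
    (measurable_finish P h) (by fun_prop)

theorem measurable_arm (P : Params K) (hσ : Measurable σ) {u : Z → unitInterval}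
    (hu : Measurable u) : Measurable fun z => (σ z).arm P (u z) := by
  refine measurable_fiber (d := fun z => (σ z).mode)
    (G := fun m z => ({ σ z with mode := m } : State K).arm P (u z)) (by fun_prop) ?_
  intro m
  rcases m with ⟨b, _ | k⟩ | ⟨k, n, m⟩ | _ | k | ⟨A, _ | k⟩ | _ | k <;> simp only [arm] <;>
    try fun_prop
  · refine measurable_fiber (d := fun z => (σ z).act) (G := fun A z => uniformArm P A (u z))
      (by fun_prop) fun A => ?_
    unfold uniformArm
    refine measurable_discrete (fun n : ℕ => (A.sort (· ≤ ·)).getD n (P.pick A)) ?_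
    exact Nat.measurable_floor.comp ((measurable_subtype_coe.comp hu).mul_const _)
  · exact Measurable.ite (measurableSet_lt (measurable_subtype_coe.comp hu) measurable_const)
      measurable_const (by fun_prop)

end State

theorem measurable_playerReward {x : Z → Fin K → ℝ} {a : Z → Fin M → Fin K}
    (hx : Measurable x) (ha : Measurable a) (j : Fin M) :
    Measurable fun z => playerReward (x z) (a z) j := by
  refine measurable_fiber (G := fun a z => playerReward (x z) a j) ha fun a => ?_
  unfold playerReward
  fun_prop

theorem measurable_arms (P : Params K) {σ : Z → Fin M → State K} {u : Z → Fin M → unitInterval}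
    (hσ : Measurable σ) (hu : Measurable u) : Measurable fun z => arms P (σ z) (u z) :=
  measurable_pi_lambda _ fun j => State.measurable_arm P (by fun_prop) (by fun_prop)

theorem measurable_run (P : Params K) (t : ℕ) :
    Measurable fun ω : Sample K M => run P ω t := by
  induction t with
  | zero => exact measurable_const
  | succ t ih =>
    refine measurable_pi_lambda _ fun j => ?_
    have h : Measurable fun ω : Sample K M => arms P (run P ω t) (ω t).2 :=
      measurable_arms P ih (by fun_prop)
    exact State.measurable_step P (by fun_prop) (by fun_prop)
      (measurable_playerReward (by fun_prop) h j)

/-- Adaptedness: the memories before round `t` ignore the coordinates from `t` on. This is what lets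
a round be resampled while the memories stay fixed. -/
theorem run_update (P : Params K) (ω : Sample K M) (s : ℕ) (x) (t : ℕ) (h : t ≤ s) :
    run P (Function.update ω s x) t = run P ω t := by
  induction t with
  | zero => rfl
  | succ t ih =>
    have hne : t ≠ s := by omega
    funext j
    simp only [run, ih (by omega), Function.update_of_ne hne]

end Measurability


/-! ### Conditional expectations within a single round. -/

section OneStep

variable {K M : ℕ}

/-- Law of one round. -/
noncomputable abbrev roundMeasure (M : ℕ) (ν : Fin K → Measure ℝ) :
    Measure ((Fin K → ℝ) × (Fin M → unitInterval)) :=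
  (Measure.pi ν).prod (Measure.pi fun _ : Fin M => (volume : Measure unitInterval))

noncomputable abbrev seedMeasure (M : ℕ) : Measure (Fin M → unitInterval) :=
  Measure.pi fun _ : Fin M => (volume : Measure unitInterval)

/-- No other player pulls the arm of player `j`. -/
def NoColl (a : Fin M → Fin K) (j : Fin M) : Prop := ∀ i, a i = a j → i = j

open Classical in
theorem playerReward_eq (x : Fin K → ℝ) (a : Fin M → Fin K) (j : Fin M) :
    playerReward x a j = if NoColl a j then x (a j) else 0 := by
  unfold playerReward
  have hiff : (1 < (Finset.univ.filter fun i => a i = a j).card) ↔ ¬ NoColl a j := by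
    rw [Finset.one_lt_card_iff]
    constructor
    · rintro ⟨i, i', hi, hi', hne⟩ h
      simp only [Finset.mem_filter, Finset.mem_univ, true_and] at hi hi'
      exact hne ((h i hi).trans (h i' hi').symm)
    · intro h
      simp only [NoColl, not_forall] at h
      obtain ⟨i, hi, hne⟩ := h
      exact ⟨i, j, by simpa using hi, by simp, hne⟩
  by_cases h : NoColl a j
  · rw [if_neg (by rw [hiff]; exact not_not.2 h), if_pos h]; ring
  · rw [if_pos (hiff.2 h), if_neg h]; ring

/-- Arm values lie in [0,1] only almost surely; clamping makes the tests bounded at every sample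
point without changing the means. -/
noncomputable def clamp (x : ℝ) : ℝ := max 0 (min 1 x)

theorem clamp_nonneg (x : ℝ) : 0 ≤ clamp x := le_max_left _ _

theorem clamp_le (x : ℝ) : clamp x ≤ 1 := max_le zero_le_one (min_le_left _ _)

theorem clamp_eq {x : ℝ} (h : x ∈ Set.Icc (0 : ℝ) 1) : clamp x = x := by
  rw [clamp, min_eq_right h.2, max_eq_right h.1]

@[fun_prop] theorem measurable_clamp : Measurable clamp := by unfold clamp; fun_prop

variable (ν : Fin K → Measure ℝ) [∀ k, IsProbabilityMeasure (ν k)]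

theorem integral_clamp (h : ∀ k, ∀ᵐ x ∂(ν k), x ∈ Set.Icc (0 : ℝ) 1) (k : Fin K) :
    ∫ x, clamp (x k) ∂(Measure.pi ν) = mean ν k := by
  unfold mean
  have h1 := integral_map (μ := Measure.pi ν) (φ := Function.eval k) (f := clamp)
    (measurable_pi_apply k).aemeasurable measurable_clamp.aestronglyMeasurable
  rw [(measurePreserving_eval ν k).map_eq] at h1
  refine h1.symm.trans ?_
  exact integral_congr_ae ((h k).mono fun x hx => clamp_eq hx)

open Classical in
-- The selection `C` and the arm `i` depend on the seeds only, which are independent of the arm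
-- values; so the value may be averaged first.
theorem integral_select (h : ∀ k, ∀ᵐ x ∂(ν k), x ∈ Set.Icc (0 : ℝ) 1)
    {C : (Fin M → unitInterval) → Prop} (hC : Measurable C)
    {i : (Fin M → unitInterval) → Fin K} (hi : Measurable i) :
    ∫ x, (if C x.2 then 1 else 0) * clamp (x.1 (i x.2)) ∂(roundMeasure M ν)
      = ∫ u, (if C u then 1 else 0) * mean ν (i u) ∂(seedMeasure M) := by
  have hCm : Measurable fun u => (if C u then (1 : ℝ) else 0) :=
    Measurable.ite (measurableSet_setOfPred.2 hC) measurable_const measurable_const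
  rw [integral_prod_symm]
  · refine integral_congr_ae (Filter.Eventually.of_forall fun u => ?_)
    exact (integral_const_mul (if C u then (1 : ℝ) else 0) fun x : Fin K → ℝ => clamp (x (i u))).trans (by rw [integral_clamp ν h (i u)])
  · refine Integrable.of_bound (C := 1) (Measurable.aestronglyMeasurable ?_)
      (Filter.Eventually.of_forall fun x => ?_)
    · exact (hCm.comp measurable_snd).mul (measurable_clamp.comp
        (measurable_coord measurable_fst (hi.comp measurable_snd)))
    · rw [Real.norm_eq_abs, abs_of_nonneg (mul_nonneg (by split_ifs <;> norm_num) (clamp_nonneg _))]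
      refine mul_le_one₀ (by split_ifs <;> norm_num) (clamp_nonneg _) (clamp_le _)

theorem integral_seed {f : (Fin M → unitInterval) → ℝ} :
    ∫ x, f x.2 ∂(roundMeasure M ν) = ∫ u, f u ∂(seedMeasure M) := by
  simpa using integral_fun_snd (μ := Measure.pi ν) (ν := seedMeasure M) f

theorem measurePreserving_seed_update (j : Fin M) :
    MeasurePreserving (fun z : (Fin M → unitInterval) × unitInterval => Function.update z.1 j z.2)
      ((seedMeasure M).prod volume) (seedMeasure M) := by
  have hmeas : Measurable
      (fun z : (Fin M → unitInterval) × unitInterval => Function.update z.1 j z.2) := by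
    refine measurable_pi_lambda _ fun i => ?_
    by_cases h : i = j
    · subst h; simpa using measurable_snd
    · simp only [Function.update_of_ne h]; fun_prop
  refine ⟨hmeas, (Measure.pi_eq fun B hB => ?_).symm⟩
  have hset : (fun z : (Fin M → unitInterval) × unitInterval => Function.update z.1 j z.2) ⁻¹'
      (Set.pi Set.univ B) = (Set.pi Set.univ (Function.update B j Set.univ)) ×ˢ B j := by
    ext ⟨u, v⟩
    simp only [Set.mem_preimage, Set.mem_pi, Set.mem_univ, true_implies, Set.mem_prod]
    constructor
    · refine fun h => ⟨fun i => ?_, by simpa using h j⟩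
      by_cases hij : i = j
      · subst hij; simp
      · simpa [Function.update_of_ne hij] using h i
    · rintro ⟨h1, h2⟩ i
      by_cases hij : i = j
      · subst hij; simpa using h2
      · simpa [Function.update_of_ne hij] using h1 i
  rw [Measure.map_apply hmeas (MeasurableSet.univ_pi hB), hset, Measure.prod_prod, Measure.pi_pi,
    ← Finset.mul_prod_erase _ _ (Finset.mem_univ j),
    ← Finset.mul_prod_erase _ (fun i => volume (B i)) (Finset.mem_univ j)]
  simp only [Function.update_self, measure_univ, one_mul]
  rw [mul_comm]
  congr 1
  refine Finset.prod_congr rfl fun i hi => ?_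
  rw [Function.update_of_ne (Finset.ne_of_mem_erase hi)]

open Classical in
-- Resampling the seed of `j` leaves `C` unchanged by `hdep`, so the coin of `j` is fair given `C`.
theorem integral_coin (j : Fin M) {C : (Fin M → unitInterval) → Prop} (hC : Measurable C)
    (hdep : ∀ u v, C (Function.update u j v) ↔ C u) :
    ∫ u, (if C u then (1 : ℝ) else 0) * (if (1 / 2 : ℝ) ≤ u j then 1 else 0) ∂(seedMeasure M)
      = 1 / 2 * ∫ u, (if C u then 1 else 0) ∂(seedMeasure M) := by
  have hCm : Measurable fun u => (if C u then (1 : ℝ) else 0) :=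
    Measurable.ite (measurableSet_setOfPred.2 hC) measurable_const measurable_const
  have hcoin : Measurable fun v : unitInterval => (if (1 / 2 : ℝ) ≤ v then (1 : ℝ) else 0) :=
    Measurable.ite (measurableSet_le measurable_const measurable_subtype_coe)
      measurable_const measurable_const
  have h := measurePreserving_seed_update (M := M) j
  set f : (Fin M → unitInterval) → ℝ :=
    fun u => (if C u then (1 : ℝ) else 0) * (if (1 / 2 : ℝ) ≤ u j then 1 else 0) with hf
  have hfm : Measurable f := hCm.mul (hcoin.comp (measurable_pi_apply j))
  have hfi : Integrable f (seedMeasure M) :=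
    Integrable.of_bound (C := 1) hfm.aestronglyMeasurable (Filter.Eventually.of_forall fun u => by
      simp only [hf]; split_ifs <;> norm_num)
  have h1 : ∫ u, f u ∂(seedMeasure M) = ∫ z, f (Function.update z.1 j z.2)
      ∂((seedMeasure M).prod volume) := by
    conv_lhs => rw [← h.map_eq]
    rw [integral_map h.measurable.aemeasurable]
    rw [h.map_eq]; exact hfi.aestronglyMeasurable
  rw [h1, integral_prod (fun z : (Fin M → unitInterval) × unitInterval =>
    f (Function.update z.1 j z.2)) (h.integrable_comp_of_integrable hfi), ← integral_const_mul]
  refine integral_congr_ae (Filter.Eventually.of_forall fun u => ?_)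
  simp only [hf, hdep, Function.update_self]
  rw [integral_const_mul, mul_comm]
  congr 1
  have : (fun v : unitInterval => (if (1 / 2 : ℝ) ≤ v then (1 : ℝ) else 0))
      = Set.indicator (Set.Ici (⟨1 / 2, by norm_num, by norm_num⟩ : unitInterval)) 1 := by
    funext v
    simp only [Set.indicator, Set.mem_Ici, Pi.one_apply, ← Subtype.coe_le_coe]
  rw [this, integral_indicator_one measurableSet_Ici, Measure.real, unitInterval.volume_Ici,
    ENNReal.toReal_ofReal] <;> norm_num

theorem measurable_uniformArm (P : Params K) (A : Finset (Fin K)) :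
    Measurable fun u => uniformArm P A u := by
  unfold uniformArm
  refine measurable_discrete (fun n : ℕ => (A.sort (· ≤ ·)).getD n (P.pick A)) ?_
  exact Nat.measurable_floor.comp (measurable_subtype_coe.mul_const _)

theorem le_volume_uniformArm (P : Params K) {A : Finset (Fin K)} {i : Fin K} (hi : i ∈ A) :
    (1 : ℝ) / A.card ≤ (volume : Measure unitInterval).real {u | uniformArm P A u = i} := by
  have hA : (0 : ℝ) < A.card := by exact_mod_cast Finset.card_pos.2 ⟨i, hi⟩
  obtain ⟨n, hn, hni⟩ := List.mem_iff_getElem.1 ((Finset.mem_sort (· ≤ ·)).2 hi)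
  have hnA : n < A.card := by simpa using hn
  have hnA' : (n : ℝ) + 1 ≤ A.card := by exact_mod_cast hnA
  have h1 : (n : ℝ) / A.card ∈ unitInterval :=
    ⟨by positivity, by rw [div_le_one hA]; linarith⟩
  have h2 : ((n : ℝ) + 1) / A.card ∈ unitInterval := ⟨by positivity, by rwa [div_le_one hA]⟩
  have hsub : Set.Ico (⟨_, h1⟩ : unitInterval) ⟨_, h2⟩ ⊆ {u | uniformArm P A u = i} := by
    intro u hu
    have hl : (n : ℝ) / A.card ≤ u := hu.1
    have hr : (u : ℝ) < ((n : ℝ) + 1) / A.card := hu.2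
    have hfl : ⌊(u : ℝ) * A.card⌋₊ = n := by
      rw [Nat.floor_eq_iff (mul_nonneg u.2.1 hA.le)]
      exact ⟨(div_le_iff₀ hA).1 hl, (lt_div_iff₀ hA).1 hr⟩
    simp only [Set.mem_ofPred_eq, uniformArm, hfl]
    rw [List.getD_eq_getElem _ _ hn, hni]
  refine le_trans (le_of_eq ?_) (measureReal_mono hsub)
  rw [Measure.real, unitInterval.volume_Ico, ENNReal.toReal_ofReal]
  · simp only; ring
  · simp only; rw [sub_nonneg]; gcongr; linarith

/-- The |A| disjoint events have probability at least 1/|A| each and at most 1 together, so equality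
holds. In this way the default value taken at the seed 1 never has to be examined. -/
theorem volume_uniformArm (P : Params K) {A : Finset (Fin K)} {i : Fin K} (hi : i ∈ A) :
    (volume : Measure unitInterval).real {u | uniformArm P A u = i} = 1 / A.card := by
  refine le_antisymm ?_ (le_volume_uniformArm P hi)
  have hA : (0 : ℝ) < A.card := by exact_mod_cast Finset.card_pos.2 ⟨i, hi⟩
  have hmeas : ∀ k, MeasurableSet {u | uniformArm P A u = k} := fun k =>
    measurableSet_setOfPred.2 (measurable_discrete (fun x => x = k) (measurable_uniformArm P A))
  have h1 : ∑ k ∈ A, (volume : Measure unitInterval).real {u | uniformArm P A u = k} ≤ 1 := by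
    rw [← measureReal_biUnion_finset]
    · exact measureReal_le_one
    · intro k _ k' _ hne
      exact Set.disjoint_left.2 fun u hu hu' => hne (hu.symm.trans hu')
    · exact fun k _ => hmeas k
  rw [← Finset.add_sum_erase _ _ hi] at h1
  have h2 : ∑ k ∈ A.erase i, (1 : ℝ) / A.card
      ≤ ∑ k ∈ A.erase i, (volume : Measure unitInterval).real {u | uniformArm P A u = k} :=
    Finset.sum_le_sum fun k hk => le_volume_uniformArm P (Finset.mem_of_mem_erase hk)
  rw [Finset.sum_const, Finset.card_erase_of_mem hi, nsmul_eq_mul,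
    Nat.cast_sub (Finset.card_pos.2 ⟨i, hi⟩)] at h2
  have h3 : ((A.card : ℝ) - (1 : ℕ)) * (1 / A.card) = 1 - 1 / A.card := by field_simp; simp
  linarith

/-- Coordinated execution of Musical Chairs on `A`. -/
def ChairsOK (m : Fin M → Mode K × Finset (Fin K)) (A : Finset (Fin K)) : Prop :=
  (∀ j, (∃ k, k ∉ A ∧ (m j).1 = .exploit k) ∨
    ((m j).2 = A ∧ ((∃ b, (m j).1 = .chairs b none) ∨ ∃ b, ∃ k ∈ A, (m j).1 = .chairs b (some k)))) ∧
  (∀ j j' b b' k, (m j).1 = .chairs b (some k) → (m j').1 = .chairs b' (some k) → j = j') ∧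
  ∃ U : Finset (Fin M), (∀ j, j ∉ U → ∃ k, (m j).1 = .exploit k) ∧ U.card ≤ A.card

/-- Increasing `u` by one multiplies the right side by (u+1)(1-1/a)/u, which is at least 1 exactly
when u + 1 ≤ a. -/
theorem one_le_mul_pow (a u : ℕ) (hu : 1 ≤ u) (hua : u ≤ a) :
    1 ≤ (u : ℝ) * (1 - 1 / a) ^ (u - 1) := by
  induction u, hu using Nat.le_induction with
  | base => simp
  | succ u hu ih =>
    have h := ih (by omega)
    have ha : (0 : ℝ) < a := by exact_mod_cast (by omega : 0 < a)
    have hua' : (u : ℝ) + 1 ≤ a := by exact_mod_cast hua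
    have hu0 : (0 : ℝ) < u := by exact_mod_cast hu
    have h1 : 0 ≤ 1 - 1 / (a : ℝ) := by
      rw [sub_nonneg, div_le_one ha]; linarith
    have h2 : (u : ℝ) ≤ (u + 1) * (1 - 1 / a) := by
      have : ((u : ℝ) + 1) / a ≤ 1 := (div_le_one ha).2 hua'
      have h3 : ((u : ℝ) + 1) * (1 - 1 / a) = u + 1 - (u + 1) / a := by ring
      linarith
    have h3 : u + 1 - 1 = (u - 1) + 1 := by omega
    rw [h3, pow_succ]
    push_cast
    calc 1 ≤ (u : ℝ) * (1 - 1 / a) ^ (u - 1) := h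
      _ ≤ ((u + 1) * (1 - 1 / a)) * (1 - 1 / a) ^ (u - 1) := by gcongr
      _ = _ := by ring

open Classical in
-- For a free arm i, player `j` draws it and no other of the u unseated players does with
-- probability (1/a)(1-1/a)^(u-1), where a = |A|. Unseated and seated players together number at
-- most a, so there are at least u free arms. The events for different arms are disjoint, and their
-- sum is at least 1/a by `one_le_mul_pow`.
theorem chairs_success (P : Params K) (σ : Fin M → State K) {A : Finset (Fin K)}
    (h : ChairsOK (fun j => ((σ j).mode, (σ j).act)) A) {j : Fin M} {b : Bool}
    (hj : (σ j).mode = .chairs b none) :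
    1 / (A.card : ℝ) ≤ (seedMeasure M).real {u | NoColl (arms P σ u) j} := by
  obtain ⟨hcase, hseat, U, hU, hUA⟩ := h
  simp only at hcase hseat hU
  let Un : Finset (Fin M) := Finset.univ.filter fun j' => ∃ b, (σ j').mode = .chairs b none
  let Se : Finset (Fin M) := Finset.univ.filter fun j' => ∃ b, ∃ k, (σ j').mode = .chairs b (some k)
  have hjUn : j ∈ Un := by simp only [Un, Finset.mem_filter]; exact ⟨Finset.mem_univ _, b, hj⟩
  let seat : Fin M → Fin K := fun j' =>
    if h : ∃ k, ∃ b, (σ j').mode = .chairs b (some k) then h.choose else P.pick ∅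
  have hseat_eq : ∀ j' b k, (σ j').mode = .chairs b (some k) → seat j' = k := by
    intro j' b k hk
    have hex : ∃ k, ∃ b, (σ j').mode = .chairs b (some k) := ⟨k, b, hk⟩
    simp only [seat, dif_pos hex]
    obtain ⟨b', hb'⟩ := hex.choose_spec
    have hb' := hk.symm.trans hb'
    simp only [Mode.chairs.injEq, Option.some.injEq] at hb'
    exact hb'.2.symm
  let Fr : Finset (Fin K) := A \ Se.image seat
  have hcard : Un.card + Se.card ≤ A.card := by
    rw [← Finset.card_union_of_disjoint]
    · refine (Finset.card_le_card ?_).trans hUA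
      intro j' hj'
      by_contra hn
      obtain ⟨k, hk⟩ := hU j' hn
      simp [Un, Se, hk] at hj'
    · refine Finset.disjoint_left.2 fun j' h1 h2 => ?_
      simp only [Un, Se, Finset.mem_filter, Finset.mem_univ, true_and] at h1 h2
      obtain ⟨b1, h1⟩ := h1
      obtain ⟨b2, k, h2⟩ := h2
      simp [h1] at h2
  have hFr : Un.card ≤ Fr.card := by
    have h1 := Finset.le_card_sdiff (Se.image seat) A
    have h2 := Finset.card_image_le (s := Se) (f := seat)
    simp only [Fr]
    omega
  have hUn1 : 1 ≤ Un.card := Finset.card_pos.2 ⟨j, hjUn⟩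
  have hApos : (0 : ℝ) < A.card := by exact_mod_cast (by omega : 0 < A.card)
  let B : Fin K → Set unitInterval := fun i => {u | uniformArm P A u = i}
  have hB : ∀ i, MeasurableSet (B i) := fun i =>
    measurableSet_setOfPred.2 (measurable_discrete (fun x => x = i) (measurable_uniformArm P A))
  -- The event for arm `i` is a box in the seeds: `j` draws `i`, the other unseated players avoid
  -- it, and the remaining seeds are free.
  let box : Fin K → Fin M → Set unitInterval := fun i j' =>
    if j' = j then B i else if j' ∈ Un then (B i)ᶜ else Set.univ
  have hbm : ∀ i j', MeasurableSet (box i j') := by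
    intro i j'
    simp only [box]
    split_ifs
    · exact hB i
    · exact (hB i).compl
    · exact MeasurableSet.univ
  have harm : ∀ j' ∈ Un, ∀ u, arms P σ u j' = uniformArm P A (u j') := by
    intro j' hj' u
    simp only [Un, Finset.mem_filter, Finset.mem_univ, true_and] at hj'
    obtain ⟨b', hb'⟩ := hj'
    have hact : (σ j').act = A := by
      rcases hcase j' with ⟨k, _, hk⟩ | ⟨hA, _⟩
      · simp [hb'] at hk
      · exact hA
    simp only [arms, State.arm, hb', hact]
  have hsub : ∀ i ∈ Fr, Set.pi Set.univ (box i) ⊆ {u | NoColl (arms P σ u) j} := by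
    intro i hi u hu j' hj'
    simp only [Fr, Finset.mem_sdiff, Finset.mem_image, not_exists, not_and] at hi
    have huj : arms P σ u j = i := by
      have := hu j (Set.mem_univ j)
      simp only [box, if_true] at this
      rw [harm j hjUn]; exact this
    rw [huj] at hj'
    by_contra hne
    rcases hcase j' with ⟨k, hkA, hk⟩ | ⟨hA, ⟨b', hb'⟩ | ⟨b', k, hkA, hb'⟩⟩
    · have : arms P σ u j' = k := by simp only [arms, State.arm, hk]
      exact hkA (by rw [← this, hj']; exact hi.1)
    · have hm : j' ∈ Un := by simp only [Un, Finset.mem_filter]; exact ⟨Finset.mem_univ _, b', hb'⟩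
      have := hu j' (Set.mem_univ j')
      simp only [box, if_neg hne, if_pos hm] at this
      exact this (by rw [harm j' hm] at hj'; exact hj')
    · have h1 : arms P σ u j' = k := by simp only [arms, State.arm, hb']
      refine hi.2 j' ?_ ((hseat_eq j' b' k hb').trans (h1.symm.trans hj'))
      simp only [Se, Finset.mem_filter]; exact ⟨Finset.mem_univ _, b', k, hb'⟩
  have hvol : ∀ i ∈ Fr, (seedMeasure M).real (Set.pi Set.univ (box i))
      = 1 / A.card * (1 - 1 / (A.card : ℝ)) ^ (Un.card - 1) := by
    intro i hi
    have hiA : i ∈ A := (Finset.mem_sdiff.1 hi).1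
    have hBi : (volume : Measure unitInterval).real (B i) = 1 / A.card := volume_uniformArm P hiA
    rw [Measure.real, Measure.pi_pi, ENNReal.toReal_prod, ← Finset.mul_prod_erase _ _
      (Finset.mem_univ j)]
    have h1 : (volume (box i j)).toReal = 1 / A.card := by simp only [box, if_true]; exact hBi
    rw [h1]
    congr 1
    have h2 : ∀ j' ∈ Finset.univ.erase j, (volume (box i j')).toReal
        = if j' ∈ Un then (1 - 1 / (A.card : ℝ)) else 1 := by
      intro j' hj'
      simp only [box, if_neg (Finset.ne_of_mem_erase hj')]
      split_ifs
      · have := probReal_compl_eq_one_sub (μ := (volume : Measure unitInterval)) (hB i)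
        rw [hBi] at this; exact this
      · simp
    rw [Finset.prod_congr rfl h2, Finset.prod_ite, Finset.prod_const, Finset.prod_const_one, mul_one]
    congr 1
    rw [← Finset.card_erase_of_mem hjUn]
    congr 1
    ext j'; simp [and_comm]
  have hdisj : Set.PairwiseDisjoint (Fr : Set (Fin K)) fun i => Set.pi Set.univ (box i) := by
    intro i _ i' _ hne
    refine Set.disjoint_left.2 fun u h1 h2 => hne ?_
    have h1 := h1 j (Set.mem_univ j)
    have h2 := h2 j (Set.mem_univ j)
    simp only [box, if_true] at h1 h2
    exact h1.symm.trans h2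
  calc 1 / (A.card : ℝ) ≤ 1 / A.card * (Un.card * (1 - 1 / (A.card : ℝ)) ^ (Un.card - 1)) := by
        refine le_mul_of_one_le_right (by positivity) (one_le_mul_pow _ _ hUn1 (by omega))
    _ ≤ Fr.card * (1 / A.card * (1 - 1 / (A.card : ℝ)) ^ (Un.card - 1)) := by
        have h1 : (1 : ℝ) / A.card ≤ 1 := by
          rw [div_le_one hApos]; exact_mod_cast (by omega : 1 ≤ A.card)
        have h2 : 0 ≤ (1 - 1 / (A.card : ℝ)) ^ (Un.card - 1) := pow_nonneg (by linarith) _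
        have h3 : (Un.card : ℝ) ≤ Fr.card := by exact_mod_cast hFr
        have h4 : 0 ≤ 1 / (A.card : ℝ) := by positivity
        calc _ = Un.card * (1 / A.card * (1 - 1 / (A.card : ℝ)) ^ (Un.card - 1)) := by ring
          _ ≤ _ := by gcongr
    _ = ∑ i ∈ Fr, (seedMeasure M).real (Set.pi Set.univ (box i)) := by
        rw [Finset.sum_congr rfl hvol, Finset.sum_const, nsmul_eq_mul]
    _ = (seedMeasure M).real (⋃ i ∈ Fr, Set.pi Set.univ (box i)) :=
        (measureReal_biUnion_finset hdisj fun i _ => MeasurableSet.univ_pi (hbm i)).symm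
    _ ≤ _ := measureReal_mono (Set.iUnion₂_subset hsub)

end OneStep


/-! ### The good event and the selections of rounds it speaks about. -/

section GoodEvent

variable {K M : ℕ}

/-- Arms pulled in round `t`. -/
noncomputable def pull (P : Params K) (ω : Sample K M) (t : ℕ) : Fin M → Fin K :=
  arms P (run P ω t) (ω t).2

open Classical in
/-- Sum of `x s` over the rounds `s < t` with the property `C`. -/
noncomputable def csum (C : ℕ → Prop) (x : ℕ → ℝ) (t : ℕ) : ℝ :=
  ∑ s ∈ Finset.range t, if C s then x s else 0

/-- The discrete part of a memory that selections of rounds depend on. -/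
abbrev Data (K : ℕ) := Mode K × Finset (Fin K) × ℕ × Fin K × Finset (Fin K)

def State.data (σ : State K) : Data K := (σ.mode, σ.act, σ.p, σ.pos, σ.decl)

/-- `Data K` is countable and discrete, so every property of these data and of the pulled arms is
measurable, however complicated. Real-valued statistics are deliberately left out of `Data`. -/
theorem measurable_ofData (P : Params K) (g : (Fin M → Data K) → (Fin M → Fin K) → Prop) :
    Measurable fun z : (Fin M → State K) × (Fin M → unitInterval) =>
      g (fun j => (z.1 j).data) (arms P z.1 z.2) := by
  refine measurable_discrete₂ g ?_ (measurable_arms P measurable_fst measurable_snd)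
  refine measurable_pi_lambda _ fun j => ?_
  unfold State.data
  fun_prop

/-- From round `t₀` on, player `j` pulls arm `i` without collision. -/
def Hit (P : Params K) (ω : Sample K M) (j : Fin M) (i : Fin K) (t₀ s : ℕ) : Prop :=
  t₀ ≤ s ∧ pull P ω s j = i ∧ NoColl (pull P ω s) j

/-- Player `j` explores, or all active players are in a first reception block. -/
def Exploring (P : Params K) (ω : Sample K M) (j : Fin M) (s : ℕ) : Prop :=
  (run P ω s j).mode = .explore ∨ ((run P ω s j).decl = ∅ ∧
    ∀ j', (run P ω s j').mode = .receive ∨ ∃ k, (run P ω s j').mode = .exploit k)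

/-- Player `j` pulls arm `i` in a round that counts for exploration. -/
def Explored (P : Params K) (ω : Sample K M) (j : Fin M) (i : Fin K) (s : ℕ) : Prop :=
  pull P ω s j = i ∧ Exploring P ω j s

/-- From round `t₀` on, player `j` pulls arm `i` and `j'` executes a declaration block for `i`. -/
def Cued (P : Params K) (ω : Sample K M) (j j' : Fin M) (i : Fin K) (t₀ s : ℕ) : Prop :=
  t₀ ≤ s ∧ pull P ω s j = i ∧ (run P ω s j').mode = .declare i

/-- From round `t₀` on, player `j` executes a declaration block and could hop to arm `i`. -/
def Visiting (P : Params K) (ω : Sample K M) (j : Fin M) (i : Fin K) (t₀ s : ℕ) : Prop :=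
  t₀ ≤ s ∧ (∃ k, (run P ω s j).mode = .declare k) ∧ (run P ω s j).pos = i

/-- Player `j` seeks a seat in coordinated Musical Chairs on `a` arms in phase `p`. -/
def Seeking (P : Params K) (ω : Sample K M) (j : Fin M) (p a s : ℕ) : Prop :=
  ChairsOK (fun j => ((run P ω s j).mode, (run P ω s j).act)) (run P ω s j).act ∧
    (∃ b, (run P ω s j).mode = .chairs b none) ∧ (run P ω s j).p = p ∧ (run P ω s j).act.card = a

/-- The event on which the algorithm works as intended up to round `H`. -/
structure Good (P : Params K) (ν : Fin K → Measure ℝ) (H : ℕ) (ω : Sample K M) : Prop where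
  mem : ∀ t k, (ω t).1 k ∈ Set.Icc (0 : ℝ) 1
  chairs : ∀ j p a t, p ≤ Nat.log 2 P.T + 2 → a ∈ Finset.Icc 1 K → t ≤ H →
    (∀ s < t, Seeking P ω j p a s → reward P ω s j = 0) →
    csum (Seeking P ω j p a) 1 t < a * P.Tc
  estimate : ∀ j, ∀ n < 2 * K, (K + n + 1) * P.Tc ≤ H → ∃ s, (K + n) * P.Tc ≤ s ∧
    s < (K + n + 1) * P.Tc ∧ (NoColl (pull P ω s) j → 0 < reward P ω s j)
  hit : ∀ j i t₀ t, t₀ ≤ H → t ≤ H →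
    csum (Hit P ω j i t₀) (fun s => (ω s).1 i) t
      < 1.06 * mean ν i * csum (Hit P ω j i t₀) 1 t + 40 * Real.log P.T ∧
    0.95 * mean ν i * csum (Hit P ω j i t₀) 1 t - 40 * Real.log P.T
      < csum (Hit P ω j i t₀) (fun s => (ω s).1 i) t
  explored : ∀ j i t, t ≤ H →
    csum (Explored P ω j i) (fun s => (ω s).1 i) t
      < 1.06 * mean ν i * csum (Explored P ω j i) 1 t + 40 * Real.log P.T ∧
    0.95 * mean ν i * csum (Explored P ω j i) 1 t - 40 * Real.log P.T
      < csum (Explored P ω j i) (fun s => (ω s).1 i) t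
  confidence : ∀ j i t, t ≤ H → 0 < csum (Explored P ω j i) 1 t →
    |csum (Explored P ω j i) (fun s => (ω s).1 i) t - mean ν i * csum (Explored P ω j i) 1 t|
      < √(2 * csum (Explored P ω j i) 1 t * Real.log P.T)
  cued : ∀ j j' i t₀ t, j ≠ j' → t₀ ≤ H → t ≤ H →
    csum (fun s => Cued P ω j j' i t₀ s ∧ (1 / 2 : ℝ) ≤ (ω s).2 j') 1 t
      < 0.53 * csum (Cued P ω j j' i t₀) 1 t + 40 * Real.log P.T
  visiting : ∀ j i t₀ t, t₀ ≤ H → t ≤ H →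
    0.47 * csum (Visiting P ω j i t₀) 1 t - 40 * Real.log P.T
      < csum (fun s => Visiting P ω j i t₀ s ∧ (1 / 2 : ℝ) ≤ (ω s).2 j) 1 t

open Classical in
/-- Tests in the rounds selected by a property of the memories and the seeds. -/
noncomputable def selectTests (P : Params K)
    (C : ℕ → (Fin M → State K) → (Fin M → unitInterval) → Prop)
    (hC : ∀ t, Measurable fun z : (Fin M → State K) × (Fin M → unitInterval) => C t z.1 z.2)
    (Y : (Fin M → State K) → (Fin K → ℝ) × (Fin M → unitInterval) → ℝ)
    (hY : Measurable fun z : (Fin M → State K) × ((Fin K → ℝ) × (Fin M → unitInterval)) => Y z.1 z.2)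
    (hY0 : ∀ σ x, 0 ≤ Y σ x) (hY1 : ∀ σ x, Y σ x ≤ 1) :
    Tests ((Fin K → ℝ) × (Fin M → unitInterval)) where
  a t ω := if C t (run P ω t) (ω t).2 then 1 else 0
  y t ω := Y (run P ω t) (ω t)
  measurable_a t := Measurable.ite (measurableSet_setOfPred.2
    ((hC t).comp ((measurable_run P t).prodMk (measurable_snd.comp (measurable_pi_apply t)))))
    measurable_const measurable_const
  measurable_y t := hY.comp ((measurable_run P t).prodMk (measurable_pi_apply t))
  a_eq t ω := by split_ifs <;> simp
  y_nonneg t ω := hY0 _ _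
  y_le t ω := hY1 _ _
  dep_a t ω s x h := by rw [run_update P ω s x t h.le, Function.update_of_ne h.ne]
  dep_y t ω s x h := by rw [run_update P ω s x t h.le, Function.update_of_ne h.ne]

variable {P : Params K} {ν : Fin K → Measure ℝ} [∀ k, IsProbabilityMeasure (ν k)]
  {C : ℕ → (Fin M → State K) → (Fin M → unitInterval) → Prop}
  {Y : (Fin M → State K) → (Fin K → ℝ) × (Fin M → unitInterval) → ℝ}

open Classical in
theorem selectTests_deviation
    (hC : ∀ t, Measurable fun z : (Fin M → State K) × (Fin M → unitInterval) => C t z.1 z.2)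
    (hY : Measurable fun z : (Fin M → State K) × ((Fin K → ℝ) × (Fin M → unitInterval)) => Y z.1 z.2)
    (hY0 : ∀ σ x, 0 ≤ Y σ x) (hY1 : ∀ σ x, Y σ x ≤ 1) (l q c : ℝ)
    (hc : 1 + (Real.exp l - 1) * q ≤ Real.exp c)
    (hq : ∀ t σ, ∫ x, (if C t σ x.2 then 1 else 0) * Y σ x ∂(roundMeasure M ν)
      = q * ∫ x, (if C t σ x.2 then 1 else 0) ∂(roundMeasure M ν)) (n : ℕ) (L : ℝ) :
    sampleMeasure M ν {ω | ∃ t ≤ n,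
      L ≤ l * csum (fun s => C s (run P ω s) (ω s).2) (fun s => Y (run P ω s) (ω s)) t
        - c * csum (fun s => C s (run P ω s) (ω s).2) 1 t} ≤ ENNReal.ofReal (Real.exp (-L)) := by
  refine le_trans (measure_mono ?_) ((selectTests P C hC Y hY hY0 hY1).exp_deviation
    (roundMeasure M ν) l q c hc ?_ n L)
  · rintro ω ⟨t, ht, h⟩
    refine ⟨t, ht, ?_⟩
    simpa [csum, selectTests, ite_mul] using h
  · intro t ω
    have := hq t (run P ω t)
    simp only [selectTests, run_update P ω t _ t le_rfl, Function.update_self]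
    rw [this]

open Classical in
theorem selectTests_success
    (hC : ∀ t, Measurable fun z : (Fin M → State K) × (Fin M → unitInterval) => C t z.1 z.2)
    (hY : Measurable fun z : (Fin M → State K) × ((Fin K → ℝ) × (Fin M → unitInterval)) => Y z.1 z.2)
    (hY0 : ∀ σ x, 0 ≤ Y σ x) (hY1 : ∀ σ x, Y σ x ≤ 1) (q : ℝ)
    (hq : ∀ t σ, q * ∫ x, (if C t σ x.2 then 1 else 0) ∂(roundMeasure M ν)
      ≤ ∫ x, (if C t σ x.2 then 1 else 0) * Y σ x ∂(roundMeasure M ν)) (n : ℕ) (L : ℝ) :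
    sampleMeasure M ν {ω | ∃ t ≤ n, (∀ s < t, C s (run P ω s) (ω s).2 → Y (run P ω s) (ω s) = 0) ∧
      L ≤ q * csum (fun s => C s (run P ω s) (ω s).2) 1 t} ≤ ENNReal.ofReal (Real.exp (-L)) := by
  refine le_trans (measure_mono ?_) ((selectTests P C hC Y hY hY0 hY1).exists_success
    (roundMeasure M ν) q ?_ n L)
  · rintro ω ⟨t, ht, h0, h⟩
    refine ⟨t, ht, fun s hs => ?_, by simpa [csum, selectTests] using h⟩
    simp only [selectTests]
    split_ifs with hCs
    · rw [h0 s hs hCs, mul_zero]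
    · rw [zero_mul]
  · intro t ω
    have := hq t (run P ω t)
    simpa only [selectTests, run_update P ω t _ t le_rfl, Function.update_self] using this

/-- Two-sided multiplicative deviations for the values of an arm in selected rounds. -/
theorem arm_deviation (h : ∀ k, ∀ᵐ x ∂(ν k), x ∈ Set.Icc (0 : ℝ) 1)
    (hC : ∀ t, Measurable fun z : (Fin M → State K) × (Fin M → unitInterval) => C t z.1 z.2)
    (i : Fin K) (l c : ℝ) (hc : 1 + (Real.exp l - 1) * mean ν i ≤ Real.exp c) (n : ℕ) (L : ℝ) :
    sampleMeasure M ν {ω | (∀ t k, (ω t).1 k ∈ Set.Icc (0 : ℝ) 1) ∧ ∃ t ≤ n,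
      L ≤ l * csum (fun s => C s (run P ω s) (ω s).2) (fun s => (ω s).1 i) t
        - c * csum (fun s => C s (run P ω s) (ω s).2) 1 t} ≤ ENNReal.ofReal (Real.exp (-L)) := by
  classical
  refine le_trans (measure_mono ?_) (selectTests_deviation (P := P) (C := C)
    (Y := fun _ x => clamp (x.1 i)) (ν := ν) hC (by fun_prop) (fun _ _ => clamp_nonneg _)
    (fun _ _ => clamp_le _) l (mean ν i) c hc ?_ n L)
  · rintro ω ⟨hmem, t, ht, hL⟩
    refine ⟨t, ht, ?_⟩
    simpa only [clamp_eq (hmem _ _)] using hL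
  · intro t σ
    have hCσ : Measurable fun u => C t σ u := (hC t).comp (measurable_const.prodMk measurable_id)
    rw [integral_select ν h hCσ (measurable_const (a := i)), integral_mul_const, mul_comm,
      integral_seed ν (f := fun u => if C t σ u then (1 : ℝ) else 0)]

theorem exp_tenth_le : Real.exp 0.1 ≤ 1.106 := by
  have h := Real.exp_bound' (x := 0.1) (by norm_num) (by norm_num) (n := 3) (by norm_num)
  refine h.trans ?_
  norm_num [Finset.sum_range_succ, Nat.factorial]

theorem exp_neg_tenth_le : Real.exp (-0.1) ≤ 0.905 := by
  have h := Real.quadratic_le_exp_of_nonneg (x := 0.1) (by norm_num)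
  rw [Real.exp_neg, inv_le_comm₀ (Real.exp_pos _) (by norm_num)]
  refine le_trans ?_ h
  norm_num

theorem mul_exp_le_exp (l q : ℝ) : 1 + (Real.exp l - 1) * q ≤ Real.exp ((Real.exp l - 1) * q) := by
  rw [add_comm]; exact Real.add_one_le_exp _

theorem csum_one_nonneg (C : ℕ → Prop) (t : ℕ) : 0 ≤ csum C 1 t :=
  Finset.sum_nonneg fun s _ => by split_ifs <;> simp

open Classical in
theorem csum_one_eq (C : ℕ → Prop) (t : ℕ) :
    csum C 1 t = (((Finset.range t).filter C).card : ℝ) := by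
  simp [csum]

end GoodEvent


/-! ### The probability of the good event. -/

section GoodProbability

variable {K M : ℕ} {P : Params K} {ν : Fin K → Measure ℝ} [∀ k, IsProbabilityMeasure (ν k)]
  {C : ℕ → (Fin M → State K) → (Fin M → unitInterval) → Prop}

/-- All arm values lie in the unit interval. -/
def Bounded (ω : Sample K M) : Prop := ∀ t k, (ω t).1 k ∈ Set.Icc (0 : ℝ) 1

/-- The exponents ±0.1 suffice: e^0.1 - 1 ≤ 0.106 and 1 - e^(-0.1) ≥ 0.095, and division by 0.1
gives the factors 1.06 and 0.95 and the error 10 L. With L = 4 log T this is the 40 log T of `Good`.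
-/
theorem arm_two_sided (h : ∀ k, ∀ᵐ x ∂(ν k), x ∈ Set.Icc (0 : ℝ) 1)
    (hC : ∀ t, Measurable fun z : (Fin M → State K) × (Fin M → unitInterval) => C t z.1 z.2)
    (hμ : ∀ k, 0 ≤ mean ν k) (i : Fin K) (n : ℕ) (L : ℝ) :
    sampleMeasure M ν {ω | Bounded ω ∧ ∃ t ≤ n,
      ¬ (csum (fun s => C s (run P ω s) (ω s).2) (fun s => (ω s).1 i) t
          < 1.06 * mean ν i * csum (fun s => C s (run P ω s) (ω s).2) 1 t + 10 * L ∧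
        0.95 * mean ν i * csum (fun s => C s (run P ω s) (ω s).2) 1 t - 10 * L
          < csum (fun s => C s (run P ω s) (ω s).2) (fun s => (ω s).1 i) t)}
      ≤ 2 * ENNReal.ofReal (Real.exp (-L)) := by
  have h1 := arm_deviation (P := P) h hC i 0.1 _ (mul_exp_le_exp _ _) n L
  have h2 := arm_deviation (P := P) h hC i (-0.1) _ (mul_exp_le_exp _ _) n L
  rw [two_mul]
  refine le_trans (measure_mono ?_) ((measure_union_le _ _).trans (add_le_add h1 h2))
  rintro ω ⟨hb, t, ht, hn⟩
  rw [not_and_or, not_lt, not_lt] at hn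
  have hn0 := csum_one_nonneg (fun s => C s (run P ω s) (ω s).2) t
  rcases hn with hn | hn
  · refine Or.inl ⟨hb, t, ht, ?_⟩
    have := mul_le_mul_of_nonneg_right
      (mul_le_mul_of_nonneg_right (by linarith [exp_tenth_le] : Real.exp 0.1 - 1 ≤ 0.106) (hμ i)) hn0
    linarith
  · refine Or.inr ⟨hb, t, ht, ?_⟩
    have := mul_le_mul_of_nonneg_right
      (mul_le_mul_of_nonneg_right (by linarith [exp_neg_tenth_le] : Real.exp (-0.1) - 1 ≤ -0.095)
        (hμ i)) hn0
    linarith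

/-- The best exponent in Hoeffding's bound depends on the sample size, so the size `m` is fixed here
and a union bound over `m` is taken later. -/
theorem arm_confidence (h : ∀ k, ∀ᵐ x ∂(ν k), x ∈ Set.Icc (0 : ℝ) 1)
    (hC : ∀ t, Measurable fun z : (Fin M → State K) × (Fin M → unitInterval) => C t z.1 z.2)
    (hμ : ∀ k, 0 ≤ mean ν k) (hμ1 : ∀ k, mean ν k ≤ 1) (i : Fin K) (n m : ℕ) (hm : 0 < m) (L : ℝ)
    (hL : 0 ≤ L) :
    sampleMeasure M ν {ω | Bounded ω ∧ ∃ t ≤ n,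
      csum (fun s => C s (run P ω s) (ω s).2) 1 t = m ∧
      √(2 * m * L) ≤ |csum (fun s => C s (run P ω s) (ω s).2) (fun s => (ω s).1 i) t
          - mean ν i * m|} ≤ 2 * ENNReal.ofReal (Real.exp (-(4 * L))) := by
  set r := √(2 * m * L) with hr
  have hm' : (0 : ℝ) < m := by exact_mod_cast hm
  have hrr : r * r = 2 * m * L := Real.mul_self_sqrt (by positivity)
  have hrm : r / m * r = 2 * L := by
    rw [div_mul_eq_mul_div, hrr]; field_simp
  -- With the exponent λ = 4r/m the gain λr equals 8L and the quadratic loss λ²m/8 equals 4L, which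
  -- leaves 4L.
  have hl2 : (4 * (r / m)) ^ 2 / 8 * m = 4 * L := by
    have : (4 * (r / m)) ^ 2 / 8 * m = 2 * (r / m * r) := by field_simp; ring
    rw [this, hrm]; ring
  have hl0 : 0 ≤ 4 * (r / m) := by positivity
  have h1 := arm_deviation (P := P) h hC i (4 * (r / m)) _ (one_add_exp_le _ _ (hμ i) (hμ1 i))
    n (4 * L)
  have h2 := arm_deviation (P := P) h hC i (-(4 * (r / m))) _ (one_add_exp_le _ _ (hμ i) (hμ1 i))
    n (4 * L)
  rw [two_mul]
  refine le_trans (measure_mono ?_) ((measure_union_le _ _).trans (add_le_add h1 h2))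
  rintro ω ⟨hb, t, ht, hcm, hn⟩
  rcases le_abs.1 hn with hn | hn
  · refine Or.inl ⟨hb, t, ht, ?_⟩
    rw [hcm]
    have := mul_le_mul_of_nonneg_left hn hl0
    linarith
  · refine Or.inr ⟨hb, t, ht, ?_⟩
    rw [hcm]
    have := mul_le_mul_of_nonneg_left hn hl0
    have h3 : (-(4 * (r / m))) ^ 2 = (4 * (r / m)) ^ 2 := by ring
    rw [h3]
    linarith

open Classical in
theorem measurable_clampedReward (P : Params K) (j : Fin M) :
    Measurable fun z : (Fin M → State K) × ((Fin K → ℝ) × (Fin M → unitInterval)) =>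
      playerReward (fun k => clamp (z.2.1 k)) (arms P z.1 z.2.2) j :=
  measurable_playerReward (by fun_prop)
    (measurable_arms P measurable_fst (measurable_snd.comp measurable_snd)) j

theorem clampedReward_nonneg (x : Fin K → ℝ) (a : Fin M → Fin K) (j : Fin M) :
    0 ≤ playerReward (fun k => clamp (x k)) a j := by
  rw [playerReward_eq]; split_ifs
  · exact clamp_nonneg _
  · exact le_rfl

theorem clampedReward_le (x : Fin K → ℝ) (a : Fin M → Fin K) (j : Fin M) :
    playerReward (fun k => clamp (x k)) a j ≤ 1 := by
  rw [playerReward_eq]; split_ifs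
  · exact clamp_le _
  · exact zero_le_one

theorem measurable_noColl (P : Params K) (σ : Fin M → State K) (j : Fin M) :
    Measurable fun u => NoColl (arms P σ u) j :=
  measurable_discrete (fun a => NoColl a j) (measurable_arms P measurable_const measurable_id)

open Classical in
/-- Indicator of a proposition. -/
noncomputable def ind (p : Prop) : ℝ := if p then 1 else 0

theorem ind_nonneg (p : Prop) : 0 ≤ ind p := by unfold ind; split_ifs <;> norm_num

theorem ind_le (p : Prop) : ind p ≤ 1 := by unfold ind; split_ifs <;> norm_num

theorem integral_reward (h : ∀ k, ∀ᵐ x ∂(ν k), x ∈ Set.Icc (0 : ℝ) 1) (σ : Fin M → State K)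
    (j : Fin M) {D : (Fin M → unitInterval) → Prop} (hD : Measurable D) :
    ∫ x, ind (D x.2) * playerReward (fun k => clamp (x.1 k)) (arms P σ x.2) j ∂(roundMeasure M ν)
      = ∫ u, ind (D u ∧ NoColl (arms P σ u) j) * mean ν (arms P σ u j) ∂(seedMeasure M) := by
  refine Eq.trans ?_ (integral_select ν h (C := fun u => D u ∧ NoColl (arms P σ u) j)
    (hD.and (measurable_noColl P σ j))
    (i := fun u => arms P σ u j)
    ((measurable_pi_apply j).comp (measurable_arms P measurable_const measurable_id)))
  refine integral_congr_ae (Filter.Eventually.of_forall fun x => ?_)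
  simp only [playerReward_eq, ind]
  by_cases h1 : D x.2 <;> by_cases h2 : NoColl (arms P σ x.2) j <;> simp [h1, h2]

theorem integrable_select {D : (Fin M → unitInterval) → Prop} (hD : Measurable D)
    {f : (Fin M → unitInterval) → ℝ} (hf : Measurable f) (hf0 : ∀ u, 0 ≤ f u) (hf1 : ∀ u, f u ≤ 1) :
    Integrable (fun u => ind (D u) * f u) (seedMeasure M) := by
  classical
  have hm : Measurable fun u => ind (D u) := Measurable.ite (measurableSet_setOfPred.2 hD)
    measurable_const measurable_const
  refine Integrable.of_bound (C := 1) (hm.mul hf).aestronglyMeasurable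
    (Filter.Eventually.of_forall fun u => ?_)
  rw [Real.norm_eq_abs, abs_of_nonneg (mul_nonneg (ind_nonneg _) (hf0 u))]
  exact mul_le_one₀ (ind_le _) (hf0 u) (hf1 u)

theorem le_integral_reward (h : ∀ k, ∀ᵐ x ∂(ν k), x ∈ Set.Icc (0 : ℝ) 1) {m : ℝ} (hm : 0 ≤ m)
    (hmμ : ∀ k, m ≤ mean ν k) (hμ1 : ∀ k, mean ν k ≤ 1) (σ : Fin M → State K)
    (j : Fin M) {D : (Fin M → unitInterval) → Prop} (hD : Measurable D) :
    m * ∫ u, ind (D u ∧ NoColl (arms P σ u) j) ∂(seedMeasure M) ≤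
    ∫ x, ind (D x.2) * playerReward (fun k => clamp (x.1 k)) (arms P σ x.2) j
        ∂(roundMeasure M ν) := by
  have hDm := hD.and (measurable_noColl P σ j)
  rw [integral_reward h σ j hD, ← integral_const_mul]
  refine integral_mono ?_ ?_ fun u => ?_
  · simpa [mul_comm] using (integrable_select (f := fun _ => 1) hDm measurable_const
      (fun _ => zero_le_one) (fun _ => le_rfl)).const_mul m
  · exact integrable_select (f := fun u => mean ν (arms P σ u j)) hDm
      (measurable_discrete (fun a : Fin M → Fin K => mean ν (a j))
        (measurable_arms P measurable_const measurable_id))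
      (fun u => hm.trans (hmμ _)) (fun u => hμ1 _)
  · simp only
    rw [mul_comm]
    exact mul_le_mul_of_nonneg_left (hmμ _) (ind_nonneg _)

theorem reward_eq_clamped {ω : Sample K M} (hb : Bounded ω) (t : ℕ) (j : Fin M) :
    playerReward (fun k => clamp ((ω t).1 k)) (arms P (run P ω t) (ω t).2) j = reward P ω t j := by
  unfold reward
  congr 1
  funext k
  exact clamp_eq (hb t k)

theorem reward_nonneg {ω : Sample K M} (hb : Bounded ω) (t : ℕ) (j : Fin M) :
    0 ≤ reward P ω t j := by
  rw [← reward_eq_clamped hb]; exact clampedReward_nonneg _ _ _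

theorem log_le_muMin_mul_Tc (hP : 0 < P.muMin) : Real.log P.T ≤ P.muMin * P.Tc := by
  have := Nat.le_ceil (Real.log P.T / P.muMin)
  rw [div_le_iff₀ hP] at this
  rw [Params.Tc, mul_comm]; exact this

/-- A seeking player succeeds with probability at least `P.muMin / a`: alone on its arm by
`chairs_success`, then a reward of mean at least `P.muMin`. After a T_c unsuccessful rounds the
exponent is μ_min T_c ≥ log T. -/
theorem chairs_fail (h : ∀ k, ∀ᵐ x ∂(ν k), x ∈ Set.Icc (0 : ℝ) 1) (hP : 0 < P.muMin)
    (hmμ : ∀ k, P.muMin ≤ mean ν k) (hμ1 : ∀ k, mean ν k ≤ 1) (j : Fin M) (p a : ℕ) (ha : 0 < a)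
    (H : ℕ) :
    sampleMeasure M ν {ω | Bounded ω ∧ ∃ t ≤ H,
      (∀ s < t, Seeking P ω j p a s → reward P ω s j = 0) ∧
      (a : ℝ) * P.Tc ≤ csum (Seeking P ω j p a) 1 t} ≤ ENNReal.ofReal (Real.exp (-Real.log P.T)) := by
  classical
  let D : (Fin M → State K) → Prop := fun σ =>
    ChairsOK (fun j => ((σ j).mode, (σ j).act)) (σ j).act ∧
    (∃ b, (σ j).mode = .chairs b none) ∧ (σ j).p = p ∧ (σ j).act.card = a
  have ha' : (0 : ℝ) < a := by exact_mod_cast ha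
  refine le_trans (measure_mono ?_) (selectTests_success (P := P) (ν := ν)
    (C := fun _ σ _ => D σ)
    (Y := fun σ x => playerReward (fun k => clamp (x.1 k)) (arms P σ x.2) j)
    (fun _ => measurable_ofData P fun d _ => ChairsOK (fun j => ((d j).1, (d j).2.1)) (d j).2.1 ∧
      (∃ b, (d j).1 = .chairs b none) ∧ (d j).2.2.1 = p ∧ (d j).2.1.card = a)
    (measurable_clampedReward P j) (fun _ _ => clampedReward_nonneg _ _ _)
    (fun _ _ => clampedReward_le _ _ _) (P.muMin / a) ?_ H (Real.log P.T))
  · rintro ω ⟨hb, t, ht, h0, hL⟩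
    refine ⟨t, ht, fun s hs hD => ?_, ?_⟩
    · rw [reward_eq_clamped hb]; exact h0 s hs hD
    · refine (log_le_muMin_mul_Tc hP).trans ?_
      rw [div_mul_eq_mul_div, le_div_iff₀ ha']
      calc P.muMin * P.Tc * a = P.muMin * (a * P.Tc) := by ring
        _ ≤ _ := mul_le_mul_of_nonneg_left hL hP.le
  · intro t σ
    refine le_trans ?_ (le_integral_reward h hP.le hmμ hμ1 σ j (D := fun _ => D σ) measurable_const)
    rw [div_mul_eq_mul_div, mul_div_assoc]
    refine mul_le_mul_of_nonneg_left ?_ hP.le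
    by_cases hD : D σ
    · obtain ⟨hok, ⟨b, hb⟩, -, hcard⟩ := id hD
      have := chairs_success P σ hok hb
      rw [hcard] at this
      simp only [hD, if_true, true_and, integral_const, probReal_univ, smul_eq_mul, mul_one]
      refine this.trans (le_of_eq ?_)
      have hm : MeasurableSet {u | NoColl (arms P σ u) j} :=
        measurableSet_setOfPred.2 (measurable_noColl P σ j)
      rw [← integral_indicator_one hm]
      rfl
    · simp [hD, ind]

/-- The estimation blocks occupy deterministic rounds. Only collision-free rounds are tested, each
with a mean reward of at least `P.muMin`; T_c of them without reward have probability at most 1/T.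
-/
theorem estimate_fail (h : ∀ k, ∀ᵐ x ∂(ν k), x ∈ Set.Icc (0 : ℝ) 1) (hP : 0 < P.muMin)
    (hmμ : ∀ k, P.muMin ≤ mean ν k) (hμ1 : ∀ k, mean ν k ≤ 1) (j : Fin M) (n : ℕ) :
    sampleMeasure M ν {ω | Bounded ω ∧ ∀ s, (K + n) * P.Tc ≤ s → s < (K + n + 1) * P.Tc →
      NoColl (pull P ω s) j ∧ reward P ω s j ≤ 0} ≤ ENNReal.ofReal (Real.exp (-Real.log P.T)) := by
  classical
  refine le_trans (measure_mono ?_) (selectTests_success (P := P) (ν := ν)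
    (C := fun t σ u => ((K + n) * P.Tc ≤ t ∧ t < (K + n + 1) * P.Tc) ∧ NoColl (arms P σ u) j)
    (Y := fun σ x => playerReward (fun k => clamp (x.1 k)) (arms P σ x.2) j)
    (fun t => measurable_ofData P fun _ a =>
      ((K + n) * P.Tc ≤ t ∧ t < (K + n + 1) * P.Tc) ∧ NoColl a j)
    (measurable_clampedReward P j) (fun _ _ => clampedReward_nonneg _ _ _)
    (fun _ _ => clampedReward_le _ _ _) P.muMin ?_ ((K + n + 1) * P.Tc) (Real.log P.T))
  · rintro ω ⟨hb, h0⟩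
    refine ⟨_, le_rfl, ?_, ?_⟩
    · rintro s - ⟨⟨hs1, hs2⟩, -⟩
      rw [reward_eq_clamped hb]
      exact le_antisymm (h0 s hs1 hs2).2 (reward_nonneg hb s j)
    · refine (log_le_muMin_mul_Tc hP).trans (mul_le_mul_of_nonneg_left ?_ hP.le)
      rw [csum_one_eq, Nat.cast_le]
      have hcard : (Finset.Ico ((K + n) * P.Tc) ((K + n + 1) * P.Tc)).card = P.Tc := by
        rw [Nat.card_Ico, ← Nat.sub_mul]; simp
      refine hcard.symm.le.trans (Finset.card_le_card fun s hs => ?_)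
      rw [Finset.mem_Ico] at hs
      simp only [Finset.mem_filter, Finset.mem_range]
      exact ⟨hs.2, hs, (h0 s hs.1 hs.2).1⟩
  · intro t σ
    have hD := (measurable_const (a := ((K + n) * P.Tc ≤ t ∧ t < (K + n + 1) * P.Tc))).and
      (measurable_noColl P σ j)
    refine le_trans (le_of_eq ?_) (le_integral_reward h hP.le hmμ hμ1 σ j hD)
    refine Eq.trans (congrArg _ (integral_seed ν (f := fun u => ind (((K + n) * P.Tc ≤ t ∧
      t < (K + n + 1) * P.Tc) ∧ NoColl (arms P σ u) j)))) ?_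
    simp only [and_assoc, and_self]

open Classical in
-- The selection must not use the seed of `j'`; it may depend on all the other seeds of the round,
-- for instance through the arms pulled by the other players.
theorem coin_deviation (j' : Fin M)
    (hC : ∀ t, Measurable fun z : (Fin M → State K) × (Fin M → unitInterval) => C t z.1 z.2)
    (hdep : ∀ t σ u v, C t σ (Function.update u j' v) ↔ C t σ u) (l c : ℝ)
    (hc : 1 + (Real.exp l - 1) * (1 / 2) ≤ Real.exp c) (n : ℕ) (L : ℝ) :
    sampleMeasure M ν {ω | ∃ t ≤ n,
      L ≤ l * csum (fun s => C s (run P ω s) (ω s).2 ∧ (1 / 2 : ℝ) ≤ (ω s).2 j') 1 t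
        - c * csum (fun s => C s (run P ω s) (ω s).2) 1 t} ≤ ENNReal.ofReal (Real.exp (-L)) := by
  have hcoin : Measurable fun v : unitInterval => (if (1 / 2 : ℝ) ≤ v then (1 : ℝ) else 0) :=
    Measurable.ite (measurableSet_le measurable_const measurable_subtype_coe)
      measurable_const measurable_const
  refine le_trans (measure_mono ?_) (selectTests_deviation (P := P) (C := C) (ν := ν)
    (Y := fun _ x => if (1 / 2 : ℝ) ≤ x.2 j' then 1 else 0) hC
    (hcoin.comp ((measurable_pi_apply j').comp (measurable_snd.comp measurable_snd)))
    (fun _ _ => by split_ifs <;> norm_num) (fun _ _ => by split_ifs <;> norm_num) l (1 / 2) c hc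
    ?_ n L)
  · rintro ω ⟨t, ht, hL⟩
    refine ⟨t, ht, ?_⟩
    simpa only [csum, ite_and, Pi.one_apply] using hL
  · intro t σ
    have hCσ : Measurable fun u => C t σ u := (hC t).comp (measurable_const.prodMk measurable_id)
    have := integral_coin j' hCσ (hdep t σ)
    rw [← integral_seed ν, ← integral_seed ν] at this
    exact this

theorem cued_fail (j j' : Fin M) (hne : j ≠ j') (i : Fin K) (t₀ n : ℕ) (L : ℝ) :
    sampleMeasure M ν {ω | ∃ t ≤ n,
      0.53 * csum (Cued P ω j j' i t₀) 1 t + 10 * L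
        ≤ csum (fun s => Cued P ω j j' i t₀ s ∧ (1 / 2 : ℝ) ≤ (ω s).2 j') 1 t}
      ≤ ENNReal.ofReal (Real.exp (-L)) := by
  refine le_trans (measure_mono ?_) (coin_deviation (P := P) (ν := ν) j'
    (C := fun t σ u => t₀ ≤ t ∧ arms P σ u j = i ∧ (σ j').mode = .declare i)
    (fun t => measurable_ofData P fun d a => t₀ ≤ t ∧ a j = i ∧ (d j').1 = .declare i) ?_ 0.1 _
    (mul_exp_le_exp _ _) n L)
  · rintro ω ⟨t, ht, hL⟩
    refine ⟨t, ht, ?_⟩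
    have hn0 := csum_one_nonneg (Cued P ω j j' i t₀) t
    have := mul_le_mul_of_nonneg_right (by linarith [exp_tenth_le] : Real.exp 0.1 - 1 ≤ 0.106) hn0
    change L ≤ 0.1 * csum (fun s => Cued P ω j j' i t₀ s ∧ (1 / 2 : ℝ) ≤ (ω s).2 j') 1 t
      - (Real.exp 0.1 - 1) * (1 / 2) * csum (Cued P ω j j' i t₀) 1 t
    linarith
  · intro t σ u v
    simp only [arms, Function.update_of_ne hne]

theorem visiting_fail (j : Fin M) (i : Fin K) (t₀ n : ℕ) (L : ℝ) :
    sampleMeasure M ν {ω | ∃ t ≤ n,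
      csum (fun s => Visiting P ω j i t₀ s ∧ (1 / 2 : ℝ) ≤ (ω s).2 j) 1 t
        ≤ 0.47 * csum (Visiting P ω j i t₀) 1 t - 10 * L}
      ≤ ENNReal.ofReal (Real.exp (-L)) := by
  refine le_trans (measure_mono ?_) (coin_deviation (P := P) (ν := ν) j
    (C := fun t σ _ => t₀ ≤ t ∧ (∃ k, (σ j).mode = .declare k) ∧ (σ j).pos = i)
    (fun t => measurable_ofData P fun d _ => t₀ ≤ t ∧ (∃ k, (d j).1 = .declare k) ∧
      (d j).2.2.2.1 = i) (fun t σ u v => Iff.rfl) (-0.1) _ (mul_exp_le_exp _ _) n L)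
  rintro ω ⟨t, ht, hL⟩
  refine ⟨t, ht, ?_⟩
  have hn0 := csum_one_nonneg (Visiting P ω j i t₀) t
  have := mul_le_mul_of_nonneg_right
    (by linarith [exp_neg_tenth_le] : Real.exp (-0.1) - 1 ≤ -0.095) hn0
  change L ≤ -0.1 * csum (fun s => Visiting P ω j i t₀ s ∧ (1 / 2 : ℝ) ≤ (ω s).2 j) 1 t
    - (Real.exp (-0.1) - 1) * (1 / 2) * csum (Visiting P ω j i t₀) 1 t
  linarith

theorem ae_bounded (h : ∀ k, ∀ᵐ x ∂(ν k), x ∈ Set.Icc (0 : ℝ) 1) :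
    ∀ᵐ ω ∂(sampleMeasure M ν), Bounded ω := by
  unfold Bounded
  rw [ae_all_iff]; intro t
  rw [ae_all_iff]; intro k
  have h1 : MeasurePreserving (fun ω : Sample K M => (ω t).1 k) (sampleMeasure M ν) (ν k) :=
    (measurePreserving_eval ν k).comp (measurePreserving_fst.comp
      (measurePreserving_eval_infinitePi _ t))
  exact h1.quasiMeasurePreserving.ae (h k)

theorem measure_exists_le {Ω ι : Type*} [MeasurableSpace Ω] (μ : Measure Ω) [Fintype ι]
    (B : ι → Set Ω) (ε : ENNReal) (h : ∀ i, μ (B i) ≤ ε) :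
    μ {ω | ∃ i, ω ∈ B i} ≤ Fintype.card ι * ε := by
  have : {ω | ∃ i, ω ∈ B i} = ⋃ i, B i := by ext; simp
  rw [this]
  refine (measure_iUnion_fintype_le μ B).trans ((Finset.sum_le_sum fun i _ => h i).trans ?_)
  simp

/-- Union bound on two scales. Musical Chairs and the estimation account for only O(M K log T)
events, for which probability 1/T is affordable; the other events are also indexed by starting
rounds or sample sizes and need T^(-4). -/
theorem measure_not_good (h : ∀ k, ∀ᵐ x ∂(ν k), x ∈ Set.Icc (0 : ℝ) 1) (hP : 0 < P.muMin)
    (hmμ : ∀ k, P.muMin ≤ mean ν k) (hμ1 : ∀ k, mean ν k ≤ 1) (hT : 1 ≤ P.T) (H : ℕ) :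
    sampleMeasure M ν {ω | ¬ Good P ν H ω} ≤
      (M * (Nat.log 2 P.T + 3) * K + M * (2 * K) : ℕ) *
        ENNReal.ofReal (Real.exp (-Real.log P.T))
      + (M * K * (H + 1) * 2 + M * K * 2 + M * K * (H + 1) * 2 + M * M * K * (H + 1)
          + M * K * (H + 1) : ℕ) * ENNReal.ofReal (Real.exp (-(4 * Real.log P.T))) := by
  set μ := sampleMeasure M ν
  set δ := ENNReal.ofReal (Real.exp (-Real.log P.T))
  set ε := ENNReal.ofReal (Real.exp (-(4 * Real.log P.T)))
  set L := Real.log P.T with hLdef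
  have hL : 0 ≤ L := Real.log_nonneg (by exact_mod_cast hT)
  have hμ0 : ∀ k, 0 ≤ mean ν k := fun k => hP.le.trans (hmμ k)
  have h40 : (40 : ℝ) * L = 10 * (4 * L) := by ring
  let B0 : Set (Sample K M) := {ω | ¬ Bounded ω}
  let B1 : Set (Sample K M) := {ω | ∃ i : Fin M × Fin (Nat.log 2 P.T + 3) × Fin K,
    ω ∈ {ω | Bounded ω ∧ ∃ t ≤ H,
      (∀ s < t, Seeking P ω i.1 i.2.1 ((i.2.2 : ℕ) + 1) s → reward P ω s i.1 = 0) ∧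
      (((i.2.2 : ℕ) + 1 : ℕ) : ℝ) * P.Tc ≤ csum (Seeking P ω i.1 i.2.1 ((i.2.2 : ℕ) + 1)) 1 t}}
  let B2 : Set (Sample K M) := {ω | ∃ i : Fin M × Fin (2 * K),
    ω ∈ {ω | Bounded ω ∧ ∀ s, (K + i.2) * P.Tc ≤ s → s < (K + i.2 + 1) * P.Tc →
      NoColl (pull P ω s) i.1 ∧ reward P ω s i.1 ≤ 0}}
  let B3 : Set (Sample K M) := {ω | ∃ i : Fin M × Fin K × Fin (H + 1),
    ω ∈ {ω | Bounded ω ∧ ∃ t ≤ H, ¬ (csum (Hit P ω i.1 i.2.1 i.2.2) (fun s => (ω s).1 i.2.1) t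
        < 1.06 * mean ν i.2.1 * csum (Hit P ω i.1 i.2.1 i.2.2) 1 t + 10 * (4 * L) ∧
      0.95 * mean ν i.2.1 * csum (Hit P ω i.1 i.2.1 i.2.2) 1 t - 10 * (4 * L)
        < csum (Hit P ω i.1 i.2.1 i.2.2) (fun s => (ω s).1 i.2.1) t)}}
  let B4 : Set (Sample K M) := {ω | ∃ i : Fin M × Fin K,
    ω ∈ {ω | Bounded ω ∧ ∃ t ≤ H, ¬ (csum (Explored P ω i.1 i.2) (fun s => (ω s).1 i.2) t
        < 1.06 * mean ν i.2 * csum (Explored P ω i.1 i.2) 1 t + 10 * (4 * L) ∧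
      0.95 * mean ν i.2 * csum (Explored P ω i.1 i.2) 1 t - 10 * (4 * L)
        < csum (Explored P ω i.1 i.2) (fun s => (ω s).1 i.2) t)}}
  let B5 : Set (Sample K M) := {ω | ∃ i : Fin M × Fin K × Fin (H + 1),
    ω ∈ {ω | Bounded ω ∧ ∃ t ≤ H, 0 < (i.2.2 : ℕ) ∧
      csum (Explored P ω i.1 i.2.1) 1 t = (i.2.2 : ℕ) ∧
      √(2 * (i.2.2 : ℕ) * L) ≤ |csum (Explored P ω i.1 i.2.1) (fun s => (ω s).1 i.2.1) t
        - mean ν i.2.1 * (i.2.2 : ℕ)|}}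
  let B6 : Set (Sample K M) := {ω | ∃ i : Fin M × Fin M × Fin K × Fin (H + 1),
    ω ∈ {ω | i.1 ≠ i.2.1 ∧ ∃ t ≤ H, 0.53 * csum (Cued P ω i.1 i.2.1 i.2.2.1 i.2.2.2) 1 t
        + 10 * (4 * L) ≤ csum (fun s => Cued P ω i.1 i.2.1 i.2.2.1 i.2.2.2 s ∧
          (1 / 2 : ℝ) ≤ (ω s).2 i.2.1) 1 t}}
  let B7 : Set (Sample K M) := {ω | ∃ i : Fin M × Fin K × Fin (H + 1),
    ω ∈ {ω | ∃ t ≤ H, csum (fun s => Visiting P ω i.1 i.2.1 i.2.2 s ∧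
          (1 / 2 : ℝ) ≤ (ω s).2 i.1) 1 t
        ≤ 0.47 * csum (Visiting P ω i.1 i.2.1 i.2.2) 1 t - 10 * (4 * L)}}
  have hsub : {ω | ¬ Good P ν H ω} ⊆ B0 ∪ (B1 ∪ B2 ∪ (B3 ∪ B4 ∪ B5 ∪ B6 ∪ B7)) := by
    intro ω hω
    by_contra hn
    simp only [Set.mem_union, not_or] at hn
    obtain ⟨h0, ⟨h1, h2⟩, ⟨⟨⟨⟨h3, h4⟩, h5⟩, h6⟩, h7⟩⟩ := hn
    have hb : Bounded ω := not_not.1 h0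
    refine hω ⟨hb, ?_, ?_, ?_, ?_, ?_, ?_, ?_⟩
    · intro j p a t hp ha ht h0
      by_contra hle
      rw [Finset.mem_Icc] at ha
      refine h1 ⟨(j, ⟨p, by omega⟩, ⟨a - 1, by omega⟩), hb, t, ht, ?_⟩
      simp only [Nat.sub_add_cancel ha.1]
      exact ⟨h0, not_lt.1 hle⟩
    · intro j n hn hH
      by_contra hle
      push Not at hle
      refine h2 ⟨(j, ⟨n, hn⟩), hb, fun s hs1 hs2 => ?_⟩
      exact hle s hs1 hs2
    · intro j i t₀ t ht₀ ht
      by_contra hle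
      rw [h40] at hle
      exact h3 ⟨(j, i, ⟨t₀, by omega⟩), hb, t, ht, hle⟩
    · intro j i t ht
      by_contra hle
      rw [h40] at hle
      exact h4 ⟨(j, i), hb, t, ht, hle⟩
    · intro j i t ht hpos
      by_contra hle
      classical
      rw [csum_one_eq] at hpos hle
      have hcard : ((Finset.range t).filter (Explored P ω j i)).card ≤ t := by
        simpa using Finset.card_filter_le (Finset.range t) (Explored P ω j i)
      -- The random sample size itself is the index at which the union bound is used.
      refine h5 ⟨(j, i, ⟨((Finset.range t).filter (Explored P ω j i)).card, by omega⟩), hb, t, ht,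
        by exact_mod_cast hpos, csum_one_eq _ _, not_lt.1 hle⟩
    · intro j j' i t₀ t hne ht₀ ht
      by_contra hle
      rw [h40] at hle
      exact h6 ⟨(j, j', i, ⟨t₀, by omega⟩), hne, t, ht, not_lt.1 hle⟩
    · intro j i t₀ t ht₀ ht
      by_contra hle
      rw [h40] at hle
      exact h7 ⟨(j, i, ⟨t₀, by omega⟩), t, ht, not_lt.1 hle⟩
  have hB0 : μ B0 = 0 := ae_iff.1 (ae_bounded h)
  have hB1 : μ B1 ≤ (M * (Nat.log 2 P.T + 3) * K : ℕ) * δ := by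
    refine (measure_exists_le μ _ δ fun i => ?_).trans (le_of_eq ?_)
    · exact chairs_fail h hP hmμ hμ1 _ _ _ (Nat.succ_pos _) H
    · simp [mul_assoc]
  have hB2 : μ B2 ≤ (M * (2 * K) : ℕ) * δ := by
    refine (measure_exists_le μ _ δ fun i => ?_).trans (le_of_eq ?_)
    · exact estimate_fail h hP hmμ hμ1 _ _
    · simp [mul_assoc]
  have hB3 : μ B3 ≤ (M * K * (H + 1) * 2 : ℕ) * ε := by
    refine (measure_exists_le μ _ (2 * ε) fun i => ?_).trans (le_of_eq ?_)
    · exact arm_two_sided (C := fun t σ u => i.2.2 ≤ t ∧ arms P σ u i.1 = i.2.1 ∧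
        NoColl (arms P σ u) i.1) h (fun t => measurable_ofData P fun _ a => i.2.2 ≤ t ∧
        a i.1 = i.2.1 ∧ NoColl a i.1) hμ0 i.2.1 H (4 * L)
    · simp [mul_assoc]
  let CE : Fin M → Fin K → ℕ → (Fin M → State K) → (Fin M → unitInterval) → Prop :=
    fun j i _ σ u => arms P σ u j = i ∧ ((σ j).mode = .explore ∨ ((σ j).decl = ∅ ∧
      ∀ j', (σ j').mode = .receive ∨ ∃ k, (σ j').mode = .exploit k))
  have hmE : ∀ j i t, Measurable
      fun z : (Fin M → State K) × (Fin M → unitInterval) => CE j i t z.1 z.2 := fun j i _ =>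
    measurable_ofData P fun d a => a j = i ∧ ((d j).1 = .explore ∨ ((d j).2.2.2.2 = ∅ ∧
        ∀ j', (d j').1 = .receive ∨ ∃ k, (d j').1 = .exploit k))
  have hB4 : μ B4 ≤ (M * K * 2 : ℕ) * ε := by
    refine (measure_exists_le μ _ (2 * ε) fun i => ?_).trans (le_of_eq ?_)
    · exact arm_two_sided (C := CE i.1 i.2) h (hmE i.1 i.2) hμ0 i.2 H (4 * L)
    · simp [mul_assoc]
  have hB5 : μ B5 ≤ (M * K * (H + 1) * 2 : ℕ) * ε := by
    refine (measure_exists_le μ _ (2 * ε) fun i => ?_).trans (le_of_eq ?_)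
    · by_cases hi : 0 < (i.2.2 : ℕ)
      · refine (measure_mono ?_).trans
          (arm_confidence (P := P) (C := CE i.1 i.2.1) h (hmE i.1 i.2.1) hμ0 hμ1 i.2.1 H i.2.2 hi L hL)
        rintro ω ⟨hb, t, ht, -, h1, h2⟩
        exact ⟨hb, t, ht, h1, h2⟩
      · refine (measure_mono_null (t := ∅) ?_ measure_empty).trans_le bot_le
        rintro ω ⟨hb, t, ht, h0, h1, h2⟩
        exact hi h0
    · simp [mul_assoc]
  have hB6 : μ B6 ≤ (M * M * K * (H + 1) : ℕ) * ε := by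
    refine (measure_exists_le μ _ ε fun i => ?_).trans (le_of_eq ?_)
    · by_cases hi : i.1 = i.2.1
      · refine (measure_mono_null (t := ∅) ?_ measure_empty).trans_le bot_le
        rintro ω ⟨hne, -⟩
        exact hne hi
      · refine (measure_mono ?_).trans (cued_fail (P := P) i.1 i.2.1 hi i.2.2.1 i.2.2.2 H (4 * L))
        exact fun ω hω => hω.2
    · simp [mul_assoc]
  have hB7 : μ B7 ≤ (M * K * (H + 1) : ℕ) * ε := by
    refine (measure_exists_le μ _ ε fun i => ?_).trans (le_of_eq ?_)
    · exact visiting_fail i.1 i.2.1 i.2.2 H (4 * L)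
    · simp [mul_assoc]
  calc μ {ω | ¬ Good P ν H ω} ≤ μ (B0 ∪ (B1 ∪ B2 ∪ (B3 ∪ B4 ∪ B5 ∪ B6 ∪ B7))) := measure_mono hsub
    _ ≤ μ B0 + (μ B1 + μ B2 + (μ B3 + μ B4 + μ B5 + μ B6 + μ B7)) := by
        refine (measure_union_le _ _).trans (add_le_add le_rfl ?_)
        refine (measure_union_le _ _).trans (add_le_add (measure_union_le _ _) ?_)
        refine (measure_union_le _ _).trans (add_le_add ?_ le_rfl)
        refine (measure_union_le _ _).trans (add_le_add ?_ le_rfl)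
        exact (measure_union_le _ _).trans (add_le_add (measure_union_le _ _) le_rfl)
    _ ≤ 0 + (((M * (Nat.log 2 P.T + 3) * K : ℕ) * δ + (M * (2 * K) : ℕ) * δ) +
        ((M * K * (H + 1) * 2 : ℕ) * ε + (M * K * 2 : ℕ) * ε + (M * K * (H + 1) * 2 : ℕ) * ε +
        (M * M * K * (H + 1) : ℕ) * ε + (M * K * (H + 1) : ℕ) * ε)) := by
        rw [hB0]; gcongr
    _ = _ := by
        simp only [zero_add, Nat.cast_add, add_mul]

end GoodProbability


/-! ### The regret as the expected loss given the pulled arms. -/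

section RegretFormula

variable {K M : ℕ} {P : Params K} {ν : Fin K → Measure ℝ}

/-- Expected reward of player `j` in round `t` given the pulled arms. -/
noncomputable def gain (P : Params K) (ν : Fin K → Measure ℝ) (ω : Sample K M) (t : ℕ)
    (j : Fin M) : ℝ := ind (NoColl (pull P ω t) j) * mean ν (pull P ω t j)

/-- Loss of round `t` given the pulled arms. -/
noncomputable def loss (P : Params K) (ν : Fin K → Measure ℝ) (ω : Sample K M) (t : ℕ) : ℝ :=
  ∑ k ∈ Finset.Icc 1 M, orderStat (mean ν) k - ∑ j, gain P ν ω t j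

theorem measurable_gain (t : ℕ) (j : Fin M) : Measurable fun ω => gain P ν ω t j := by
  have h : Measurable fun ω : Sample K M => pull P ω t :=
    measurable_arms P (measurable_run P t) (measurable_snd.comp (measurable_pi_apply t))
  exact measurable_discrete (fun a => ind (NoColl a j) * mean ν (a j)) h

theorem gain_nonneg (hμ : ∀ k, 0 ≤ mean ν k) (ω : Sample K M) (t : ℕ) (j : Fin M) :
    0 ≤ gain P ν ω t j := mul_nonneg (ind_nonneg _) (hμ _)

theorem gain_le (hμ : ∀ k, 0 ≤ mean ν k) (hμ1 : ∀ k, mean ν k ≤ 1) (ω : Sample K M) (t : ℕ)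
    (j : Fin M) : gain P ν ω t j ≤ 1 := mul_le_one₀ (ind_le _) (hμ _) (hμ1 _)

theorem orderStat_le_one (hμ1 : ∀ k, mean ν k ≤ 1) (k : ℕ) : orderStat (mean ν) k ≤ 1 := by
  unfold orderStat; split_ifs
  · exact hμ1 _
  · exact zero_le_one

theorem loss_le (hμ : ∀ k, 0 ≤ mean ν k) (hμ1 : ∀ k, mean ν k ≤ 1) (ω : Sample K M) (t : ℕ) :
    loss P ν ω t ≤ M := by
  have h1 : ∑ k ∈ Finset.Icc 1 M, orderStat (mean ν) k ≤ ∑ _k ∈ Finset.Icc 1 M, (1 : ℝ) :=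
    Finset.sum_le_sum fun k _ => orderStat_le_one hμ1 k
  have h2 : 0 ≤ ∑ j, gain P ν ω t j := Finset.sum_nonneg fun j _ => gain_nonneg hμ ω t j
  simp only [Finset.sum_const, Nat.card_Icc, nsmul_eq_mul, mul_one, add_tsub_cancel_right] at h1
  unfold loss
  linarith

variable [∀ k, IsProbabilityMeasure (ν k)]

instance : IsProbabilityMeasure (sampleMeasure M ν) := by unfold sampleMeasure; infer_instance

theorem integrable_gain (hμ : ∀ k, 0 ≤ mean ν k) (hμ1 : ∀ k, mean ν k ≤ 1) (t : ℕ) (j : Fin M) :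
    Integrable (fun ω => gain P ν ω t j) (sampleMeasure M ν) :=
  Integrable.of_bound (C := 1) (measurable_gain t j).aestronglyMeasurable
    (Filter.Eventually.of_forall fun ω => by
      rw [Real.norm_eq_abs, abs_of_nonneg (gain_nonneg hμ ω t j)]; exact gain_le hμ hμ1 ω t j)

theorem measurable_reward_clamped (t : ℕ) (j : Fin M) : Measurable fun ω : Sample K M =>
    playerReward (fun k => clamp ((ω t).1 k)) (arms P (run P ω t) (ω t).2) j :=
  (measurable_clampedReward P j).comp ((measurable_run P t).prodMk (measurable_pi_apply t))

theorem integrable_reward_clamped (t : ℕ) (j : Fin M) : Integrable (fun ω : Sample K M =>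
    playerReward (fun k => clamp ((ω t).1 k)) (arms P (run P ω t) (ω t).2) j)
    (sampleMeasure M ν) :=
  Integrable.of_bound (C := 1) (measurable_reward_clamped t j).aestronglyMeasurable
    (Filter.Eventually.of_forall fun ω => by
      rw [Real.norm_eq_abs, abs_of_nonneg (clampedReward_nonneg _ _ _)]
      exact clampedReward_le _ _ _)

theorem reward_ae_eq (h : ∀ k, ∀ᵐ x ∂(ν k), x ∈ Set.Icc (0 : ℝ) 1) (t : ℕ) (j : Fin M) :
    (fun ω : Sample K M => playerReward (fun k => clamp ((ω t).1 k))
      (arms P (run P ω t) (ω t).2) j) =ᵐ[sampleMeasure M ν] fun ω => reward P ω t j :=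
  (ae_bounded h).mono fun _ hb => reward_eq_clamped hb t j

/-- Round `t` is resampled with the past fixed; given the seeds, the arm value may be replaced by
its mean. -/
theorem integral_reward_eq (h : ∀ k, ∀ᵐ x ∂(ν k), x ∈ Set.Icc (0 : ℝ) 1)
    (hμ : ∀ k, 0 ≤ mean ν k) (hμ1 : ∀ k, mean ν k ≤ 1) (t : ℕ) (j : Fin M) :
    ∫ ω, reward P ω t j ∂(sampleMeasure M ν) = ∫ ω, gain P ν ω t j ∂(sampleMeasure M ν) := by
  rw [← integral_congr_ae (reward_ae_eq h t j)]
  have h1 := integral_update (ρ := roundMeasure M ν) t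
    (integrable_reward_clamped (P := P) (ν := ν) t j)
  have h2 := integral_update (ρ := roundMeasure M ν) t (integrable_gain (P := P) hμ hμ1 t j)
  refine h1.trans (Eq.trans ?_ h2.symm)
  refine integral_congr_ae (Filter.Eventually.of_forall fun ω => ?_)
  simp only [gain, pull, run_update P ω t _ t le_rfl, Function.update_self]
  have h3 := integral_reward (P := P) h (run P ω t) j (D := fun _ => True) measurable_const
  simp only [true_and, show ind True = 1 by simp [ind], one_mul] at h3
  rw [h3]
  exact (integral_seed ν (f := fun u => ind (NoColl (arms P (run P ω t) u) j) *
    mean ν (arms P (run P ω t) u j))).symm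

theorem regret_eq (h : ∀ k, ∀ᵐ x ∂(ν k), x ∈ Set.Icc (0 : ℝ) 1)
    (hμ : ∀ k, 0 ≤ mean ν k) (hμ1 : ∀ k, mean ν k ≤ 1) :
    regret M P ν = ∫ ω, ∑ t ∈ Finset.range P.T, loss P ν ω t ∂(sampleMeasure M ν) := by
  have hi : ∀ t j, Integrable (fun ω : Sample K M => reward P ω t j) (sampleMeasure M ν) :=
    fun t j => (integrable_reward_clamped t j).congr (reward_ae_eq h t j)
  have hg := fun t j => integrable_gain (M := M) (P := P) hμ hμ1 t j
  have hl : ∀ t, Integrable (fun ω : Sample K M => loss P ν ω t) (sampleMeasure M ν) := fun t =>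
    (integrable_const _).sub (integrable_finsetSum _ fun j _ => hg t j)
  unfold regret
  rw [integral_finsetSum _ fun t _ => integrable_finsetSum _ fun j _ => hi t j,
    integral_finsetSum _ fun t _ => hl t, ← Finset.sum_sub_distrib]
  refine Finset.sum_congr rfl fun t _ => ?_
  unfold loss
  rw [integral_sub (integrable_const _) (integrable_finsetSum _ fun j _ => hg t j),
    integral_finsetSum _ fun j _ => hi t j, integral_finsetSum _ fun j _ => hg t j]
  simp only [integral_const, probReal_univ, smul_eq_mul, one_mul]
  congr 1
  exact Finset.sum_congr rfl fun j _ => integral_reward_eq h hμ hμ1 t j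

/-- This is the interface between the two halves of the proof: a pathwise bound on `G`, and the
trivial loss `M` per round outside it. -/
theorem regret_le (h : ∀ k, ∀ᵐ x ∂(ν k), x ∈ Set.Icc (0 : ℝ) 1)
    (hμ : ∀ k, 0 ≤ mean ν k) (hμ1 : ∀ k, mean ν k ≤ 1) (G : Set (Sample K M)) {R : ℝ}
    (hR0 : 0 ≤ R) (hR : ∀ ω ∈ G, ∑ t ∈ Finset.range P.T, loss P ν ω t ≤ R) {ε : ℝ} (hε : 0 ≤ ε)
    (hG : sampleMeasure M ν Gᶜ ≤ ENNReal.ofReal ε) :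
    regret M P ν ≤ R + P.T * M * ε := by
  set μ := sampleMeasure M ν with hμdef
  have hl : ∀ t, Integrable (fun ω : Sample K M => loss P ν ω t) μ := fun t =>
    (integrable_const _).sub (integrable_finsetSum _ fun j _ => integrable_gain hμ hμ1 t j)
  -- `G` is not assumed measurable; the measurable hull of its complement has the same measure.
  let B := toMeasurable μ Gᶜ
  have hBm : MeasurableSet B := measurableSet_toMeasurable _ _
  have hTM : (0 : ℝ) ≤ P.T * M := by positivity
  rw [regret_eq h hμ hμ1]
  calc ∫ ω, ∑ t ∈ Finset.range P.T, loss P ν ω t ∂μ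
      ≤ ∫ ω, (R + P.T * M * B.indicator 1 ω) ∂μ := by
        refine integral_mono (integrable_finsetSum _ fun t _ => hl t) ?_ fun ω => ?_
        · exact (integrable_const _).add (((integrable_const 1).indicator hBm).const_mul _)
        · by_cases hω : ω ∈ G
          · have : 0 ≤ P.T * M * B.indicator (1 : Sample K M → ℝ) ω :=
              mul_nonneg hTM (Set.indicator_nonneg (fun _ _ => zero_le_one) _)
            linarith [hR ω hω]
          · have hB : ω ∈ B := subset_toMeasurable μ _ hω
            have h1 : ∑ t ∈ Finset.range P.T, loss P ν ω t ≤ ∑ _t ∈ Finset.range P.T, (M : ℝ) :=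
              Finset.sum_le_sum fun t _ => loss_le hμ hμ1 ω t
            simp only [Finset.sum_const, Finset.card_range, nsmul_eq_mul] at h1
            simp only [Set.indicator_of_mem hB, Pi.one_apply, mul_one]
            linarith
    _ = R + P.T * M * μ.real B := by
        rw [integral_add (integrable_const _) (((integrable_const 1).indicator hBm).const_mul _),
          integral_const_mul, integral_indicator_one hBm]
        simp
    _ ≤ R + P.T * M * ε := by
        have : μ.real B ≤ ε := by
          rw [Measure.real, measure_toMeasurable]
          exact ENNReal.toReal_le_of_le_ofReal hε hG
        gcongr

end RegretFormula


/-! ### Cyclic hopping on a set of arms. -/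

section Hopping

variable {K : ℕ}

/-- The arm reached from `k` after `s` hops on `A`. -/
def hop (A : Finset (Fin K)) (s : ℕ) (k : Fin K) : Fin K := (succArm A)^[s] k

theorem hop_zero (A : Finset (Fin K)) (k : Fin K) : hop A 0 k = k := rfl

theorem hop_succ (A : Finset (Fin K)) (s : ℕ) (k : Fin K) :
    hop A (s + 1) k = succArm A (hop A s k) := Function.iterate_succ_apply' _ _ _

/-- In the increasing enumeration of `A`, a hop is addition of 1 modulo |A|; all later facts on
hopping reduce to arithmetic modulo |A|. -/
theorem succArm_emb {A : Finset (Fin K)} {n : ℕ} (hn : A.card = n) (m m' : Fin n)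
    (h : (m' : ℕ) = (m + 1) % n) :
    succArm A (A.orderEmbOfFin hn m) = A.orderEmbOfFin hn m' := by
  have hpos : 0 < n := m.pos
  unfold succArm
  by_cases hlast : (m : ℕ) + 1 < n
  · have hm' : (m' : ℕ) = m + 1 := by rw [h, Nat.mod_eq_of_lt hlast]
    have hmem : A.orderEmbOfFin hn m' ∈ A.filter fun i => A.orderEmbOfFin hn m < i := by
      rw [Finset.mem_filter]
      exact ⟨Finset.orderEmbOfFin_mem _ _ _, by
        rw [OrderEmbedding.lt_iff_lt, Fin.lt_def]; omega⟩
    rw [dif_pos ⟨_, hmem⟩]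
    refine le_antisymm (Finset.min'_le _ _ hmem) (Finset.le_min' _ _ _ fun x hx => ?_)
    rw [Finset.mem_filter] at hx
    have hxr : x ∈ Set.range (A.orderEmbOfFin hn) := by
      rw [Finset.range_orderEmbOfFin]; exact hx.1
    obtain ⟨r, rfl⟩ := hxr
    rw [OrderEmbedding.le_iff_le, Fin.le_def]
    have := hx.2
    rw [OrderEmbedding.lt_iff_lt, Fin.lt_def] at this
    omega
  · have hm' : (m' : ℕ) = 0 := by
      have : (m : ℕ) + 1 = n := by omega
      rw [h, this, Nat.mod_self]
    have hne : ¬ (A.filter fun i => A.orderEmbOfFin hn m < i).Nonempty := by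
      rintro ⟨x, hx⟩
      rw [Finset.mem_filter] at hx
      have hxr : x ∈ Set.range (A.orderEmbOfFin hn) := by
        rw [Finset.range_orderEmbOfFin]; exact hx.1
      obtain ⟨r, rfl⟩ := hxr
      have := hx.2
      rw [OrderEmbedding.lt_iff_lt, Fin.lt_def] at this
      omega
    have hA : A.Nonempty := ⟨_, Finset.orderEmbOfFin_mem A hn m⟩
    rw [dif_neg hne, dif_pos hA]
    have hm0 : m' = ⟨0, hpos⟩ := Fin.ext hm'
    rw [hm0, Finset.orderEmbOfFin_zero hn hpos]

theorem hop_emb {A : Finset (Fin K)} {n : ℕ} (hn : A.card = n) (m : Fin n) (s : ℕ) (m' : Fin n)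
    (h : (m' : ℕ) = (m + s) % n) :
    hop A s (A.orderEmbOfFin hn m) = A.orderEmbOfFin hn m' := by
  induction s generalizing m' with
  | zero =>
    rw [hop_zero]
    congr 1
    exact Fin.ext (by rw [h, add_zero, Nat.mod_eq_of_lt m.2])
  | succ s ih =>
    have hpos : 0 < n := m.pos
    rw [hop_succ, ih ⟨(m + s) % n, Nat.mod_lt _ hpos⟩ rfl]
    exact succArm_emb hn _ _ (by rw [h, ← add_assoc, Nat.mod_add_mod])

theorem exists_emb {A : Finset (Fin K)} {n : ℕ} (hn : A.card = n) {k : Fin K} (hk : k ∈ A) :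
    ∃ m : Fin n, A.orderEmbOfFin hn m = k := by
  have : k ∈ Set.range (A.orderEmbOfFin hn) := by rw [Finset.range_orderEmbOfFin]; exact hk
  exact this

theorem hop_mem {A : Finset (Fin K)} {k : Fin K} (hk : k ∈ A) (s : ℕ) : hop A s k ∈ A := by
  obtain ⟨m, rfl⟩ := exists_emb rfl hk
  rw [hop_emb rfl m s ⟨(m + s) % A.card, Nat.mod_lt _ m.pos⟩ rfl]
  exact Finset.orderEmbOfFin_mem _ _ _

theorem hop_inj {A : Finset (Fin K)} {k k' : Fin K} (hk : k ∈ A) (hk' : k' ∈ A) (s : ℕ)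
    (h : hop A s k = hop A s k') : k = k' := by
  obtain ⟨m, rfl⟩ := exists_emb rfl hk
  obtain ⟨m', rfl⟩ := exists_emb rfl hk'
  rw [hop_emb rfl m s ⟨(m + s) % A.card, Nat.mod_lt _ m.pos⟩ rfl,
    hop_emb rfl m' s ⟨(m' + s) % A.card, Nat.mod_lt _ m.pos⟩ rfl] at h
  have h1 := (A.orderEmbOfFin rfl).injective h
  simp only [Fin.mk.injEq] at h1
  have h2 : (m : ℕ) ≡ m' [MOD A.card] := Nat.ModEq.add_right_cancel' s h1
  have h3 : m = m' := Fin.ext (by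
    have := h2
    unfold Nat.ModEq at this
    rwa [Nat.mod_eq_of_lt m.2, Nat.mod_eq_of_lt m'.2] at this)
  rw [h3]

/-- Every window of `n` consecutive integers meets each residue class exactly once. -/
theorem count_mod (n c m i : ℕ) (hi : i < n) (hm : m < n) :
    Nat.count (fun s => (m + s) % n = i) (n * c) = c := by
  induction c with
  | zero => simp
  | succ c ih =>
    rw [Nat.mul_succ, Nat.count_add, ih]
    congr 1
    have h1 : (fun k => (m + (n * c + k)) % n = i) = fun k => (m + k) % n = i := by
      funext k
      rw [show m + (n * c + k) = m + k + n * c by ring, Nat.add_mul_mod_self_left]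
    simp only [h1]
    rw [Nat.count_eq_card_filter_range]
    have h2 : (Finset.range n).filter (fun s => (m + s) % n = i) = {(i + n - m) % n} := by
      ext s
      simp only [Finset.mem_filter, Finset.mem_range, Finset.mem_singleton]
      constructor
      · rintro ⟨hs, h⟩
        rcases lt_or_ge (m + s) n with h3 | h3
        · rw [Nat.mod_eq_of_lt h3] at h
          rw [show i + n - m = s + n by omega, Nat.add_mod_right, Nat.mod_eq_of_lt hs]
        · rw [Nat.mod_eq_sub_mod h3, Nat.mod_eq_of_lt (by omega)] at h
          rw [show i + n - m = s by omega, Nat.mod_eq_of_lt hs]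
      · rintro rfl
        refine ⟨Nat.mod_lt _ (by omega), ?_⟩
        rw [Nat.add_mod_mod, show m + (i + n - m) = i + n by omega, Nat.add_mod_right,
          Nat.mod_eq_of_lt hi]
    rw [h2, Finset.card_singleton]

/-- In `c` rounds of hopping every arm is visited `c` times. -/
theorem card_visits {A : Finset (Fin K)} {k i : Fin K} (hk : k ∈ A) (hi : i ∈ A) (c : ℕ) :
    ((Finset.range (A.card * c)).filter fun s => hop A s k = i).card = c := by
  obtain ⟨m, rfl⟩ := exists_emb rfl hk
  obtain ⟨r, rfl⟩ := exists_emb rfl hi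
  rw [← Nat.count_eq_card_filter_range]
  have h1 : (fun s => hop A s (A.orderEmbOfFin rfl m) = A.orderEmbOfFin rfl r)
      = fun s => (m + s) % A.card = r := by
    funext s
    rw [hop_emb rfl m s ⟨(m + s) % A.card, Nat.mod_lt _ m.pos⟩ rfl]
    rw [(A.orderEmbOfFin rfl).injective.eq_iff, Fin.ext_iff]
  simp only [h1]
  exact count_mod _ _ _ _ r.2 m.2

end Hopping

/-! ### Synchronous execution of a loop, and the phase counter. -/

section Loops

variable {K M : ℕ} {P : Params K} {ω : Sample K M}

theorem run_succ (t : ℕ) (j : Fin M) :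
    run P ω (t + 1) j = (run P ω t j).step P (pull P ω t j) (reward P ω t j) := rfl

open Classical in
theorem reward_eq (t : ℕ) (j : Fin M) :
    reward P ω t j = if NoColl (pull P ω t) j then (ω t).1 (pull P ω t j) else 0 :=
  playerReward_eq _ _ _

theorem noColl_of_reward_pos {t : ℕ} {j : Fin M} (h : 0 < reward P ω t j) :
    NoColl (pull P ω t) j := by
  by_contra hn
  rw [reward_eq, if_neg hn] at h
  exact h.false

/-- The memory after the observation of a round, with `l` steps left. -/
noncomputable def observed (P : Params K) (ω : Sample K M) (t : ℕ) (l : ℕ) (j : Fin M) : State K :=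
  { (run P ω t j).observe (pull P ω t j) (reward P ω t j) with left := l }

/-- Fields that do not change inside a loop. -/
structure Kept (σ τ : State K) : Prop where
  p : τ.p = σ.p
  act : τ.act = σ.act
  Mp : τ.Mp = σ.Mp
  Td : τ.Td = σ.Td
  decl : τ.decl = σ.decl
  rej : τ.rej = σ.rej
  acc : τ.acc = σ.acc

theorem Kept.refl (σ : State K) : Kept σ σ := ⟨rfl, rfl, rfl, rfl, rfl, rfl, rfl⟩

theorem Kept.observe {σ τ : State K} (h : Kept σ τ) (i : Fin K) (r : ℝ) (l : ℕ) :
    Kept σ { τ.observe i r with left := l } := by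
  obtain ⟨h1, h2, h3, h4, h5, h6, h7⟩ := h
  unfold State.observe
  split <;> exact ⟨h1, h2, h3, h4, h5, h6, h7⟩

theorem observe_left (σ : State K) (i : Fin K) (r : ℝ) : (σ.observe i r).left = σ.left := by
  unfold State.observe
  split <;> rfl

theorem exploit_succ {t : ℕ} {j : Fin M} {k : Fin K} (h : (run P ω t j).mode = .exploit k) :
    ∃ l, run P ω (t + 1) j = observed P ω t l j ∧ (run P ω (t + 1) j).mode = .exploit k := by
  have hobs : (run P ω t j).observe (pull P ω t j) (reward P ω t j) = run P ω t j := by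
    unfold State.observe; rw [h]
  have hfin : (run P ω t j).finish P = run P ω t j := by
    unfold State.finish; rw [h]
  rw [run_succ]
  unfold State.step observed
  rw [hobs, hfin]
  split_ifs
  · exact ⟨_, rfl, h⟩
  · exact ⟨_, rfl, h⟩

theorem exploit_forever {t : ℕ} {j : Fin M} {k : Fin K} (h : (run P ω t j).mode = .exploit k)
    (s : ℕ) : (run P ω (t + s) j).mode = .exploit k := by
  induction s with
  | zero => exact h
  | succ s ih => exact (exploit_succ ih).choose_spec.2

theorem pull_exploit {t : ℕ} {j : Fin M} {k : Fin K} (h : (run P ω t j).mode = .exploit k) :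
    pull P ω t j = k := by
  simp only [pull, arms, State.arm, h]

/-- Joint induction over a loop that the players in `U` execute synchronously. -/
theorem loop_sync {U : Finset (Fin M)} {t L : ℕ} (hL : 1 ≤ L)
    (hleft : ∀ j ∈ U, (run P ω t j).left = L)
    (hex : ∀ j, j ∉ U → ∃ k, (run P ω t j).mode = .exploit k)
    (J : ℕ → (Fin M → State K) → Prop) (h0 : J 0 (run P ω t))
    (hstep : ∀ s < L, J s (run P ω (t + s)) → ∀ l : Fin M → ℕ,
      J (s + 1) fun j => observed P ω (t + s) (l j) j) :
    (∀ s < L, J s (run P ω (t + s))) ∧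
      ∃ τ : Fin M → State K, J L τ ∧ ∀ j ∈ U, run P ω (t + L) j = (τ j).finish P := by
  have key : ∀ s < L, J s (run P ω (t + s)) ∧ ∀ j ∈ U, (run P ω (t + s) j).left = L - s := by
    intro s
    induction s with
    | zero => exact fun _ => ⟨h0, hleft⟩
    | succ s ih =>
      intro hs
      obtain ⟨hJ, hl⟩ := ih (by omega)
      have hrun : ∃ l : Fin M → ℕ, (run P ω (t + (s + 1)) = fun j => observed P ω (t + s) (l j) j) ∧
          ∀ j ∈ U, l j = L - (s + 1) := by
        have : ∀ j, ∃ l, run P ω (t + (s + 1)) j = observed P ω (t + s) l j ∧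
            (j ∈ U → l = L - (s + 1)) := by
          intro j
          by_cases hj : j ∈ U
          · refine ⟨L - (s + 1), ?_, fun _ => rfl⟩
            rw [← add_assoc, run_succ, State.step, if_neg (by rw [hl j hj]; omega), hl j hj]
            rfl
          · obtain ⟨k, hk⟩ := hex j hj
            obtain ⟨l, h1, -⟩ := exploit_succ (exploit_forever hk s)
            exact ⟨l, h1, fun h => absurd h hj⟩
        choose l h1 h2 using this
        exact ⟨l, funext h1, h2⟩
      obtain ⟨l, hr, hlU⟩ := hrun
      rw [hr]
      exact ⟨hstep s (by omega) hJ l, fun j hj => hlU j hj⟩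
  refine ⟨fun s hs => (key s hs).1, ?_⟩
  obtain ⟨hJ, hl⟩ := key (L - 1) (by omega)
  -- In the last step the counter `left` is not decremented but `finish` is called, so the invariant
  -- is used with the old value. This and the unsynchronised counters of the exploiting players are
  -- why `hstep` allows arbitrary values of `left`.
  have := hstep (L - 1) (by omega) hJ fun j => (run P ω (t + (L - 1)) j).left
  rw [show L - 1 + 1 = L by omega] at this
  refine ⟨_, this, fun j hj => ?_⟩
  have h1 : t + L = t + (L - 1) + 1 := by omega
  rw [h1, run_succ, State.step, if_pos (by rw [hl j hj]; omega)]
  congr 1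
  unfold observed
  rw [← observe_left (run P ω (t + (L - 1)) j) (pull P ω (t + (L - 1)) j)
    (reward P ω (t + (L - 1)) j)]

/-- Before the first phase the phase counter is `0`. -/
def PhaseOK (σ : State K) : Prop :=
  ((∃ f, σ.mode = .chairs true f) ∨ ∃ k n m, σ.mode = .estimate k n m) → σ.p = 0

theorem nextBlock_phase (σ : State K) :
    (State.nextBlock P σ).p = σ.p ∧ PhaseOK (State.nextBlock P σ) := by
  unfold State.nextBlock State.startBlock
  split_ifs <;> exact ⟨rfl, by simp [PhaseOK]⟩

theorem startPhase_phase (σ : State K) (p : ℕ) :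
    (State.startPhase P σ p).p = p ∧ PhaseOK (State.startPhase P σ p) := by
  unfold State.startPhase
  split_ifs <;> exact ⟨rfl, by simp [PhaseOK]⟩

theorem PhaseOK.observe {σ : State K} (h : PhaseOK σ) (i : Fin K) (r : ℝ) :
    PhaseOK (σ.observe i r) := by
  have hp := (Kept.observe (Kept.refl σ) i r σ.left).p
  unfold PhaseOK at h ⊢
  rw [show (σ.observe i r).p = σ.p from hp]
  unfold State.observe
  split <;> rename_i hm <;> simp_all [State.countBlock]

theorem PhaseOK.finish {σ : State K} (h : PhaseOK σ) :
    PhaseOK (σ.finish P) ∧ σ.p ≤ (σ.finish P).p := by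
  have h' := h
  unfold PhaseOK at h
  unfold State.finish
  split <;> rename_i hm
  · exact ⟨fun _ => h (Or.inl ⟨_, hm⟩), le_rfl⟩
  · have hp := h (Or.inr ⟨_, _, _, hm⟩)
    split_ifs
    · exact ⟨fun _ => hp, le_rfl⟩
    · exact ⟨fun _ => hp, le_rfl⟩
    · rw [(startPhase_phase _ _).1, hp]
      exact ⟨(startPhase_phase _ _).2, zero_le_one⟩
    · rw [(startPhase_phase _ _).1, hp]
      exact ⟨(startPhase_phase _ _).2, zero_le_one⟩
  · exact ⟨by simp [PhaseOK], le_rfl⟩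
  · refine ⟨(nextBlock_phase _).2, ?_⟩
    unfold State.startComm
    rw [(nextBlock_phase _).1]
  · refine ⟨(nextBlock_phase _).2, ?_⟩
    rw [(nextBlock_phase _).1]
  · exact ⟨by simp [PhaseOK, State.startBlock], le_rfl⟩
  · exact ⟨by simp [PhaseOK], le_rfl⟩
  · split_ifs
    · exact ⟨by simp [PhaseOK, State.startBlock], le_rfl⟩
    · rw [(startPhase_phase _ _).1]
      exact ⟨(startPhase_phase _ _).2, Nat.le_succ _⟩
  · exact ⟨h', le_rfl⟩

theorem run_phaseOK (t : ℕ) (j : Fin M) : PhaseOK (run P ω t j) := by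
  induction t with
  | zero => exact fun _ => rfl
  | succ t ih =>
    rw [run_succ]
    unfold State.step
    have h := ih.observe (pull P ω t j) (reward P ω t j)
    split_ifs
    · exact h.finish.1
    · exact h

/-- The counter is raised by one after a communication phase and set to 1 after the estimation,
where `PhaseOK` says that it was 0. Monotonicity shows that no round before a Musical Chairs of a
new phase already counted for it. -/
theorem run_p_mono (j : Fin M) : Monotone fun t => (run P ω t j).p := by
  refine monotone_nat_of_le_succ fun t => ?_
  rw [run_succ]
  unfold State.step
  have h := (run_phaseOK (P := P) (ω := ω) t j).observe (pull P ω t j) (reward P ω t j)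
  have hp := (Kept.observe (Kept.refl (run P ω t j)) (pull P ω t j) (reward P ω t j) 0).p
  split_ifs
  · exact hp.ge.trans h.finish.2
  · exact hp.ge

end Loops


/-! ### Musical Chairs on the good event. -/

section Chairs

variable {K M : ℕ} {P : Params K} {ω : Sample K M} {ν : Fin K → Measure ℝ} {H : ℕ}

theorem uniformArm_mem (hpick : ∀ A : Finset (Fin K), A.Nonempty → P.pick A ∈ A)
    {A : Finset (Fin K)} (hA : A.Nonempty) (u : unitInterval) : uniformArm P A u ∈ A := by
  unfold uniformArm
  rcases lt_or_ge ⌊(u : ℝ) * A.card⌋₊ (A.sort (· ≤ ·)).length with h | h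
  · rw [List.getD_eq_getElem _ _ h]
    exact (Finset.mem_sort (· ≤ ·)).1 (List.getElem_mem h)
  · rw [List.getD_eq_default _ _ h]
    exact hpick A hA

/-- The statistics coincide. -/
structure SameStats (σ τ : State K) : Prop where
  S : τ.S = σ.S
  N : τ.N = σ.N
  s : τ.s = σ.s
  n : τ.n = σ.n

open Classical in
theorem le_csum_one {C : ℕ → Prop} {t L : ℕ} (h : ∀ s < L, C (t + s)) :
    (L : ℝ) ≤ csum C 1 (t + L) := by
  rw [csum_one_eq, Nat.cast_le]
  have hcard : (Finset.Ico t (t + L)).card = L := by simp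
  refine hcard.symm.le.trans (Finset.card_le_card fun s hs => ?_)
  rw [Finset.mem_Ico] at hs
  simp only [Finset.mem_filter, Finset.mem_range]
  refine ⟨hs.2, ?_⟩
  have := h (s - t) (by omega)
  rwa [Nat.add_sub_cancel' hs.1] at this

theorem Good.reward_nonneg (good : Good P ν H ω) (t : ℕ) (j : Fin M) : 0 ≤ reward P ω t j :=
  NoSensing.reward_nonneg good.mem t j

/-- On the good event Musical Chairs seats the active players on different arms. -/
theorem chairs_window (good : Good P ν H ω)
    (hpick : ∀ A : Finset (Fin K), A.Nonempty → P.pick A ∈ A) {b : Bool} {p t : ℕ}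
    {A : Finset (Fin K)} {U : Finset (Fin M)} (hA : 1 ≤ A.card) (hTc : 1 ≤ P.Tc)
    (hUA : U.card ≤ A.card)
    (hex : ∀ j, j ∉ U → ∃ k, k ∉ A ∧ (run P ω t j).mode = .exploit k)
    (hmode : ∀ j ∈ U, (run P ω t j).mode = .chairs b none)
    (hleft : ∀ j ∈ U, (run P ω t j).left = A.card * P.Tc)
    (hact : ∀ j ∈ U, (run P ω t j).act = A) (hp : ∀ j ∈ U, (run P ω t j).p = p)
    (hpT : p ≤ Nat.log 2 P.T + 2) (hH : t + A.card * P.Tc ≤ H)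
    (hpast : ∀ s < t, ∀ j ∈ U, ¬ Seeking P ω j p A.card s) :
    (∀ s < A.card * P.Tc, ∀ j ∈ U, ∃ g, (run P ω (t + s) j).mode = .chairs b g) ∧
    ∃ (f : Fin M → Fin K) (τ : Fin M → State K), (∀ j ∈ U, f j ∈ A) ∧
      (∀ j ∈ U, ∀ j' ∈ U, f j = f j' → j = j') ∧
      ∀ j ∈ U, run P ω (t + A.card * P.Tc) j = (τ j).finish P ∧
        (τ j).mode = .chairs b (some (f j)) ∧ Kept (run P ω t j) (τ j) ∧
        SameStats (run P ω t j) (τ j) := by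
  have hAne : A.Nonempty := Finset.card_pos.1 hA
  have hL : 1 ≤ A.card * P.Tc := Nat.mul_pos hA hTc
  let J : ℕ → (Fin M → State K) → Prop := fun s σ =>
    (∀ j, j ∉ U → ∃ k, k ∉ A ∧ (σ j).mode = .exploit k) ∧
    (∀ j ∈ U, Kept (run P ω t j) (σ j) ∧ SameStats (run P ω t j) (σ j) ∧
      (((σ j).mode = .chairs b none ∧
        ∀ r < s, (run P ω (t + r) j).mode = .chairs b none ∧ reward P ω (t + r) j ≤ 0) ∨
        ∃ k ∈ A, (σ j).mode = .chairs b (some k))) ∧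
    ∀ j ∈ U, ∀ j' ∈ U, ∀ k, (σ j).mode = .chairs b (some k) → (σ j').mode = .chairs b (some k) →
      j = j'
  have hloop := loop_sync (P := P) (ω := ω) hL hleft (fun j hj => (hex j hj).imp fun _ h => h.2) J
    ?_ ?_
  · obtain ⟨hJ, τ, ⟨-, hU, hdist⟩, hfin⟩ := hloop
    have hseated : ∀ j ∈ U, ∃ k ∈ A, (τ j).mode = .chairs b (some k) := by
      intro j hj
      rcases (hU j hj).2.2 with ⟨-, h⟩ | h
      · exfalso
        -- A player unseated at the end has been seeking without reward in all |A| T_c rounds of the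
        -- loop, and by `hpast` no earlier round counted; this contradicts `Good.chairs`.
        have hseek : ∀ s < A.card * P.Tc, Seeking P ω j p A.card (t + s) := by
          intro s hs
          obtain ⟨h1, h2, h3⟩ := hJ s hs
          have hk := (h2 j hj).1
          have hactj : (run P ω (t + s) j).act = A := hk.act.trans (hact j hj)
          refine ⟨⟨fun j' => ?_, ?_, U, fun j' hj' => ?_, by rw [hactj]; exact hUA⟩,
            ⟨b, (h s hs).1⟩, hk.p.trans (hp j hj), by rw [hactj]⟩
          · rw [hactj]
            by_cases hj' : j' ∈ U
            · refine Or.inr ⟨(h2 j' hj').1.act.trans (hact j' hj'), ?_⟩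
              rcases (h2 j' hj').2.2 with h4 | ⟨k, hk, h4⟩
              · exact Or.inl ⟨b, h4.1⟩
              · exact Or.inr ⟨b, k, hk, h4⟩
            · exact Or.inl (h1 j' hj')
          · intro j1 j2 b1 b2 k hk1 hk2
            have hin : ∀ j' b', (run P ω (t + s) j').mode = .chairs b' (some k) →
                j' ∈ U ∧ (run P ω (t + s) j').mode = .chairs b (some k) := by
              intro j' b' h5
              have hj'U : j' ∈ U := by
                by_contra hn
                obtain ⟨k', -, hk'⟩ := h1 j' hn
                simp [hk'] at h5
              refine ⟨hj'U, ?_⟩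
              rcases (h2 j' hj'U).2.2 with h4 | ⟨k', hk', h4⟩
              · simp [h4.1] at h5
              · rw [h4] at h5 ⊢
                simp only [Mode.chairs.injEq] at h5 ⊢
                exact ⟨trivial, h5.2⟩
            exact h3 j1 (hin j1 b1 hk1).1 j2 (hin j2 b2 hk2).1 k (hin j1 b1 hk1).2 (hin j2 b2 hk2).2
          · exact (h1 j' hj').imp fun _ h => h.2
        have hlt := good.chairs j p A.card (t + A.card * P.Tc) hpT
          (Finset.mem_Icc.2 ⟨hA, by simpa using Finset.card_le_univ A⟩) hH ?_
        · have := le_csum_one hseek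
          push_cast at this
          linarith
        · intro s hs hsk
          rcases lt_or_ge s t with hst | hst
          · exact absurd hsk (hpast s hst j hj)
          · have h4 := (h (s - t) (by omega)).2
            rw [Nat.add_sub_cancel' hst] at h4
            exact le_antisymm h4 (good.reward_nonneg s j)
      · exact h
    have : Nonempty (Fin K) := ⟨hAne.choose⟩
    choose! f hfA hf using hseated
    refine ⟨fun s hs j hj => ?_, f, τ, hfA, fun j hj j' hj' hff => ?_, fun j hj => ⟨hfin j hj, hf j hj, (hU j hj).1,
      (hU j hj).2.1⟩⟩
    · rcases ((hJ s hs).2.1 j hj).2.2 with h | ⟨k, -, h⟩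
      · exact ⟨_, h.1⟩
      · exact ⟨_, h⟩
    exact hdist j hj j' hj' (f j) (hf j hj) (by rw [hff]; exact hf j' hj')
  · refine ⟨hex, fun j hj => ⟨Kept.refl _, ⟨rfl, rfl, rfl, rfl⟩, Or.inl ⟨hmode j hj, ?_⟩⟩, ?_⟩
    · intro r hr; omega
    · intro j hj j' hj' k hk; rw [hmode j hj] at hk; simp at hk
  · rintro s hs ⟨h1, h2, h3⟩ l
    have hobs_none : ∀ j, (run P ω (t + s) j).mode = .chairs b none →
        (observed P ω (t + s) (l j) j).mode
          = .chairs b (if 0 < reward P ω (t + s) j then some (pull P ω (t + s) j) else none) := by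
      intro j hj; unfold observed State.observe; rw [hj]
    have hobs_some : ∀ j k, (run P ω (t + s) j).mode = .chairs b (some k) →
        (observed P ω (t + s) (l j) j).mode = .chairs b (some k) := by
      intro j k hj; unfold observed State.observe; rw [hj]; exact hj
    have hpull : ∀ j k, (run P ω (t + s) j).mode = .chairs b (some k) →
        pull P ω (t + s) j = k := by
      intro j k hj; simp only [pull, arms, State.arm, hj]
    refine ⟨fun j hj => ?_, fun j hj => ⟨(h2 j hj).1.observe _ _ _, ?_, ?_⟩, ?_⟩
    · obtain ⟨k, hk, hm⟩ := h1 j hj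
      refine ⟨k, hk, ?_⟩
      beta_reduce
      unfold observed State.observe; rw [hm]; exact hm
    · obtain ⟨g1, g2, g3, g4⟩ := (h2 j hj).2.1
      beta_reduce
      unfold observed State.observe
      rcases (h2 j hj).2.2 with h4 | ⟨k, hk, h4⟩
      · rw [h4.1]; exact ⟨g1, g2, g3, g4⟩
      · rw [h4]; exact ⟨g1, g2, g3, g4⟩
    · rcases (h2 j hj).2.2 with ⟨h4, h5⟩ | ⟨k, hk, h4⟩
      · beta_reduce
        rw [hobs_none j h4]
        by_cases hr : 0 < reward P ω (t + s) j
        · refine Or.inr ⟨pull P ω (t + s) j, ?_, by rw [if_pos hr]⟩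
          have : pull P ω (t + s) j = uniformArm P A ((ω (t + s)).2 j) := by
            simp only [pull, arms, State.arm, h4, (h2 j hj).1.act.trans (hact j hj)]
          rw [this]
          exact uniformArm_mem hpick hAne _
        · refine Or.inl ⟨by rw [if_neg hr], fun r hrs => ?_⟩
          rcases Nat.lt_succ_iff_lt_or_eq.1 hrs with h6 | h6
          · exact h5 r h6
          · rw [h6]; exact ⟨h4, not_lt.1 hr⟩
      · exact Or.inr ⟨k, hk, hobs_some j k h4⟩
    · intro j hj j' hj' k hk hk'
      have hcase : ∀ j ∈ U, (observed P ω (t + s) (l j) j).mode = .chairs b (some k) →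
          (run P ω (t + s) j).mode = .chairs b (some k) ∨
          (0 < reward P ω (t + s) j ∧ pull P ω (t + s) j = k) := by
        intro j hj hk
        rcases (h2 j hj).2.2 with ⟨h4, -⟩ | ⟨k', -, h4⟩
        · rw [hobs_none j h4] at hk
          split_ifs at hk with hr
          · simp only [Mode.chairs.injEq, Option.some.injEq, true_and] at hk
            exact Or.inr ⟨hr, hk⟩
          · simp at hk
        · rw [hobs_some j k' h4] at hk
          rw [← hk]; exact Or.inl h4
      -- A positive reward excludes any collision, in particular one with a seated player, who keeps
      -- pulling the seat; so no arm gets two owners.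
      rcases hcase j hj hk with g | ⟨g1, g2⟩
      · rcases hcase j' hj' hk' with g' | ⟨g1', g2'⟩
        · exact h3 j hj j' hj' k g g'
        · exact noColl_of_reward_pos g1' j ((hpull j k g).trans g2'.symm)
      · rcases hcase j' hj' hk' with g' | ⟨g1', g2'⟩
        · exact (noColl_of_reward_pos g1 j' ((hpull j' k g').trans g2.symm)).symm
        · exact (noColl_of_reward_pos g1 j' (g2'.trans g2.symm)).symm

end Chairs


/-! ### Sums over selected rounds. -/

section Selections

theorem csum_succ (C : ℕ → Prop) [DecidablePred C] (x : ℕ → ℝ) (t : ℕ) :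
    csum C x (t + 1) = csum C x t + if C t then x t else 0 := by
  unfold csum
  rw [Finset.sum_range_succ]
  congr!

theorem csum_succ_of {C : ℕ → Prop} (x : ℕ → ℝ) {t : ℕ} (h : C t) :
    csum C x (t + 1) = csum C x t + x t := by
  classical
  rw [csum_succ, if_pos h]

theorem csum_succ_of_not {C : ℕ → Prop} (x : ℕ → ℝ) {t : ℕ} (h : ¬ C t) :
    csum C x (t + 1) = csum C x t := by
  classical
  rw [csum_succ, if_neg h, add_zero]

theorem csum_add_of_not {C : ℕ → Prop} (x : ℕ → ℝ) {t L : ℕ} (h : ∀ s < L, ¬ C (t + s)) :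
    csum C x (t + L) = csum C x t := by
  induction L with
  | zero => rfl
  | succ L ih =>
    rw [← add_assoc, csum_succ_of_not x (h L (by omega)), ih fun s hs => h s (by omega)]

theorem csum_eq_zero {C : ℕ → Prop} (x : ℕ → ℝ) {t : ℕ} (h : ∀ s < t, ¬ C s) :
    csum C x t = 0 := by
  have := csum_add_of_not x (t := 0) (L := t) (C := C) (by simpa using h)
  rw [zero_add] at this
  rw [this]; simp [csum]

theorem csum_mono_of_imp {C D : ℕ → Prop} {t : ℕ} (h : ∀ s < t, C s → D s) :
    csum C 1 t ≤ csum D 1 t := by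
  classical
  rw [csum_one_eq, csum_one_eq, Nat.cast_le]
  refine Finset.card_le_card fun s hs => ?_
  rw [Finset.mem_filter, Finset.mem_range] at hs ⊢
  exact ⟨hs.1, h s hs.1 hs.2⟩

theorem csum_congr {C D : ℕ → Prop} (x : ℕ → ℝ) {t : ℕ} (h : ∀ s < t, (C s ↔ D s)) :
    csum C x t = csum D x t := by
  classical
  unfold csum
  refine Finset.sum_congr rfl fun s hs => ?_
  have := h s (Finset.mem_range.1 hs)
  by_cases hC : C s
  · rw [if_pos hC, if_pos (this.1 hC)]
  · rw [if_neg hC, if_neg fun hD => hC (this.2 hD)]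

end Selections

/-- The parameters fit the arms, and `Top` consists of `M` best arms. -/
structure Env {K : ℕ} (P : Params K) (ν : Fin K → Measure ℝ) (M : ℕ) (Top : Finset (Fin K))
    (m : ℝ) : Prop where
  pick : ∀ A : Finset (Fin K), A.Nonempty → P.pick A ∈ A
  card : Top.card = M
  sum_top : ∑ k ∈ Finset.Icc 1 M, orderStat (mean ν) k = ∑ k ∈ Top, mean ν k
  le_top : ∀ k ∈ Top, m ≤ mean ν k
  bad_le : ∀ k, k ∉ Top → mean ν k ≤ m
  log_pos : 0 < Real.log P.T
  log_le : ∀ k, 2400 * Real.log P.T ≤ mean ν k * P.T0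
  Tc_pos : 1 ≤ P.Tc
  Tc_le : 3 * P.Tc ≤ P.T0
  T0_ge : 1000 ≤ P.T0
  mean_pos : ∀ k, 0 < mean ν k
  mean_le : ∀ k, mean ν k ≤ 1

/-! ### The estimation of the number of players. -/

section Estimation

variable {K M : ℕ} {P : Params K} {ω : Sample K M} {ν : Fin K → Measure ℝ} {H : ℕ}
  {Top : Finset (Fin K)} {m : ℝ}

theorem succArm_univ (k : Fin K) : (succArm Finset.univ k : ℕ) = (k + 1) % K := by
  have hid : (id : Fin K → Fin K)
      = (Finset.univ : Finset (Fin K)).orderEmbOfFin (Finset.card_fin K) :=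
    Finset.orderEmbOfFin_unique _ (fun _ => Finset.mem_univ _) strictMono_id
  have h := succArm_emb (Finset.card_fin K) k ⟨(k + 1) % K, Nat.mod_lt _ k.pos⟩ rfl
  rw [← hid] at h
  simp only [id] at h
  rw [h]

/-- In the estimation, the players with seats `k` and `k'` meet exactly in block `k + k' + 1`. -/
theorem meet_iff {k k' n : ℕ} (hk : k < K) (hk' : k' < K) (hne : k ≠ k') :
    (k + (n - 2 * k)) % K = (k' + (n - 2 * k')) % K ↔ k + k' = n := by
  have static : ∀ {a : ℕ}, a < K → n ≤ 2 * a → (a + (n - 2 * a)) % K = a := by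
    intro a ha h
    rw [Nat.sub_eq_zero_of_le h, add_zero, Nat.mod_eq_of_lt ha]
  -- Before reduction modulo `K` the moving player is at n - a. A wrap-around meeting would need n =
  -- a + b + K ≤ 2b, impossible for b < K.
  have mixed : ∀ {a b : ℕ}, a < K → b < K → a ≠ b → 2 * a < n → n ≤ 2 * b →
      ((a + (n - 2 * a)) % K = b ↔ a + b = n) := by
    intro a b ha hb hab h1 h2
    have e : a + (n - 2 * a) = n - a := by omega
    rw [e]
    rcases lt_or_ge (n - a) K with h | h
    · rw [Nat.mod_eq_of_lt h]; omega
    · rw [Nat.mod_eq_sub_mod h, Nat.mod_eq_of_lt (by omega)]; omega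
  -- Two moving players keep the distance b - a, which lies strictly between 0 and `K`.
  have moving : ∀ {a b : ℕ}, a < b → b < K → 2 * b < n →
      (a + (n - 2 * a)) % K ≠ (b + (n - 2 * b)) % K := by
    intro a b hab hb h1 h
    have h2 := (Nat.modEq_iff_dvd' (by omega)).1 (h.symm : _ ≡ _ [MOD K])
    have h3 := Nat.eq_zero_of_dvd_of_lt h2 (by omega)
    omega
  rcases le_or_gt n (2 * k) with h | h <;> rcases le_or_gt n (2 * k') with h' | h'
  · rw [static hk h, static hk' h']; omega
  · rw [static hk h, eq_comm, mixed hk' hk hne.symm h' h, add_comm]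
  · rw [static hk' h', mixed hk hk' hne h h']
  · rcases lt_or_gt_of_ne hne with h1 | h1
    · exact iff_of_false (moving h1 hk' h') (by omega)
    · exact iff_of_false (moving h1 hk h).symm (by omega)

/-- Number of players that a player meets in the first `n` blocks of the estimation. -/
def meetings (f : Fin M → Fin K) (j : Fin M) (n : ℕ) : ℕ :=
  (Finset.univ.filter fun j' => j' ≠ j ∧ (f j : ℕ) + f j' < n).card

theorem meetings_succ {f : Fin M → Fin K} (hf : Function.Injective f) (j : Fin M) (n : ℕ)
    [Decidable (∃ j', j' ≠ j ∧ (f j : ℕ) + f j' = n)] :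
    meetings f j (n + 1)
      = meetings f j n + if ∃ j', j' ≠ j ∧ (f j : ℕ) + f j' = n then 1 else 0 := by
  unfold meetings
  split_ifs with h
  · obtain ⟨i, hi, hn⟩ := h
    rw [← Finset.card_insert_of_notMem (a := i)]
    · congr 1
      ext j'
      simp only [Finset.mem_filter, Finset.mem_univ, true_and, Finset.mem_insert]
      constructor
      · rintro ⟨h1, h2⟩
        rcases Nat.lt_succ_iff_lt_or_eq.1 h2 with h3 | h3
        · exact Or.inr ⟨h1, h3⟩
        · exact Or.inl (hf (Fin.ext (by omega)))
      · rintro (rfl | ⟨h1, h2⟩)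
        · exact ⟨hi, by omega⟩
        · exact ⟨h1, by omega⟩
    · simp only [Finset.mem_filter, Finset.mem_univ, true_and]; omega
  · rw [add_zero]
    congr 1
    ext j'
    simp only [Finset.mem_filter, Finset.mem_univ, true_and]
    constructor
    · rintro ⟨h1, h2⟩
      exact ⟨h1, (Nat.lt_succ_iff_lt_or_eq.1 h2).resolve_right fun h3 => h ⟨j', h1, h3⟩⟩
    · rintro ⟨h1, h2⟩
      exact ⟨h1, by omega⟩

theorem meetings_end (f : Fin M → Fin K) (j : Fin M) (n : ℕ) (hn : 2 * K ≤ n) :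
    1 + meetings f j n = M := by
  unfold meetings
  have : (Finset.univ.filter fun j' => j' ≠ j ∧ (f j : ℕ) + f j' < n) = Finset.univ.erase j := by
    ext j'
    simp only [Finset.mem_filter, Finset.mem_univ, true_and, Finset.mem_erase, and_true,
      and_iff_left_iff_imp]
    intro _
    have := (f j).2
    have := (f j').2
    omega
  rw [this, Finset.card_erase_of_mem (Finset.mem_univ _), Finset.card_fin]
  have := j.pos
  omega

/-- Memory before block `n + 1` of the estimation of the number of players. -/
structure Estimating (P : Params K) (f : Fin M → Fin K) (n : ℕ) (j : Fin M) (σ : State K) :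
    Prop where
  mode : σ.mode = .estimate (f j) (n + 1) (1 + meetings f j n)
  pos : (σ.pos : ℕ) = (f j + (n - 2 * f j)) % K
  left : σ.left = P.Tc
  r : σ.r = 0
  act : σ.act = Finset.univ
  decl : σ.decl = ∅
  Td : σ.Td = 0
  S : σ.S = fun _ => 0
  N : σ.N = fun _ => 0
  s : σ.s = fun _ => 0
  n : σ.n = fun _ => 0

theorem not_exploring_of_mode {j : Fin M} {s : ℕ} (h1 : (run P ω s j).mode ≠ .explore)
    (h2 : (run P ω s j).mode ≠ .receive) (h3 : ∀ k, (run P ω s j).mode ≠ .exploit k) :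
    ¬ Exploring P ω j s := by
  rintro (h | ⟨-, h⟩)
  · exact h1 h
  · rcases h j with h | ⟨k, h⟩
    · exact h2 h
    · exact h3 k h

/-- Positions do not change within a block, so a player collides either in all its rounds or in
none. In the second case `Good.estimate` provides a positive reward; hence the total reward vanishes
exactly when somebody is met. -/
theorem estimate_window (good : Good P ν H ω) (env : Env P ν M Top m) {f : Fin M → Fin K}
    (hf : Function.Injective f) {n : ℕ} (hn : n < 2 * K) (hH : (K + n + 1) * P.Tc ≤ H)
    (h : ∀ j, Estimating P f n j (run P ω ((K + n) * P.Tc) j)) :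
    (∀ s < P.Tc, ∀ j, ¬ Exploring P ω j ((K + n) * P.Tc + s)) ∧
    ∀ j, ∃ τ : State K, run P ω ((K + n + 1) * P.Tc) j = τ.finish P ∧
      τ.mode = .estimate (f j) (n + 1) (1 + meetings f j n) ∧
      (τ.pos : ℕ) = (f j + (n - 2 * f j)) % K ∧ Kept (run P ω ((K + n) * P.Tc) j) τ ∧
      SameStats (run P ω ((K + n) * P.Tc) j) τ ∧
      (τ.r = 0 ↔ ∃ j', j' ≠ j ∧ (f j : ℕ) + f j' = n) := by
  set t := (K + n) * P.Tc with ht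
  have ht' : (K + n + 1) * P.Tc = t + P.Tc := by rw [ht]; ring
  let J : ℕ → (Fin M → State K) → Prop := fun s σ => ∀ j,
    (σ j).mode = .estimate (f j) (n + 1) (1 + meetings f j n) ∧
    ((σ j).pos : ℕ) = (f j + (n - 2 * f j)) % K ∧ Kept (run P ω t j) (σ j) ∧
    SameStats (run P ω t j) (σ j) ∧ (σ j).r = ∑ r ∈ Finset.range s, reward P ω (t + r) j
  have hloop := loop_sync (P := P) (ω := ω) (U := Finset.univ) env.Tc_pos
    (fun j _ => (h j).left) (fun j hj => absurd (Finset.mem_univ j) hj) J ?_ ?_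
  · obtain ⟨hJ, τ, hτ, hfin⟩ := hloop
    have hpull : ∀ s < P.Tc, ∀ j, ((pull P ω (t + s) j : Fin K) : ℕ)
        = (f j + (n - 2 * f j)) % K := by
      intro s hs j
      obtain ⟨h1, h2, -⟩ := hJ s hs j
      simp only [pull, arms, State.arm, h1, h2]
    have hcoll : ∀ s < P.Tc, ∀ j, NoColl (pull P ω (t + s)) j ↔
        ¬ ∃ j', j' ≠ j ∧ (f j : ℕ) + f j' = n := by
      intro s hs j
      unfold NoColl
      rw [not_exists]
      refine forall_congr' fun j' => ?_
      rw [Fin.ext_iff, hpull s hs, hpull s hs, not_and]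
      by_cases hj : j' = j
      · simp [hj]
      · have hff : (f j' : ℕ) ≠ f j := fun e => hj (hf (Fin.ext e))
        rw [meet_iff (f j').2 (f j).2 hff]
        constructor
        · intro h1 _ h2; exact hj (h1 (by omega))
        · intro h1 h2; exact absurd (by omega) (h1 hj)
    refine ⟨fun s hs j => ?_, fun j => ?_⟩
    · have h1 := (hJ s hs j).1
      exact not_exploring_of_mode (by simp [h1]) (by simp [h1]) (by simp [h1])
    · obtain ⟨h1, h2, h3, h4, h5⟩ := hτ j
      refine ⟨τ j, by rw [ht']; exact hfin j (Finset.mem_univ _), h1, h2, h3, h4, ?_⟩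
      rw [h5]
      constructor
      · intro h0
        by_contra hno
        obtain ⟨s, hs1, hs2, hs3⟩ := good.estimate j n hn hH
        rw [ht'] at hs2
        have hs : t + (s - t) = s := Nat.add_sub_cancel' hs1
        have hc := (hcoll (s - t) (by omega) j).2 hno
        rw [hs] at hc
        have hsum := (Finset.sum_eq_zero_iff_of_nonneg
          (fun r _ => good.reward_nonneg (t + r) j)).1 h0 (s - t) (Finset.mem_range.2 (by omega))
        rw [hs] at hsum
        have := hs3 hc
        linarith
      · intro hc
        refine Finset.sum_eq_zero fun s hs => ?_
        rw [reward_eq, if_neg]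
        rw [hcoll s (Finset.mem_range.1 hs), not_not]
        exact hc
  · intro j
    exact ⟨(h j).mode, (h j).pos, Kept.refl _, ⟨rfl, rfl, rfl, rfl⟩, by simp [(h j).r]⟩
  · intro s hs hJ l j
    obtain ⟨h1, h2, h3, h4, h5⟩ := hJ j
    refine ⟨?_, ?_, h3.observe _ _ _, ?_, ?_⟩
    · beta_reduce; unfold observed State.observe; rw [h1]
    · beta_reduce; unfold observed State.observe; rw [h1]; exact h2
    · obtain ⟨g1, g2, g3, g4⟩ := h4
      beta_reduce; unfold observed State.observe; rw [h1]; exact ⟨g1, g2, g3, g4⟩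
    · rw [Finset.sum_range_succ, ← h5]
      beta_reduce; unfold observed State.observe; rw [h1]

/-- The K T_c rounds of Musical Chairs and the 2K blocks of T_c rounds take 3 K T_c rounds. Two
ranks below K add up to less than 2K, so every other player is met exactly once and the count ends
at M. -/
theorem initialization (good : Good P ν H ω) (env : Env P ν M Top m) (hM : 1 ≤ M) (hMK : M ≤ K)
    (hH : 3 * K * P.Tc ≤ H) :
    (∀ s < 3 * K * P.Tc, ∀ j, ¬ Exploring P ω j s) ∧
    ∃ f : Fin M → Fin K, Function.Injective f ∧ ∀ j, ∃ σ, run P ω (3 * K * P.Tc) j = σ ∧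
      σ.mode = .explore ∧ σ.left = K * (2 * P.T0) ∧ σ.p = 1 ∧ σ.act = Finset.univ ∧
      σ.Mp = M ∧ σ.pos = f j ∧ (∀ i, σ.S i = 0 ∧ σ.N i = 0) := by
  classical
  have hK : 1 ≤ K := hM.trans hMK
  obtain ⟨hch, f, τ, -, hinj, hτ⟩ := chairs_window (U := Finset.univ) (A := Finset.univ) (t := 0)
    (b := true) (p := 0) good env.pick (by simpa using hK) env.Tc_pos (by simpa using hMK)
    (fun j hj => absurd (Finset.mem_univ j) hj) (fun j _ => rfl) (fun j _ => by simp [run, State.init])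
    (fun j _ => rfl) (fun j _ => rfl) (Nat.zero_le _)
    (le_trans (by rw [Finset.card_fin]; nlinarith [Nat.zero_le (K * P.Tc)]) hH)
    (fun s hs => absurd hs (Nat.not_lt_zero s))
  simp only [zero_add, Finset.card_fin] at hch hτ
  have hf : Function.Injective f := fun j j' => hinj j (Finset.mem_univ _) j' (Finset.mem_univ _)
  have key : ∀ n, n ≤ 2 * K → (∀ s < (K + n) * P.Tc, ∀ j, ¬ Exploring P ω j s) ∧
      (n < 2 * K → ∀ j, Estimating P f n j (run P ω ((K + n) * P.Tc) j)) ∧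
      (n = 2 * K → ∀ j, ∃ σ, run P ω ((K + n) * P.Tc) j = σ ∧
        σ.mode = .explore ∧ σ.left = K * (2 * P.T0) ∧ σ.p = 1 ∧ σ.act = Finset.univ ∧
        σ.Mp = M ∧ σ.pos = f j ∧ (∀ i, σ.S i = 0 ∧ σ.N i = 0)) := by
    intro n
    induction n with
    | zero =>
      intro _
      refine ⟨fun s hs j => ?_, fun _ j => ?_, fun h => by omega⟩
      · rw [add_zero] at hs
        obtain ⟨g, hg⟩ := hch s hs j (Finset.mem_univ _)
        exact not_exploring_of_mode (by simp [hg]) (by simp [hg]) (by simp [hg])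
      · obtain ⟨h1, h2, h3, h4⟩ := hτ j (Finset.mem_univ _)
        rw [add_zero, h1]
        have hm : meetings f j 0 = 0 := by simp [meetings]
        unfold State.finish
        rw [h2]
        unfold State.startEstimate
        refine ⟨by simp [hm], ?_, rfl, rfl, h3.act, h3.decl, h3.Td, h4.S, h4.N, h4.s, h4.n⟩
        have h5 : ¬ 2 * ((f j : ℕ) + 1) ≤ 1 := by omega
        simp [h5, Nat.mod_eq_of_lt (f j).2]
    | succ n ih =>
      intro hn
      obtain ⟨h1, h2, -⟩ := ih (by omega)
      have hle : (K + n + 1) * P.Tc ≤ H := le_trans (Nat.mul_le_mul_right _ (by omega)) hH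
      obtain ⟨h3, h4⟩ := estimate_window good env hf (by omega) hle (h2 (by omega))
      refine ⟨fun s hs j => ?_, fun hn' j => ?_, fun hn' j => ?_⟩
      · rcases lt_or_ge s ((K + n) * P.Tc) with h5 | h5
        · exact h1 s h5 j
        · have h6 : (K + (n + 1)) * P.Tc = (K + n) * P.Tc + P.Tc := by ring
          have := h3 (s - (K + n) * P.Tc) (by omega) j
          rwa [Nat.add_sub_cancel' h5] at this
      · obtain ⟨τ, g1, g2, g3, g4, g5, g6⟩ := h4 j
        have e := h2 (by omega) j
        rw [← add_assoc, g1]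
        unfold State.finish
        rw [g2]
        simp only [hn', if_true]
        unfold State.startEstimate
        refine ⟨?_, ?_, rfl, rfl, g4.act.trans e.act, g4.decl.trans e.decl, g4.Td.trans e.Td,
          g5.S.trans e.S, g5.N.trans e.N, g5.s.trans e.s, g5.n.trans e.n⟩
        · simp only [Mode.estimate.injEq, true_and]
          rw [meetings_succ hf]
          simp only [g6]
          split_ifs <;> omega
        · simp only
          split_ifs with h5
          · rw [succArm_univ, g3, Nat.mod_add_mod]
            congr 1; omega
          · rw [g3]; congr 1; omega
      · obtain ⟨τ, g1, g2, g3, g4, g5, g6⟩ := h4 j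
        have e := h2 (by omega) j
        refine ⟨_, rfl, ?_⟩
        have hd := g4.decl.trans e.decl
        rw [← add_assoc, g1]
        unfold State.finish
        rw [g2]
        simp only [show ¬ (n + 1 < 2 * K) by omega, if_false]
        unfold State.startPhase
        rw [if_neg (by simp [hd])]
        -- Since `Td` and the block statistics are still zero, nothing is deducted from the first
        -- phase and nothing is added to its statistics.
        refine ⟨rfl, ?_, rfl, g4.act.trans e.act, ?_, rfl, fun i => ?_⟩
        · simp only [g4.act.trans e.act, g4.Td.trans e.Td, Finset.card_fin]
          rw [Nat.sub_zero, pow_one, mul_assoc]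
        · have h7 := meetings_end f j (n + 1) hn'.ge
          rw [meetings_succ hf] at h7
          simp only [g6]
          split_ifs at h7 ⊢ <;> omega
        · simp [g5.S.trans e.S, g5.N.trans e.N, g5.s.trans e.s, g5.n.trans e.n]
  obtain ⟨h1, -, h3⟩ := key (2 * K) le_rfl
  have e : (K + 2 * K) * P.Tc = 3 * K * P.Tc := by ring
  rw [e] at h1 h3
  exact ⟨h1, f, hf, h3 rfl⟩

end Estimation


/-! ### Exploration phases: collision-free hopping and its loss. -/

section Phases

variable {K M : ℕ} {P : Params K} {ω : Sample K M} {ν : Fin K → Measure ℝ} {H : ℕ}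
  {Top : Finset (Fin K)} {m : ℝ}

/-- The players outside `U` exploit different arms of `Top` outside `B`, and there is one player
in `U` for each arm of `Top ∩ B`. -/
structure Seated (P : Params K) (ω : Sample K M) (t : ℕ) (Top B : Finset (Fin K))
    (U : Finset (Fin M)) (seat : Fin M → Fin K) : Prop where
  exploit : ∀ j, j ∉ U → (run P ω t j).mode = .exploit (seat j)
  seat_mem : ∀ j, j ∉ U → seat j ∈ Top
  seat_notMem : ∀ j, j ∉ U → seat j ∉ B
  seat_inj : ∀ j, j ∉ U → ∀ j', j' ∉ U → seat j = seat j' → j = j'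
  card : U.card = (Top ∩ B).card

variable {t : ℕ} {A B : Finset (Fin K)} {U : Finset (Fin M)} {seat : Fin M → Fin K}

theorem Seated.add (h : Seated P ω t Top B U seat) (s : ℕ) : Seated P ω (t + s) Top B U seat :=
  ⟨fun j hj => exploit_forever (h.exploit j hj) s, h.seat_mem, h.seat_notMem, h.seat_inj, h.card⟩

theorem Seated.pull_eq (h : Seated P ω t Top B U seat) {j : Fin M} (hj : j ∉ U) :
    pull P ω t j = seat j := pull_exploit (h.exploit j hj)

/-- The seats lie in `Top \ B` and are distinct, and the cardinality of `U` makes their number equal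
to that of `Top \ B`. -/
theorem Seated.image_eq (h : Seated P ω t Top B U seat) (hTop : Top.card = M) :
    Uᶜ.image seat = Top \ B := by
  refine Finset.eq_of_subset_of_card_le (fun k hk => ?_) ?_
  · obtain ⟨j, hj, rfl⟩ := Finset.mem_image.1 hk
    rw [Finset.mem_compl] at hj
    exact Finset.mem_sdiff.2 ⟨h.seat_mem j hj, h.seat_notMem j hj⟩
  · rw [Finset.card_image_of_injOn, Finset.card_compl, Fintype.card_fin]
    · have h1 := Finset.card_sdiff_add_card_inter Top B
      have h2 := h.card
      omega
    · intro j hj j' hj' hjj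
      simp only [Finset.coe_compl, Set.mem_compl_iff, Finset.mem_coe] at hj hj'
      exact h.seat_inj j hj j' hj' hjj

theorem Seated.sum_seats (h : Seated P ω t Top B U seat) (hTop : Top.card = M) (g : Fin K → ℝ) :
    ∑ j ∈ Uᶜ, g (seat j) = ∑ k ∈ Top \ B, g k := by
  rw [← h.image_eq hTop, Finset.sum_image]
  intro j hj j' hj' hjj
  simp only [Finset.coe_compl, Set.mem_compl_iff, Finset.mem_coe] at hj hj'
  exact h.seat_inj j hj j' hj' hjj

theorem Seated.noColl (h : Seated P ω t Top B U seat) {q : Fin M → Fin K}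
    (hpull : ∀ j ∈ U, pull P ω t j = q j) (hq : ∀ j ∈ U, q j ∈ B)
    (hinj : ∀ j ∈ U, ∀ j' ∈ U, q j = q j' → j = j') (j : Fin M) : NoColl (pull P ω t) j := by
  intro i hi
  by_cases hiU : i ∈ U <;> by_cases hjU : j ∈ U
  · rw [hpull i hiU, hpull j hjU] at hi; exact hinj i hiU j hjU hi
  · rw [hpull i hiU, h.pull_eq hjU] at hi
    exact absurd (hi ▸ hq i hiU) (h.seat_notMem j hjU)
  · rw [hpull j hjU, h.pull_eq hiU] at hi
    exact absurd (hi ▸ hq j hjU) (h.seat_notMem i hiU)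
  · rw [h.pull_eq hiU, h.pull_eq hjU] at hi; exact h.seat_inj i hiU j hjU hi

/-- Nobody collides, and the exploited arms cancel against the top arms outside `B`; only the top
arms inside `B` are compared with the arms pulled by `U`. -/
theorem Seated.loss_eq (h : Seated P ω t Top B U seat) (env : Env P ν M Top m) {q : Fin M → Fin K}
    (hpull : ∀ j ∈ U, pull P ω t j = q j) (hq : ∀ j ∈ U, q j ∈ B)
    (hinj : ∀ j ∈ U, ∀ j' ∈ U, q j = q j' → j = j') :
    loss P ν ω t = ∑ k ∈ Top ∩ B, mean ν k - ∑ j ∈ U, mean ν (q j) := by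
  unfold loss
  rw [env.sum_top]
  have h1 : ∀ j, gain P ν ω t j = mean ν (pull P ω t j) := by
    intro j
    unfold gain ind
    rw [if_pos (h.noColl hpull hq hinj j), one_mul]
  simp only [h1]
  rw [← Finset.sum_add_sum_compl U, Finset.sum_congr (rfl : U = U) fun j hj => by rw [hpull j hj],
    Finset.sum_congr (rfl : Uᶜ = Uᶜ) fun j hj => by rw [h.pull_eq (Finset.mem_compl.1 hj)],
    h.sum_seats env.card (mean ν), ← Finset.sum_inter_add_sum_sdiff Top B]
  ring

/-- Loss of a round of hopping on `A`. -/
noncomputable def gap (ν : Fin K → Measure ℝ) (Top A : Finset (Fin K)) : ℝ :=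
  A.card * ∑ k ∈ Top ∩ A, mean ν k - (Top ∩ A).card * ∑ k ∈ A, mean ν k

theorem sum_hop {k : Fin K} (hk : k ∈ A) (c : ℕ) (g : Fin K → ℝ) :
    ∑ s ∈ Finset.range (A.card * c), g (hop A s k) = c * ∑ i ∈ A, g i := by
  rw [← Finset.sum_fiberwise_of_maps_to (t := A) (g := fun s => hop A s k)
    fun s _ => hop_mem hk s, Finset.mul_sum]
  refine Finset.sum_congr rfl fun i hi => ?_
  rw [Finset.sum_congr rfl fun s hs => by rw [(Finset.mem_filter.1 hs).2], Finset.sum_const,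
    card_visits hk hi, nsmul_eq_mul]

/-- In `c` full cycles every hopping player visits each arm of `A` exactly `c` times, so the loss
does not depend on the starting positions. -/
theorem Seated.sum_loss_hop (h : Seated P ω t Top A U seat) (env : Env P ν M Top m)
    {q : Fin M → Fin K} (hq : ∀ j ∈ U, q j ∈ A) (hinj : ∀ j ∈ U, ∀ j' ∈ U, q j = q j' → j = j')
    {c : ℕ} (hpull : ∀ s < A.card * c, ∀ j ∈ U, pull P ω (t + s) j = hop A s (q j)) :
    ∑ s ∈ Finset.range (A.card * c), loss P ν ω (t + s) = c * gap ν Top A := by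
  rw [Finset.sum_congr rfl fun s hs => (h.add s).loss_eq env (hpull s (Finset.mem_range.1 hs))
    (fun j hj => hop_mem (hq j hj) s) (fun j hj j' hj' hjj => hinj j hj j' hj'
      (hop_inj (hq j hj) (hq j' hj') s hjj)),
    Finset.sum_sub_distrib, Finset.sum_const, Finset.card_range, Finset.sum_comm,
    Finset.sum_congr (rfl : U = U) fun j hj => sum_hop (hq j hj) c (mean ν), Finset.sum_const, h.card]
  unfold gap
  simp only [nsmul_eq_mul]
  push_cast
  ring

theorem Seated.loss_eq_zero (h : Seated P ω t Top B ∅ seat) (env : Env P ν M Top m) :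
    loss P ν ω t = 0 := by
  rw [h.loss_eq env (q := seat) (by simp) (by simp) (by simp)]
  have : Top ∩ B = ∅ := by
    have := h.card
    rw [Finset.card_empty] at this
    exact Finset.card_eq_zero.1 this.symm
  rw [this]; simp

/-- A sum of at most `M` means is at most the sum over `Top`. -/
theorem Env.sum_le (env : Env P ν M Top m) {S : Finset (Fin K)} (hS : S.card ≤ M) :
    ∑ k ∈ S, mean ν k ≤ ∑ k ∈ Top, mean ν k := by
  rw [← Finset.sum_inter_add_sum_sdiff S Top, ← Finset.sum_inter_add_sum_sdiff Top S,
    Finset.inter_comm Top S]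
  have hc : (S \ Top).card ≤ (Top \ S).card := by
    have h1 := Finset.card_sdiff_add_card_inter S Top
    have h2 := Finset.card_sdiff_add_card_inter Top S
    rw [Finset.inter_comm] at h2
    have := env.card
    omega
  have key : ∑ k ∈ S \ Top, mean ν k ≤ ∑ k ∈ Top \ S, mean ν k := by
    rcases (S \ Top).eq_empty_or_nonempty with h0 | ⟨b, hb⟩
    · rw [h0, Finset.sum_empty]; exact Finset.sum_nonneg fun k _ => (env.mean_pos k).le
    · have hm : 0 ≤ m := (env.mean_pos b).le.trans (env.bad_le b (Finset.mem_sdiff.1 hb).2)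
      calc ∑ k ∈ S \ Top, mean ν k ≤ (S \ Top).card • m :=
            Finset.sum_le_card_nsmul _ _ _ fun k hk => env.bad_le k (Finset.mem_sdiff.1 hk).2
        _ ≤ (Top \ S).card • m := by
            rw [nsmul_eq_mul, nsmul_eq_mul]
            exact mul_le_mul_of_nonneg_right (by exact_mod_cast hc) hm
        _ ≤ ∑ k ∈ Top \ S, mean ν k :=
            Finset.card_nsmul_le_sum _ _ _ fun k hk => env.le_top k (Finset.mem_sdiff.1 hk).1
  linarith

/-- Arms pulled without collision are distinct, so their means are dominated by those of `Top`. It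
makes the cumulative loss monotone, so that a bound at a later round also bounds the horizon. -/
theorem Env.loss_nonneg (env : Env P ν M Top m) (ω : Sample K M) (t : ℕ) : 0 ≤ loss P ν ω t := by
  classical
  unfold loss
  rw [env.sum_top, sub_nonneg]
  let F : Finset (Fin M) := Finset.univ.filter fun j => NoColl (pull P ω t) j
  have h1 : ∑ j, gain P ν ω t j = ∑ j ∈ F, mean ν (pull P ω t j) := by
    rw [Finset.sum_filter]
    refine Finset.sum_congr rfl fun j _ => ?_
    unfold gain ind
    split_ifs <;> simp
  rw [h1, ← Finset.sum_image (s := F) (g := pull P ω t) (f := mean ν)]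
  · exact env.sum_le (Finset.card_image_le.trans ((Finset.card_le_univ F).trans (by simp)))
  · intro j _ j' hj' hjj
    exact (Finset.mem_filter.1 hj').2 j hjj

/-- A player in `U` at the start, or in the middle, of an exploration phase, with `c` rounds of
hopping left. -/
structure Explorer (P : Params K) (ω : Sample K M) (Top : Finset (Fin K)) (p t : ℕ)
    (A : Finset (Fin K)) (c : ℕ) (j : Fin M) : Prop where
  mode : (run P ω t j).mode = .explore
  left : (run P ω t j).left = A.card * c
  phase : (run P ω t j).p = p
  act : (run P ω t j).act = A
  Mp : (run P ω t j).Mp = (Top ∩ A).card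
  pos : (run P ω t j).pos ∈ A
  -- At the end of phase `p` an active arm has been counted (2 + 4 + ... + 2^p) T_0 = (2^(p+1) - 2)
  -- T_0 times; `c` of these pulls are still to come.
  count : ∀ i ∈ A, (run P ω t j).N i + c + 2 * P.T0 = 2 ^ (p + 1) * P.T0
  S : ∀ i ∈ A, (run P ω t j).S i = csum (Explored P ω j i) (fun s => (ω s).1 i) t
  N : ∀ i ∈ A, ((run P ω t j).N i : ℝ) = csum (Explored P ω j i) 1 t

/-- Start of exploration phase `p`. -/
structure ExploreStart (P : Params K) (ω : Sample K M) (Top : Finset (Fin K)) (p t : ℕ)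
    (A : Finset (Fin K)) (c : ℕ) (U : Finset (Fin M)) (seat : Fin M → Fin K) : Prop where
  seated : Seated P ω t Top A U seat
  explorer : ∀ j ∈ U, Explorer P ω Top p t A c j
  inj : ∀ j ∈ U, ∀ j' ∈ U, (run P ω t j).pos = (run P ω t j').pos → j = j'

/-- Memory after the hopping of an exploration phase. -/
structure ExploreEnd (P : Params K) (ω : Sample K M) (Top : Finset (Fin K)) (p t : ℕ)
    (A : Finset (Fin K)) (j : Fin M) (σ : State K) : Prop where
  mode : σ.mode = .explore
  phase : σ.p = p
  act : σ.act = A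
  Mp : σ.Mp = (Top ∩ A).card
  pos : σ.pos ∈ A
  count : ∀ i ∈ A, σ.N i + 2 * P.T0 = 2 ^ (p + 1) * P.T0
  S : ∀ i ∈ A, σ.S i = csum (Explored P ω j i) (fun s => (ω s).1 i) t
  N : ∀ i ∈ A, (σ.N i : ℝ) = csum (Explored P ω j i) 1 t

/-- The statistics are followed as sums over `Explored` rounds counted from round 0, the form in
which `Good` controls them. -/
theorem ExploreStart.window {p c : ℕ} (h : ExploreStart P ω Top p t A c U seat)
    (env : Env P ν M Top m) (hL : 1 ≤ A.card * c) :
    (∃ τ : Fin M → State K, (∀ j ∈ U, run P ω (t + A.card * c) j = (τ j).finish P ∧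
      ExploreEnd P ω Top p (t + A.card * c) A j (τ j)) ∧
      ∀ j ∈ U, ∀ j' ∈ U, (τ j).pos = (τ j').pos → j = j') ∧
    ∑ s ∈ Finset.range (A.card * c), loss P ν ω (t + s) = c * gap ν Top A := by
  classical
  let q : Fin M → Fin K := fun j => (run P ω t j).pos
  have hq : ∀ j ∈ U, q j ∈ A := fun j hj => (h.explorer j hj).pos
  let J : ℕ → (Fin M → State K) → Prop := fun s σ => ∀ j ∈ U,
    (σ j).mode = .explore ∧ Kept (run P ω t j) (σ j) ∧ (σ j).pos = hop A s (q j) ∧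
    ∀ i ∈ A, (σ j).S i = csum (Explored P ω j i) (fun s => (ω s).1 i) (t + s) ∧
      ((σ j).N i : ℝ) = csum (Explored P ω j i) 1 (t + s) ∧
      (σ j).N i = (run P ω t j).N i + ((Finset.range s).filter fun r => hop A r (q j) = i).card
  have hpullJ : ∀ s, J s (run P ω (t + s)) → ∀ j ∈ U, pull P ω (t + s) j = hop A s (q j) := by
    intro s hJ j hj
    obtain ⟨h1, -, h3, -⟩ := hJ j hj
    simp only [pull, arms, State.arm, h1, h3]
  have hloop := loop_sync (P := P) (ω := ω) hL (fun j hj => (h.explorer j hj).left)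
    (fun j hj => ⟨_, h.seated.exploit j hj⟩) J ?_ ?_
  · obtain ⟨hJ, τ, hτ, hfin⟩ := hloop
    refine ⟨⟨τ, fun j hj => ⟨hfin j hj, ?_⟩, fun j hj j' hj' hjj => ?_⟩, ?_⟩
    · obtain ⟨h1, h2, h3, h4⟩ := hτ j hj
      have e := h.explorer j hj
      refine ⟨h1, h2.p.trans e.phase, h2.act.trans e.act, h2.Mp.trans e.Mp,
        h3 ▸ hop_mem (hq j hj) _, fun i hi => ?_, fun i hi => (h4 i hi).1,
        fun i hi => (h4 i hi).2.1⟩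
      rw [(h4 i hi).2.2, card_visits (hq j hj) hi, e.count i hi]
    · rw [(hτ j hj).2.2.1, (hτ j' hj').2.2.1] at hjj
      exact h.inj j hj j' hj' (hop_inj (hq j hj) (hq j' hj') _ hjj)
    · exact h.seated.sum_loss_hop env hq h.inj fun s hs => hpullJ s (hJ s hs)
  · intro j hj
    have e := h.explorer j hj
    exact ⟨e.mode, Kept.refl _, rfl, fun i hi => ⟨e.S i hi, e.N i hi, by simp⟩⟩
  · intro s hs hJ l j hj
    obtain ⟨h1, h2, h3, h4⟩ := hJ j hj
    have e := h.explorer j hj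
    -- Distinct positions stay distinct under simultaneous hops, and the exploiting players sit
    -- outside `A`; so the observed reward is the value of the arm.
    have hnc : NoColl (pull P ω (t + s)) j :=
      (h.seated.add s).noColl (hpullJ s hJ) (fun j hj => hop_mem (hq j hj) s)
        (fun j hj j' hj' hjj => h.inj j hj j' hj' (hop_inj (hq j hj) (hq j' hj') s hjj)) j
    have hp := hpullJ s hJ j hj
    refine ⟨?_, h2.observe _ _ _, ?_, fun i hi => ?_⟩
    · beta_reduce; unfold observed State.observe; rw [h1]
    · beta_reduce; unfold observed State.observe; rw [h1]
      simp only [h2.act.trans e.act, h3]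
      rw [hop_succ]
    · have hE : Explored P ω j i (t + s) ↔ pull P ω (t + s) j = i :=
        and_iff_left (Or.inl h1)
      obtain ⟨g1, g2, g3⟩ := h4 i hi
      have hSobs : (observed P ω (t + s) (l j) j).S
          = Function.update (run P ω (t + s) j).S (pull P ω (t + s) j)
            ((run P ω (t + s) j).S (pull P ω (t + s) j) + reward P ω (t + s) j) := by
        unfold observed State.observe; rw [h1]
      have hNobs : (observed P ω (t + s) (l j) j).N
          = Function.update (run P ω (t + s) j).N (pull P ω (t + s) j)
            ((run P ω (t + s) j).N (pull P ω (t + s) j) + 1) := by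
        unfold observed State.observe; rw [h1]
      rw [← add_assoc, Finset.range_add_one, Finset.filter_insert]
      beta_reduce
      rw [hSobs, hNobs]
      by_cases hi' : pull P ω (t + s) j = i
      · rw [csum_succ_of _ (hE.2 hi'), csum_succ_of _ (hE.2 hi'), if_pos (hp.symm.trans hi'),
          Finset.card_insert_of_notMem (by simp), reward_eq, if_pos hnc, hi',
          Function.update_self, Function.update_self, g1, g3]
        refine ⟨rfl, ?_, by ring⟩
        rw [← g2, g3]; push_cast; simp
      · rw [csum_succ_of_not _ (mt hE.1 hi'), csum_succ_of_not _ (mt hE.1 hi'),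
          if_neg fun hh => hi' (hp.trans hh), Function.update_of_ne (Ne.symm hi'),
          Function.update_of_ne (Ne.symm hi')]
        exact ⟨g1, g2, g3⟩

end Phases


/-! ### Accepted and rejected arms, and the invariant of a communication block. -/

section Communication

variable {K M : ℕ} {P : Params K} {ω : Sample K M} {ν : Fin K → Measure ℝ} {H : ℕ}
  {Top : Finset (Fin K)} {m : ℝ}

/-- Common confidence radius of the active arms after exploration phase `p`. -/
noncomputable def width (P : Params K) (p : ℕ) : ℝ :=
  √(2 * Real.log P.T / (2 ^ (p + 1) * P.T0 - 2 * P.T0))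

/-- What a player knows in the communication phase. -/
structure Informed (P : Params K) (ν : Fin K → Measure ℝ) (Top : Finset (Fin K)) (m : ℝ) (p : ℕ)
    (A : Finset (Fin K)) (σ : State K) : Prop where
  phase : σ.p = p
  act : σ.act = A
  Mp : σ.Mp = (Top ∩ A).card
  Td : σ.Td = A.card * P.T0
  count : ∀ i ∈ A, σ.N i + 2 * P.T0 = 2 ^ (p + 1) * P.T0
  S_le : ∀ i ∈ A, σ.S i ≤ 1.07 * mean ν i * σ.N i
  le_S : ∀ i ∈ A, 0.94 * mean ν i * σ.N i ≤ σ.S i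
  rej : ∀ k ∈ σ.rej, k ∈ A ∧ k ∉ Top
  acc : ∀ k ∈ σ.acc, k ∈ A ∧ k ∈ Top
  mem_rej : ∀ b ∈ A, b ∉ Top → 4 * width P p ≤ m - mean ν b → b ∈ σ.rej
  mem_acc : ∀ g ∈ A, g ∈ Top → 4 * width P p ≤ mean ν g - m → g ∈ σ.acc

theorem Informed.congr {p : ℕ} {A : Finset (Fin K)} {σ τ : State K}
    (h : Informed P ν Top m p A σ) (h1 : τ.p = σ.p) (h2 : τ.act = σ.act) (h3 : τ.Mp = σ.Mp)
    (h4 : τ.Td = σ.Td) (h5 : τ.S = σ.S) (h6 : τ.N = σ.N) (h7 : τ.rej = σ.rej)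
    (h8 : τ.acc = σ.acc) : Informed P ν Top m p A τ := by
  obtain ⟨a1, a2, a3, a4, a5, a6, a7, a8, a9, a10, a11⟩ := h
  constructor
  · rw [h1, a1]
  · rw [h2, a2]
  · rw [h3, a3]
  · rw [h4, a4]
  · rwa [h6]
  · rwa [h5, h6]
  · rwa [h5, h6]
  · rwa [h7]
  · rwa [h8]
  · rwa [h7]
  · rwa [h8]

variable {A D : Finset (Fin K)} {U : Finset (Fin M)} {seat : Fin M → Fin K} {p t : ℕ}

/-- Separated confidence intervals order the means correctly. Hence the arms found better than a top
arm are other top arms, fewer than `Mp`; dually, those found worse than a bad arm are too few for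
acceptance. Conversely, a distance of 4w from the threshold `m` separates a bad arm from all active
top arms, or a top arm from all active bad ones. -/
theorem informed_of_close {σ : State K} (hTop : ∀ k ∈ Top, m ≤ mean ν k)
    (hBad : ∀ k, k ∉ Top → mean ν k ≤ m) (hact : σ.act = A) (hMp : σ.Mp = (Top ∩ A).card) {w : ℝ}
    (hrad : ∀ i ∈ A, σ.radius P i = w) (hclose : ∀ i ∈ A, |σ.avg i - mean ν i| < w) :
    (∀ k ∈ σ.rejected P, k ∈ A ∧ k ∉ Top) ∧ (∀ k ∈ σ.accepted P, k ∈ A ∧ k ∈ Top) ∧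
    (∀ b ∈ A, b ∉ Top → 4 * w ≤ m - mean ν b → b ∈ σ.rejected P) ∧
    (∀ g ∈ A, g ∈ Top → 4 * w ≤ mean ν g - m → g ∈ σ.accepted P) := by
  have hlo : ∀ i ∈ A, mean ν i < σ.avg i + w := fun i hi => by
    linarith [(abs_lt.1 (hclose i hi)).1]
  have hhi : ∀ i ∈ A, σ.avg i < mean ν i + w := fun i hi => by
    linarith [(abs_lt.1 (hclose i hi)).2]
  have hcard : (A \ Top).card + (Top ∩ A).card = A.card := by
    rw [Finset.inter_comm]; exact Finset.card_sdiff_add_card_inter A Top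
  unfold State.rejected State.accepted
  rw [hact, hMp]
  simp only [Finset.mem_filter]
  refine ⟨?_, ?_, ?_, ?_⟩
  · rintro k ⟨hk, hc⟩
    refine ⟨hk, fun hkT => ?_⟩
    have hkm : k ∈ Top ∩ A := Finset.mem_inter.2 ⟨hkT, hk⟩
    have hsub : (A.filter fun i => σ.avg k + σ.radius P k ≤ σ.avg i - σ.radius P i)
        ⊆ (Top ∩ A).erase k := by
      intro i hi
      obtain ⟨hiA, hi⟩ := Finset.mem_filter.1 hi
      rw [hrad k hk, hrad i hiA] at hi
      have hlt : mean ν k < mean ν i := by linarith [hlo k hk, hhi i hiA]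
      refine Finset.mem_erase.2 ⟨fun e => by rw [e] at hlt; exact hlt.false,
        Finset.mem_inter.2 ⟨?_, hiA⟩⟩
      by_contra hn
      linarith [hTop k hkT, hBad i hn]
    have := Finset.card_le_card hsub
    rw [Finset.card_erase_of_mem hkm] at this
    have := Finset.card_pos.2 ⟨k, hkm⟩
    omega
  · rintro k ⟨hk, hc⟩
    refine ⟨hk, ?_⟩
    by_contra hkT
    have hkm : k ∈ A \ Top := Finset.mem_sdiff.2 ⟨hk, hkT⟩
    have hsub : (A.filter fun i => σ.avg i + σ.radius P i ≤ σ.avg k - σ.radius P k)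
        ⊆ (A \ Top).erase k := by
      intro i hi
      obtain ⟨hiA, hi⟩ := Finset.mem_filter.1 hi
      rw [hrad k hk, hrad i hiA] at hi
      have hlt : mean ν i < mean ν k := by linarith [hlo i hiA, hhi k hk]
      refine Finset.mem_erase.2 ⟨fun e => by rw [e] at hlt; exact hlt.false,
        Finset.mem_sdiff.2 ⟨hiA, ?_⟩⟩
      intro hn
      linarith [hTop i hn, hBad k hkT]
    have := Finset.card_le_card hsub
    rw [Finset.card_erase_of_mem hkm] at this
    have := Finset.card_pos.2 ⟨k, hkm⟩
    omega
  · intro b hb hbT hgap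
    refine ⟨hb, ?_⟩
    rw [Nat.cast_le]
    refine Finset.card_le_card fun g hg => ?_
    obtain ⟨hgT, hg⟩ := Finset.mem_inter.1 hg
    refine Finset.mem_filter.2 ⟨hg, ?_⟩
    rw [hrad b hb, hrad g hg]
    linarith [hlo g hg, hhi b hb, hTop g hgT]
  · intro g hg hgT hgap
    refine ⟨hg, ?_⟩
    have : (A \ Top).card ≤
        (A.filter fun i => σ.avg i + σ.radius P i ≤ σ.avg g - σ.radius P g).card := by
      refine Finset.card_le_card fun b hb => ?_
      obtain ⟨hb, hbT⟩ := Finset.mem_sdiff.1 hb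
      refine Finset.mem_filter.2 ⟨hb, ?_⟩
      rw [hrad b hb, hrad g hg]
      linarith [hlo g hg, hhi b hb, hBad b hbT]
    omega

theorem ExploreEnd.informed {j : Fin M} {σ : State K} (h : ExploreEnd P ω Top p t A j σ)
    (good : Good P ν H ω) (env : Env P ν M Top m) (hp : 1 ≤ p) (hH : t ≤ H) :
    Informed P ν Top m p A { σ with
      Td := σ.act.card * P.T0, decl := ∅, rej := σ.rejected P, acc := σ.accepted P } := by
  have hT0 : (1000 : ℝ) ≤ P.T0 := by exact_mod_cast env.T0_ge
  have hpow : (4 : ℝ) ≤ 2 ^ (p + 1) := by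
    calc (4 : ℝ) = 2 ^ (1 + 1) := by norm_num
      _ ≤ 2 ^ (p + 1) := pow_le_pow_right₀ (by norm_num) (by omega)
  have hN : ∀ i ∈ A, (σ.N i : ℝ) = 2 ^ (p + 1) * P.T0 - 2 * P.T0 := by
    intro i hi
    have := h.count i hi
    have h1 : (σ.N i : ℝ) + 2 * P.T0 = 2 ^ (p + 1) * P.T0 := by exact_mod_cast this
    linarith
  have hN2 : ∀ i ∈ A, 2 * (P.T0 : ℝ) ≤ σ.N i := by
    intro i hi; rw [hN i hi]; nlinarith
  have hrad : ∀ i ∈ A, σ.radius P i = width P p := by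
    intro i hi; unfold State.radius width; rw [hN i hi]
  have hclose : ∀ i ∈ A, |σ.avg i - mean ν i| < width P p := by
    intro i hi
    have hpos : (0 : ℝ) < σ.N i := by linarith [hN2 i hi]
    have hc := good.confidence j i t hH (by rw [← h.N i hi]; exact hpos)
    rw [← h.N i hi, ← h.S i hi] at hc
    have e1 : σ.avg i - mean ν i = (σ.S i - mean ν i * σ.N i) / σ.N i := by
      unfold State.avg; field_simp
    have e2 : width P p = √(2 * σ.N i * Real.log P.T) / σ.N i := by
      unfold width
      rw [← hN i hi, eq_div_iff hpos.ne',
        show 2 * (σ.N i : ℝ) * Real.log P.T = 2 * Real.log P.T / σ.N i * (σ.N i) ^ 2 by field_simp,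
        Real.sqrt_mul (by have := env.log_pos; positivity), Real.sqrt_sq hpos.le]
    rw [e1, e2, abs_div, abs_of_pos hpos]
    exact div_lt_div_of_pos_right hc hpos
  obtain ⟨h1, h2, h3, h4⟩ := informed_of_close env.le_top env.bad_le h.act h.Mp hrad hclose
  refine ⟨h.phase, h.act, h.Mp, ?_, h.count, fun i hi => ?_, fun i hi => ?_, h1, h2, h3, h4⟩
  · simp only [h.act]
  -- From N ≥ 2 T_0 and 2400 log T ≤ μ T_0 follows 40 log T ≤ μ N / 120, which turns 1.06 and 0.95
  -- into 1.07 and 0.94.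
  · have := (good.explored j i t hH).1
    rw [← h.N i hi, ← h.S i hi] at this
    have hl := env.log_le i
    have hm := env.mean_pos i
    have := mul_le_mul_of_nonneg_left (hN2 i hi) hm.le
    simp only
    nlinarith
  · have := (good.explored j i t hH).2
    rw [← h.N i hi, ← h.S i hi] at this
    have hl := env.log_le i
    have hm := env.mean_pos i
    have := mul_le_mul_of_nonneg_left (hN2 i hi) hm.le
    simp only
    nlinarith

/-- The types of blocks of a communication phase in which the arms in `D` have been signaled. -/
def BlockMode (D : Finset (Fin K)) (σ : State K) : Prop :=
  (∃ k ∈ σ.rej \ D, σ.mode = .declare k) ∨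
  (σ.rej ⊆ D ∧ (σ.acc \ D).Nonempty ∧ σ.mode = .occupy (σ.acc \ D) none) ∨
  (σ.rej ⊆ D ∧ σ.acc ⊆ D ∧ σ.mode = .receive)

/-- A player at the start of a block of the communication phase. -/
structure Ready (P : Params K) (ω : Sample K M) (ν : Fin K → Measure ℝ) (Top : Finset (Fin K))
    (m : ℝ) (p t : ℕ) (A D : Finset (Fin K)) (j : Fin M) (σ : State K) : Prop where
  informed : Informed P ν Top m p A σ
  decl : σ.decl = D
  left : σ.left = A.card * P.T0
  s : σ.s = fun _ => 0
  n : σ.n = fun _ => 0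
  pos : σ.pos ∈ A
  S : ∀ i ∈ A, σ.S i = csum (Explored P ω j i) (fun s => (ω s).1 i) t
  N : ∀ i ∈ A, (σ.N i : ℝ) = csum (Explored P ω j i) 1 t
  mode : BlockMode D σ

/-- Start of a block of the communication phase. -/
structure BlockStart (P : Params K) (ω : Sample K M) (ν : Fin K → Measure ℝ)
    (Top : Finset (Fin K)) (m : ℝ) (p t : ℕ) (A D : Finset (Fin K)) (U : Finset (Fin M))
    (seat : Fin M → Fin K) : Prop where
  seated : Seated P ω t Top (A \ D) U seat
  sub : D ⊆ A
  ready : ∀ j ∈ U, Ready P ω ν Top m p t A D j (run P ω t j)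
  inj : ∀ j ∈ U, ∀ j' ∈ U, (run P ω t j).pos = (run P ω t j').pos → j = j'

theorem nextBlock_pos (σ : State K) : (State.nextBlock P σ).pos = σ.pos := by
  unfold State.nextBlock State.startBlock; split_ifs <;> rfl

theorem nextBlock_ready (hpick : ∀ A : Finset (Fin K), A.Nonempty → P.pick A ∈ A) {j : Fin M}
    {σ : State K} (h : Informed P ν Top m p A σ) (hdecl : σ.decl = D) (hpos : σ.pos ∈ A)
    (hS : ∀ i ∈ A, σ.S i = csum (Explored P ω j i) (fun s => (ω s).1 i) t)
    (hN : ∀ i ∈ A, (σ.N i : ℝ) = csum (Explored P ω j i) 1 t) :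
    Ready P ω ν Top m p t A D j (State.nextBlock P σ) := by
  have hTd := h.Td
  unfold State.nextBlock State.startBlock
  rw [hdecl]
  split_ifs with h1 h2
  · exact ⟨h.congr rfl rfl rfl rfl rfl rfl rfl rfl, rfl, hTd, rfl, rfl, hpos, hS, hN,
      Or.inl ⟨_, hpick _ h1, rfl⟩⟩
  · exact ⟨h.congr rfl rfl rfl rfl rfl rfl rfl rfl, rfl, hTd, rfl, rfl, hpos, hS, hN,
      Or.inr (Or.inl ⟨Finset.sdiff_eq_empty_iff_subset.1 (Finset.not_nonempty_iff_eq_empty.1 h1),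
        h2, rfl⟩)⟩
  · exact ⟨h.congr rfl rfl rfl rfl rfl rfl rfl rfl, rfl, hTd, rfl, rfl, hpos, hS, hN,
      Or.inr (Or.inr ⟨Finset.sdiff_eq_empty_iff_subset.1 (Finset.not_nonempty_iff_eq_empty.1 h1),
        Finset.sdiff_eq_empty_iff_subset.1 (Finset.not_nonempty_iff_eq_empty.1 h2), rfl⟩)⟩

/-- After the exploration, the communication phase starts. -/
theorem ExploreStart.blockStart {c : ℕ} (h : ExploreStart P ω Top p t A c U seat)
    (good : Good P ν H ω) (env : Env P ν M Top m) (hp : 1 ≤ p) (hL : 1 ≤ A.card * c)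
    (hH : t + A.card * c ≤ H) :
    BlockStart P ω ν Top m p (t + A.card * c) A ∅ U seat := by
  obtain ⟨⟨τ, hτ, hinj⟩, -⟩ := h.window env hL
  have hrun : ∀ j ∈ U, run P ω (t + A.card * c) j = (τ j).startComm P := by
    intro j hj
    rw [(hτ j hj).1]
    unfold State.finish
    rw [(hτ j hj).2.mode]
  refine ⟨by rw [Finset.sdiff_empty]; exact h.seated.add _, Finset.empty_subset _,
    fun j hj => ?_, fun j hj j' hj' hjj => ?_⟩
  · have e := (hτ j hj).2
    rw [hrun j hj]
    exact nextBlock_ready env.pick (e.informed good env hp hH) rfl e.pos e.S e.N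
  · rw [hrun j hj, hrun j' hj'] at hjj
    unfold State.startComm at hjj
    rw [nextBlock_pos, nextBlock_pos] at hjj
    exact hinj j hj j' hj' hjj

/-- From round `t₀` on, player `j` pulls arm `i`. -/
def Pulled (P : Params K) (ω : Sample K M) (j : Fin M) (i : Fin K) (t₀ s : ℕ) : Prop :=
  t₀ ≤ s ∧ pull P ω s j = i

/-- Memories after `s` steps of a block that started in round `t`. -/
structure InBlock (P : Params K) (ω : Sample K M) (t : ℕ) (A D : Finset (Fin K))
    (U : Finset (Fin M)) (s : ℕ) (σ : Fin M → State K) : Prop where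
  kept : ∀ j ∈ U, Kept (run P ω t j) (σ j) ∧ (σ j).S = (run P ω t j).S ∧
    (σ j).N = (run P ω t j).N
  cases : ∀ j ∈ U, ((σ j).mode = (run P ω t j).mode ∧ (σ j).pos = hop A s (run P ω t j).pos ∧
      ∀ i, (σ j).s i = csum (Hit P ω j i t) (fun r => (ω r).1 i) (t + s) ∧
        ((σ j).n i : ℝ) = csum (Pulled P ω j i t) 1 (t + s)) ∨
    ((run P ω t j).mode = .occupy ((run P ω t j).acc \ D) none ∧
      ∃ k ∈ (run P ω t j).acc \ D, (σ j).mode = .occupy ((run P ω t j).acc \ D) (some k))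
  distinct : ∀ j ∈ U, ∀ j' ∈ U, ∀ B B' k, (σ j).mode = .occupy B (some k) →
    (σ j').mode = .occupy B' (some k) → j = j'
  hist : ∀ j ∈ U, ∀ r < s, ∀ B k, (run P ω (t + r) j).mode = .occupy B (some k) →
    (σ j).mode = .occupy B (some k)
  unrewarded : ∀ j ∈ U, ∀ B, (σ j).mode = .occupy B none →
    ∀ r < s, pull P ω (t + r) j ∈ B → reward P ω (t + r) j ≤ 0

theorem hit_count {j : Fin M} {s : ℕ} {f : Fin K → ℝ}
    (hf : ∀ i, f i = csum (Hit P ω j i t) (fun r => (ω r).1 i) (t + s)) (i : Fin K) :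
    Function.update f (pull P ω (t + s) j) (f (pull P ω (t + s) j) + reward P ω (t + s) j) i
      = csum (Hit P ω j i t) (fun r => (ω r).1 i) (t + (s + 1)) := by
  classical
  have hH : Hit P ω j i t (t + s) ↔ pull P ω (t + s) j = i ∧ NoColl (pull P ω (t + s)) j :=
    and_iff_right (Nat.le_add_right _ _)
  rw [← add_assoc, csum_succ, ← hf]
  by_cases hi : pull P ω (t + s) j = i
  · rw [hi, Function.update_self, reward_eq, hi]
    simp only [hH, hi, true_and]
  · rw [Function.update_of_ne (Ne.symm hi), if_neg fun h => hi (hH.1 h).1, add_zero]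

theorem pulled_count {j : Fin M} {s : ℕ} {f : Fin K → ℕ}
    (hf : ∀ i, (f i : ℝ) = csum (Pulled P ω j i t) 1 (t + s)) (i : Fin K) :
    ((Function.update f (pull P ω (t + s) j) (f (pull P ω (t + s) j) + 1) i : ℕ) : ℝ)
      = csum (Pulled P ω j i t) 1 (t + (s + 1)) := by
  classical
  have hH : Pulled P ω j i t (t + s) ↔ pull P ω (t + s) j = i :=
    and_iff_right (Nat.le_add_right _ _)
  rw [← add_assoc, csum_succ, ← hf]
  by_cases hi : pull P ω (t + s) j = i
  · rw [hi, Function.update_self, if_pos (hH.2 hi)]; simp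
  · rw [Function.update_of_ne (Ne.symm hi), if_neg fun h => hi (hH.1 h), add_zero]

theorem BlockMode.ne_occupy_some {σ : State K} (h : BlockMode D σ) (B : Finset (Fin K)) (k : Fin K) :
    σ.mode ≠ .occupy B (some k) := by
  rcases h with ⟨k', -, h⟩ | ⟨-, -, h⟩ | ⟨-, -, h⟩ <;> rw [h] <;> simp

/-- The invariant records for each player either the block statistics or the arm it settled on.
Settling takes a positive reward, which excludes collisions, so players settle on different arms;
and settling is never undone. -/
theorem BlockStart.window (h : BlockStart P ω ν Top m p t A D U seat)
    (hL : 1 ≤ A.card * P.T0) :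
    (∀ s < A.card * P.T0, InBlock P ω t A D U s (run P ω (t + s))) ∧
    ∃ τ : Fin M → State K, InBlock P ω t A D U (A.card * P.T0) τ ∧
      ∀ j ∈ U, run P ω (t + A.card * P.T0) j = (τ j).finish P := by
  refine loop_sync (P := P) (ω := ω) hL (fun j hj => (h.ready j hj).left)
    (fun j hj => ⟨_, h.seated.exploit j hj⟩) (InBlock P ω t A D U) ?_ ?_
  · refine ⟨fun j hj => ⟨Kept.refl _, rfl, rfl⟩, fun j hj => Or.inl ⟨rfl, rfl, fun i => ?_⟩, ?_,
      fun j hj r hr => absurd hr (Nat.not_lt_zero r), fun j hj B hB r hr =>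
        absurd hr (Nat.not_lt_zero r)⟩
    · rw [(h.ready j hj).s, (h.ready j hj).n, csum_eq_zero _ fun s hs hh => ?_,
        csum_eq_zero _ fun s hs hh => ?_]
      · simp
      · exact absurd hh.1 (by omega)
      · exact absurd hh.1 (by omega)
    · intro j hj j' hj' B B' k hk
      exact absurd hk ((h.ready j hj).mode.ne_occupy_some B k)
  · intro s hs hJ l
    have hfixed : ∀ j B k, (run P ω (t + s) j).mode = .occupy B (some k) →
        observed P ω (t + s) (l j) j = { run P ω (t + s) j with left := l j } := by
      intro j B k hj; unfold observed State.observe; rw [hj]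
    have hnew : ∀ j ∈ U, ∀ B k, (observed P ω (t + s) (l j) j).mode = .occupy B (some k) →
        (run P ω (t + s) j).mode = .occupy B (some k) ∨
        (0 < reward P ω (t + s) j ∧ pull P ω (t + s) j = k) := by
      intro j hj B k hk
      rcases hJ.cases j hj with ⟨h1, -⟩ | ⟨-, k', -, h1⟩
      · rcases (h.ready j hj).mode with ⟨k', -, h2⟩ | ⟨-, -, h2⟩ | ⟨-, -, h2⟩ <;> rw [h2] at h1 <;>
          unfold observed State.observe at hk <;> rw [h1] at hk <;>
          simp only [State.countBlock, h1, Mode.occupy.injEq, reduceCtorEq] at hk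
        obtain ⟨-, hk⟩ := hk
        split_ifs at hk with h3
        exact Or.inr ⟨h3.2, Option.some.inj hk⟩
      · rw [hfixed j _ _ h1] at hk
        exact Or.inl hk
    have hpull : ∀ j B k, (run P ω (t + s) j).mode = .occupy B (some k) →
        pull P ω (t + s) j = k := by
      intro j B k hj; simp only [pull, arms, State.arm, hj]
    refine ⟨fun j hj => ⟨(hJ.kept j hj).1.observe _ _ _, ?_⟩, fun j hj => ?_, ?_, ?_, ?_⟩
    · obtain ⟨-, g1, g2⟩ := hJ.kept j hj
      unfold observed State.observe
      rcases hJ.cases j hj with ⟨h1, -⟩ | ⟨-, k', -, h1⟩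
      · rcases (h.ready j hj).mode with ⟨k', -, h2⟩ | ⟨-, -, h2⟩ | ⟨-, -, h2⟩ <;> rw [h2] at h1 <;>
          rw [h1] <;> exact ⟨g1, g2⟩
      · rw [h1]; exact ⟨g1, g2⟩
    · rcases hJ.cases j hj with ⟨h1, h3, h4⟩ | ⟨h0, k', hk', h1⟩
      · have hact := (hJ.kept j hj).1.act.trans (h.ready j hj).informed.act
        have hs := hit_count (P := P) (ω := ω) (t := t) (s := s) fun i => (h4 i).1
        have hn := pulled_count (P := P) (ω := ω) (t := t) (s := s) fun i => (h4 i).2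
        have hpos : succArm (run P ω (t + s) j).act (run P ω (t + s) j).pos
            = hop A (s + 1) (run P ω t j).pos := by rw [hact, h3, hop_succ]
        rcases (h.ready j hj).mode with ⟨k', -, h2⟩ | ⟨-, -, h2⟩ | ⟨-, -, h2⟩
        · left
          have h5 := h1.trans h2
          unfold observed State.observe; rw [h5]
          exact ⟨h1, hpos, fun i => ⟨hs i, hn i⟩⟩
        · have h5 := h1.trans h2
          by_cases hc : pull P ω (t + s) j ∈ (run P ω t j).acc \ D ∧ 0 < reward P ω (t + s) j
          · right
            refine ⟨h2, _, hc.1, ?_⟩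
            unfold observed State.observe; rw [h5]
            simp only [if_pos hc]
          · left
            unfold observed State.observe; rw [h5]
            simp only [if_neg hc]
            exact ⟨h2.symm, hpos, fun i => ⟨hs i, hn i⟩⟩
        · left
          have h5 := h1.trans h2
          unfold observed State.observe; rw [h5]
          exact ⟨h1, hpos, fun i => ⟨hs i, hn i⟩⟩
      · right
        refine ⟨h0, k', hk', ?_⟩
        rw [hfixed j _ _ h1]; exact h1
    · intro j hj j' hj' B B' k hk hk'
      rcases hnew j hj B k hk with g | ⟨g1, g2⟩
      · rcases hnew j' hj' B' k hk' with g' | ⟨g1', g2'⟩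
        · exact hJ.distinct j hj j' hj' B B' k g g'
        · exact noColl_of_reward_pos g1' j ((hpull j B k g).trans g2'.symm)
      · rcases hnew j' hj' B' k hk' with g' | ⟨g1', g2'⟩
        · exact (noColl_of_reward_pos g1 j' ((hpull j' B' k g').trans g2.symm)).symm
        · exact (noColl_of_reward_pos g1 j' (g2'.trans g2.symm)).symm
    · intro j hj r hr B k hk
      have h1 : (run P ω (t + s) j).mode = .occupy B (some k) := by
        rcases Nat.lt_succ_iff_lt_or_eq.1 hr with h6 | h6
        · exact hJ.hist j hj r h6 B k hk
        · rw [← h6]; exact hk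
      rw [hfixed j _ _ h1]; exact h1
    · intro j hj B hB r hr hpB
      have h1 : (run P ω (t + s) j).mode = .occupy B none ∧
          ¬ (pull P ω (t + s) j ∈ B ∧ 0 < reward P ω (t + s) j) := by
        rcases hJ.cases j hj with ⟨h1, -⟩ | ⟨-, k', -, h1⟩
        · rcases (h.ready j hj).mode with ⟨k', -, h2⟩ | ⟨-, -, h2⟩ | ⟨-, -, h2⟩ <;>
            rw [h2] at h1 <;> beta_reduce at hB <;>
            unfold observed State.observe at hB <;> rw [h1] at hB <;>
            simp only [State.countBlock, h1, Mode.occupy.injEq, reduceCtorEq] at hB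
          obtain ⟨rfl, hB⟩ := hB
          split_ifs at hB with h3
          exact ⟨h1, h3⟩
        · beta_reduce at hB
          rw [hfixed j _ _ h1] at hB
          simp [h1] at hB
      rcases Nat.lt_succ_iff_lt_or_eq.1 hr with h6 | h6
      · exact hJ.unrewarded j hj B h1.1 r h6 hpB
      · rw [h6] at hpB ⊢
        by_contra hpos
        exact h1.2 ⟨hpB, not_le.1 hpos⟩

end Communication


/-! ### What the players observe in one communication block. -/

section Blocks

variable {K M : ℕ} {P : Params K} {ω : Sample K M} {ν : Fin K → Measure ℝ} {H : ℕ}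
  {Top : Finset (Fin K)} {m : ℝ}

theorem card_le_csum {C q : ℕ → Prop} [DecidablePred q] {t L : ℕ}
    (h : ∀ s < L, q s → C (t + s)) : (((Finset.range L).filter q).card : ℝ) ≤ csum C 1 (t + L) := by
  classical
  rw [csum_one_eq, Nat.cast_le]
  refine Finset.card_le_card_of_injOn (fun s => t + s) (fun s hs => ?_)
    fun s _ s' _ e => Nat.add_left_cancel e
  simp only [Finset.coe_filter, Finset.mem_range, Set.mem_ofPred_eq] at hs ⊢
  exact ⟨by omega, h s hs.1 hs.2⟩

theorem csum_le_card {C q : ℕ → Prop} [DecidablePred q] {t L : ℕ} (h0 : ∀ s < t, ¬ C s)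
    (h : ∀ s < L, C (t + s) → q s) : csum C 1 (t + L) ≤ (((Finset.range L).filter q).card : ℝ) := by
  classical
  rw [csum_one_eq, Nat.cast_le]
  refine Finset.card_le_card_of_injOn (fun s => s - t) (fun s hs => ?_) fun s hs s' hs' e => ?_
  · simp only [Finset.coe_filter, Finset.mem_range, Set.mem_ofPred_eq] at hs ⊢
    have hts : t ≤ s := by by_contra hn; exact h0 s (by omega) hs.2
    refine ⟨by omega, h (s - t) (by omega) ?_⟩
    rw [Nat.add_sub_cancel' hts]; exact hs.2
  · simp only [Finset.coe_filter, Finset.mem_range, Set.mem_ofPred_eq] at hs hs'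
    have h1 : t ≤ s := by by_contra hn; exact h0 s (by omega) hs.2
    have h2 : t ≤ s' := by by_contra hn; exact h0 s' (by omega) hs'.2
    simp only at e
    omega

/-- The disturbed case: the old average is at least 0.94 μ, and three quarters of it, 0.705 μ,
exceed the block average 0.7 μ. -/
theorem quarter_le_abs {S s μ N n : ℝ} (hN : 0 < N) (hn : 0 < n) (hμ : 0 < μ)
    (hS : 0.94 * μ * N ≤ S) (hs : s ≤ 0.7 * μ * n) : S / (4 * N) ≤ |S / N - s / n| := by
  have h1 : 0.94 * μ ≤ S / N := by rw [le_div_iff₀ hN]; exact hS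
  have h2 : s / n ≤ 0.7 * μ := by rw [div_le_iff₀ hn]; exact hs
  have h3 : S / (4 * N) = S / N / 4 := by rw [mul_comm, div_mul_eq_div_div]
  rw [h3]
  refine le_trans ?_ (le_abs_self _)
  linarith

/-- The undisturbed case: 0.75 · 1.07 < 0.91 and 1.25 · 0.94 > 1.1. -/
theorem abs_lt_quarter {S s μ N n : ℝ} (hN : 0 < N) (hn : 0 < n) (hμ : 0 < μ)
    (hS : 0.94 * μ * N ≤ S) (hS' : S ≤ 1.07 * μ * N) (hs : 0.91 * μ * n ≤ s)
    (hs' : s ≤ 1.1 * μ * n) : |S / N - s / n| < S / (4 * N) := by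
  have h1 : 0.94 * μ ≤ S / N := by rw [le_div_iff₀ hN]; exact hS
  have h2 : s / n ≤ 1.1 * μ := by rw [div_le_iff₀ hn]; exact hs'
  have h4 : S / N ≤ 1.07 * μ := by rw [div_le_iff₀ hN]; exact hS'
  have h5 : 0.91 * μ ≤ s / n := by rw [le_div_iff₀ hn]; exact hs
  have h3 : S / (4 * N) = S / N / 4 := by rw [mul_comm, div_mul_eq_div_div]
  rw [h3, abs_lt]
  constructor <;> linarith

variable {A D : Finset (Fin K)} {U : Finset (Fin M)} {seat : Fin M → Fin K} {p t : ℕ}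

section Window

variable {s : ℕ} {σ : Fin M → State K}

theorem BlockStart.pull_hop (h : BlockStart P ω ν Top m p t A D U seat)
    (I : InBlock P ω t A D U s (run P ω (t + s))) {j : Fin M} (hj : j ∈ U)
    (hm : (run P ω (t + s) j).mode = (run P ω t j).mode)
    (hd : ∀ k, (run P ω t j).mode = .declare k → (1 / 2 : ℝ) ≤ (ω (t + s)).2 j) :
    pull P ω (t + s) j = hop A s (run P ω t j).pos := by
  have hpos : (run P ω (t + s) j).pos = hop A s (run P ω t j).pos := by
    rcases I.cases j hj with ⟨-, h1, -⟩ | ⟨h0, k, -, h1⟩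
    · exact h1
    · rw [hm, h0] at h1; simp at h1
  rcases (h.ready j hj).mode with ⟨k, -, h2⟩ | ⟨-, -, h2⟩ | ⟨-, -, h2⟩
  · have := hd k h2
    simp only [pull, arms, State.arm, hm, h2, hpos]
    rw [if_neg (not_lt.2 this)]
  · simp only [pull, arms, State.arm, hm, h2, hpos]
  · simp only [pull, arms, State.arm, hm, h2, hpos]

theorem BlockStart.pull_declare {k : Fin K} {j : Fin M}
    (hm : (run P ω (t + s) j).mode = .declare k) (hu : ¬ (1 / 2 : ℝ) ≤ (ω (t + s)).2 j) :
    pull P ω (t + s) j = k := by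
  simp only [pull, arms, State.arm, hm]
  rw [if_pos (not_le.1 hu)]

theorem BlockStart.pull_eq_or (h : BlockStart P ω ν Top m p t A D U seat)
    (I : InBlock P ω t A D U s (run P ω (t + s))) {j : Fin M} (hj : j ∈ U)
    (hm : (run P ω (t + s) j).mode = (run P ω t j).mode) :
    pull P ω (t + s) j = hop A s (run P ω t j).pos ∨
      (run P ω t j).mode = .declare (pull P ω (t + s) j) := by
  by_cases hd : ∀ k, (run P ω t j).mode = .declare k → (1 / 2 : ℝ) ≤ (ω (t + s)).2 j
  · exact Or.inl (h.pull_hop I hj hm hd)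
  · push Not at hd
    obtain ⟨k, hk, hu⟩ := hd
    right
    rw [pull_declare (k := k) (hm.trans hk) (not_le.2 hu), hk]

/-- No collision on an arm that nobody else occupies or declares. -/
theorem BlockStart.noColl (h : BlockStart P ω ν Top m p t A D U seat)
    (I : InBlock P ω t A D U s (run P ω (t + s))) {j : Fin M} (hj : j ∈ U)
    (hm : (run P ω (t + s) j).mode = (run P ω t j).mode) {i : Fin K}
    (hi : pull P ω (t + s) j = i) (hseat : ∀ j', j' ∉ U → seat j' ≠ i)
    (hfix : ∀ j' ∈ U, ∀ B, (run P ω (t + s) j').mode ≠ .occupy B (some i))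
    (hdecl : ∀ j' ∈ U, (run P ω t j').mode ≠ .declare i) : NoColl (pull P ω (t + s)) j := by
  intro j' hj'
  rw [hi] at hj'
  by_cases hU : j' ∈ U
  · rcases I.cases j' hU with ⟨h1, -⟩ | ⟨-, k, -, h1⟩
    · have e : ∀ j ∈ U, (run P ω (t + s) j).mode = (run P ω t j).mode → pull P ω (t + s) j = i →
          hop A s (run P ω t j).pos = i := by
        intro j hj hm hi
        rcases h.pull_eq_or I hj hm with g | g
        · rw [← g, hi]
        · rw [hi] at g; exact absurd g (hdecl j hj)
      have e1 := e j hj hm hi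
      have e2 := e j' hU h1 hj'
      exact h.inj j' hU j hj (hop_inj (h.ready j' hU).pos (h.ready j hj).pos s (e2.trans e1.symm))
    · have : pull P ω (t + s) j' = k := by simp only [pull, arms, State.arm, h1]
      rw [hj'] at this
      rw [← this] at h1
      exact absurd h1 (hfix j' hU _)
  · rw [(h.seated.add s).pull_eq hU] at hj'
    exact absurd hj' (hseat j' hU)

/-- Since settling is permanent, a player unsettled at step `s` was unsettled at every earlier step
of the block. -/
theorem InBlock.mode_eq (h : BlockStart P ω ν Top m p t A D U seat)
    (I : InBlock P ω t A D U s σ) {r : ℕ} (hr : r < s)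
    (Ir : InBlock P ω t A D U r (run P ω (t + r))) {j : Fin M} (hj : j ∈ U)
    (hm : (σ j).mode = (run P ω t j).mode) : (run P ω (t + r) j).mode = (run P ω t j).mode := by
  rcases Ir.cases j hj with ⟨h1, -⟩ | ⟨-, k, -, h1⟩
  · exact h1
  · have := I.hist j hj r hr _ _ h1
    rw [hm] at this
    exact absurd this ((h.ready j hj).mode.ne_occupy_some _ _)

theorem InBlock.not_fixed (I : InBlock P ω t A D U s σ) {i : Fin K}
    (hfix : ∀ j ∈ U, ∀ B, (σ j).mode ≠ .occupy B (some i)) {r : ℕ} (hr : r < s) :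
    ∀ j ∈ U, ∀ B, (run P ω (t + r) j).mode ≠ .occupy B (some i) :=
  fun j hj B hB => hfix j hj B (I.hist j hj r hr _ _ hB)

theorem BlockStart.declare_mem (h : BlockStart P ω ν Top m p t A D U seat) {j : Fin M} (hj : j ∈ U)
    {k : Fin K} (hk : (run P ω t j).mode = .declare k) : k ∈ (run P ω t j).rej \ D := by
  rcases (h.ready j hj).mode with ⟨k', h1, h2⟩ | ⟨-, -, h2⟩ | ⟨-, -, h2⟩
  · rw [h2] at hk
    simp only [Mode.declare.injEq] at hk
    exact hk ▸ h1
  · simp [h2] at hk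
  · simp [h2] at hk

theorem BlockStart.seat_ne (h : BlockStart P ω ν Top m p t A D U seat) {k : Fin K} (hk : k ∈ A \ D)
    (j : Fin M) (hj : j ∉ U) : seat j ≠ k :=
  fun e => h.seated.seat_notMem j hj (e ▸ hk)

theorem BlockStart.acc_mem (h : BlockStart P ω ν Top m p t A D U seat) {j : Fin M} (hj : j ∈ U)
    {k : Fin K} (hk : k ∈ (run P ω t j).acc \ D) : k ∈ A \ D ∧ k ∈ Top := by
  rw [Finset.mem_sdiff] at hk ⊢
  have := (h.ready j hj).informed.acc k hk.1
  exact ⟨⟨this.1, hk.2⟩, this.2⟩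

theorem BlockStart.declare_ne (h : BlockStart P ω ν Top m p t A D U seat) {k : Fin K}
    (hk : k ∈ Top) (j : Fin M) (hj : j ∈ U) : (run P ω t j).mode ≠ .declare k :=
  fun hd => ((h.ready j hj).informed.rej k (Finset.mem_sdiff.1 (h.declare_mem hj hd)).1).2 hk

/-- After a tenth of the block, the arms that somebody still wants to occupy are occupied. -/
theorem BlockStart.exists_fixed (h : BlockStart P ω ν Top m p t A D U seat)
    (good : Good P ν H ω) (env : Env P ν M Top m) (hs : A.card * (P.T0 / 10) ≤ s)
    (hH : t + s ≤ H) (I : InBlock P ω t A D U s σ)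
    (hI : ∀ r < s, InBlock P ω t A D U r (run P ω (t + r))) {j : Fin M} (hj : j ∈ U)
    {B : Finset (Fin K)} (hm0 : (run P ω t j).mode = .occupy B none)
    (hm : (σ j).mode = (run P ω t j).mode) {k : Fin K} (hkB : k ∈ B)
    (hk : k ∈ (run P ω t j).acc \ D) :
    ∃ j' ∈ U, ∃ B', (σ j').mode = .occupy B' (some k) := by
  by_contra hno
  push Not at hno
  obtain ⟨hkA, hkT⟩ := h.acc_mem hj hk
  -- As long as nobody sits on `k`, every visit is a hit: `k` is no seat, and being in `Top` it is
  -- declared by nobody.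
  have hhit : ∀ r < s, pull P ω (t + r) j = k → NoColl (pull P ω (t + r)) j := by
    intro r hr hp
    exact h.noColl (hI r hr) hj (I.mode_eq h hr (hI r hr) hj hm) hp (h.seat_ne hkA)
      (I.not_fixed hno hr) (h.declare_ne hkT)
  have hzero : csum (Hit P ω j k t) (fun r => (ω r).1 k) (t + s) ≤ 0 := by
    unfold csum
    refine Finset.sum_nonpos fun r hr => ?_
    rw [Finset.mem_range] at hr
    split_ifs with hh
    · obtain ⟨h1, h2, h3⟩ := hh
      have h4 := I.unrewarded j hj B (hm.trans hm0) (r - t) (by omega)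
      rw [Nat.add_sub_cancel' h1, reward_eq, if_pos h3, h2] at h4
      exact h4 hkB
    · exact le_rfl
  have hcount : ((P.T0 / 10 : ℕ) : ℝ) ≤ csum (Hit P ω j k t) 1 (t + s) := by
    rw [← card_visits (h.ready j hj).pos (Finset.mem_sdiff.1 hkA).1 (P.T0 / 10)]
    refine le_trans ?_ (card_le_csum (q := fun r => hop A r (run P ω t j).pos = k) ?_)
    · rw [Nat.cast_le]
      exact Finset.card_le_card (Finset.filter_subset_filter _
        (Finset.range_subset_range.2 hs))
    · intro r hr hq
      have hp := h.pull_hop (hI r hr) hj (I.mode_eq h hr (hI r hr) hj hm)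
        (fun k hk => by rw [hm0] at hk; simp at hk)
      rw [hq] at hp
      exact ⟨Nat.le_add_right _ _, hp, hhit r hr hp⟩
  have hg := (good.hit j k t (t + s) (by omega) hH).2
  have hl := env.log_le k
  have hμ := env.mean_pos k
  have hT0 := env.T0_ge
  -- Replacing the rounded T_0/10 by T_0/11 is harmless as T_0 ≥ 1000, and 0.95 · 2400/11 exceeds
  -- 40, so the visits must have produced a positive reward.
  have hdiv : (P.T0 : ℝ) ≤ 11 * ((P.T0 / 10 : ℕ) : ℝ) := by
    have : P.T0 ≤ 11 * (P.T0 / 10) := by omega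
    exact_mod_cast this
  have h1 := mul_le_mul_of_nonneg_left hcount hμ.le
  have h2 := mul_le_mul_of_nonneg_left hdiv hμ.le
  have h3 : (0 : ℝ) < P.T0 := by have : 0 < P.T0 := by omega
                                 exact_mod_cast this
  nlinarith [mul_pos hμ h3]

end Window

section BlockEnd

variable {τ : Fin M → State K}

/-- Every arm is pulled often in a block. -/
theorem BlockStart.le_count (h : BlockStart P ω ν Top m p t A D U seat)
    (good : Good P ν H ω) (env : Env P ν M Top m) (hH : t + A.card * P.T0 ≤ H)
    (hI : ∀ r < A.card * P.T0, InBlock P ω t A D U r (run P ω (t + r)))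
    (I : InBlock P ω t A D U (A.card * P.T0) τ) {j : Fin M} (hj : j ∈ U)
    (hm : (τ j).mode = (run P ω t j).mode) {i : Fin K} (hi : i ∈ A) :
    0.45 * (P.T0 : ℝ) ≤ csum (Pulled P ω j i t) 1 (t + A.card * P.T0) := by
  have hmr : ∀ r < A.card * P.T0, (run P ω (t + r) j).mode = (run P ω t j).mode :=
    fun r hr => I.mode_eq h hr (hI r hr) hj hm
  have hvis := card_visits (h.ready j hj).pos hi P.T0
  have hT0 : (0 : ℝ) ≤ P.T0 := Nat.cast_nonneg _
  by_cases hd : ∃ k, (run P ω t j).mode = .declare k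
  · obtain ⟨k, hk⟩ := hd
    -- In a declaration block π hops at every step, so it passes each arm T_0 times, and the coin
    -- turns at least 0.47 T_0 - 40 log T of these visits into pulls. Since log T ≤ T_0/2400, this
    -- is at least 0.45 T_0.
    have h1 : (P.T0 : ℝ) ≤ csum (Visiting P ω j i t) 1 (t + A.card * P.T0) := by
      conv_lhs => rw [← hvis]
      refine card_le_csum fun s hs hq => ⟨Nat.le_add_right _ _, ⟨k, (hmr s hs).trans hk⟩, ?_⟩
      rcases (hI s hs).cases j hj with ⟨-, g, -⟩ | ⟨g, -⟩
      · rw [g, hq]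
      · rw [hk] at g; simp at g
    have h2 : csum (fun s => Visiting P ω j i t s ∧ (1 / 2 : ℝ) ≤ (ω s).2 j) 1 (t + A.card * P.T0)
        ≤ csum (Pulled P ω j i t) 1 (t + A.card * P.T0) := by
      refine csum_mono_of_imp fun s hs hv => ⟨hv.1.1, ?_⟩
      obtain ⟨⟨g1, ⟨k', g2⟩, g3⟩, g4⟩ := hv
      simp only [pull, arms, State.arm, g2]
      rw [if_neg (not_lt.2 g4), g3]
    have h3 := good.visiting j i t (t + A.card * P.T0) (by omega) hH
    have hl := env.log_le i
    have hm1 := mul_le_mul_of_nonneg_right (env.mean_le i) hT0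
    nlinarith
  · push Not at hd
    have : (P.T0 : ℝ) ≤ csum (Pulled P ω j i t) 1 (t + A.card * P.T0) := by
      conv_lhs => rw [← hvis]
      refine card_le_csum fun s hs hq => ⟨Nat.le_add_right _ _, ?_⟩
      rw [h.pull_hop (hI s hs) hj (hmr s hs) fun k hk => absurd hk (hd k), hq]
    linarith

theorem Informed.count_pos {σ : State K} (h : Informed P ν Top m p A σ) (env : Env P ν M Top m)
    (hp : 1 ≤ p) {i : Fin K} (hi : i ∈ A) : (0 : ℝ) < σ.N i := by
  have h1 := h.count i hi
  have h2 := env.T0_ge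
  have h3 : 2 ^ (1 + 1) ≤ 2 ^ (p + 1) := Nat.pow_le_pow_right (by norm_num) (by omega)
  have h4 := Nat.mul_le_mul_right P.T0 h3
  have : 0 < σ.N i := by omega
  exact_mod_cast this

/-- Statistics of a player that is not fixed at the end of a block. -/
theorem BlockStart.stats (h : BlockStart P ω ν Top m p t A D U seat)
    (good : Good P ν H ω) (env : Env P ν M Top m) (hH : t + A.card * P.T0 ≤ H)
    (hI : ∀ r < A.card * P.T0, InBlock P ω t A D U r (run P ω (t + r)))
    (I : InBlock P ω t A D U (A.card * P.T0) τ) {j : Fin M} (hj : j ∈ U)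
    (hm : (τ j).mode = (run P ω t j).mode) (i : Fin K) (hi : i ∈ A) :
    (τ j).act = A ∧ (τ j).s i = csum (Hit P ω j i t) (fun r => (ω r).1 i) (t + A.card * P.T0) ∧
      ((τ j).n i : ℝ) = csum (Pulled P ω j i t) 1 (t + A.card * P.T0) ∧
      40 * Real.log P.T ≤ mean ν i * (τ j).n i / 27 ∧ (0 : ℝ) < (τ j).n i := by
  have hn : (τ j).act = A ∧
      (τ j).s i = csum (Hit P ω j i t) (fun r => (ω r).1 i) (t + A.card * P.T0) ∧
      ((τ j).n i : ℝ) = csum (Pulled P ω j i t) 1 (t + A.card * P.T0) := by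
    refine ⟨(I.kept j hj).1.act.trans (h.ready j hj).informed.act, ?_⟩
    rcases I.cases j hj with ⟨-, -, g⟩ | ⟨g0, k, -, g⟩
    · exact g i
    · rw [hm, g0] at g; simp at g
  have h1 := h.le_count good env hH hI I hj hm hi
  rw [← hn.2.2] at h1
  have hl := env.log_le i
  have hμ := env.mean_pos i
  have hT0 : (0 : ℝ) < P.T0 := by
    have := env.T0_ge
    have : 0 < P.T0 := by omega
    exact_mod_cast this
  have h2 := mul_le_mul_of_nonneg_left h1 hμ.le
  refine ⟨hn.1, hn.2.1, hn.2.2, ?_, by linarith⟩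
  -- Here 0.45 · 2400 = 27 · 40.
  nlinarith

/-- An arm on which a player settled during the block is signaled. -/
theorem BlockStart.signaled_of_fixed (h : BlockStart P ω ν Top m p t A D U seat) (hp : 1 ≤ p)
    (good : Good P ν H ω) (env : Env P ν M Top m) (hH : t + A.card * P.T0 ≤ H)
    (hI : ∀ r < A.card * P.T0, InBlock P ω t A D U r (run P ω (t + r)))
    (I : InBlock P ω t A D U (A.card * P.T0) τ) {j : Fin M} (hj : j ∈ U)
    (hm : (τ j).mode = (run P ω t j).mode) {k : Fin K} {j' : Fin M} {B : Finset (Fin K)}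
    (hj' : j' ∈ U) (hfix : (τ j').mode = .occupy B (some k)) : k ∈ (τ j).signaled := by
  obtain ⟨hm', hk⟩ : (run P ω t j').mode = .occupy ((run P ω t j').acc \ D) none ∧
      k ∈ (run P ω t j').acc \ D := by
    rcases I.cases j' hj' with ⟨g, -⟩ | ⟨g0, k', hk', g⟩
    · rw [hfix] at g; exact absurd g.symm ((h.ready j' hj').mode.ne_occupy_some _ _)
    · rw [hfix] at g
      simp only [Mode.occupy.injEq, Option.some.injEq] at g
      exact ⟨g0, g.2 ▸ hk'⟩
  obtain ⟨hkA, hkT⟩ := h.acc_mem hj' hk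
  have hkA' := (Finset.mem_sdiff.1 hkA).1
  have hT0 := env.T0_ge
  have hle : A.card * (P.T0 / 10) ≤ A.card * P.T0 := Nat.mul_le_mul_left _ (by omega)
  -- After a tenth of the block somebody sits on `k`: either `j'` already, or, while `j'` still
  -- wants `k`, another player by `BlockStart.exists_fixed`.
  have hocc : ∀ r, A.card * (P.T0 / 10) ≤ r → r < A.card * P.T0 →
      ∃ j'' ∈ U, ∃ B', (run P ω (t + r) j'').mode = .occupy B' (some k) := by
    intro r hr1 hr2
    rcases (hI r hr2).cases j' hj' with ⟨g, -⟩ | ⟨g0, k', hk', g⟩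
    · exact h.exists_fixed good env hr1 (by omega) (hI r hr2) (fun r' hr' => hI r' (by omega)) hj'
        hm' g hk hk
    · have := I.hist j' hj' r hr2 _ _ g
      rw [hfix] at this
      simp only [Mode.occupy.injEq, Option.some.injEq] at this
      rw [← this.2] at g
      exact ⟨j', hj', _, g⟩
  have hcount : csum (Hit P ω j k t) 1 (t + A.card * P.T0) ≤ ((P.T0 / 10 : ℕ) : ℝ) := by
    have e1 : csum (Hit P ω j k t) 1 (t + A.card * P.T0)
        = csum (Hit P ω j k t) 1 (t + A.card * (P.T0 / 10)) := by
      have := csum_add_of_not 1 (C := Hit P ω j k t) (t := t + A.card * (P.T0 / 10))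
        (L := A.card * P.T0 - A.card * (P.T0 / 10)) ?_
      · rwa [add_assoc, Nat.add_sub_cancel' hle] at this
      · rintro s hs ⟨-, h2, h3⟩
        rw [add_assoc] at h2 h3
        obtain ⟨j'', hj'', B', hB'⟩ := hocc (A.card * (P.T0 / 10) + s) (by omega) (by omega)
        have hp'' : pull P ω (t + (A.card * (P.T0 / 10) + s)) j'' = k := by
          simp only [pull, arms, State.arm, hB']
        have := h3 j'' (hp''.trans h2.symm)
        rw [this] at hB'
        rw [I.mode_eq h (by omega) (hI _ (by omega)) hj hm] at hB'
        exact (h.ready j hj).mode.ne_occupy_some _ _ hB'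
    rw [e1]
    refine (csum_le_card (q := fun s => hop A s (run P ω t j).pos = k)
      (fun s hs hh => absurd hh.1 (by omega)) fun s hs hh => ?_).trans
      (Nat.cast_le.2 (card_visits (h.ready j hj).pos hkA' (P.T0 / 10)).le)
    have hs' : s < A.card * P.T0 := by omega
    rcases h.pull_eq_or (hI s hs') hj (I.mode_eq h hs' (hI s hs') hj hm) with g | g
    · rw [← g]; exact hh.2.1
    · rw [hh.2.1] at g; exact absurd g (h.declare_ne hkT j hj)
  obtain ⟨hact, hs, hn, hlog, hnpos⟩ := h.stats good env hH hI I hj hm k hkA'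
  have hinf := (h.ready j hj).informed
  have hN := hinf.count_pos env hp hkA'
  refine Finset.mem_filter.2 ⟨by rw [hact]; exact hkA', ?_⟩
  rw [(I.kept j hj).2.1, (I.kept j hj).2.2]
  refine quarter_le_abs hN hnpos (env.mean_pos k) (hinf.le_S k hkA') ?_
  have hg := (good.hit j k t (t + A.card * P.T0) (by omega) hH).1
  rw [← hs] at hg
  have h1 := h.le_count good env hH hI I hj hm hkA'
  rw [← hn] at h1
  have hμ := env.mean_pos k
  have hdiv : ((P.T0 / 10 : ℕ) : ℝ) ≤ P.T0 / 10 := by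
    have := Nat.cast_div_le (α := ℝ) (m := P.T0) (n := 10)
    exact_mod_cast this
  have h2 := mul_le_mul_of_nonneg_left (hcount.trans hdiv) hμ.le
  have h3 := mul_le_mul_of_nonneg_left h1 hμ.le
  -- At most T_0/10 hits among at least 0.45 T_0 pulls: 1.06 · 0.1/0.45 + 1/27 is well below 0.7.
  nlinarith [mul_pos hμ hnpos]

/-- An arm that another player declared during the block is signaled. -/
theorem BlockStart.signaled_of_declare (h : BlockStart P ω ν Top m p t A D U seat) (hp : 1 ≤ p)
    (good : Good P ν H ω) (env : Env P ν M Top m) (hH : t + A.card * P.T0 ≤ H)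
    (hI : ∀ r < A.card * P.T0, InBlock P ω t A D U r (run P ω (t + r)))
    (I : InBlock P ω t A D U (A.card * P.T0) τ) {j : Fin M} (hj : j ∈ U)
    (hm : (τ j).mode = (run P ω t j).mode) {k : Fin K} {j' : Fin M}
    (hj' : j' ∈ U) (hdecl : (run P ω t j').mode = .declare k) (hne : j ≠ j') :
    k ∈ (τ j).signaled := by
  have hk := h.declare_mem hj' hdecl
  have hkA := ((h.ready j' hj').informed.rej k (Finset.mem_sdiff.1 hk).1).1
  have hmode' : ∀ r < A.card * P.T0, (run P ω (t + r) j').mode = .declare k := by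
    intro r hr
    rcases (hI r hr).cases j' hj' with ⟨g, -⟩ | ⟨g, -⟩
    · rw [g, hdecl]
    · rw [hdecl] at g; simp at g
  obtain ⟨hact, hs, hn, hlog, hnpos⟩ := h.stats good env hH hI I hj hm k hkA
  have hinf := (h.ready j hj).informed
  have hN := hinf.count_pos env hp hkA
  -- A hit of `j` on `k` requires that the coin of `j'` did not choose `k`.
  have e1 : csum (Hit P ω j k t) 1 (t + A.card * P.T0)
      ≤ csum (fun s => Cued P ω j j' k t s ∧ (1 / 2 : ℝ) ≤ (ω s).2 j') 1 (t + A.card * P.T0) := by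
    refine csum_mono_of_imp fun s hs hh => ?_
    have hsr : t + (s - t) = s := Nat.add_sub_cancel' hh.1
    have hm1 := hmode' (s - t) (by omega)
    rw [hsr] at hm1
    refine ⟨⟨hh.1, hh.2.1, hm1⟩, ?_⟩
    by_contra hu
    have hp' : pull P ω s j' = k := by
      simp only [pull, arms, State.arm, hm1]
      rw [if_pos (not_le.1 hu)]
    exact hne (hh.2.2 j' (hp'.trans hh.2.1.symm)).symm
  have e2 : csum (Cued P ω j j' k t) 1 (t + A.card * P.T0)
      ≤ csum (Pulled P ω j k t) 1 (t + A.card * P.T0) :=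
    csum_mono_of_imp fun s _ hh => ⟨hh.1, hh.2.1⟩
  rw [← hn] at e2
  have hc := good.cued j j' k t (t + A.card * P.T0) hne (by omega) hH
  have hg := (good.hit j k t (t + A.card * P.T0) (by omega) hH).1
  rw [← hs] at hg
  refine Finset.mem_filter.2 ⟨by rw [hact]; exact hkA, ?_⟩
  rw [(I.kept j hj).2.1, (I.kept j hj).2.2]
  refine quarter_le_abs hN hnpos (env.mean_pos k) (hinf.le_S k hkA) ?_
  have hμ := env.mean_pos k
  have hμ1 := env.mean_le k
  have h0 : csum (Hit P ω j k t) 1 (t + A.card * P.T0)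
      ≤ 0.53 * (τ j).n k + 40 * Real.log P.T := by linarith
  have h1 := mul_le_mul_of_nonneg_left h0 hμ.le
  have h2 : mean ν k * (40 * Real.log P.T) ≤ 40 * Real.log P.T :=
    mul_le_of_le_one_left (by have := env.log_pos; positivity) hμ1
  -- The block average is at most μ times 1.06 · (0.53 + 1/27) + 1/27, which is below 0.7.
  nlinarith [mul_pos hμ hnpos]

/-- Sums of rewards of an arm that nobody occupied or declared. -/
theorem BlockStart.stats_of_free (h : BlockStart P ω ν Top m p t A D U seat)
    (good : Good P ν H ω) (env : Env P ν M Top m) (hH : t + A.card * P.T0 ≤ H)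
    (hI : ∀ r < A.card * P.T0, InBlock P ω t A D U r (run P ω (t + r)))
    (I : InBlock P ω t A D U (A.card * P.T0) τ) {j : Fin M} (hj : j ∈ U)
    (hm : (τ j).mode = (run P ω t j).mode) {i : Fin K} (hi : i ∈ A)
    (hseat : ∀ j', j' ∉ U → seat j' ≠ i)
    (hfix : ∀ j' ∈ U, ∀ B, (τ j').mode ≠ .occupy B (some i))
    (hdecl : ∀ j' ∈ U, (run P ω t j').mode ≠ .declare i) :
    0.91 * mean ν i * (τ j).n i ≤ (τ j).s i ∧ (τ j).s i ≤ 1.1 * mean ν i * (τ j).n i := by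
  obtain ⟨hact, hs, hn, hlog, hnpos⟩ := h.stats good env hH hI I hj hm i hi
  -- Without an occupant or a declarer the only possible collisions would be between hopping
  -- players, which do not occur; every pull is a hit.
  have e1 : csum (Hit P ω j i t) 1 (t + A.card * P.T0) = (τ j).n i := by
    rw [hn]
    refine csum_congr _ fun s hs => ⟨fun hh => ⟨hh.1, hh.2.1⟩, fun hh => ⟨hh.1, hh.2, ?_⟩⟩
    have hsr : t + (s - t) = s := Nat.add_sub_cancel' hh.1
    have hlt : s - t < A.card * P.T0 := by have := hh.1; omega
    have := h.noColl (hI (s - t) hlt) hj (I.mode_eq h hlt (hI _ hlt) hj hm)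
      (i := i) (by rw [hsr]; exact hh.2) hseat (I.not_fixed hfix hlt) hdecl
    rwa [hsr] at this
  have hg := good.hit j i t (t + A.card * P.T0) (by omega) hH
  rw [← hs, e1] at hg
  have hμ := env.mean_pos i
  -- The error 40 log T is at most μ n / 27, so 0.95 and 1.06 become 0.91 and 1.1.
  constructor <;> nlinarith [mul_pos hμ hnpos, hg.1, hg.2]

/-- An arm outside `D` has no occupant from earlier blocks, so undisturbed statistics keep it below
the signal threshold: there are no false alarms. -/
theorem BlockStart.not_signaled (h : BlockStart P ω ν Top m p t A D U seat) (hp : 1 ≤ p)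
    (good : Good P ν H ω) (env : Env P ν M Top m) (hH : t + A.card * P.T0 ≤ H)
    (hI : ∀ r < A.card * P.T0, InBlock P ω t A D U r (run P ω (t + r)))
    (I : InBlock P ω t A D U (A.card * P.T0) τ) {j : Fin M} (hj : j ∈ U)
    (hm : (τ j).mode = (run P ω t j).mode) {i : Fin K} (hi : i ∈ A \ D)
    (hfix : ∀ j' ∈ U, ∀ B, (τ j').mode ≠ .occupy B (some i))
    (hdecl : ∀ j' ∈ U, (run P ω t j').mode ≠ .declare i) : i ∉ (τ j).signaled := by
  have hiA := (Finset.mem_sdiff.1 hi).1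
  obtain ⟨h1, h2⟩ := h.stats_of_free good env hH hI I hj hm hiA (h.seat_ne hi) hfix hdecl
  obtain ⟨hact, hs, hn, hlog, hnpos⟩ := h.stats good env hH hI I hj hm i hiA
  have hinf := (h.ready j hj).informed
  intro hmem
  have := (Finset.mem_filter.1 hmem).2
  rw [(I.kept j hj).2.1, (I.kept j hj).2.2] at this
  exact absurd this (not_le.2 (abs_lt_quarter (hinf.count_pos env hp hiA) hnpos (env.mean_pos i)
    (hinf.le_S i hiA) (hinf.S_le i hiA) h1 h2))

/-- An arm that is occupied during the whole block gives no reward to the others. -/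
theorem BlockStart.stats_of_seat (h : BlockStart P ω ν Top m p t A D U seat)
    (I : InBlock P ω t A D U (A.card * P.T0) τ) {j : Fin M} (hj : j ∈ U)
    (hm : (τ j).mode = (run P ω t j).mode) {j' : Fin M} (hj' : j' ∉ U) :
    (τ j).s (seat j') = 0 := by
  have hs : (τ j).s (seat j')
      = csum (Hit P ω j (seat j') t) (fun r => (ω r).1 (seat j')) (t + A.card * P.T0) := by
    rcases I.cases j hj with ⟨-, -, g⟩ | ⟨g0, k, -, g⟩
    · exact (g _).1
    · rw [hm, g0] at g; simp at g
  rw [hs]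
  refine csum_eq_zero _ fun s _ hh => ?_
  have hsr : t + (s - t) = s := Nat.add_sub_cancel' hh.1
  have hp := (h.seated.add (s - t)).pull_eq hj'
  rw [hsr] at hp
  exact hj' (hh.2.2 j' (hp.trans hh.2.1.symm) ▸ hj)

end BlockEnd

end Blocks


/-! ### From one communication block to the next: agreement on the signaled arms. -/

section Transitions

variable {K M : ℕ} {P : Params K} {ω : Sample K M} {ν : Fin K → Measure ℝ} {H : ℕ}
  {Top : Finset (Fin K)} {m : ℝ} {A D D' : Finset (Fin K)} {U : Finset (Fin M)}
  {seat : Fin M → Fin K} {p t : ℕ} {τ : Fin M → State K}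

theorem receive_ready {j : Fin M} {σ : State K} (h : Informed P ν Top m p A σ)
    (hdecl : σ.decl = D) (hrej : σ.rej ⊆ D) (hacc : σ.acc ⊆ D) (hpos : σ.pos ∈ A)
    (hS : ∀ i ∈ A, σ.S i = csum (Explored P ω j i) (fun s => (ω s).1 i) t)
    (hN : ∀ i ∈ A, (σ.N i : ℝ) = csum (Explored P ω j i) 1 t) :
    Ready P ω ν Top m p t A D j (State.startBlock σ .receive) :=
  ⟨h.congr rfl rfl rfl rfl rfl rfl rfl rfl, hdecl, h.Td, rfl, rfl, hpos, hS, hN,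
    Or.inr (Or.inr ⟨hrej, hacc, rfl⟩)⟩

theorem finish_declare {σ : State K} {k : Fin K} (h : σ.mode = .declare k) :
    σ.finish P = State.nextBlock P { σ with decl := σ.decl ∪ (σ.signaled ∪ {k}) } := by
  cases σ; subst h; rfl

theorem finish_occupy {σ : State K} {B : Finset (Fin K)} (h : σ.mode = .occupy B none) :
    σ.finish P = State.startBlock { σ with decl := σ.decl ∪ σ.signaled } .receive := by
  cases σ; subst h; rfl

theorem finish_receive {σ : State K} (h : σ.mode = .receive) :
    σ.finish P = if (σ.signaled \ σ.decl).Nonempty then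
        State.startBlock { σ with decl := σ.decl ∪ σ.signaled } .receive
      else State.startPhase P σ.updateActive (σ.p + 1) := by
  cases σ; subst h; rfl

open Classical in
/-- Arms declared in a block. -/
noncomputable def declared (P : Params K) (ω : Sample K M) (t : ℕ) (U : Finset (Fin M)) :
    Finset (Fin K) :=
  Finset.univ.filter fun k => ∃ j ∈ U, (run P ω t j).mode = .declare k

open Classical in
/-- Arms on which players settled. -/
noncomputable def settled (U : Finset (Fin M)) (τ : Fin M → State K) : Finset (Fin K) :=
  Finset.univ.filter fun k => ∃ j ∈ U, ∃ B, (τ j).mode = .occupy B (some k)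

open Classical in
/-- Players that did not settle. -/
noncomputable def unsettled (P : Params K) (ω : Sample K M) (t : ℕ) (U : Finset (Fin M))
    (τ : Fin M → State K) : Finset (Fin M) :=
  U.filter fun j => (τ j).mode = (run P ω t j).mode

theorem mem_declared {k : Fin K} :
    k ∈ declared P ω t U ↔ ∃ j ∈ U, (run P ω t j).mode = .declare k := by
  simp [declared]

theorem mem_settled {k : Fin K} :
    k ∈ settled U τ ↔ ∃ j ∈ U, ∃ B, (τ j).mode = .occupy B (some k) := by
  simp [settled]

theorem mem_unsettled {j : Fin M} :
    j ∈ unsettled P ω t U τ ↔ j ∈ U ∧ (τ j).mode = (run P ω t j).mode := by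
  simp [unsettled]

theorem BlockStart.settled_of_mode (h : BlockStart P ω ν Top m p t A D U seat) {s : ℕ}
    (I : InBlock P ω t A D U s τ) {j : Fin M} (hj : j ∈ U) {B : Finset (Fin K)}
    {k : Fin K} (hk : (τ j).mode = .occupy B (some k)) :
    (run P ω t j).mode = .occupy ((run P ω t j).acc \ D) none ∧ k ∈ (run P ω t j).acc \ D := by
  rcases I.cases j hj with ⟨g, -⟩ | ⟨g0, k', hk', g⟩
  · rw [hk] at g; exact absurd g.symm ((h.ready j hj).mode.ne_occupy_some _ _)
  · rw [hk] at g
    simp only [Mode.occupy.injEq, Option.some.injEq] at g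
    exact ⟨g0, g.2 ▸ hk'⟩

theorem BlockStart.settled_sub (h : BlockStart P ω ν Top m p t A D U seat) {s : ℕ}
    (I : InBlock P ω t A D U s τ) : settled U τ ⊆ Top ∩ (A \ D) := by
  intro k hk
  obtain ⟨j, hj, B, hB⟩ := mem_settled.1 hk
  have := h.acc_mem hj (h.settled_of_mode I hj hB).2
  exact Finset.mem_inter.2 ⟨this.2, this.1⟩

theorem BlockStart.declared_sub (h : BlockStart P ω ν Top m p t A D U seat) :
    declared P ω t U ⊆ (A \ D) \ Top := by
  intro k hk
  obtain ⟨j, hj, hd⟩ := mem_declared.1 hk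
  have h1 := Finset.mem_sdiff.1 (h.declare_mem hj hd)
  have h2 := (h.ready j hj).informed.rej k h1.1
  exact Finset.mem_sdiff.2 ⟨Finset.mem_sdiff.2 ⟨h2.1, h1.2⟩, h2.2⟩

theorem exists_settled (I : InBlock P ω t A D U (A.card * P.T0) τ) {j : Fin M} (hj : j ∈ U)
    (hn : j ∉ unsettled P ω t U τ) : ∃ B k, (τ j).mode = .occupy B (some k) := by
  rcases I.cases j hj with ⟨g, -⟩ | ⟨-, k, -, g⟩
  · exact absurd (mem_unsettled.2 ⟨hj, g⟩) hn
  · exact ⟨_, k, g⟩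

/-- After a block, the players that settled exploit their arms. -/
theorem BlockStart.seated_next (h : BlockStart P ω ν Top m p t A D U seat)
    (I : InBlock P ω t A D U (A.card * P.T0) τ)
    (hfin : ∀ j ∈ U, run P ω (t + A.card * P.T0) j = (τ j).finish P) :
    ∃ seat', Seated P ω (t + A.card * P.T0) Top (A \ (D ∪ (settled U τ ∪ declared P ω t U)))
      (unsettled P ω t U τ) seat' := by
  classical
  have hsub : ∀ {k}, k ∈ A \ (D ∪ (settled U τ ∪ declared P ω t U)) → k ∈ A \ D := by
    intro k hk
    simp only [Finset.mem_sdiff, Finset.mem_union, not_or] at hk ⊢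
    exact ⟨hk.1, hk.2.1⟩
  have hex : ∀ j, ∃ k, (j ∉ U → k = seat j) ∧
      (j ∈ U → j ∉ unsettled P ω t U τ → ∃ B, (τ j).mode = .occupy B (some k)) := by
    intro j
    by_cases hj : j ∈ U
    · by_cases hn : j ∈ unsettled P ω t U τ
      · exact ⟨seat j, fun h => absurd hj h, fun _ h => absurd hn h⟩
      · obtain ⟨B, k, hk⟩ := exists_settled I hj hn
        exact ⟨k, fun h => absurd hj h, fun _ _ => ⟨B, hk⟩⟩
    · exact ⟨seat j, fun _ => rfl, fun h => absurd h hj⟩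
  choose seat' hold hnew using hex
  have hset : ∀ j ∈ U, j ∉ unsettled P ω t U τ → seat' j ∈ settled U τ := by
    intro j hj hn
    exact mem_settled.2 ⟨j, hj, hnew j hj hn⟩
  refine ⟨seat', ?_, ?_, ?_, ?_, ?_⟩
  · intro j hn
    by_cases hj : j ∈ U
    · obtain ⟨B, hB⟩ := hnew j hj hn
      rw [hfin j hj]
      unfold State.finish
      rw [hB]
    · rw [hold j hj]
      exact exploit_forever (h.seated.exploit j hj) _
  · intro j hn
    by_cases hj : j ∈ U
    · exact (Finset.mem_inter.1 (h.settled_sub I (hset j hj hn))).1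
    · rw [hold j hj]; exact h.seated.seat_mem j hj
  · intro j hn
    by_cases hj : j ∈ U
    · have := hset j hj hn
      simp only [Finset.mem_sdiff, Finset.mem_union, not_and, not_not]
      exact fun _ => Or.inr (Or.inl this)
    · rw [hold j hj]; exact fun hh => h.seated.seat_notMem j hj (hsub hh)
  · intro j hn j' hn' hjj
    have hmix : ∀ i i', i ∉ U → i' ∈ U → i' ∉ unsettled P ω t U τ → seat' i ≠ seat' i' := by
      intro i i' hi hi' hin' e
      have := (Finset.mem_inter.1 (h.settled_sub I (hset i' hi' hin'))).2
      rw [← e, hold i hi] at this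
      exact h.seated.seat_notMem i hi this
    by_cases hj : j ∈ U <;> by_cases hj' : j' ∈ U
    · obtain ⟨B, hB⟩ := hnew j hj hn
      obtain ⟨B', hB'⟩ := hnew j' hj' hn'
      exact I.distinct j hj j' hj' B B' (seat' j) hB (hjj ▸ hB')
    · exact absurd hjj.symm (hmix j' j hj' hj hn)
    · exact absurd hjj (hmix j j' hj hj' hn')
    · rw [hold j hj, hold j' hj'] at hjj
      exact h.seated.seat_inj j hj j' hj' hjj
  -- Settled players and settled arms correspond one to one.
  · have e1 : (U \ unsettled P ω t U τ).image seat' = settled U τ := by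
      ext k
      simp only [Finset.mem_image, Finset.mem_sdiff]
      constructor
      · rintro ⟨j, ⟨hj, hn⟩, rfl⟩
        exact hset j hj hn
      · intro hk
        obtain ⟨j, hj, B, hB⟩ := mem_settled.1 hk
        have hn : j ∉ unsettled P ω t U τ := by
          intro hh
          have := (mem_unsettled.1 hh).2
          rw [hB] at this
          exact (h.ready j hj).mode.ne_occupy_some _ _ this.symm
        obtain ⟨B', hB'⟩ := hnew j hj hn
        refine ⟨j, ⟨hj, hn⟩, ?_⟩
        rw [hB] at hB'
        simp only [Mode.occupy.injEq, Option.some.injEq] at hB'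
        exact hB'.2.symm
    have e2 : (U \ unsettled P ω t U τ).card = (settled U τ).card := by
      rw [← e1, Finset.card_image_of_injOn]
      intro j hj j' hj' hjj
      simp only [Finset.coe_sdiff, Set.mem_sdiff, Finset.mem_coe] at hj hj'
      obtain ⟨B, hB⟩ := hnew j hj.1 hj.2
      obtain ⟨B', hB'⟩ := hnew j' hj'.1 hj'.2
      exact I.distinct j hj.1 j' hj'.1 B B' (seat' j) hB (hjj ▸ hB')
    -- Declared arms lie outside `Top`, so among the top arms only the settled ones leave.
    have e3 : Top ∩ (A \ (D ∪ (settled U τ ∪ declared P ω t U)))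
        = (Top ∩ (A \ D)) \ settled U τ := by
      ext k
      simp only [Finset.mem_inter, Finset.mem_sdiff, Finset.mem_union, not_or]
      constructor
      · tauto
      · rintro ⟨⟨h1, h2, h3⟩, h4⟩
        exact ⟨h1, h2, h3, h4, fun hd => (Finset.mem_sdiff.1 (h.declared_sub hd)).2 h1⟩
    have e4 : unsettled P ω t U τ ⊆ U := Finset.filter_subset _ _
    have h1 := Finset.card_sdiff_add_card_eq_card e4
    have h2 := Finset.card_sdiff_add_card_eq_card (h.settled_sub I)
    have h3 := h.seated.card
    rw [e3]
    omega

/-- The arms signaled in a block are those declared by others or occupied. -/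
theorem BlockStart.signaled_iff (h : BlockStart P ω ν Top m p t A D U seat) (hp : 1 ≤ p)
    (good : Good P ν H ω) (env : Env P ν M Top m) (hH : t + A.card * P.T0 ≤ H)
    (hI : ∀ r < A.card * P.T0, InBlock P ω t A D U r (run P ω (t + r)))
    (I : InBlock P ω t A D U (A.card * P.T0) τ) {j : Fin M}
    (hj : j ∈ unsettled P ω t U τ) (i : Fin K) :
    i ∈ D ∪ (settled U τ ∪ declared P ω t U) ↔
      i ∈ D ∨ i ∈ (τ j).signaled ∨ (run P ω t j).mode = .declare i := by
  obtain ⟨hjU, hm⟩ := mem_unsettled.1 hj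
  simp only [Finset.mem_union]
  constructor
  · rintro (h1 | h1 | h1)
    · exact Or.inl h1
    · obtain ⟨j', hj', B, hB⟩ := mem_settled.1 h1
      exact Or.inr (Or.inl (h.signaled_of_fixed hp good env hH hI I hjU hm hj' hB))
    · obtain ⟨j', hj', hd⟩ := mem_declared.1 h1
      by_cases e : j = j'
      · exact Or.inr (Or.inr (e ▸ hd))
      · exact Or.inr (Or.inl (h.signaled_of_declare hp good env hH hI I hjU hm hj' hd e))
  · rintro (h1 | h1 | h1)
    · exact Or.inl h1
    · by_cases hD : i ∈ D
      · exact Or.inl hD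
      · right
        by_contra hno
        rw [not_or] at hno
        have hiA : i ∈ A := by
          have := (Finset.mem_filter.1 h1).1
          rwa [(I.kept j hjU).1.act, (h.ready j hjU).informed.act] at this
        exact h.not_signaled hp good env hH hI I hjU hm (Finset.mem_sdiff.2 ⟨hiA, hD⟩)
          (fun j' hj' B hB => hno.1 (mem_settled.2 ⟨j', hj', B, hB⟩))
          (fun j' hj' hd => hno.2 (mem_declared.2 ⟨j', hj', hd⟩)) h1
    · exact Or.inr (Or.inr (mem_declared.2 ⟨j, hjU, h1⟩))

theorem BlockStart.not_exploring (h : BlockStart P ω ν Top m p t A D U seat) {s : ℕ}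
    (I : InBlock P ω t A D U s (run P ω (t + s))) {j j₀ : Fin M} (hj : j ∈ U) (hj₀ : j₀ ∈ U)
    (hm : (run P ω t j₀).mode ≠ .receive) : ¬ Exploring P ω j (t + s) := by
  rintro (h1 | ⟨-, h1⟩)
  · rcases I.cases j hj with ⟨g, -⟩ | ⟨-, k, -, g⟩
    · rw [h1] at g
      rcases (h.ready j hj).mode with ⟨k, -, h2⟩ | ⟨-, -, h2⟩ | ⟨-, -, h2⟩ <;> simp [h2] at g
    · simp [g] at h1
  · rcases I.cases j₀ hj₀ with ⟨g, -⟩ | ⟨-, k, -, g⟩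
    · have := h1 j₀
      rw [g] at this
      rcases (h.ready j₀ hj₀).mode with ⟨k, -, h2⟩ | ⟨-, -, h2⟩ | ⟨-, -, h2⟩
      · simp [h2] at this
      · simp [h2] at this
      · exact hm h2
    · have := h1 j₀
      simp [g] at this

/-- After a block that is not a reception block for everybody, more arms are signaled. -/
theorem BlockStart.next (h : BlockStart P ω ν Top m p t A D U seat) (hp : 1 ≤ p)
    (good : Good P ν H ω) (env : Env P ν M Top m) (hL : 1 ≤ A.card * P.T0)
    (hH : t + A.card * P.T0 ≤ H) {j₀ : Fin M} (hj₀ : j₀ ∈ U)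
    (hm₀ : (run P ω t j₀).mode ≠ .receive) :
    ∃ D' U' seat', D ⊂ D' ∧
      BlockStart P ω ν Top m p (t + A.card * P.T0) A D' U' seat' := by
  obtain ⟨hI, τ, I, hfin⟩ := h.window hL
  obtain ⟨seat', hseat'⟩ := h.seated_next I hfin
  set D' := D ∪ (settled U τ ∪ declared P ω t U) with hD'
  have hDD' : D ⊆ D' := Finset.subset_union_left
  -- A player left unsettled by a fixation block has seen all the arms it wanted taken by others.
  -- They all join `D'`, so continuing with reception blocks is consistent with `BlockMode`.
  have hfix : ∀ j ∈ unsettled P ω t U τ, ∀ B, (run P ω t j).mode = .occupy B none →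
      ∀ k ∈ (run P ω t j).acc \ D, k ∈ settled U τ := by
    intro j hj B hB k hk
    obtain ⟨hjU, hm⟩ := mem_unsettled.1 hj
    have hB' : B = (run P ω t j).acc \ D := by
      rcases (h.ready j hjU).mode with ⟨k, -, h2⟩ | ⟨-, -, h2⟩ | ⟨-, -, h2⟩ <;> rw [h2] at hB <;>
        simp only [Mode.occupy.injEq, reduceCtorEq, and_true] at hB
      exact hB.symm
    exact mem_settled.2 (h.exists_fixed good env (Nat.mul_le_mul_left _ (by omega)) hH I hI hjU hB
      hm (hB' ▸ hk) hk)
  -- A player that is not receiving declares an arm, settles, or sees a wanted arm settled by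
  -- another player; each case yields an arm outside `D`.
  have hlt : D ⊂ D' := by
    refine Finset.ssubset_iff_subset_ne.2 ⟨hDD', fun e => ?_⟩
    have hnotin : ∀ k, k ∈ settled U τ ∪ declared P ω t U → False := by
      intro k hk
      have hkD : k ∈ D := by rw [e]; exact Finset.mem_union_right _ hk
      rcases Finset.mem_union.1 hk with h1 | h1
      · exact (Finset.mem_sdiff.1 (Finset.mem_inter.1 (h.settled_sub I h1)).2).2 hkD
      · exact (Finset.mem_sdiff.1 (Finset.mem_sdiff.1 (h.declared_sub h1)).1).2 hkD
    rcases (h.ready j₀ hj₀).mode with ⟨k, -, h2⟩ | ⟨-, ⟨k, hk⟩, h2⟩ | ⟨-, -, h2⟩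
    · exact hnotin k (Finset.mem_union_right _ (mem_declared.2 ⟨j₀, hj₀, h2⟩))
    · by_cases hu : j₀ ∈ unsettled P ω t U τ
      · exact hnotin k (Finset.mem_union_left _ (hfix j₀ hu _ h2 k hk))
      · obtain ⟨B, k', hk'⟩ := exists_settled I hj₀ hu
        exact hnotin k' (Finset.mem_union_left _ (mem_settled.2 ⟨j₀, hj₀, B, hk'⟩))
    · exact hm₀ h2
  have hposτ : ∀ j ∈ unsettled P ω t U τ, (τ j).pos = hop A (A.card * P.T0) (run P ω t j).pos := by
    intro j hj
    obtain ⟨hjU, hm⟩ := mem_unsettled.1 hj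
    rcases I.cases j hjU with ⟨-, g, -⟩ | ⟨g0, k, -, g⟩
    · exact g
    · rw [hm, g0] at g; simp at g
  have key : ∀ j ∈ unsettled P ω t U τ,
      Ready P ω ν Top m p (t + A.card * P.T0) A D' j (run P ω (t + A.card * P.T0) j) ∧
      (run P ω (t + A.card * P.T0) j).pos = (τ j).pos := by
    intro j hj
    obtain ⟨hjU, hm⟩ := mem_unsettled.1 hj
    have hsig := h.signaled_iff hp good env hH hI I hj
    rw [← hD'] at hsig
    have r := h.ready j hjU
    obtain ⟨kp, kS, kN⟩ := I.kept j hjU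
    have hdecl : (τ j).decl = D := kp.decl.trans r.decl
    have hinf : Informed P ν Top m p A (τ j) :=
      r.informed.congr kp.p kp.act kp.Mp kp.Td kS kN kp.rej kp.acc
    have hpos : (τ j).pos ∈ A := by rw [hposτ j hj]; exact hop_mem r.pos _
    -- The exploration statistics and the `Explored` rounds both stand still in such a block.
    have hne : ∀ i, ∀ s < A.card * P.T0, ¬ Explored P ω j i (t + s) :=
      fun i s hs hh => h.not_exploring (hI s hs) hjU hj₀ hm₀ hh.2
    have hS : ∀ i ∈ A, (τ j).S i = csum (Explored P ω j i) (fun s => (ω s).1 i)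
        (t + A.card * P.T0) := by
      intro i hi; rw [kS, r.S i hi, csum_add_of_not _ (hne i)]
    have hN : ∀ i ∈ A, ((τ j).N i : ℝ) = csum (Explored P ω j i) 1 (t + A.card * P.T0) := by
      intro i hi; rw [kN, r.N i hi, csum_add_of_not _ (hne i)]
    have hsig' : (∀ k, (run P ω t j).mode ≠ .declare k) → D ∪ (τ j).signaled = D' := by
      intro hnd
      ext i
      rw [hsig i, Finset.mem_union]
      simp [hnd i]
    rw [hfin j hjU]
    rcases r.mode with ⟨k, hk, h2⟩ | ⟨hrej, hne, h2⟩ | ⟨hrej, hacc, h2⟩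
    · have hfin' : (τ j).finish P = State.nextBlock P
          { τ j with decl := (τ j).decl ∪ ((τ j).signaled ∪ {k}) } := finish_declare (hm.trans h2)
      rw [hfin']
      refine ⟨nextBlock_ready env.pick (hinf.congr rfl rfl rfl rfl rfl rfl rfl rfl) ?_ hpos hS hN,
        nextBlock_pos _⟩
      ext i
      simp only [hdecl]
      rw [hsig i, h2]
      simp only [Finset.mem_union, Finset.mem_singleton, Mode.declare.injEq, eq_comm]
    · have hfin' : (τ j).finish P = State.startBlock
          { τ j with decl := (τ j).decl ∪ (τ j).signaled } .receive := finish_occupy (hm.trans h2)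
      rw [hfin']
      have hd : (τ j).decl ∪ (τ j).signaled = D' := by rw [hdecl]; exact hsig' (by simp [h2])
      refine ⟨receive_ready (hinf.congr rfl rfl rfl rfl rfl rfl rfl rfl) hd ?_ ?_ hpos hS hN, rfl⟩
      · simp only [kp.rej]; exact hrej.trans hDD'
      · simp only [kp.acc]
        intro k hk
        by_cases hkD : k ∈ D
        · exact hDD' hkD
        · exact Finset.mem_union_right _ (Finset.mem_union_left _
            (hfix j hj _ h2 k (Finset.mem_sdiff.2 ⟨hk, hkD⟩)))
    · have hd : (τ j).decl ∪ (τ j).signaled = D' := by rw [hdecl]; exact hsig' (by simp [h2])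
      have hnonempty : ((τ j).signaled \ (τ j).decl).Nonempty := by
        obtain ⟨i, hi, hiD⟩ := Finset.exists_of_ssubset hlt
        rw [← hd, hdecl, Finset.mem_union] at hi
        exact ⟨i, Finset.mem_sdiff.2 ⟨hi.resolve_left hiD, by rwa [hdecl]⟩⟩
      have hfin' : (τ j).finish P = State.startBlock
          { τ j with decl := (τ j).decl ∪ (τ j).signaled } .receive := by
        rw [finish_receive (hm.trans h2), if_pos hnonempty]
      rw [hfin']
      refine ⟨receive_ready (hinf.congr rfl rfl rfl rfl rfl rfl rfl rfl) hd ?_ ?_ hpos hS hN, rfl⟩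
      · simp only [kp.rej]; exact hrej.trans hDD'
      · simp only [kp.acc]; exact hacc.trans hDD'
  refine ⟨D', unsettled P ω t U τ, seat', hlt, hseat', ?_, fun j hj => (key j hj).1,
    fun j hj j' hj' hjj => ?_⟩
  · refine Finset.union_subset h.sub (Finset.union_subset ?_ ?_)
    · exact (h.settled_sub I).trans (Finset.inter_subset_right.trans Finset.sdiff_subset)
    · exact h.declared_sub.trans (Finset.sdiff_subset.trans Finset.sdiff_subset)
  · rw [(key j hj).2, (key j' hj').2, hposτ j hj, hposτ j' hj'] at hjj
    have hjU := (mem_unsettled.1 hj).1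
    have hjU' := (mem_unsettled.1 hj').1
    exact h.inj j hjU j' hjU' (hop_inj (h.ready j hjU).pos (h.ready j' hjU').pos _ hjj)

/-- The communication phase comes to a last block, unless all players settle before. -/
theorem BlockStart.exists_last (h : BlockStart P ω ν Top m p t A D U seat) (hp : 1 ≤ p)
    (good : Good P ν H ω) (env : Env P ν M Top m) (hL : 1 ≤ A.card * P.T0)
    (hH : t + (A.card + 1 - D.card) * (A.card * P.T0) ≤ H) :
    ∃ t' D' U' seat', D ⊆ D' ∧ t ≤ t' ∧ t' ≤ t + (D'.card - D.card) * (A.card * P.T0) ∧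
      BlockStart P ω ν Top m p t' A D' U' seat' ∧
      ∀ j ∈ U', (run P ω t' j).mode = .receive := by
  induction hn : A.card - D.card using Nat.strong_induction_on generalizing t D U seat with
  | _ n ih =>
    by_cases hall : ∀ j ∈ U, (run P ω t j).mode = .receive
    · exact ⟨t, D, U, seat, subset_rfl, le_rfl, by simp, h, hall⟩
    · push Not at hall
      obtain ⟨j₀, hj₀, hm₀⟩ := hall
      have hDA := Finset.card_le_card h.sub
      have hH' : t + A.card * P.T0 ≤ H := by
        refine le_trans ?_ hH
        have : 1 ≤ A.card + 1 - D.card := by omega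
        nlinarith [Nat.mul_le_mul_right (A.card * P.T0) this]
      obtain ⟨D', U', seat', hlt, h'⟩ := h.next hp good env hL hH' hj₀ hm₀
      have hc := Finset.card_lt_card hlt
      have hDA' := Finset.card_le_card h'.sub
      have hstep : t + A.card * P.T0 + (A.card + 1 - D'.card) * (A.card * P.T0)
          ≤ t + (A.card + 1 - D.card) * (A.card * P.T0) := by
        have : 1 + (A.card + 1 - D'.card) ≤ A.card + 1 - D.card := by omega
        nlinarith [Nat.mul_le_mul_right (A.card * P.T0) this]
      obtain ⟨t2, D2, U2, seat2, h1, h2, h3, h4, h5⟩ := ih (A.card - D'.card) (by omega) h'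
        (hstep.trans hH) rfl
      refine ⟨t2, D2, U2, seat2, hlt.subset.trans h1, by omega, h3.trans ?_, h4, h5⟩
      have hc2 := Finset.card_le_card h1
      have : 1 + (D2.card - D'.card) ≤ D2.card - D.card := by omega
      nlinarith [Nat.mul_le_mul_right (A.card * P.T0) this]

end Transitions


/-! ### The last block of a communication phase and the start of the next exploration. -/

section NextPhase

variable {K M : ℕ} {P : Params K} {ω : Sample K M} {ν : Fin K → Measure ℝ} {H : ℕ}
  {Top : Finset (Fin K)} {m : ℝ} {A D D' : Finset (Fin K)} {U : Finset (Fin M)}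
  {seat : Fin M → Fin K} {p t : ℕ} {τ : Fin M → State K}

theorem csum_split (C : ℕ → Prop) (x : ℕ → ℝ) (t L : ℕ) :
    csum C x (t + L) = csum C x t + csum (fun s => t ≤ s ∧ C s) x (t + L) := by
  induction L with
  | zero => rw [add_zero, csum_eq_zero (C := fun s => t ≤ s ∧ C s) x fun s hs h => absurd h.1 (by omega),
      add_zero]
  | succ L ih =>
    rw [← add_assoc]
    by_cases h : C (t + L)
    · rw [csum_succ_of x h, csum_succ_of (C := fun s => t ≤ s ∧ C s) x ⟨Nat.le_add_right _ _, h⟩, ih]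
      ring
    · rw [csum_succ_of_not x h, csum_succ_of_not (C := fun s => t ≤ s ∧ C s) x fun hh => h hh.2, ih]

theorem finish_chairs {σ : State K} {k : Fin K} (h : σ.mode = .chairs false (some k)) :
    σ.finish P = { σ with
      mode := .explore, pos := k, left := σ.act.card * 2 ^ σ.p * P.T0 } := by
  cases σ; subst h; rfl

/-- What remains of the active arms after the last block is close to the threshold. -/
theorem BlockStart.close (h : BlockStart P ω ν Top m p t A D U seat) (hU : U.Nonempty)
    (hrec : ∀ j ∈ U, (run P ω t j).mode = .receive) {i : Fin K} (hi : i ∈ A \ D) :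
    (i ∉ Top → m - mean ν i < 4 * width P p) ∧ (i ∈ Top → mean ν i - m < 4 * width P p) := by
  obtain ⟨j, hj⟩ := hU
  obtain ⟨hiA, hiD⟩ := Finset.mem_sdiff.1 hi
  have r := h.ready j hj
  obtain ⟨h1, h2⟩ : (run P ω t j).rej ⊆ D ∧ (run P ω t j).acc ⊆ D := by
    rcases r.mode with ⟨k, -, g⟩ | ⟨-, -, g⟩ | ⟨g1, g2, -⟩
    · rw [hrec j hj] at g; simp at g
    · rw [hrec j hj] at g; simp at g
    · exact ⟨g1, g2⟩
  constructor
  · intro hT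
    by_contra hlt
    exact hiD (h1 (r.informed.mem_rej i hiA hT (not_lt.1 hlt)))
  · intro hT
    by_contra hlt
    exact hiD (h2 (r.informed.mem_acc i hiA hT (not_lt.1 hlt)))

/-- Memory at the end of the last block. -/
structure LastBlock (P : Params K) (ω : Sample K M) (Top : Finset (Fin K)) (p t : ℕ)
    (A D : Finset (Fin K)) (j : Fin M) (σ : State K) : Prop where
  run : run P ω (t + A.card * P.T0) j = State.startPhase P σ.updateActive (p + 1)
  act : σ.act = A
  Mp : σ.updateActive.Mp = (Top ∩ (A \ D)).card
  decl : σ.decl = D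
  Td : σ.Td = A.card * P.T0
  pos : σ.pos = hop A (A.card * P.T0) (NoSensing.run P ω t j).pos
  S : σ.S = (NoSensing.run P ω t j).S
  N : σ.N = (NoSensing.run P ω t j).N
  s : ∀ i, σ.s i = csum (Hit P ω j i t) (fun r => (ω r).1 i) (t + A.card * P.T0)
  n : ∀ i, (σ.n i : ℝ) = csum (Pulled P ω j i t) 1 (t + A.card * P.T0)

/-- When all unsettled players receive, nothing new disturbs the arms, so none is signaled outside
`D` and all of them stop together. An arm of `D` in `Top` is occupied by an exploiting player and
yields exactly zero; one outside `Top` is undisturbed and yields a positive sum. The zeros therefore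
count the players that left. -/
theorem BlockStart.lastBlock (h : BlockStart P ω ν Top m p t A D U seat) (hp : 1 ≤ p)
    (good : Good P ν H ω) (env : Env P ν M Top m) (hL : 1 ≤ A.card * P.T0)
    (hH : t + A.card * P.T0 ≤ H) (hrec : ∀ j ∈ U, (run P ω t j).mode = .receive) :
    (∀ s < A.card * P.T0, ∀ j ∈ U, Kept (run P ω t j) (run P ω (t + s) j) ∧
      (run P ω (t + s) j).mode = .receive ∧
      pull P ω (t + s) j = hop A s (run P ω t j).pos) ∧
    ∀ j ∈ U, ∃ σ, LastBlock P ω Top p t A D j σ := by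
  obtain ⟨hI, τ, I, hfin⟩ := h.window hL
  have hcases : ∀ {s σ}, InBlock P ω t A D U s σ → ∀ j ∈ U, (σ j).mode = (run P ω t j).mode ∧
      (σ j).pos = hop A s (run P ω t j).pos ∧
      ∀ i, (σ j).s i = csum (Hit P ω j i t) (fun r => (ω r).1 i) (t + s) ∧
        ((σ j).n i : ℝ) = csum (Pulled P ω j i t) 1 (t + s) := by
    intro s σ I j hj
    rcases I.cases j hj with g | ⟨g, -⟩
    · exact g
    · rw [hrec j hj] at g; simp at g
  refine ⟨fun s hs j hj => ⟨((hI s hs).kept j hj).1, ?_, ?_⟩, fun j hj => ?_⟩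
  · rw [(hcases (hI s hs) j hj).1, hrec j hj]
  · exact h.pull_hop (hI s hs) hj (hcases (hI s hs) j hj).1
      fun k hk => by rw [hrec j hj] at hk; simp at hk
  · obtain ⟨hm, hpos, hst⟩ := hcases I j hj
    have hmrec := hm.trans (hrec j hj)
    obtain ⟨kp, kS, kN⟩ := I.kept j hj
    have r := h.ready j hj
    have hdecl := kp.decl.trans r.decl
    have hact := kp.act.trans r.informed.act
    have hnofix : ∀ i, ∀ j' ∈ U, ∀ B, (τ j').mode ≠ .occupy B (some i) := by
      intro i j' hj' B hB
      rw [(hcases I j' hj').1, hrec j' hj'] at hB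
      simp at hB
    have hnodecl : ∀ i, ∀ j' ∈ U, (run P ω t j').mode ≠ .declare i := by
      intro i j' hj' hd
      rw [hrec j' hj'] at hd
      simp at hd
    have hsig : ¬ ((τ j).signaled \ (τ j).decl).Nonempty := by
      rintro ⟨i, hi⟩
      obtain ⟨hi, hiD⟩ := Finset.mem_sdiff.1 hi
      have hiA : i ∈ A := by
        have := (Finset.mem_filter.1 hi).1
        rwa [hact] at this
      rw [hdecl] at hiD
      exact h.not_signaled hp good env hH hI I hj hm (Finset.mem_sdiff.2 ⟨hiA, hiD⟩) (hnofix i)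
        (hnodecl i) hi
    refine ⟨τ j, ?_, hact, ?_, hdecl, kp.Td.trans r.informed.Td, hpos, kS, kN,
      fun i => (hst i).1, fun i => (hst i).2⟩
    · rw [hfin j hj, finish_receive hmrec, if_neg hsig, kp.p, r.informed.phase]
    -- By `Seated.image_eq` the top arms in `D` are exactly seats of exploiting players.
    · have hfilter : (τ j).decl.filter (fun i => (τ j).s i = 0) = Top ∩ D := by
        ext i
        rw [Finset.mem_filter, hdecl, Finset.mem_inter]
        constructor
        · rintro ⟨hiD, hs0⟩
          refine ⟨?_, hiD⟩
          by_contra hiT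
          have hiA := h.sub hiD
          have h1 := (h.stats_of_free good env hH hI I hj hm hiA
            (fun j' hj' e => hiT (e ▸ h.seated.seat_mem j' hj')) (hnofix i) (hnodecl i)).1
          obtain ⟨-, -, -, -, hnpos⟩ := h.stats good env hH hI I hj hm i hiA
          rw [hs0] at h1
          have := mul_pos (env.mean_pos i) hnpos
          linarith
        · rintro ⟨hiT, hiD⟩
          refine ⟨hiD, ?_⟩
          have hmem : i ∈ Top \ (A \ D) :=
            Finset.mem_sdiff.2 ⟨hiT, fun hh => (Finset.mem_sdiff.1 hh).2 hiD⟩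
          rw [← h.seated.image_eq env.card] at hmem
          obtain ⟨j', hj', rfl⟩ := Finset.mem_image.1 hmem
          exact h.stats_of_seat I hj hm (Finset.mem_compl.1 hj')
      unfold State.updateActive
      simp only
      rw [hfilter, kp.Mp, r.informed.Mp]
      have e : (Top ∩ (A \ D)).card + (Top ∩ D).card = (Top ∩ A).card := by
        rw [← Finset.card_union_of_disjoint]
        · congr 1
          ext i
          simp only [Finset.mem_union, Finset.mem_inter, Finset.mem_sdiff]
          have := @h.sub i
          tauto
        · rw [Finset.disjoint_left]
          intro i h1 h2
          exact (Finset.mem_sdiff.1 (Finset.mem_inter.1 h1).2).2 (Finset.mem_inter.1 h2).2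
      omega

/-- A reception block without any signal continues the exploration. -/
theorem BlockStart.continue (h : BlockStart P ω ν Top m p t A ∅ U seat) (hp : 1 ≤ p)
    (good : Good P ν H ω) (env : Env P ν M Top m) (hL : 1 ≤ A.card * P.T0)
    (hH : t + A.card * P.T0 ≤ H) (hrec : ∀ j ∈ U, (run P ω t j).mode = .receive) :
    ExploreStart P ω Top (p + 1) (t + A.card * P.T0) A (2 ^ (p + 1) * P.T0 - P.T0) U seat ∧
    ∑ s ∈ Finset.range (A.card * P.T0), loss P ν ω (t + s) = P.T0 * gap ν Top A := by
  obtain ⟨hwin, hlast⟩ := h.lastBlock hp good env hL hH hrec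
  have hseated : Seated P ω t Top A U seat := by
    have := h.seated; rwa [Finset.sdiff_empty] at this
  have hq : ∀ j ∈ U, (run P ω t j).pos ∈ A := fun j hj => (h.ready j hj).pos
  have hpull := fun s hs j hj => (hwin s hs j hj).2.2
  have hrun : ∀ j ∈ U, ∀ σ, LastBlock P ω Top p t A ∅ j σ →
      run P ω (t + A.card * P.T0) j = { σ.updateActive with
        p := p + 1
        S := fun i => σ.S i + σ.s i
        N := fun i => σ.N i + σ.n i
        mode := .explore
        left := σ.updateActive.act.card * 2 ^ (p + 1) * P.T0 - σ.Td } := by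
    intro j hj σ l
    rw [l.run]
    unfold State.startPhase
    rw [if_neg (by simp [State.updateActive, l.decl])]
    rfl
  have hexp : ∀ j ∈ U, ∀ i, ∀ s, t ≤ s → s < t + A.card * P.T0 →
      (Explored P ω j i s ↔ pull P ω s j = i) ∧ NoColl (pull P ω s) j := by
    intro j hj i s hs1 hs2
    have hsr : t + (s - t) = s := Nat.add_sub_cancel' hs1
    have hlt : s - t < A.card * P.T0 := by omega
    constructor
    · refine and_iff_left (Or.inr ⟨?_, fun j' => ?_⟩)
      · have := (hwin (s - t) hlt j hj).1.decl.trans (h.ready j hj).decl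
        rwa [hsr] at this
      · by_cases hj' : j' ∈ U
        · have := (hwin (s - t) hlt j' hj').2.1
          rw [hsr] at this
          exact Or.inl this
        · have := (hseated.add (s - t)).exploit j' hj'
          rw [hsr] at this
          exact Or.inr ⟨_, this⟩
    · have := (hseated.add (s - t)).noColl (hpull (s - t) hlt) (fun j hj => hop_mem (hq j hj) _)
        (fun j hj j' hj' hjj => h.inj j hj j' hj' (hop_inj (hq j hj) (hq j' hj') _ hjj)) j
      rwa [hsr] at this
  refine ⟨⟨hseated.add _, fun j hj => ?_, fun j hj j' hj' hjj => ?_⟩,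
    hseated.sum_loss_hop env hq h.inj hpull⟩
  · obtain ⟨σ, l⟩ := hlast j hj
    have r := h.ready j hj
    have e := hrun j hj σ l
    have hpos : (run P ω (t + A.card * P.T0) j).pos = σ.pos := by rw [e]; rfl
    have hact : σ.updateActive.act = A := by
      simp [State.updateActive, l.act, l.decl]
    have hn : ∀ i ∈ A, σ.n i = P.T0 := by
      intro i hi
      have h1 : (σ.n i : ℝ) = P.T0 := by
        rw [l.n i]
        have hvis := card_visits (hq j hj) hi P.T0
        refine le_antisymm ?_ ?_
        · refine (csum_le_card (q := fun s => hop A s (run P ω t j).pos = i)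
            (fun s hs hh => absurd hh.1 (by omega)) fun s hs hh => ?_).trans (Nat.cast_le.2 hvis.le)
          rw [← hpull s hs j hj]; exact hh.2
        · refine (Nat.cast_le.2 hvis.ge).trans
            (card_le_csum fun s hs hh => ⟨Nat.le_add_right _ _, ?_⟩)
          rw [hpull s hs j hj]; exact hh
      exact_mod_cast h1
    refine ⟨by rw [e], ?_, by rw [e], by rw [e]; exact hact, ?_, ?_, fun i hi => ?_, fun i hi => ?_,
      fun i hi => ?_⟩
    · rw [e]
      simp only
      rw [hact, l.Td, mul_assoc, Nat.mul_sub]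
    · rw [e]
      have := l.Mp
      rw [Finset.sdiff_empty] at this
      exact this
    · rw [hpos, l.pos]; exact hop_mem (hq j hj) _
    · rw [e]
      simp only
      -- The T_0 pulls of the reception block make up for the T_0 cycles by which the coming phase
      -- is shortened.
      rw [l.N, hn i hi]
      have := r.informed.count i hi
      have h1 : 2 ^ (p + 1 + 1) * P.T0 = 2 * (2 ^ (p + 1) * P.T0) := by ring
      have h2 : P.T0 ≤ 2 ^ (p + 1) * P.T0 := Nat.le_mul_of_pos_left _ (by positivity)
      omega
    · rw [e]
      simp only
      rw [l.S, r.S i hi, l.s i, csum_split (Explored P ω j i)]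
      congr 1
      refine csum_congr _ fun s hs => ?_
      constructor
      · rintro ⟨g1, g2, g3⟩
        exact ⟨g1, ((hexp j hj i s g1 hs).1).2 g2⟩
      · rintro ⟨g1, g2⟩
        exact ⟨g1, ((hexp j hj i s g1 hs).1).1 g2, (hexp j hj i s g1 hs).2⟩
    · rw [e]
      simp only
      push_cast
      rw [l.N, r.N i hi, l.n i, csum_split (Explored P ω j i)]
      congr 1
      refine csum_congr _ fun s hs => ?_
      constructor
      · rintro ⟨g1, g2⟩
        exact ⟨g1, ((hexp j hj i s g1 hs).1).2 g2⟩
      · rintro ⟨g1, g2⟩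
        exact ⟨g1, ((hexp j hj i s g1 hs).1).1 g2⟩
  · obtain ⟨σ, l⟩ := hlast j hj
    obtain ⟨σ', l'⟩ := hlast j' hj'
    rw [hrun j hj σ l, hrun j' hj' σ' l'] at hjj
    simp only [State.updateActive, l.pos, l'.pos] at hjj
    exact h.inj j hj j' hj' (hop_inj (hq j hj) (hq j' hj') _ hjj)

/-- After signals the players find new seats by Musical Chairs. -/
theorem BlockStart.restart (h : BlockStart P ω ν Top m p t A D U seat) (hp : 1 ≤ p)
    (good : Good P ν H ω) (env : Env P ν M Top m) (hL : 1 ≤ A.card * P.T0) (hU : U.Nonempty)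
    (hD : D.Nonempty) (hpT : p + 1 ≤ Nat.log 2 P.T + 2)
    (hH : t + A.card * P.T0 + A.card * P.Tc ≤ H)
    (hrec : ∀ j ∈ U, (run P ω t j).mode = .receive) :
    ExploreStart P ω Top (p + 1) (t + A.card * P.T0 + (A \ D).card * P.Tc) (A \ D)
      (2 ^ (p + 1) * P.T0) U seat := by
  obtain ⟨hwin, hlast⟩ := h.lastBlock hp good env hL (by omega) hrec
  have hrun : ∀ j ∈ U, ∀ σ, LastBlock P ω Top p t A D j σ →
      run P ω (t + A.card * P.T0) j = { σ.updateActive with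
        p := p + 1, mode := .chairs false none, left := σ.updateActive.act.card * P.Tc } := by
    intro j hj σ l
    rw [l.run]
    unfold State.startPhase
    rw [if_pos (by simp [State.updateActive, l.decl, hD.card_pos])]
  have : Nonempty (State K) := ⟨run P ω 0 hU.choose⟩
  choose! σ l using hlast
  have hact : ∀ j ∈ U, (run P ω (t + A.card * P.T0) j).act = A \ D := by
    intro j hj
    rw [hrun j hj _ (l j hj)]
    simp [State.updateActive, (l j hj).act, (l j hj).decl]
  have hUle : U.card ≤ (A \ D).card := by
    rw [h.seated.card]; exact Finset.card_le_card Finset.inter_subset_right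
  have hle : (A \ D).card * P.Tc ≤ A.card * P.Tc :=
    Nat.mul_le_mul_right _ (Finset.card_le_card Finset.sdiff_subset)
  have hseat2 := h.seated.add (A.card * P.T0)
  -- In the last round of the block the phase counter is still `p`, and it is monotone.
  have hpast : ∀ s < t + A.card * P.T0, ∀ j ∈ U,
      ¬ Seeking P ω j (p + 1) (A \ D).card s := by
    rintro s hs j hj ⟨-, -, hp', -⟩
    have hmono := run_p_mono (P := P) (ω := ω) j
      (show s ≤ t + (A.card * P.T0 - 1) by omega)
    simp only at hmono
    rw [hp', (hwin (A.card * P.T0 - 1) (by omega) j hj).1.p, (h.ready j hj).informed.phase] at hmono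
    omega
  obtain ⟨hch, f, τ, hf, hinj, hτ⟩ := chairs_window (U := U) (A := A \ D) (t := t + A.card * P.T0)
    (b := false) (p := p + 1) good env.pick (hU.card_pos.trans_le hUle) env.Tc_pos hUle
    (fun j hj => ⟨seat j, h.seated.seat_notMem j hj, hseat2.exploit j hj⟩)
    (fun j hj => by rw [hrun j hj _ (l j hj)])
    (fun j hj => by
      rw [← hact j hj, hrun j hj _ (l j hj)])
    hact (fun j hj => by rw [hrun j hj _ (l j hj)]) hpT (by omega) hpast
  have hrun' : ∀ j ∈ U, run P ω (t + A.card * P.T0 + (A \ D).card * P.Tc) j = { τ j with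
      mode := .explore, pos := f j, left := (τ j).act.card * 2 ^ (τ j).p * P.T0 } := by
    intro j hj
    obtain ⟨g1, g2, -⟩ := hτ j hj
    rw [g1, finish_chairs g2]
  -- A reception block after signals and Musical Chairs do not count for exploration, matching the
  -- statistics the algorithm discards.
  have hnot : ∀ j ∈ U, ∀ s < A.card * P.T0 + (A \ D).card * P.Tc, ¬ Exploring P ω j (t + s) := by
    intro j hj s hs
    rcases lt_or_ge s (A.card * P.T0) with h1 | h1
    · obtain ⟨g1, g2, -⟩ := hwin s h1 j hj
      rintro (h2 | ⟨h2, -⟩)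
      · rw [g2] at h2; simp at h2
      · rw [g1.decl, (h.ready j hj).decl] at h2
        exact hD.ne_empty h2
    · obtain ⟨g, hg⟩ := hch (s - A.card * P.T0) (by omega) j hj
      rw [add_assoc, Nat.add_sub_cancel' h1] at hg
      exact not_exploring_of_mode (by simp [hg]) (by simp [hg]) (by simp [hg])
  refine ⟨hseat2.add _, fun j hj => ?_, fun j hj j' hj' hjj => ?_⟩
  · obtain ⟨-, -, g3, g4⟩ := hτ j hj
    have lj := l j hj
    have r := h.ready j hj
    have hr := hrun j hj _ lj
    have e := hrun' j hj
    have hp' : (τ j).p = p + 1 := by rw [g3.p, hr]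
    have hact' : (τ j).act = A \ D := g3.act.trans (hact j hj)
    have hS : (τ j).S = (run P ω t j).S := by rw [g4.S, hr, ← lj.S]; rfl
    have hN : (τ j).N = (run P ω t j).N := by rw [g4.N, hr, ← lj.N]; rfl
    refine ⟨by rw [e], ?_, by rw [e]; exact hp', by rw [e]; exact hact', ?_,
      by rw [e]; exact hf j hj, fun i hi => ?_, fun i hi => ?_, fun i hi => ?_⟩
    · rw [e]; simp only [hact', hp']; rw [mul_assoc]
    · rw [e]; simp only; rw [g3.Mp, hr]; exact lj.Mp
    · rw [e]; simp only; rw [hN]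
      have := r.informed.count i (Finset.mem_sdiff.1 hi).1
      have h1 : 2 ^ (p + 1 + 1) * P.T0 = 2 * (2 ^ (p + 1) * P.T0) := by ring
      omega
    · rw [e]; simp only
      rw [hS, r.S i (Finset.mem_sdiff.1 hi).1, add_assoc,
        csum_add_of_not _ fun s hs hh => hnot j hj s hs hh.2]
    · rw [e]; simp only
      rw [hN, r.N i (Finset.mem_sdiff.1 hi).1, add_assoc,
        csum_add_of_not _ fun s hs hh => hnot j hj s hs hh.2]
  · rw [hrun' j hj, hrun' j' hj'] at hjj
    exact hinj j hj j' hj' hjj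

end NextPhase


/-! ### Accounting of the loss over all phases. -/

section Cost

variable {K M : ℕ} {P : Params K} {ω : Sample K M} {ν : Fin K → Measure ℝ} {H : ℕ}
  {Top : Finset (Fin K)} {m : ℝ} {A : Finset (Fin K)} {U : Finset (Fin M)}
  {seat : Fin M → Fin K} {p t c : ℕ}

/-- Loss of the first `t` rounds. -/
noncomputable def cum (P : Params K) (ν : Fin K → Measure ℝ) (ω : Sample K M) (t : ℕ) : ℝ :=
  ∑ s ∈ Finset.range t, loss P ν ω s

theorem cum_add (t L : ℕ) :
    cum P ν ω (t + L) = cum P ν ω t + ∑ s ∈ Finset.range L, loss P ν ω (t + s) :=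
  Finset.sum_range_add _ _ _

theorem Env.cum_mono (env : Env P ν M Top m) (ω : Sample K M) : Monotone (cum P ν ω) :=
  monotone_nat_of_le_succ fun t => by
    rw [cum_add]; simpa using env.loss_nonneg ω t

theorem Env.cum_le (env : Env P ν M Top m) (ω : Sample K M) {t t' n : ℕ} (h : t' ≤ t + n) :
    cum P ν ω t' ≤ cum P ν ω t + M * n := by
  refine (env.cum_mono ω h).trans ?_
  rw [cum_add]
  have : ∑ s ∈ Finset.range n, loss P ν ω (t + s) ≤ ∑ _s ∈ Finset.range n, (M : ℝ) :=
    Finset.sum_le_sum fun s _ => loss_le (fun k => (env.mean_pos k).le) env.mean_le ω _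
  rw [Finset.sum_const, Finset.card_range, nsmul_eq_mul] at this
  linarith

/-- As a double sum over pairs of a bad and a top arm, `gap` is visibly nonnegative and is
controlled by the largest difference of means, charged to each bad arm separately. -/
theorem gap_eq (ν : Fin K → Measure ℝ) (Top A : Finset (Fin K)) :
    gap ν Top A = ∑ b ∈ A \ Top, ∑ g ∈ Top ∩ A, (mean ν g - mean ν b) := by
  have h1 : ((A \ Top).card : ℝ) + (Top ∩ A).card = A.card := by
    rw [Finset.inter_comm]; exact_mod_cast Finset.card_sdiff_add_card_inter A Top
  have h2 := Finset.sum_inter_add_sum_sdiff A Top (mean ν)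
  rw [Finset.inter_comm] at h2
  unfold gap
  simp only [Finset.sum_sub_distrib, Finset.sum_const, nsmul_eq_mul]
  rw [← h1, ← h2, ← Finset.mul_sum]
  ring

theorem Env.gap_nonneg (env : Env P ν M Top m) (A : Finset (Fin K)) : 0 ≤ gap ν Top A := by
  rw [gap_eq]
  refine Finset.sum_nonneg fun b hb => Finset.sum_nonneg fun g hg => ?_
  linarith [env.le_top g (Finset.mem_inter.1 hg).1, env.bad_le b (Finset.mem_sdiff.1 hb).2]

theorem gap_le_sum {w : ℝ} (h : ∀ b ∈ A \ Top, ∀ g ∈ Top ∩ A, mean ν g - mean ν b ≤ w) :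
    gap ν Top A ≤ ∑ _b ∈ A \ Top, (Top ∩ A).card * w := by
  rw [gap_eq]
  refine Finset.sum_le_sum fun b hb => ?_
  calc ∑ g ∈ Top ∩ A, (mean ν g - mean ν b) ≤ (Top ∩ A).card • w :=
        Finset.sum_le_card_nsmul _ _ _ fun g hg => h b hb g hg
    _ = (Top ∩ A).card * w := nsmul_eq_mul _ _

theorem Env.card_inter_le (env : Env P ν M Top m) (A : Finset (Fin K)) :
    ((Top ∩ A).card : ℝ) ≤ M := by
  rw [← env.card]; exact_mod_cast Finset.card_le_card Finset.inter_subset_left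

theorem Env.gap_le (env : Env P ν M Top m) (A : Finset (Fin K)) : gap ν Top A ≤ M * K := by
  refine (gap_le_sum (w := 1) fun b _ g _ => by linarith [env.mean_le g, env.mean_pos b]).trans ?_
  rw [Finset.sum_const, nsmul_eq_mul, mul_one, mul_comm]
  have h1 : ((A \ Top).card : ℝ) ≤ K := by
    exact_mod_cast (Finset.card_le_univ _).trans (by simp)
  exact mul_le_mul (env.card_inter_le A) h1 (Nat.cast_nonneg _) (Nat.cast_nonneg _)

theorem card_le (A : Finset (Fin K)) : A.card ≤ K := (Finset.card_le_univ A).trans (by simp)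

theorem Seated.nonempty (h : Seated P ω t Top A U seat) (hU : U.Nonempty) : 1 ≤ A.card := by
  have h1 := h.card
  have h2 := hU.card_pos
  have h3 := Finset.card_le_card (Finset.inter_subset_right : Top ∩ A ⊆ A)
  omega

/-- From one exploration phase to the next one, or to the time when all players are settled. -/
theorem ExploreStart.next (h : ExploreStart P ω Top p t A c U seat) (hp : 1 ≤ p) (hc : 1 ≤ c)
    (hU : U.Nonempty) (good : Good P ν H ω) (env : Env P ν M Top m)
    (hpT : p + 1 ≤ Nat.log 2 P.T + 2)
    (hH : t + A.card * c + (A.card + 2) * (A.card * P.T0) ≤ H) :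
    (∃ t' B seat', Seated P ω t' Top B ∅ seat' ∧
      cum P ν ω t' ≤ cum P ν ω t + c * gap ν Top A + M * (K * (K * P.T0))) ∨
    ∃ t' D c' U' seat', D ⊆ A ∧ U'.Nonempty ∧
      ExploreStart P ω Top (p + 1) t' (A \ D) c' U' seat' ∧
      1 ≤ c' ∧ c' ≤ 2 ^ (p + 1) * P.T0 ∧ 2 ^ (p + 1) * P.T0 ≤ c' + P.T0 ∧
      (∀ i ∈ A \ D, (i ∉ Top → m - mean ν i < 4 * width P p) ∧
        (i ∈ Top → mean ν i - m < 4 * width P p)) ∧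
      cum P ν ω t' + c' * gap ν Top (A \ D) ≤ cum P ν ω t + c * gap ν Top A
        + 2 ^ (p + 1) * P.T0 * gap ν Top (A \ D) + 3 * (M * (K * P.T0)) * D.card := by
  have hT0 := env.T0_ge
  have hTc := env.Tc_le
  have hA := h.seated.nonempty hU
  have hL0 : 1 ≤ A.card * c := Nat.mul_pos hA hc
  have hL : 1 ≤ A.card * P.T0 := Nat.mul_pos hA (by omega)
  have hAK := card_le A
  have hcum : cum P ν ω (t + A.card * c) = cum P ν ω t + c * gap ν Top A := by
    rw [cum_add, (h.window env hL0).2]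
  have hH1 : t + A.card * c + (A.card + 1) * (A.card * P.T0) + A.card * P.T0 ≤ H := by
    refine le_trans (le_of_eq ?_) hH; ring
  have hb := h.blockStart good env hp hL0 (by omega)
  obtain ⟨t₁, D, U', seat', -, ht1, ht2, hb', hrec⟩ := hb.exists_last hp good env hL (by
    rw [Finset.card_empty, Nat.sub_zero]; omega)
  rw [Finset.card_empty, Nat.sub_zero] at ht2
  have hDA := Finset.card_le_card hb'.sub
  have hDmul : D.card * (A.card * P.T0) ≤ A.card * (A.card * P.T0) := Nat.mul_le_mul_right _ hDA
  have hAT : A.card * P.T0 ≤ K * P.T0 := Nat.mul_le_mul_right _ hAK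
  have hTcA : A.card * P.Tc ≤ A.card * P.T0 := Nat.mul_le_mul_left _ (by omega)
  have hsplit : (A.card + 1) * (A.card * P.T0) = A.card * (A.card * P.T0) + A.card * P.T0 := by ring
  rcases U'.eq_empty_or_nonempty with rfl | hU'
  · refine Or.inl ⟨t₁, A \ D, seat', hb'.seated, ?_⟩
    -- At most |D| ≤ K blocks of at most K T_0 rounds were executed, at loss at most `M` per round.
    have h1 := env.cum_le ω (ht2.trans (Nat.add_le_add_left
      (Nat.mul_le_mul (hDA.trans hAK) hAT) _))
    rw [hcum] at h1
    push_cast at h1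
    exact h1
  · right
    rcases D.eq_empty_or_nonempty with rfl | hD
    · rw [Finset.card_empty, zero_mul, add_zero] at ht2
      obtain rfl : t₁ = t + A.card * c := le_antisymm ht2 ht1
      obtain ⟨g1, g2⟩ := hb'.continue hp good env hL (by omega) hrec
      have hle : P.T0 ≤ 2 ^ (p + 1) * P.T0 := Nat.le_mul_of_pos_left _ (by positivity)
      have hle2 : 2 * P.T0 ≤ 2 ^ (p + 1) * P.T0 := by
        refine Nat.mul_le_mul_right _ ?_
        calc 2 = 2 ^ 1 := rfl
          _ ≤ 2 ^ (p + 1) := Nat.pow_le_pow_right (by norm_num) (by omega)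
      refine ⟨t + A.card * c + A.card * P.T0, ∅, 2 ^ (p + 1) * P.T0 - P.T0, U', seat', Finset.empty_subset _, hU', ?_, by omega,
        by omega, by omega, fun i hi => hb'.close hU' hrec hi, ?_⟩
      · rw [Finset.sdiff_empty]; exact g1
      -- Without signals the reception block is part of phase p + 1: T_0 + c' = 2^(p+1) T_0, so
      -- communication costs nothing extra and the balance is an equality.
      · rw [Finset.sdiff_empty, cum_add, g2, hcum, Nat.cast_sub hle]
        push_cast
        apply le_of_eq
        simp
        ring
    · have g := hb'.restart hp good env hL hU' hD hpT (by omega) hrec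
      refine ⟨_, D, 2 ^ (p + 1) * P.T0, U', seat', hb'.sub, hU', g, ?_, le_rfl, by omega,
        fun i hi => hb'.close hU' hrec hi, ?_⟩
      · exact Nat.mul_pos (by positivity) (by omega)
      · have hD1 := hD.card_pos
        have hle : (A \ D).card * P.Tc ≤ A.card * P.T0 :=
          Nat.mul_le_mul (Finset.card_le_card Finset.sdiff_subset) (by omega)
        -- At most |D| blocks precede the last one. Together with it and Musical Chairs, each at
        -- most K T_0 rounds long, and since |D| ≥ 1, everything is charged to the |D| removed arms.
        have htime : t₁ + A.card * P.T0 + (A \ D).card * P.Tc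
            ≤ t + A.card * c + 3 * (K * P.T0) * D.card := by
          have h2 : D.card * (A.card * P.T0) ≤ D.card * (K * P.T0) := Nat.mul_le_mul_left _ hAT
          have h3 : 1 * (K * P.T0) ≤ D.card * (K * P.T0) := Nat.mul_le_mul_right _ hD1
          have h4 : 3 * (K * P.T0) * D.card = 3 * (D.card * (K * P.T0)) := by ring
          omega
        have h1 := env.cum_le ω htime
        rw [hcum] at h1
        push_cast at h1 ⊢
        linarith

/-- The rounds of exploration of different arms are different. -/
theorem sum_explored_le (j : Fin M) (A : Finset (Fin K)) (t : ℕ) :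
    ∑ i ∈ A, csum (Explored P ω j i) 1 t ≤ t := by
  classical
  unfold csum
  rw [Finset.sum_comm]
  calc ∑ s ∈ Finset.range t, ∑ i ∈ A, (if Explored P ω j i s then (1 : ℕ → ℝ) s else 0)
      ≤ ∑ s ∈ Finset.range t, (1 : ℝ) := by
        refine Finset.sum_le_sum fun s _ => ?_
        calc ∑ i ∈ A, (if Explored P ω j i s then (1 : ℕ → ℝ) s else 0)
            ≤ ∑ i ∈ A, (if pull P ω s j = i then (1 : ℝ) else 0) := by
              refine Finset.sum_le_sum fun i _ => ?_
              by_cases h : Explored P ω j i s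
              · rw [if_pos h, if_pos h.1]; simp
              · rw [if_neg h]; split_ifs <;> norm_num
          _ ≤ 1 := by rw [Finset.sum_ite_eq]; split_ifs <;> norm_num
    _ = t := by simp

/-- A player has already counted at least (2^p - 2) T_0 pulls of each active arm, and these took
place in different rounds before `t`. It bounds both the length of a phase and the number of phases
in terms of the elapsed time. -/
theorem ExploreStart.card_mul_le (h : ExploreStart P ω Top p t A c U seat) (hU : U.Nonempty)
    (hc : c ≤ 2 ^ p * P.T0) : A.card * (2 ^ p * P.T0) ≤ t + A.card * (2 * P.T0) := by
  obtain ⟨j, hj⟩ := hU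
  have e := h.explorer j hj
  have h1 : ∀ i ∈ A, 2 ^ p * P.T0 ≤ (run P ω t j).N i + 2 * P.T0 := by
    intro i hi
    have := e.count i hi
    have h2 : 2 ^ (p + 1) * P.T0 = 2 * (2 ^ p * P.T0) := by ring
    omega
  have h2 : ∑ i ∈ A, (run P ω t j).N i ≤ t := by
    have := sum_explored_le (P := P) (ω := ω) j A t
    rw [← Finset.sum_congr rfl e.N] at this
    exact_mod_cast this
  calc A.card * (2 ^ p * P.T0) ≤ ∑ i ∈ A, ((run P ω t j).N i + 2 * P.T0) := by
        rw [← smul_eq_mul]; exact Finset.card_nsmul_le_sum _ _ _ h1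
    _ ≤ t + A.card * (2 * P.T0) := by
        rw [Finset.sum_add_distrib, Finset.sum_const, smul_eq_mul]; omega

/-- Bound of the loss due to the arm `b` in exploration phase `q`. -/
noncomputable def phaseCost (P : Params K) (ν : Fin K → Measure ℝ) (M : ℕ) (m : ℝ) (q : ℕ)
    (b : Fin K) : ℝ :=
  if m - mean ν b ≤ 4 * width P (q - 1) then
    8 * width P (q - 1) * min ((M : ℝ) * (2 ^ q * P.T0)) (2 * P.T) else 0

theorem width_nonneg (P : Params K) (p : ℕ) : 0 ≤ width P p := Real.sqrt_nonneg _

theorem phaseCost_nonneg (q : ℕ) (b : Fin K) : 0 ≤ phaseCost P ν M m q b := by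
  unfold phaseCost
  have := width_nonneg P (q - 1)
  split_ifs
  · positivity
  · exact le_rfl

/-- After communication each remaining arm is within four widths of `m`, so a top and a bad arm
differ by at most eight. The number of remaining top arms is at most M, and also at most |A|, which
is where the bound 2T comes from. -/
theorem ExploreStart.gap_le (h : ExploreStart P ω Top (p + 1) t A c U seat) (hp : 1 ≤ p)
    (hU : U.Nonempty) (hc : c ≤ 2 ^ (p + 1) * P.T0) (env : Env P ν M Top m) (ht : t ≤ P.T)
    (hclose : ∀ i ∈ A, (i ∉ Top → m - mean ν i < 4 * width P p) ∧
      (i ∈ Top → mean ν i - m < 4 * width P p)) :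
    2 ^ (p + 1) * P.T0 * gap ν Top A ≤ ∑ b ∈ Topᶜ, phaseCost P ν M m (p + 1) b := by
  have hw := width_nonneg P p
  have h1 : gap ν Top A ≤ ∑ _b ∈ A \ Top, (Top ∩ A).card * (8 * width P p) :=
    gap_le_sum fun b hb g hg => by
      have e1 := (hclose b (Finset.mem_sdiff.1 hb).1).1 (Finset.mem_sdiff.1 hb).2
      have e2 := (hclose g (Finset.mem_inter.1 hg).2).2 (Finset.mem_inter.1 hg).1
      linarith
  have hz : (0 : ℝ) ≤ 2 ^ (p + 1) * P.T0 := by positivity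
  have h2 : ((Top ∩ A).card : ℝ) * (2 ^ (p + 1) * P.T0)
      ≤ min ((M : ℝ) * (2 ^ (p + 1) * P.T0)) (2 * P.T) := by
    refine le_min (mul_le_mul_of_nonneg_right (env.card_inter_le A) hz) ?_
    have h3 := h.card_mul_le hU hc
    -- The correction |A| 2 T_0 in `ExploreStart.card_mul_le` is at most half of the left side
    -- there, whence |A| 2^(p+1) T_0 ≤ 2t.
    have h4 : 2 * (2 * P.T0) ≤ 2 ^ (p + 1) * P.T0 := by
      rw [← mul_assoc]
      exact Nat.mul_le_mul_right _ (Nat.pow_le_pow_right (n := 2) (by norm_num)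
        (show 2 ≤ p + 1 by omega))
    have h5 := Nat.mul_le_mul_left A.card h4
    have h6 : A.card * (2 * (2 * P.T0)) = 2 * (A.card * (2 * P.T0)) := by ring
    have h7 : A.card * (2 ^ (p + 1) * P.T0) ≤ 2 * P.T := by omega
    have h8 : ((Top ∩ A).card : ℝ) ≤ A.card := by
      exact_mod_cast Finset.card_le_card Finset.inter_subset_right
    refine (mul_le_mul_of_nonneg_right h8 hz).trans ?_
    exact_mod_cast h7
  calc 2 ^ (p + 1) * P.T0 * gap ν Top A
      ≤ 2 ^ (p + 1) * P.T0 * ∑ _b ∈ A \ Top, (Top ∩ A).card * (8 * width P p) :=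
        mul_le_mul_of_nonneg_left h1 hz
    _ = ∑ _b ∈ A \ Top, 8 * width P p * ((Top ∩ A).card * (2 ^ (p + 1) * P.T0)) := by
        rw [Finset.mul_sum]; exact Finset.sum_congr rfl fun b _ => by ring
    _ ≤ ∑ b ∈ A \ Top, phaseCost P ν M m (p + 1) b := by
        refine Finset.sum_le_sum fun b hb => ?_
        have e1 := (hclose b (Finset.mem_sdiff.1 hb).1).1 (Finset.mem_sdiff.1 hb).2
        unfold phaseCost
        rw [Nat.add_sub_cancel, if_pos e1.le]
        exact mul_le_mul_of_nonneg_left h2 (by positivity)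
    _ ≤ ∑ b ∈ Topᶜ, phaseCost P ν M m (p + 1) b := by
        refine Finset.sum_le_sum_of_subset_of_nonneg (fun b hb => ?_)
          fun b _ _ => phaseCost_nonneg _ _
        exact Finset.mem_compl.2 (Finset.mem_sdiff.1 hb).2

theorem Seated.cum_eq (h : Seated P ω t Top A ∅ seat) (env : Env P ν M Top m) (n : ℕ) :
    cum P ν ω (t + n) = cum P ν ω t := by
  rw [cum_add, Finset.sum_eq_zero fun s _ => (h.add s).loss_eq_zero env, add_zero]

/-- Loss of the first phases. -/
theorem cum_dichotomy (good : Good P ν (8 * P.T) ω) (env : Env P ν M Top m) (hM : 1 ≤ M)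
    (hMK : M ≤ K) (hKT : K * (K * P.T0) ≤ P.T) (hp : 1 ≤ p) (hpT : p ≤ Nat.log 2 P.T + 2) :
    (∃ t A c U seat, ExploreStart P ω Top p t A c U seat ∧ U.Nonempty ∧ 1 ≤ c ∧
      c ≤ 2 ^ p * P.T0 ∧ t ≤ P.T ∧
      cum P ν ω t + c * gap ν Top A ≤ 3 * (M * (K * P.T0))
        + 3 * (M * (K * P.T0)) * (K - A.card)
        + ∑ q ∈ Finset.Icc 2 p, ∑ b ∈ Topᶜ, phaseCost P ν M m q b) ∨
    cum P ν ω P.T ≤ 8 * (M * (K * (K * P.T0)))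
      + ∑ q ∈ Finset.Icc 2 p, ∑ b ∈ Topᶜ, phaseCost P ν M m q b := by
  have hK : 1 ≤ K := hM.trans hMK
  have hT0 := env.T0_ge
  have hTc := env.Tc_le
  have hK1 : K * P.T0 ≤ K * (K * P.T0) := Nat.le_mul_of_pos_left _ hK
  have hKTc : 3 * K * P.Tc ≤ K * P.T0 := by
    calc 3 * K * P.Tc = K * (3 * P.Tc) := by ring
      _ ≤ K * P.T0 := Nat.mul_le_mul_left _ hTc
  have hy : (0 : ℝ) ≤ M * (K * P.T0) := by positivity
  have hyK : (M : ℝ) * (K * P.T0) ≤ M * (K * (K * P.T0)) :=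
    mul_le_mul_of_nonneg_left (by exact_mod_cast hK1) (Nat.cast_nonneg _)
  have hyK2 : (M : ℝ) * (K * P.T0) * K = M * (K * (K * P.T0)) := by ring
  induction p, hp using Nat.le_induction with
  | base =>
    left
    obtain ⟨hne, f, hf, hrun⟩ := initialization good env hM hMK (by omega)
    have : Nonempty (Fin M) := ⟨⟨0, hM⟩⟩
    refine ⟨3 * K * P.Tc, Finset.univ, 2 * P.T0, Finset.univ, f, ⟨⟨?_, ?_, ?_, ?_, ?_⟩,
      fun j _ => ?_, fun j _ j' _ hjj => ?_⟩, Finset.univ_nonempty, by omega, by simp, by omega, ?_⟩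
    · exact fun j hj => absurd (Finset.mem_univ j) hj
    · exact fun j hj => absurd (Finset.mem_univ j) hj
    · exact fun j hj => absurd (Finset.mem_univ j) hj
    · exact fun j hj => absurd (Finset.mem_univ j) hj
    · rw [Finset.inter_univ, env.card]; simp
    · obtain ⟨σ, rfl, h1, h2, h3, h4, h5, h6, h7⟩ := hrun j
      refine ⟨h1, by rw [h2]; simp, h3, h4, ?_, Finset.mem_univ _, fun i _ => ?_, fun i _ => ?_,
        fun i _ => ?_⟩
      · rw [h5, Finset.inter_univ, env.card]
      · rw [(h7 i).2]; ring
      · rw [(h7 i).1, csum_eq_zero _ fun s hs hh => hne s hs j hh.2]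
      · rw [(h7 i).2, csum_eq_zero _ fun s hs hh => hne s hs j hh.2]; simp
    · obtain ⟨σ, rfl, -, -, -, -, -, h6, -⟩ := hrun j
      obtain ⟨σ', rfl, -, -, -, -, -, h6', -⟩ := hrun j'
      rw [h6, h6'] at hjj
      exact hf hjj
    -- The initialization lasts 3 K T_c ≤ K T_0 rounds, and the 2 T_0 cycles of the first phase cost
    -- at most 2 T_0 M K.
    · have h1 := env.cum_le ω (t := 0) (t' := 3 * K * P.Tc) (n := K * P.T0) (by omega)
      have h2 := mul_le_mul_of_nonneg_left (env.gap_le (Finset.univ : Finset (Fin K)))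
        (Nat.cast_nonneg (2 * P.T0))
      have h3 : cum P ν ω 0 = 0 := by simp [cum]
      rw [h3] at h1
      push_cast at h1 h2 ⊢
      have h4 : 2 * (P.T0 : ℝ) * (M * K) = 2 * (M * (K * P.T0)) := by ring
      simp only [Finset.card_fin, sub_self, mul_zero, add_zero]
      rw [h4] at h2
      simp
      linarith
  | succ p hp ih =>
    have hsum : ∑ q ∈ Finset.Icc 2 (p + 1), ∑ b ∈ Topᶜ, phaseCost P ν M m q b
        = (∑ q ∈ Finset.Icc 2 p, ∑ b ∈ Topᶜ, phaseCost P ν M m q b)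
          + ∑ b ∈ Topᶜ, phaseCost P ν M m (p + 1) b :=
      Finset.sum_Icc_succ_top (by omega) _
    have hE : 0 ≤ ∑ b ∈ Topᶜ, phaseCost P ν M m (p + 1) b :=
      Finset.sum_nonneg fun b _ => phaseCost_nonneg _ _
    rw [hsum]
    rcases ih (by omega) with ⟨t, A, c, U, seat, h, hU, hc, hc', ht, hcost⟩ | hdone
    · have hAK := card_le A
      have hAT : A.card * P.T0 ≤ K * P.T0 := Nat.mul_le_mul_right _ hAK
      have hAAT : A.card * (A.card * P.T0) ≤ K * (K * P.T0) := Nat.mul_le_mul hAK hAT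
      have h1 := h.card_mul_le hU hc'
      have h2 : A.card * c ≤ A.card * (2 ^ p * P.T0) := Nat.mul_le_mul_left _ hc'
      have h3 : A.card * (2 * P.T0) = 2 * (A.card * P.T0) := by ring
      have h4 : (A.card + 2) * (A.card * P.T0)
          = A.card * (A.card * P.T0) + 2 * (A.card * P.T0) := by ring
      have hAR : ((A.card : ℕ) : ℝ) ≤ K := by exact_mod_cast hAK
      have hA0 : (0 : ℝ) ≤ M * (K * P.T0) * A.card := by positivity
      -- With t ≤ T, |A| c ≤ t + 2|A| T_0 and K² T_0 ≤ T, the next phase starts within 7T rounds.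
      -- The run is followed beyond the horizon so that phases need not be cut, hence the 8T in
      -- `Good`.
      rcases h.next hp hc hU good env hpT (by omega) with
        ⟨t', B, seat', hs, hcum⟩ | ⟨t', D, c', U', seat', hDA, hU', h', hc1, hc2, hc3, hclose, hcum⟩
      · right
        have e := hs.cum_eq env P.T
        have e2 := env.cum_mono ω (Nat.le_add_left P.T t')
        rw [e] at e2
        linarith
      · have hcard : ((A \ D).card : ℝ) = A.card - D.card := by
          rw [Finset.card_sdiff_of_subset hDA, Nat.cast_sub (Finset.card_le_card hDA)]
        have hD0 : (D.card : ℝ) ≤ A.card := by exact_mod_cast Finset.card_le_card hDA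
        rcases le_or_gt t' P.T with ht' | ht'
        · left
          refine ⟨t', A \ D, c', U', seat', h', hU', hc1, hc2, ht', ?_⟩
          have e := h'.gap_le hp hU' hc2 env ht' hclose
          rw [hcard]
          linarith
        · right
          have e2 := env.cum_mono ω ht'.le
          -- The prepaid cost c' `gap` on the left cancels the cost of phase p + 1 up to T_0 `gap` ≤
          -- M K T_0.
          have e3 : (2 : ℝ) ^ (p + 1) * P.T0 ≤ c' + P.T0 := by exact_mod_cast hc3
          have e4 := mul_le_mul_of_nonneg_right e3 (env.gap_nonneg (A \ D))
          have e5 := mul_le_mul_of_nonneg_left (env.gap_le (A \ D)) (Nat.cast_nonneg P.T0)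
          have e6 : (P.T0 : ℝ) * (M * K) = M * (K * P.T0) := by ring
          have e7 := mul_le_mul_of_nonneg_left hD0 hy
          rw [e6] at e5
          linarith
    · right; linarith

/-- Loss up to the horizon on the good event. -/
theorem cum_horizon_le (good : Good P ν (8 * P.T) ω) (env : Env P ν M Top m) (hM : 1 ≤ M)
    (hMK : M ≤ K) (hT : 1 ≤ P.T) (hKT : K * (K * P.T0) ≤ P.T) :
    cum P ν ω P.T ≤ 8 * (M * (K * (K * P.T0)))
      + ∑ b ∈ Topᶜ, ∑ q ∈ Finset.Icc 2 (Nat.log 2 P.T + 2), phaseCost P ν M m q b := by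
  rw [Finset.sum_comm]
  refine (cum_dichotomy good env hM hMK hKT (by omega) le_rfl).resolve_left ?_
  rintro ⟨t, A, c, U, seat, h, hU, -, hc', ht, -⟩
  have h1 := h.card_mul_le hU hc'
  have hA := h.seated.nonempty hU
  have hlog : P.T < 2 ^ (Nat.log 2 P.T + 1) := Nat.lt_pow_succ_log_self (by norm_num) _
  have h2 : 2 ^ (Nat.log 2 P.T + 2) = 2 * 2 ^ (Nat.log 2 P.T + 1) := by ring
  rw [h2] at h1
  have hT0 := env.T0_ge
  -- Since 2^(log₂ T + 2) ≥ 2(T + 1), a phase with this number would need more exploration than T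
  -- rounds provide.
  have h3 : A.card * (2 * P.T0) + A.card * (2 * P.T * P.T0)
      ≤ A.card * (2 * 2 ^ (Nat.log 2 P.T + 1) * P.T0) := by
    rw [← Nat.mul_add]
    refine Nat.mul_le_mul_left _ ?_
    rw [← Nat.add_mul]
    exact Nat.mul_le_mul_right _ (by omega)
  have h4 : 1 * (2 * P.T * 1) ≤ A.card * (2 * P.T * P.T0) :=
    Nat.mul_le_mul hA (Nat.mul_le_mul_left _ (by omega))
  omega

end Cost


/-! ### Summing the phase costs. -/

section Sums

theorem lt_sqrt_two : (1.4 : ℝ) < √2 := Real.lt_sqrt_of_sq_lt (by norm_num)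

/-- Geometric sums with ratio `√2` are dominated by their largest terms. -/
theorem sum_geometric_le {x X : ℝ} (hx : 0 ≤ x) (hX : 0 ≤ X) (Q : Finset ℕ)
    (h : ∀ q ∈ Q, x * √2 ^ q ≤ X) : ∑ q ∈ Q, x * √2 ^ q ≤ 4 * X := by
  have hr := lt_sqrt_two
  -- The constant 4 is reproduced by the induction because 4 ≤ 3 √2.
  have key : ∀ n, ∑ q ∈ Finset.range (n + 1), √2 ^ q ≤ 4 * √2 ^ n := by
    intro n
    induction n with
    | zero => norm_num
    | succ n ih =>
      rw [Finset.sum_range_succ, pow_succ]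
      have : (0 : ℝ) < √2 ^ n := by positivity
      nlinarith
  rcases Q.eq_empty_or_nonempty with rfl | hQ
  · simpa using hX
  · have hsub : Q ⊆ Finset.range (Q.max' hQ + 1) := fun q hq =>
      Finset.mem_range.2 (Nat.lt_succ_of_le (Q.le_max' q hq))
    calc ∑ q ∈ Q, x * √2 ^ q ≤ ∑ q ∈ Finset.range (Q.max' hQ + 1), x * √2 ^ q :=
          Finset.sum_le_sum_of_subset_of_nonneg hsub fun q _ _ => by positivity
      _ = x * ∑ q ∈ Finset.range (Q.max' hQ + 1), √2 ^ q := (Finset.mul_sum _ _ _).symm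
      _ ≤ x * (4 * √2 ^ Q.max' hQ) := mul_le_mul_of_nonneg_left (key _) hx
      _ = 4 * (x * √2 ^ Q.max' hQ) := by ring
      _ ≤ 4 * X := mul_le_mul_of_nonneg_left (h _ (Q.max'_mem hQ)) (by norm_num)

theorem sum_inv_geometric_le {x Y : ℝ} (hx : 0 < x) (hY : 0 < Y) (Q : Finset ℕ)
    (h : ∀ q ∈ Q, Y ≤ x * √2 ^ q) : ∑ q ∈ Q, (x * √2 ^ q)⁻¹ ≤ 4 * Y⁻¹ := by
  have hr := lt_sqrt_two
  -- Telescoping: each term is at most four times the difference to the next one, since 1/√2 ≤ 3/4.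
  have key : ∀ a n, ∑ q ∈ Finset.Ico a (a + n), (√2 ^ q)⁻¹
      ≤ 4 * ((√2 ^ a)⁻¹ - (√2 ^ (a + n))⁻¹) := by
    intro a n
    induction n with
    | zero => simp
    | succ n ih =>
      rw [← add_assoc, Finset.sum_Ico_succ_top (by omega), pow_succ, mul_inv]
      have h1 : (0 : ℝ) < (√2 ^ (a + n))⁻¹ := by positivity
      have h2 : (√2)⁻¹ ≤ (5 / 7 : ℝ) := by
        rw [inv_le_comm₀ (by positivity) (by norm_num)]
        norm_num at hr ⊢
        exact hr.le
      have h3 := mul_le_mul_of_nonneg_left h2 h1.le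
      linarith
  rcases Q.eq_empty_or_nonempty with rfl | hQ
  · simp; positivity
  · have hle : Q.min' hQ ≤ Q.max' hQ := Q.min'_le _ (Q.max'_mem hQ)
    have hsub : Q ⊆ Finset.Ico (Q.min' hQ) (Q.min' hQ + (Q.max' hQ - Q.min' hQ + 1)) := by
      intro q hq
      have h1 := Q.le_max' q hq
      have h2 := Q.min'_le q hq
      exact Finset.mem_Ico.2 ⟨h2, by omega⟩
    calc ∑ q ∈ Q, (x * √2 ^ q)⁻¹
        ≤ ∑ q ∈ Finset.Ico (Q.min' hQ) (Q.min' hQ + (Q.max' hQ - Q.min' hQ + 1)),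
            (x * √2 ^ q)⁻¹ :=
          Finset.sum_le_sum_of_subset_of_nonneg hsub fun q _ _ => by positivity
      _ = x⁻¹ * ∑ q ∈ Finset.Ico (Q.min' hQ) (Q.min' hQ + (Q.max' hQ - Q.min' hQ + 1)),
            (√2 ^ q)⁻¹ := by
          rw [Finset.mul_sum]; exact Finset.sum_congr rfl fun q _ => mul_inv _ _
      _ ≤ x⁻¹ * (4 * (√2 ^ Q.min' hQ)⁻¹) := by
          refine mul_le_mul_of_nonneg_left ((key _ _).trans ?_) (by positivity)
          have : (0 : ℝ) ≤ (√2 ^ (Q.min' hQ + (Q.max' hQ - Q.min' hQ + 1)))⁻¹ := by positivity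
          linarith
      _ = 4 * (x * √2 ^ Q.min' hQ)⁻¹ := by rw [mul_inv]; ring
      _ ≤ 4 * Y⁻¹ := mul_le_mul_of_nonneg_left (inv_anti₀ hY (h _ (Q.min'_mem hQ))) (by norm_num)

variable {K : ℕ} {P : Params K} {ν : Fin K → Measure ℝ} {M : ℕ} {m : ℝ}

theorem width_le (hT0 : 0 < P.T0) (hL : 0 ≤ Real.log P.T) {q : ℕ} (hq : 2 ≤ q) :
    width P (q - 1) ≤ 2 * √(Real.log P.T) * (√P.T0 * √2 ^ q)⁻¹ := by
  have hT : (0 : ℝ) < P.T0 := by exact_mod_cast hT0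
  have hpow : (4 : ℝ) ≤ 2 ^ q := by
    calc (4 : ℝ) = 2 ^ 2 := by norm_num
      _ ≤ 2 ^ q := pow_le_pow_right₀ (by norm_num) hq
  have hy : 0 < √(P.T0 : ℝ) * √2 ^ q := by positivity
  have hsq : (√(P.T0 : ℝ) * √2 ^ q) ^ 2 = P.T0 * 2 ^ q := by
    rw [mul_pow, Real.sq_sqrt hT.le, ← pow_mul, mul_comm q 2, pow_mul,
      Real.sq_sqrt (by norm_num)]
  unfold width
  rw [show q - 1 + 1 = q by omega]
  refine Real.sqrt_le_iff.2 ⟨by positivity, ?_⟩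
  rw [mul_pow, mul_pow, Real.sq_sqrt hL, inv_pow, hsq]
  have hden : 0 < (2 : ℝ) ^ q * P.T0 - 2 * P.T0 := by nlinarith
  rw [div_le_iff₀ hden]
  -- Since q ≥ 2, 2^q - 2 is at least half of 2^q.
  have h1 : (P.T0 * 2 ^ q : ℝ)⁻¹ * (2 ^ q * P.T0 - 2 * P.T0) ≥ 1 / 2 := by
    rw [ge_iff_le, inv_mul_eq_div, div_le_div_iff₀ (by norm_num) (by positivity)]
    nlinarith
  nlinarith

/-- With y = √(T_0 2^q) the width is at most 2 √(log T) / y. The two branches of the minimum give a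
bound growing like y and one decaying like 1/y, and a nonzero cost forces the gap to be at most 8
√(log T) / y. -/
theorem phaseCost_le (hT0 : 0 < P.T0) (hL : 0 ≤ Real.log P.T) {q : ℕ} (hq : 2 ≤ q) (b : Fin K) :
    phaseCost P ν M m q b ≤ 16 * √(Real.log P.T) * M * (√P.T0 * √2 ^ q) ∧
    phaseCost P ν M m q b ≤ 32 * √(Real.log P.T) * P.T * (√P.T0 * √2 ^ q)⁻¹ ∧
    (phaseCost P ν M m q b ≠ 0 →
      (m - mean ν b) * (√P.T0 * √2 ^ q) ≤ 8 * √(Real.log P.T)) := by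
  have hT : (0 : ℝ) < P.T0 := by exact_mod_cast hT0
  have hw := width_le hT0 hL hq
  have hw0 := width_nonneg P (q - 1)
  have hz : (2 : ℝ) ^ q * P.T0 = (√P.T0 * √2 ^ q) * (√P.T0 * √2 ^ q) := by
    rw [← sq, mul_pow, Real.sq_sqrt hT.le, ← pow_mul, mul_comm q 2, pow_mul,
      Real.sq_sqrt (by norm_num), mul_comm]
  have hy : 0 < √(P.T0 : ℝ) * √2 ^ q := by positivity
  set y := √(P.T0 : ℝ) * √2 ^ q
  set l := √(Real.log P.T)
  have hl : 0 ≤ l := Real.sqrt_nonneg _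
  unfold phaseCost
  rw [hz]
  split_ifs with h
  · refine ⟨?_, ?_, fun _ => ?_⟩
    · calc 8 * width P (q - 1) * min (M * (y * y)) (2 * P.T)
          ≤ 8 * (2 * l * y⁻¹) * (M * (y * y)) := by
            gcongr; exact min_le_left _ _
        _ = 16 * l * M * y := by field_simp; ring
    · calc 8 * width P (q - 1) * min (M * (y * y)) (2 * P.T)
          ≤ 8 * (2 * l * y⁻¹) * (2 * P.T) := by
            gcongr; exact min_le_right _ _
        _ = 32 * l * P.T * y⁻¹ := by ring
    · calc (m - mean ν b) * y ≤ 4 * (2 * l * y⁻¹) * y := by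
            refine mul_le_mul_of_nonneg_right (h.trans ?_) hy.le
            linarith
        _ = 8 * l := by field_simp; ring
  · exact ⟨by positivity, by positivity, fun h0 => absurd rfl h0⟩

theorem sum_phaseCost_le_sqrt (hT0 : 0 < P.T0) (hL : 0 ≤ Real.log P.T) (hM : 1 ≤ M) (hT : 1 ≤ P.T)
    {Q : Finset ℕ} (hQ : ∀ q ∈ Q, 2 ≤ q) (b : Fin K) :
    ∑ q ∈ Q, phaseCost P ν M m q b ≤ 192 * √(M * P.T * Real.log P.T) := by
  have hx : 0 < √(P.T0 : ℝ) := Real.sqrt_pos.2 (by exact_mod_cast hT0)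
  have hsM : 0 < √(M : ℝ) := Real.sqrt_pos.2 (by exact_mod_cast hM)
  have hsT : 0 < √(P.T : ℝ) := Real.sqrt_pos.2 (by exact_mod_cast hT)
  have hl : 0 ≤ √(Real.log P.T) := Real.sqrt_nonneg _
  have hMs : (M : ℝ) = √M * √M := (Real.mul_self_sqrt (Nat.cast_nonneg _)).symm
  have hTs : (P.T : ℝ) = √P.T * √P.T := (Real.mul_self_sqrt (Nat.cast_nonneg _)).symm
  have hY : 0 < √(P.T : ℝ) / √M := by positivity
  -- The two bounds are of the same order at y = √(T/M); below it the growing one is summed, above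
  -- it the decaying one.
  rw [← Finset.sum_filter_add_sum_filter_not Q
    fun q => √(P.T0 : ℝ) * √2 ^ q ≤ √(P.T : ℝ) / √M]
  have h1 : ∑ q ∈ Q.filter (fun q => √(P.T0 : ℝ) * √2 ^ q ≤ √(P.T : ℝ) / √M),
      phaseCost P ν M m q b ≤ 16 * √(Real.log P.T) * M * (4 * (√(P.T : ℝ) / √M)) := by
    calc _ ≤ ∑ q ∈ Q.filter (fun q => √(P.T0 : ℝ) * √2 ^ q ≤ √(P.T : ℝ) / √M),
          16 * √(Real.log P.T) * M * (√P.T0 * √2 ^ q) :=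
        Finset.sum_le_sum fun q hq =>
          (phaseCost_le hT0 hL (hQ q (Finset.mem_filter.1 hq).1) b).1
      _ ≤ _ := by
        rw [← Finset.mul_sum]
        exact mul_le_mul_of_nonneg_left (sum_geometric_le hx.le hY.le _
          fun q hq => (Finset.mem_filter.1 hq).2) (by positivity)
  have h2 : ∑ q ∈ Q.filter (fun q => ¬ √(P.T0 : ℝ) * √2 ^ q ≤ √(P.T : ℝ) / √M),
      phaseCost P ν M m q b ≤ 32 * √(Real.log P.T) * P.T * (4 * (√(P.T : ℝ) / √M)⁻¹) := by
    calc _ ≤ ∑ q ∈ Q.filter (fun q => ¬ √(P.T0 : ℝ) * √2 ^ q ≤ √(P.T : ℝ) / √M),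
          32 * √(Real.log P.T) * P.T * (√P.T0 * √2 ^ q)⁻¹ :=
        Finset.sum_le_sum fun q hq =>
          (phaseCost_le hT0 hL (hQ q (Finset.mem_filter.1 hq).1) b).2.1
      _ ≤ _ := by
        rw [← Finset.mul_sum]
        exact mul_le_mul_of_nonneg_left (sum_inv_geometric_le hx hY _
          fun q hq => (not_le.1 (Finset.mem_filter.1 hq).2).le) (by positivity)
  have e : √(M * P.T * Real.log P.T) = √M * √P.T * √(Real.log P.T) := by
    rw [Real.sqrt_mul (by positivity), Real.sqrt_mul (by positivity)]
  have e1 : (M : ℝ) * (√(P.T : ℝ) / √M) = √M * √P.T := by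
    rw [mul_div_assoc', div_eq_iff hsM.ne']
    linear_combination √(P.T : ℝ) * hMs
  have e2 : (P.T : ℝ) * (√(P.T : ℝ) / √M)⁻¹ = √M * √P.T := by
    rw [inv_div, mul_div_assoc', div_eq_iff hsT.ne']
    linear_combination √(M : ℝ) * hTs
  rw [e]
  calc _ ≤ 16 * √(Real.log P.T) * M * (4 * (√(P.T : ℝ) / √M))
        + 32 * √(Real.log P.T) * P.T * (4 * (√(P.T : ℝ) / √M)⁻¹) := add_le_add h1 h2
    _ = 64 * √(Real.log P.T) * (M * (√(P.T : ℝ) / √M))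
        + 128 * √(Real.log P.T) * (P.T * (√(P.T : ℝ) / √M)⁻¹) := by ring
    _ = _ := by rw [e1, e2]; ring

/-- Only the growing bound is needed: phases with nonzero cost have y ≤ 8 √(log T) / Δ, and the
geometric sum gives 16 · 4 · 8 = 512. -/
theorem sum_phaseCost_le_div (hT0 : 0 < P.T0) (hL : 0 ≤ Real.log P.T) {Q : Finset ℕ}
    (hQ : ∀ q ∈ Q, 2 ≤ q) {b : Fin K} (hb : 0 < m - mean ν b) :
    ∑ q ∈ Q, phaseCost P ν M m q b ≤ 512 * (M * Real.log P.T / (m - mean ν b)) := by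
  have hx : 0 < √(P.T0 : ℝ) := Real.sqrt_pos.2 (by exact_mod_cast hT0)
  have hl : 0 ≤ √(Real.log P.T) := Real.sqrt_nonneg _
  rw [← Finset.sum_filter_ne_zero]
  calc _ ≤ ∑ q ∈ Q.filter (fun q => phaseCost P ν M m q b ≠ 0),
          16 * √(Real.log P.T) * M * (√P.T0 * √2 ^ q) :=
        Finset.sum_le_sum fun q hq =>
          (phaseCost_le hT0 hL (hQ q (Finset.mem_filter.1 hq).1) b).1
    _ ≤ 16 * √(Real.log P.T) * M * (4 * (8 * √(Real.log P.T) / (m - mean ν b))) := by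
        rw [← Finset.mul_sum]
        refine mul_le_mul_of_nonneg_left (sum_geometric_le hx.le (by positivity) _
          fun q hq => ?_) (by positivity)
        rw [le_div_iff₀ hb, mul_comm]
        obtain ⟨h1, h2⟩ := Finset.mem_filter.1 hq
        exact (phaseCost_le hT0 hL (hQ q h1) b).2.2 h2
    _ = 512 * (M * (√(Real.log P.T) * √(Real.log P.T)) / (m - mean ν b)) := by ring
    _ = _ := by rw [Real.mul_self_sqrt hL]

theorem sum_phaseCost_le (hT0 : 0 < P.T0) (hL : 0 ≤ Real.log P.T) (hM : 1 ≤ M) (hT : 1 ≤ P.T)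
    {Q : Finset ℕ} (hQ : ∀ q ∈ Q, 2 ≤ q) {b : Fin K} (hb : mean ν b ≤ m) :
    ∑ q ∈ Q, phaseCost P ν M m q b ≤ 512 * explorationCost M P.T (m - mean ν b) := by
  have h1 := sum_phaseCost_le_sqrt (ν := ν) (m := m) hT0 hL hM hT hQ b
  have h0 : 0 ≤ √(M * P.T * Real.log P.T) := Real.sqrt_nonneg _
  unfold explorationCost
  split_ifs with h
  · linarith
  · have hpos : 0 < m - mean ν b := lt_of_le_of_ne (by linarith) (Ne.symm h)
    have h2 := sum_phaseCost_le_div (M := M) hT0 hL hQ hpos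
    rw [mul_min_of_nonneg _ _ (by norm_num)]
    exact le_min h2 (by linarith)

theorem explorationCost_nonneg {T : ℕ} (hT : 1 ≤ T) {Δ : ℝ} (h : 0 ≤ Δ) :
    0 ≤ explorationCost M T Δ := by
  have hL : 0 ≤ Real.log T := Real.log_nonneg (by exact_mod_cast hT)
  unfold explorationCost
  split_ifs
  · positivity
  · exact le_min (by positivity) (by positivity)

end Sums

/-! ### Order statistics and a set of best arms. -/

section BestArms

variable {K : ℕ}

/-- The rank of an arm, from `0` for the best one. -/
noncomputable def rank (v : Fin K → ℝ) (k : Fin K) : Fin K := (Tuple.sort fun k => -v k).symm k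

theorem rank_sort (v : Fin K → ℝ) (n : Fin K) : rank v (Tuple.sort (fun k => -v k) n) = n := by
  simp [rank]

theorem orderStat_rank (v : Fin K → ℝ) (k : Fin K) : orderStat v (rank v k + 1) = v k := by
  unfold orderStat
  rw [dif_pos (show (rank v k : ℕ) + 1 - 1 < K from (rank v k).2)]
  simp [rank]

theorem orderStat_anti (v : Fin K → ℝ) {a b : ℕ} (ha : 1 ≤ a) (hab : a ≤ b) (hb : b ≤ K) :
    orderStat v b ≤ orderStat v a := by
  unfold orderStat
  rw [dif_pos (by omega), dif_pos (by omega)]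
  have := Tuple.monotone_sort (fun k => -v k)
    (show (⟨a - 1, by omega⟩ : Fin K) ≤ ⟨b - 1, by omega⟩ from Fin.mk_le_mk.2 (by omega))
  simpa using this

theorem sum_orderStat (v : Fin K → ℝ) (f : ℝ → ℝ) (a b : ℕ) (hb : b ≤ K) :
    ∑ n ∈ Finset.Icc (a + 1) b, f (orderStat v n)
      = ∑ k ∈ Finset.univ.filter (fun k => a ≤ (rank v k : ℕ) ∧ (rank v k : ℕ) < b), f (v k) := by
  symm
  refine Finset.sum_bij (fun k _ => (rank v k : ℕ) + 1) (fun k hk => ?_) (fun k _ k' _ h => ?_)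
    (fun n hn => ?_) fun k _ => by rw [orderStat_rank]
  · have := (Finset.mem_filter.1 hk).2
    exact Finset.mem_Icc.2 ⟨by omega, by omega⟩
  · have : rank v k = rank v k' := Fin.ext (by simpa using h)
    exact (Tuple.sort fun k => -v k).symm.injective this
  · rw [Finset.mem_Icc] at hn
    refine ⟨Tuple.sort (fun k => -v k) ⟨n - 1, by omega⟩, ?_, ?_⟩
    · refine Finset.mem_filter.2 ⟨Finset.mem_univ _, ?_⟩
      rw [rank_sort]
      exact ⟨by simp only; omega, by simp only; omega⟩
    · rw [rank_sort]
      simp only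
      omega

/-- The `M` best arms. -/
noncomputable def best (v : Fin K → ℝ) (M : ℕ) : Finset (Fin K) :=
  Finset.univ.filter fun k => (rank v k : ℕ) < M

theorem sum_best (v : Fin K → ℝ) {M : ℕ} (hM : M ≤ K) :
    ∑ n ∈ Finset.Icc 1 M, orderStat v n = ∑ k ∈ best v M, v k := by
  have := sum_orderStat v id 0 M hM
  simpa [best] using this

theorem sum_compl_best (v : Fin K → ℝ) (f : ℝ → ℝ) (M : ℕ) :
    ∑ n ∈ Finset.Icc (M + 1) K, f (orderStat v n) = ∑ k ∈ (best v M)ᶜ, f (v k) := by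
  rw [sum_orderStat v f M K le_rfl]
  refine Finset.sum_congr ?_ fun _ _ => rfl
  ext k
  simp [best]

theorem card_best (v : Fin K → ℝ) {M : ℕ} (hM : M ≤ K) : (best v M).card = M := by
  have h : (best v M).card = (Finset.univ.filter fun n : Fin K => (n : ℕ) < M).card := by
    refine Finset.card_bij (fun k _ => rank v k) (fun k hk => ?_) (fun k _ k' _ h => ?_)
      fun n hn => ⟨Tuple.sort (fun k => -v k) n, ?_, ?_⟩
    · simpa [best] using hk
    · exact (Tuple.sort fun k => -v k).symm.injective h
    · refine Finset.mem_filter.2 ⟨Finset.mem_univ _, ?_⟩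
      rw [rank_sort]
      exact (Finset.mem_filter.1 hn).2
    · exact rank_sort v n
  rw [h, Fin.card_filter_val_lt]
  exact min_eq_right hM

theorem orderStat_le_of_mem {v : Fin K → ℝ} {M : ℕ} (hMK : M ≤ K) {k : Fin K}
    (hk : k ∈ best v M) : orderStat v M ≤ v k := by
  have h := (Finset.mem_filter.1 hk).2
  rw [← orderStat_rank v k]
  exact orderStat_anti v (by omega) (by omega) hMK

theorem le_orderStat_of_notMem {v : Fin K → ℝ} {M : ℕ} (hM : 1 ≤ M) {k : Fin K}
    (hk : k ∉ best v M) : v k ≤ orderStat v M := by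
  have h : M ≤ rank v k := by simpa [best] using hk
  rw [← orderStat_rank v k]
  exact orderStat_anti v hM (by omega) (rank v k).2

end BestArms

/-! ### Parameters, the bad event and the final bound. -/

section Regret

variable {K M : ℕ} {P : Params K} {ν : Fin K → Measure ℝ} [∀ k, IsProbabilityMeasure (ν k)]

theorem mean_le_one (h : ∀ k, ∀ᵐ x ∂(ν k), x ∈ Set.Icc (0 : ℝ) 1) (k : Fin K) : mean ν k ≤ 1 := by
  unfold mean
  have hint : Integrable (fun x : ℝ => x) (ν k) :=
    Integrable.of_bound aestronglyMeasurable_id 1 (by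
      filter_upwards [h k] with x hx
      rw [Real.norm_eq_abs, abs_of_nonneg hx.1]; exact hx.2)
  calc ∫ x, x ∂(ν k) ≤ ∫ _x, (1 : ℝ) ∂(ν k) :=
        integral_mono_ae hint (integrable_const _) (by filter_upwards [h k] with x hx using hx.2)
    _ = 1 := by simp

theorem log_ge {T : ℕ} (hT : 2 ≤ T) : (0.69 : ℝ) ≤ Real.log T := by
  have h1 := Real.log_two_gt_d9
  have h2 : Real.log 2 ≤ Real.log T := Real.log_le_log (by norm_num) (by exact_mod_cast hT)
  linarith

theorem env_best (hM : M ≤ K) (hM1 : 1 ≤ M) (hT : 2 ≤ P.T)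
    (h : ∀ k, ∀ᵐ x ∂(ν k), x ∈ Set.Icc (0 : ℝ) 1) (hP : 0 < P.muMin)
    (hmμ : ∀ k, P.muMin ≤ mean ν k) (hpick : ∀ A : Finset (Fin K), A.Nonempty → P.pick A ∈ A) :
    Env P ν M (best (mean ν) M) (orderStat (mean ν) M) := by
  have hL := log_ge hT
  have hle : P.muMin ≤ 1 := (hmμ ⟨0, by omega⟩).trans (mean_le_one h _)
  have hX : (0.69 : ℝ) ≤ Real.log P.T / P.muMin := by
    rw [le_div_iff₀ hP]; nlinarith
  have hT0 : 2400 * (Real.log P.T / P.muMin) ≤ P.T0 := by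
    rw [← mul_div_assoc]; exact Nat.le_ceil _
  have hTc : (P.Tc : ℝ) < Real.log P.T / P.muMin + 1 := Nat.ceil_lt_add_one (by linarith)
  refine ⟨hpick, card_best _ hM, sum_best _ hM, fun k hk => orderStat_le_of_mem hM hk,
    fun k hk => le_orderStat_of_notMem hM1 hk, by linarith, fun k => ?_, ?_, ?_, ?_,
    fun k => hP.trans_le (hmμ k), mean_le_one h⟩
  · have h1 : 2400 * Real.log P.T = P.muMin * (2400 * (Real.log P.T / P.muMin)) := by
      field_simp
    rw [h1]
    exact mul_le_mul (hmμ k) hT0 (by linarith) (hP.le.trans (hmμ k))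
  · exact Nat.ceil_pos.2 (by linarith)
  · have : (3 * P.Tc : ℝ) ≤ P.T0 := by linarith
    exact_mod_cast this
  · have : (1000 : ℝ) ≤ P.T0 := by linarith
    exact_mod_cast this

/-- Contribution of the complement of the good event to the regret. -/
theorem cost_not_good (hM : 1 ≤ M) (hMK : M ≤ K) {T : ℕ} (hT : 2 ≤ T) (hKT : K * K ≤ T) :
    (T : ℝ) * M * (((M * (Nat.log 2 T + 3) * K + M * (2 * K) : ℕ) : ℝ) * Real.exp (-Real.log T)
      + ((M * K * (8 * T + 1) * 2 + M * K * 2 + M * K * (8 * T + 1) * 2 + M * M * K * (8 * T + 1)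
          + M * K * (8 * T + 1) : ℕ) : ℝ) * Real.exp (-(4 * Real.log T)))
      ≤ 100 * (M * (K : ℝ) ^ 2 * Real.log T) := by
  have hL := log_ge hT
  have hTpos : (0 : ℝ) < T := by exact_mod_cast (by omega : 0 < T)
  have hT2 : (2 : ℝ) ≤ T := by exact_mod_cast hT
  have hM1 : (1 : ℝ) ≤ M := by exact_mod_cast hM
  have hMK1 : (M : ℝ) ≤ K := by exact_mod_cast hMK
  have hK1 : (1 : ℝ) ≤ K := hM1.trans hMK1
  have hKT1 : (K : ℝ) * K ≤ T := by exact_mod_cast hKT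
  have e1 : Real.exp (-Real.log T) = (T : ℝ)⁻¹ := by rw [Real.exp_neg, Real.exp_log hTpos]
  have e2 : Real.exp (-(4 * Real.log T)) = ((T : ℝ) ^ 4)⁻¹ := by
    rw [Real.exp_neg, show 4 * Real.log T = ((4 : ℕ) : ℝ) * Real.log T by norm_num, Real.exp_nat_mul,
      Real.exp_log hTpos]
  rw [e1, e2, mul_add]
  -- 1.45 is an upper bound of 1 / log 2.
  have hlog : (Nat.log 2 T : ℝ) ≤ 1.45 * Real.log T := by
    have h1 : ((2 : ℝ) ^ Nat.log 2 T) ≤ T := by exact_mod_cast Nat.pow_log_le_self 2 (by omega)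
    have h2 := Real.log_le_log (by positivity) h1
    rw [Real.log_pow] at h2
    have h3 := Real.log_two_gt_d9
    have h4 : (0 : ℝ) ≤ Nat.log 2 T := Nat.cast_nonneg _
    nlinarith
  have hMKle : (M : ℝ) * M * K ≤ M * (K : ℝ) ^ 2 := by
    rw [sq, ← mul_assoc]
    gcongr
  have h0 : (0 : ℝ) ≤ M * (K : ℝ) ^ 2 := by positivity
  -- The events of probability 1/T cost M² K (log₂ T + 5), and 1.45 log T + 5 ≤ 9 log T because log
  -- T ≥ 0.69.
  have a1 : (T : ℝ) * M * (((M * (Nat.log 2 T + 3) * K + M * (2 * K) : ℕ) : ℝ) * (T : ℝ)⁻¹)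
      ≤ 9 * (M * (K : ℝ) ^ 2 * Real.log T) := by
    have : (T : ℝ) * M * (((M * (Nat.log 2 T + 3) * K + M * (2 * K) : ℕ) : ℝ) * (T : ℝ)⁻¹)
        = M * M * K * (Nat.log 2 T + 5) := by
      push_cast; field_simp; ring
    rw [this]
    calc (M : ℝ) * M * K * (Nat.log 2 T + 5) ≤ M * (K : ℝ) ^ 2 * (9 * Real.log T) := by
          refine mul_le_mul hMKle (by linarith) (by positivity) h0
      _ = _ := by ring
  have a2 : (T : ℝ) * M * (((M * K * (8 * T + 1) * 2 + M * K * 2 + M * K * (8 * T + 1) * 2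
      + M * M * K * (8 * T + 1) + M * K * (8 * T + 1) : ℕ) : ℝ) * ((T : ℝ) ^ 4)⁻¹)
      ≤ 56 * M := by
    have b1 : ((M * K * (8 * T + 1) * 2 + M * K * 2 + M * K * (8 * T + 1) * 2
        + M * M * K * (8 * T + 1) + M * K * (8 * T + 1) : ℕ) : ℝ) ≤ 56 * T * (M * M * K) := by
      push_cast
      have c1 : (M : ℝ) * K ≤ M * M * K := by
        have : (0 : ℝ) ≤ M * K := by positivity
        nlinarith
      have c2 : (8 * (T : ℝ) + 1) ≤ 9 * T := by linarith
      have c3 : (M : ℝ) * K * (8 * T + 1) ≤ M * M * K * (9 * T) :=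
        mul_le_mul c1 c2 (by positivity) (by positivity)
      have c4 : (M : ℝ) * M * K * (8 * T + 1) ≤ M * M * K * (9 * T) :=
        mul_le_mul_of_nonneg_left c2 (by positivity)
      have c5 : (M : ℝ) * K * 2 ≤ M * M * K * T := mul_le_mul c1 hT2 (by norm_num) (by positivity)
      linarith
    -- K ≤ K² ≤ T absorbs all powers of `M` and `K` into T², which T^(-4) then cancels.
    have b2 : (M : ℝ) * M * K ≤ T * T := by
      calc (M : ℝ) * M * K ≤ K * K * T := by
            refine mul_le_mul (mul_le_mul hMK1 hMK1 (by positivity) (by positivity)) ?_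
              (by positivity) (by positivity)
            nlinarith
        _ ≤ T * T := mul_le_mul_of_nonneg_right hKT1 hTpos.le
    have b3 := b1.trans (mul_le_mul_of_nonneg_left b2 (by positivity : (0 : ℝ) ≤ 56 * T))
    calc _ ≤ (T : ℝ) * M * (56 * T * (T * T) * ((T : ℝ) ^ 4)⁻¹) := by gcongr
      _ = 56 * M := by field_simp
  have a3 : 56 * (M : ℝ) ≤ 90 * (M * (K : ℝ) ^ 2 * Real.log T) := by
    have c1 : (M : ℝ) * 1 ≤ M * (K : ℝ) ^ 2 :=
      mul_le_mul_of_nonneg_left (one_le_pow₀ hK1) (by positivity)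
    nlinarith
  linarith

/-- The pathwise analysis needs K² T_0 ≤ T. In the remaining case M T < M K² T_0, which is already
of the order of the last term. -/
theorem regret_bound (hM : 1 ≤ M) (hMK : M ≤ K) (hT : 2 ≤ P.T)
    (h : ∀ k, ∀ᵐ x ∂(ν k), x ∈ Set.Icc (0 : ℝ) 1) (hP : 0 < P.muMin)
    (hmμ : ∀ k, P.muMin ≤ mean ν k) (hpick : ∀ A : Finset (Fin K), A.Nonempty → P.pick A ∈ A) :
    regret M P ν ≤ 20000 * ((∑ k ∈ Finset.Icc (M + 1) K,
        explorationCost M P.T (orderStat (mean ν) M - orderStat (mean ν) k))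
      + M * (K : ℝ) ^ 2 * Real.log P.T / P.muMin) := by
  have env := env_best hMK hM hT h hP hmμ hpick
  have hμ : ∀ k, 0 ≤ mean ν k := fun k => (env.mean_pos k).le
  have hL := log_ge hT
  have hle : P.muMin ≤ 1 := (hmμ ⟨0, by omega⟩).trans (env.mean_le _)
  have hX : Real.log P.T ≤ Real.log P.T / P.muMin := by
    rw [le_div_iff₀ hP]; nlinarith
  -- Rounding up adds at most 1, which is below 2 log T / μ_min since log T ≥ 0.69 and μ_min ≤ 1.
  have hT0 : (P.T0 : ℝ) ≤ 2402 * (Real.log P.T / P.muMin) := by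
    have := Nat.ceil_lt_add_one (a := 2400 * Real.log P.T / P.muMin) (by positivity)
    rw [mul_div_assoc] at this
    unfold Params.T0
    rw [mul_div_assoc]
    linarith
  rw [sum_compl_best (mean ν) (fun x => explorationCost M P.T (orderStat (mean ν) M - x))]
  have hsum : 0 ≤ ∑ k ∈ (best (mean ν) M)ᶜ,
      explorationCost M P.T (orderStat (mean ν) M - mean ν k) :=
    Finset.sum_nonneg fun k hk => explorationCost_nonneg (by omega)
      (sub_nonneg.2 (env.bad_le k (Finset.mem_compl.1 hk)))
  have hA : (0 : ℝ) ≤ M * (K : ℝ) ^ 2 := by positivity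
  have hMKT : (M : ℝ) * (K * (K * P.T0)) ≤ 2402 * (M * (K : ℝ) ^ 2 * Real.log P.T / P.muMin) := by
    have := mul_le_mul_of_nonneg_left hT0 hA
    calc (M : ℝ) * (K * (K * P.T0)) = M * (K : ℝ) ^ 2 * P.T0 := by ring
      _ ≤ _ := this
      _ = _ := by ring
  have hX0 : 0 ≤ M * (K : ℝ) ^ 2 * Real.log P.T / P.muMin := by positivity
  rcases le_or_gt (K * (K * P.T0)) P.T with hKT | hKT
  · have hgood := regret_le h hμ env.mean_le {ω : Sample K M | Good P ν (8 * P.T) ω}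
      (R := 8 * (M * (K * (K * P.T0))) + 512 * ∑ k ∈ (best (mean ν) M)ᶜ,
        explorationCost M P.T (orderStat (mean ν) M - mean ν k)) (by positivity)
      (fun ω good => (cum_horizon_le good env hM hMK (by omega) hKT).trans
        (add_le_add le_rfl (by
          rw [Finset.mul_sum]
          exact Finset.sum_le_sum fun b hb => sum_phaseCost_le (by have := env.T0_ge; omega)
            env.log_pos.le hM (by omega) (fun q hq => (Finset.mem_Icc.1 hq).1)
            (env.bad_le b (Finset.mem_compl.1 hb)))))
      (ε := ((M * (Nat.log 2 P.T + 3) * K + M * (2 * K) : ℕ) : ℝ) * Real.exp (-Real.log P.T)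
      + ((M * K * (8 * P.T + 1) * 2 + M * K * 2 + M * K * (8 * P.T + 1) * 2
          + M * M * K * (8 * P.T + 1) + M * K * (8 * P.T + 1) : ℕ) : ℝ)
          * Real.exp (-(4 * Real.log P.T))) (by positivity) (by
        refine (measure_not_good h hP hmμ env.mean_le (by omega) (8 * P.T)).trans (le_of_eq ?_)
        rw [ENNReal.ofReal_add (by positivity) (by positivity),
          ENNReal.ofReal_mul (Nat.cast_nonneg _), ENNReal.ofReal_mul (Nat.cast_nonneg _),
          ENNReal.ofReal_natCast, ENNReal.ofReal_natCast])
    have hT0' := env.T0_ge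
    have hKK : K * K ≤ P.T := by
      refine le_trans (Nat.mul_le_mul_left _ ?_) hKT
      exact Nat.le_mul_of_pos_right _ (by omega)
    have hbad := cost_not_good hM hMK hT hKK
    have hlast : M * (K : ℝ) ^ 2 * Real.log P.T ≤ M * (K : ℝ) ^ 2 * Real.log P.T / P.muMin := by
      rw [mul_div_assoc]; exact mul_le_mul_of_nonneg_left hX hA
    -- The constants add up to 8 · 2402 + 100 ≤ 20000 and 512 ≤ 20000.
    linarith
  · have hgood := regret_le (P := P) h hμ env.mean_le (∅ : Set (Sample K M)) (R := 0) le_rfl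
      (fun ω hω => absurd hω (Set.notMem_empty ω)) (ε := 1) zero_le_one (by
        rw [ENNReal.ofReal_one]
        have : IsProbabilityMeasure (sampleMeasure M ν) := by unfold sampleMeasure; infer_instance
        exact prob_le_one)
    have h1 : (P.T : ℝ) ≤ K * (K * P.T0) := by exact_mod_cast hKT.le
    have h2 := mul_le_mul_of_nonneg_left h1 (Nat.cast_nonneg (α := ℝ) M)
    linarith

end Regret

end NoSensing

theorem mainTheorem3 :
    ∃ C : ℝ, 0 < C ∧
      ∀ (K M T : ℕ) (_ : 1 ≤ M) (_ : M ≤ K) (_ : 2 ≤ T)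
        (ν : Fin K → MeasureTheory.Measure ℝ)
        [∀ k, MeasureTheory.IsProbabilityMeasure (ν k)]
        (_ : ∀ k, ∀ᵐ x ∂(ν k), x ∈ Set.Icc (0 : ℝ) 1)
        (muMin : ℝ) (_ : 0 < muMin) (_ : ∀ k, muMin ≤ NoSensing.mean ν k)
        (pick : Finset (Fin K) → Fin K) (_ : ∀ A, A.Nonempty → pick A ∈ A),
        NoSensing.regret M { T := T, muMin := muMin, pick := pick } ν ≤
          C * ((∑ k ∈ Finset.Icc (M + 1) K,
                NoSensing.explorationCost M T
                  (NoSensing.orderStat (NoSensing.mean ν) M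
                    - NoSensing.orderStat (NoSensing.mean ν) k))
              + M * (K : ℝ) ^ 2 * Real.log T / muMin) := by
  refine ⟨20000, by norm_num, ?_⟩
  intro K M T hM hMK hT ν _ h muMin hmin hmμ pick hpick
  exact NoSensing.regret_bound (P := { T := T, muMin := muMin, pick := pick })
    hM hMK hT h hmin hmμ hpick
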